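/- Setting. Let $X$ and $Y$ be connected, Hausdorff, second-countable smooth real manifolds, $\dim X=n$, let $Y\to X$ be a smooth fibre bundle (even fields) with a splitting $VY=Y\times_X W$ of its vertical tangent bundle for some vector bundle $W\to X$, and let $F\to X$ be a vector bundle (odd fields). For a vector bundle $E\to X$, let $\overline E^*=E^*\otimes\bigwedge^nT^*X$ be its density-dual. Let $\mathcal S^0$ be the ring of graded functions of finite jet order of the even and odd fields. Fix $N\ge 1$ and finitely many vector bundles over $X$. Let $\mathcal P\{N\}$ be the graded-commutative ring of graded functions of the fields and their jets that are polynomial in the jets of the following antifields: the antifields $\overline s_A$ with values in $\overline W^*$ (odd) and $\overline F^*$ (even), of antifield number $1$; and, for $0\le k\le N$, the antifields $\overline c_{r_k}$ of antifield number $k+2$, with values in the density-duals of the given bundles, each even or odd. For $-1\le k\le N$ let $\mathcal P\{k\}$ be the subring of elements which involve only antifields of antifield number $\le k+2$, and let $\mathcal P^{0,n}\{k\}_m$ be the module of densities (horizontal $n$-forms) with coefficients in $\mathcal P\{k\}$ which have antifield number $m$. All the derivations below are odd right contact graded derivations (they commute with the total derivatives $d_\lambda$) of antifield number $-1$ which vanish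 on $\mathcal S^0$. Let $L$ be an even graded Lagrangian with variational derivatives $\mathcal E_A$, and let $\overline\delta$ be the Koszul–Tate differential: $\overline\delta\,\overline s_A=\mathcal E_A$, $\overline\delta\,\overline c_{r_k}=0$. Let $\delta_N$ be a derivation of $\mathcal P\{N\}$ with $\delta_N\overline s_A=\mathcal E_A$. Put $\Delta_{r_k}=\delta_N\overline c_{r_k}$; for $k\ge1$ write $\Delta_{r_k}=\sum_\Lambda\Delta_{r_k}^{r_{k-1},\Lambda}\overline c_{\Lambda r_{k-1}}+h_{r_k}$, where $h_{r_k}$ involves only antifields of antifield number $\le k$, and for $k=0$ write $\Delta_{r_0}=\sum_\Lambda\Delta_{r_0}^{A,\Lambda}\overline s_{\Lambda A}$. The $(M+1)$-homology regularity condition says that, for $-1\le k<M-1$, every $\delta_N$-cycle in $\mathcal P^{0,n}\{k\}_{k+3}$ is the $\delta_N$-boundary of an element of $\mathcal P^{0,n}\{k+1\}_{k+4}$. The system is $N$-stage reducible: $\delta_N\circ\delta_N=0$; the complex $$0\leftarrow \mathrm{Im}\,\overline\delta\leftarrow\mathcal P^{0,n}\{N\}_1\leftarrow\mathcal P^{0,n}\{N\}_2\leftarrow\cdots$$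 with boundary operator $\delta_N$ is $(N+1)$-exact, i.e. its homology vanishes in degrees $1,\dots,N+1$; and the $(N+1)$-homology regularity condition holds. For $k\ge 1$, a $k$-stage Noether identity is a pair of densities $G=\sum_\Lambda G^{r_{k-1},\Lambda}\overline c_{\Lambda r_{k-1}}\omega$, with coefficients in $\mathcal S^0$, and $H\in\mathcal P^{0,n}\{k-2\}_{k+1}$, each term of which contains an antifield of antifield number $k$, such that $$\sum_\Lambda G^{r_{k-1},\Lambda}d_\Lambda\Big(\sum_\Sigma\Delta_{r_{k-1}}^{r_{k-2},\Sigma}\overline c_{\Sigma r_{k-2}}\Big)\omega+\overline\delta H=0,$$ where, for $k=1$, $\overline c_{r_{-1}}$ stands for $\overline s_A$. The complete $k$-stage identities are those for the components of $\Delta_{r_k}$; the complete Noether identities ($k=0$) are $\overline\delta\Delta_{r_0}=\sum_\Lambda\Delta^{A,\Lambda}_{r_0}d_\Lambda\mathcal E_A=0$. The $(N+1)$-stage identity given by an $(N+2)$-cycle $\Phi$ (see (i)) is called trivial if $\Phi$ is a boundary or if the summand of $\Phi$ linear in the $\overline c_{\Lambda r_N}$ is $\overline\delta$-exact. Theorem.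 Let the homology $H_{N+2}(\delta_N)$ be nontrivial. (i) If $\Phi\in\mathcal P^{0,n}\{N\}_{N+2}$ is a cycle, then the summand $G$ of $\Phi$ linear in the antifields $\overline c_{\Lambda r_N}$ and the summand $H$ of $\Phi$ consisting of the terms bilinear in the $\overline s_{\Xi A}$ and $\overline c_{\Sigma r_{N-1}}$ form an $(N+1)$-stage Noether identity. Conversely, if $(G,H)$ is an $(N+1)$-stage Noether identity, then $G$ is the summand linear in the $\overline c_{\Lambda r_N}$ of some $(N+2)$-cycle. (ii) All the $(N+2)$-cycles which give trivial $(N+1)$-stage Noether identities are boundaries if and only if the $(N+2)$-homology regularity condition holds. In this case, a cycle gives a nontrivial identity if and only if its class in $H_{N+2}(\delta_N)$ is nonzero, and two cycles differ by a trivial one if and only if their classes coincide. (iii) Suppose that $H_{N+2}(\delta_N)$ is finitely generated by $\mathcal C$: $\mathcal C\subset H_{N+2}(\delta_N)$ is a Grassmann-graded finitely generated projective $C^\infty(X)$-submodule such that every element of $H_{N+2}(\delta_N)$ is of the form $\sum\Phi^{r,\Xi}d_\Xi\Delta_r\omega$ with $\Phi^{r,\Xi}\in\mathcal S^0$ and $\Delta_r\omega$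 representing elements of $\mathcal C$. Then there are vector bundles $V_{N+1},E_{N+1}\to X$ and, on the ring extended by new even and odd antifields of antifield number $N+3$ with values in $\overline V^*_{N+1}$ and $\overline E^*_{N+1}$, a nilpotent derivation $\delta_{N+1}$ which extends $\delta_N$, whose values on the new antifields are $(N+2)$-cycles of opposite Grassmann parity that represent generators of $\mathcal C$, and whose complex is $(N+2)$-exact. The complete Noether identities and the complete $k$-stage Noether identities, $1\le k\le N+1$, hold for $\delta_{N+1}$; they follow from nilpotency, i.e., they hold for every nilpotent derivation of the extended ring whose value on each $\overline s_A$ is $\mathcal E_A$. -/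

import Mathlib

open Set Filter Topology Bundle
open scoped Manifold ContDiff

noncomputable section

namespace KoszulTate

/-! ### Subquotients of modules -/

section Subquotient

variable {R M : Type} [CommRing R] [AddCommGroup M] [Module R M]

/-- The module `Z / (Z ∩ Q)` for submodules `Z`, `Q` of a module. -/
def Subquot (Z Q : Submodule R M) := Z ⧸ Q.submoduleOf Z

instance (Z Q : Submodule R M) : AddCommGroup (Subquot Z Q) :=
  inferInstanceAs (AddCommGroup (Z ⧸ Q.submoduleOf Z))

instance (Z Q : Submodule R M) : Module R (Subquot Z Q) :=
  inferInstanceAs (Module R (Z ⧸ Q.submoduleOf Z))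

/-- The class of an element of `Z`. -/
def Subquot.mk (Z Q : Submodule R M) : Z →ₗ[R] Subquot Z Q := (Q.submoduleOf Z).mkQ

end Subquotient

/-! ### Functions, vector fields, vector bundles and densities on the base manifold -/

section Base

variable (n : ℕ) (X : Type) [TopologicalSpace X] [ChartedSpace (EuclideanSpace ℝ (Fin n)) X]

/-- The ring `C^∞(X)`. -/
abbrev Sm := C^∞⟮𝓡 n, X; ℝ⟯

/-- Vector fields on `X`, as derivations of `C^∞(X)`. -/
abbrev VF := Derivation ℝ (Sm n X) (Sm n X)

/-- Exterior `n`-forms on the `n`-dimensional manifold `X` (sections of `⋀ⁿ T*X`), as alternating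
`C^∞(X)`-multilinear functions of vector fields. -/
abbrev TopForm := (VF n X) [⋀^Fin n]→ₗ[Sm n X] (Sm n X)

/-- Smooth real vector bundles of finite rank over `X`. -/
structure VB where
  rank : ℕ
  fiber : X → Type
  [acg : ∀ x, AddCommGroup (fiber x)]
  [mod : ∀ x, Module ℝ (fiber x)]
  [top : ∀ x, TopologicalSpace (fiber x)]
  [tot : TopologicalSpace (TotalSpace (EuclideanSpace ℝ (Fin rank)) fiber)]
  [fb : FiberBundle (EuclideanSpace ℝ (Fin rank)) fiber]
  [vb : VectorBundle ℝ (EuclideanSpace ℝ (Fin rank)) fiber]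
  [smooth : ContMDiffVectorBundle ∞ (EuclideanSpace ℝ (Fin rank)) fiber (𝓡 n)]

attribute [instance] VB.acg VB.mod VB.top VB.tot VB.fb VB.vb VB.smooth

variable {n X}

/-- Global smooth sections of a vector bundle. -/
abbrev Sec (B : VB n X) := Cₛ^∞⟮𝓡 n; EuclideanSpace ℝ (Fin B.rank), B.fiber⟯

instance Sec.instSMul (B : VB n X) : SMul (Sm n X) (Sec B) :=
  ⟨fun a s => ⟨fun x => a x • s x, a.contMDiff.smul_section s.contMDiff⟩⟩

theorem Sec.smul_apply (B : VB n X) (a : Sm n X) (s : Sec B) (x : X) :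
    (a • s) x = a x • s x := rfl

instance Sec.instModule (B : VB n X) : Module (Sm n X) (Sec B) where
  one_smul s := by ext x; simp [Sec.smul_apply]
  mul_smul a b s := by ext x; simp [Sec.smul_apply, mul_smul]
  smul_zero a := by ext x; simp [Sec.smul_apply]
  smul_add a s t := by ext x; simp [Sec.smul_apply]
  add_smul a b s := by ext x; simp [Sec.smul_apply, add_smul]
  zero_smul s := by ext x; simp [Sec.smul_apply]

instance Sec.instTower (B : VB n X) : IsScalarTower ℝ (Sm n X) (Sec B) where
  smul_assoc r a s := by ext x; simp [Sec.smul_apply, mul_smul]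

/-- Sections of the density-dual `B* ⊗ ⋀ⁿ T*X` of a vector bundle `B`. -/
def DensDual (B : VB n X) := Sec B →ₗ[Sm n X] TopForm n X

instance (B : VB n X) : AddCommGroup (DensDual B) :=
  inferInstanceAs (AddCommGroup (Sec B →ₗ[Sm n X] TopForm n X))

instance (B : VB n X) : Module ℝ (DensDual B) :=
  inferInstanceAs (Module ℝ (Sec B →ₗ[Sm n X] TopForm n X))

/-- The function `k(v)(σ₁, …, σₙ)` on `X`, for a section `k` of the density-dual of `B`. -/
def DensDual.pair {B : VB n X} (v : Sec B) (σ : Fin n → VF n X) : DensDual B →ₗ[ℝ] Sm n X where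
  toFun k := (show Sec B →ₗ[Sm n X] TopForm n X from k) v σ
  map_add' _ _ := rfl
  map_smul' _ _ := rfl

/-- The differential operator `τ₁ ∘ ⋯ ∘ τₖ` on functions, for a list of vector fields. -/
def word (l : List (VF n X)) : Module.End ℝ (Sm n X) :=
  (l.map fun τ => (τ : Sm n X →ₗ[ℝ] Sm n X)).prod

/-- The functional `a ↦ (τ₁ ⋯ τₖ a)(x)`. -/
def jetEval (x : X) (l : List (VF n X)) : Sm n X →ₗ[ℝ] ℝ where
  toFun a := word l a x
  map_add' a b := by simp
  map_smul' r a := by simp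

open Classical in
/-- A globally defined smooth function with the same germ at `x` as `g` (and `0` if `g` is not
smooth near `x`). -/
def germExt (g : X → ℝ) (x : X) : Sm n X :=
  if h : ∃ a : Sm n X, (a : X → ℝ) =ᶠ[𝓝 x] g then h.choose else 0

/-- Near `x₀`, the vector fields `τ` are the coordinate fields of a local coordinate system. -/
def IsCoordFrame (x₀ : X) (τ : Fin n → VF n X) : Prop :=
  ∃ y : Fin n → Sm n X, ∀ᶠ x in 𝓝 x₀, ∀ i j, τ i (y j) x = if i = j then 1 else 0

end Base

/-! ### The bundles of fields and of antifields -/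

/-- The geometric data of a system of even and odd fields: a smooth fibre bundle `proj : Y → X`
(with typical fibre `M`) of even fields, a vector bundle `F` of odd fields, and a vector bundle `W`
over `X` together with a splitting `VY = Y ×_X W` of the vertical tangent bundle of `Y`. -/
structure FieldSpace (n d : ℕ) (X Y : Type)
    [TopologicalSpace X] [ChartedSpace (EuclideanSpace ℝ (Fin n)) X]
    [TopologicalSpace Y] [ChartedSpace (EuclideanSpace ℝ (Fin d)) Y]
    [IsManifold (𝓡 d) ∞ Y] where
  proj : Y → X
  contMDiff_proj : ContMDiff (𝓡 d) (𝓡 n) ∞ proj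
  m : ℕ
  M : Type
  [topM : TopologicalSpace M]
  [chM : ChartedSpace (EuclideanSpace ℝ (Fin m)) M]
  [manM : IsManifold (𝓡 m) ∞ M]
  locTriv : ∀ x : X, ∃ e : Trivialization M proj, x ∈ e.baseSet ∧
    ContMDiffOn (𝓡 d) ((𝓡 n).prod (𝓡 m)) ∞ e e.source ∧
    ContMDiffOn ((𝓡 n).prod (𝓡 m)) (𝓡 d) ∞ e.toOpenPartialHomeomorph.symm e.target
  F : VB n X
  W : VB n X
  vert : ∀ y : Y, W.fiber (proj y) →ₗ[ℝ] TangentSpace (𝓡 d) y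
  vert_injective : ∀ y, Function.Injective (vert y)
  vert_range : ∀ y (v : TangentSpace (𝓡 d) y),
    v ∈ LinearMap.range (vert y) ↔ mfderiv (𝓡 d) (𝓡 n) proj y v = 0
  vert_smooth : ∀ w : Sec W, ContMDiff (𝓡 d) (𝓡 d).tangent ∞
    (fun y => (⟨y, vert y (w (proj y))⟩ : TangentBundle (𝓡 d) Y))

/-- The bundles of higher antifields. For each index `i`, the antifields of the density-dual of
`V i` are even, those of the density-dual of `E i` are odd, and both have antifield number
`ant i`. -/
structure Antifields (n : ℕ) (X : Type)
    [TopologicalSpace X] [ChartedSpace (EuclideanSpace ℝ (Fin n)) X] (ι : Type) where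
  V : ι → VB n X
  E : ι → VB n X
  ant : ι → ℕ

/-- Adjoin one more pair of bundles of antifields, of antifield number `a`. -/
def Antifields.extend {n : ℕ} {X : Type} [TopologicalSpace X]
    [ChartedSpace (EuclideanSpace ℝ (Fin n)) X] {ι : Type} (K : Antifields n X ι)
    (V' E' : VB n X) (a : ℕ) : Antifields n X (Option ι) where
  V o := o.elim V' K.V
  E o := o.elim E' K.E
  ant o := o.elim a K.ant

section Jets

variable {n d : ℕ} {X Y : Type}
  [TopologicalSpace X] [ChartedSpace (EuclideanSpace ℝ (Fin n)) X]
  [TopologicalSpace Y] [ChartedSpace (EuclideanSpace ℝ (Fin d)) Y] [IsManifold (𝓡 d) ∞ Y]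
  (B : FieldSpace n d X Y)

/-- `s` is a smooth section of `Y → X` on a neighbourhood of `x`. -/
def IsSecAt (s : X → Y) (x : X) : Prop :=
  ∀ᶠ x' in 𝓝 x, ContMDiffAt (𝓡 n) (𝓡 d) ∞ s x' ∧ B.proj (s x') = x'

/-- A point of a jet manifold of `Y → X`, represented by a base point and a local section. Every
function on this type that is considered below depends only on some jet `jʳ_x s`. -/
structure JetPt where
  x : X
  s : X → Y
  isSec : IsSecAt B s x

/-- The function `jʳ_x s ↦ (τ₁ ⋯ τₖ (h ∘ s))(x)` on a jet manifold, for `h ∈ C^∞(Y)`. -/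
def jetFun (h : Sm d Y) (l : List (VF n X)) (p : JetPt B) : ℝ :=
  jetEval p.x l (germExt (fun x => h (p.s x)) p.x)

/-- `f` is (the pull-back of) a smooth function on the jet manifold `JʳY`: near every point it is
a smooth function of finitely many of the functions `jetFun` of order at most `r` (these include
local coordinates on `JʳY`). -/
def SmoothJet (r : ℕ) (f : JetPt B → ℝ) : Prop :=
  ∀ p : JetPt B, ∃ (k : ℕ) (h : Fin k → Sm d Y) (l : Fin k → List (VF n X))
    (g : (Fin k → ℝ) → ℝ) (ε : ℝ), (∀ i, (l i).length ≤ r) ∧ ContDiff ℝ ∞ g ∧ 0 < ε ∧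
    ∀ p' : JetPt B, (∀ i, |jetFun B (h i) (l i) p' - jetFun B (h i) (l i) p| < ε) →
      f p' = g fun i => jetFun B (h i) (l i) p'

end Jets

/-! ### The graded-commutative ring of fields and antifields -/

section Ring

variable {n d : ℕ} {X Y : Type}
  [TopologicalSpace X] [ChartedSpace (EuclideanSpace ℝ (Fin n)) X]
  [TopologicalSpace Y] [ChartedSpace (EuclideanSpace ℝ (Fin d)) Y] [IsManifold (𝓡 d) ∞ Y]
  (B : FieldSpace n d X Y) {ι : Type} (K : Antifields n X ι)

/-- Sections of the bundle of even antifields: the density-duals of `F` and of the `V i`. -/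
abbrev QEven := DensDual B.F × (∀ i, DensDual (K.V i))

/-- Sections of the bundle of odd variables: the odd fields `F`, and the odd antifields, i.e. the
density-duals of `W` and of the `E i`. -/
def QOdd := Sec B.F × DensDual B.W × (∀ i, DensDual (K.E i))

instance : AddCommGroup (QOdd B K) :=
  inferInstanceAs (AddCommGroup (Sec B.F × DensDual B.W × (∀ i, DensDual (K.E i))))

instance : Module ℝ (QOdd B K) :=
  inferInstanceAs (Module ℝ (Sec B.F × DensDual B.W × (∀ i, DensDual (K.E i))))

/-- The component in `F`. -/
def QOdd.field : QOdd B K →ₗ[ℝ] Sec B.F :=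
  LinearMap.fst ℝ (Sec B.F) (DensDual B.W × (∀ i, DensDual (K.E i)))

/-- The component in the density-dual of `W`. -/
def QOdd.anti : QOdd B K →ₗ[ℝ] DensDual B.W :=
  LinearMap.fst ℝ (DensDual B.W) (∀ i, DensDual (K.E i)) ∘ₗ
    LinearMap.snd ℝ (Sec B.F) (DensDual B.W × (∀ i, DensDual (K.E i)))

/-- The component in the density-dual of `E i`. -/
def QOdd.ghost (i : ι) : QOdd B K →ₗ[ℝ] DensDual (K.E i) :=
  LinearMap.proj i ∘ₗ LinearMap.snd ℝ (DensDual B.W) (∀ i, DensDual (K.E i)) ∘ₗ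
    LinearMap.snd ℝ (Sec B.F) (DensDual B.W × (∀ i, DensDual (K.E i)))

/-- The exterior algebra generated by the linear functionals of the odd variables. -/
abbrev Val := ExteriorAlgebra ℝ (Module.Dual ℝ (QOdd B K))

/-- The ambient ring of functions of a jet of `Y` and a section of the bundle of even antifields
whose values are in the exterior algebra generated by the linear functionals of the odd
variables. -/
def Fun := JetPt B × QEven B K → Val B K

instance : Ring (Fun B K) :=
  inferInstanceAs (Ring (JetPt B × QEven B K → Val B K))

theorem Fun.add_apply (Φ Ψ : Fun B K) (z) : (Φ + Ψ) z = Φ z + Ψ z := rfl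

theorem Fun.mul_apply (Φ Ψ : Fun B K) (z) : (Φ * Ψ) z = Φ z * Ψ z := rfl

/-- Functions on the base `X`, as elements of the ring. -/
def baseHom : Sm n X →+* Fun B K where
  toFun a := fun z => algebraMap ℝ _ (a z.1.x)
  map_one' := by funext z; exact map_one _
  map_mul' a b := by funext z; exact map_mul _ _ _
  map_zero' := by funext z; exact map_zero _
  map_add' a b := by funext z; exact map_add _ _ _

instance : Algebra (Sm n X) (Fun B K) :=
  (baseHom B K).toAlgebra' fun a Φ => funext fun z => Algebra.commutes (a z.1.x) (Φ z)

theorem Fun.smul_apply (a : Sm n X) (Φ : Fun B K) (z) : (a • Φ) z = a z.1.x • Φ z := by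
  rw [Algebra.smul_def, Algebra.smul_def]; rfl

/-- Functions on the jet manifolds of `Y`, as elements of the ring. -/
def bodyFun (f : JetPt B → ℝ) : Fun B K := fun z => algebraMap ℝ _ (f z.1)

/-- The odd fields and their derivatives: `τ₁ ⋯ τₖ` of a linear fibre coordinate `κ` on `F`. -/
def fieldGen (l : List (VF n X)) (κ : Sec B.F →ₗ[Sm n X] Sm n X) : Fun B K := fun z =>
  ExteriorAlgebra.ι ℝ (jetEval z.1.x l ∘ₗ κ.restrictScalars ℝ ∘ₗ QOdd.field B K)

/-- The functional `k ↦ (τ₁ ⋯ τₖ (k(v)(σ₁, …, σₙ)))(x)` on sections of a density-dual. -/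
def densEval (x : X) (l : List (VF n X)) {C : VB n X} (v : Sec C) (σ : Fin n → VF n X) :
    DensDual C →ₗ[ℝ] ℝ := jetEval x l ∘ₗ DensDual.pair v σ

/-- The even antifields of the odd fields (antifield number one) and their derivatives. -/
def antiEven (l : List (VF n X)) (v : Sec B.F) (σ : Fin n → VF n X) : Fun B K := fun z =>
  algebraMap ℝ _ (densEval z.1.x l v σ z.2.1)

/-- The odd antifields of the even fields (antifield number one) and their derivatives. -/
def antiOdd (l : List (VF n X)) (w : Sec B.W) (σ : Fin n → VF n X) : Fun B K := fun z =>
  ExteriorAlgebra.ι ℝ (densEval z.1.x l w σ ∘ₗ QOdd.anti B K)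

/-- The higher even antifields and their derivatives. -/
def ghostEven (i : ι) (l : List (VF n X)) (v : Sec (K.V i)) (σ : Fin n → VF n X) : Fun B K :=
  fun z => algebraMap ℝ _ (densEval z.1.x l v σ (z.2.2 i))

/-- The higher odd antifields and their derivatives. -/
def ghostOdd (i : ι) (l : List (VF n X)) (v : Sec (K.E i)) (σ : Fin n → VF n X) : Fun B K :=
  fun z => ExteriorAlgebra.ι ℝ (densEval z.1.x l v σ ∘ₗ QOdd.ghost B K i)

/-- The generators of jet order at most `r` and antifield number at most `l`. -/
inductive Gen (r l : ℕ) : Fun B K → Prop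
  | body (f : JetPt B → ℝ) (hf : SmoothJet B r f) : Gen r l (bodyFun B K f)
  | field (t : List (VF n X)) (ht : t.length ≤ r) (κ : Sec B.F →ₗ[Sm n X] Sm n X) :
      Gen r l (fieldGen B K t κ)
  | antiEven (hl : 1 ≤ l) (t : List (VF n X)) (ht : t.length ≤ r) (v : Sec B.F)
      (σ : Fin n → VF n X) : Gen r l (antiEven B K t v σ)
  | antiOdd (hl : 1 ≤ l) (t : List (VF n X)) (ht : t.length ≤ r) (w : Sec B.W)
      (σ : Fin n → VF n X) : Gen r l (antiOdd B K t w σ)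
  | ghostEven (i : ι) (hi : K.ant i ≤ l) (t : List (VF n X)) (ht : t.length ≤ r)
      (v : Sec (K.V i)) (σ : Fin n → VF n X) : Gen r l (ghostEven B K i t v σ)
  | ghostOdd (i : ι) (hi : K.ant i ≤ l) (t : List (VF n X)) (ht : t.length ≤ r)
      (v : Sec (K.E i)) (σ : Fin n → VF n X) : Gen r l (ghostOdd B K i t v σ)

/-- The polynomials in the generators. -/
abbrev genAlg (r l : ℕ) : Subalgebra (Sm n X) (Fun B K) :=
  Algebra.adjoin (Sm n X) {Φ | Gen B K r l Φ}

/-- Graded functions of jet order at most `r` that only involve antifields of antifield number at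
most `l`: locally over `X`, polynomials in the generators with coefficients that are smooth on
`JʳY`. -/
def ordLe (r l : ℕ) : Subalgebra (Sm n X) (Fun B K) where
  carrier := {Φ | ∀ x₀ : X, ∃ U ∈ 𝓝 x₀, ∃ Ψ ∈ genAlg B K r l, ∀ z, z.1.x ∈ U → Φ z = Ψ z}
  mul_mem' := by
    intro Φ Φ' h h' x₀
    obtain ⟨U, hU, Ψ, hΨ, e⟩ := h x₀
    obtain ⟨U', hU', Ψ', hΨ', e'⟩ := h' x₀
    refine ⟨U ∩ U', inter_mem hU hU', Ψ * Ψ', mul_mem hΨ hΨ', fun z hz => ?_⟩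
    rw [Fun.mul_apply, Fun.mul_apply, e z hz.1, e' z hz.2]
  add_mem' := by
    intro Φ Φ' h h' x₀
    obtain ⟨U, hU, Ψ, hΨ, e⟩ := h x₀
    obtain ⟨U', hU', Ψ', hΨ', e'⟩ := h' x₀
    refine ⟨U ∩ U', inter_mem hU hU', Ψ + Ψ', add_mem hΨ hΨ', fun z hz => ?_⟩
    rw [Fun.add_apply, Fun.add_apply, e z hz.1, e' z hz.2]
  algebraMap_mem' a := fun x₀ =>
    ⟨univ, univ_mem, algebraMap _ _ a, Subalgebra.algebraMap_mem _ a, fun _ _ => rfl⟩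

theorem Gen.mono {r r' l l' : ℕ} (hr : r ≤ r') (hl : l ≤ l') {Φ : Fun B K} (h : Gen B K r l Φ) :
    Gen B K r' l' Φ := by
  cases h with
  | body f hf =>
    refine Gen.body f fun p => ?_
    obtain ⟨k, h, t, g, ε, ht, hg, hε, e⟩ := hf p
    exact ⟨k, h, t, g, ε, fun i => (ht i).trans hr, hg, hε, e⟩
  | field t ht κ => exact Gen.field t (ht.trans hr) κ
  | antiEven h t ht v σ => exact Gen.antiEven (h.trans hl) t (ht.trans hr) v σ
  | antiOdd h t ht v σ => exact Gen.antiOdd (h.trans hl) t (ht.trans hr) v σ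
  | ghostEven i h t ht v σ => exact Gen.ghostEven i (h.trans hl) t (ht.trans hr) v σ
  | ghostOdd i h t ht v σ => exact Gen.ghostOdd i (h.trans hl) t (ht.trans hr) v σ

theorem ordLe_mono {r r' l l' : ℕ} (hr : r ≤ r') (hl : l ≤ l') :
    ordLe B K r l ≤ ordLe B K r' l' := by
  intro Φ h x₀
  obtain ⟨U, hU, Ψ, hΨ, e⟩ := h x₀
  exact ⟨U, hU, Ψ, Algebra.adjoin_mono (fun _ hx => Gen.mono B K hr hl hx) hΨ, e⟩

/-- The graded-commutative ring of all graded functions (of arbitrary finite jet order) of the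
fields and the antifields, polynomial in the antifields. -/
def P : Subalgebra (Sm n X) (Fun B K) where
  carrier := {Φ | ∃ r l, Φ ∈ ordLe B K r l}
  mul_mem' := by
    rintro Φ Φ' ⟨r, l, h⟩ ⟨r', l', h'⟩
    exact ⟨max r r', max l l',
      mul_mem (ordLe_mono B K (le_max_left _ _) (le_max_left _ _) h)
        (ordLe_mono B K (le_max_right _ _) (le_max_right _ _) h')⟩
  add_mem' := by
    rintro Φ Φ' ⟨r, l, h⟩ ⟨r', l', h'⟩
    exact ⟨max r r', max l l',
      add_mem (ordLe_mono B K (le_max_left _ _) (le_max_left _ _) h)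
        (ordLe_mono B K (le_max_right _ _) (le_max_right _ _) h')⟩
  algebraMap_mem' a := ⟨0, 0, Subalgebra.algebraMap_mem _ a⟩

/-- Grassmann parity. -/
def IsPar (i : ZMod 2) (Φ : Fun B K) : Prop :=
  ∀ z, Φ z ∈ CliffordAlgebra.evenOdd (0 : QuadraticForm ℝ (Module.Dual ℝ (QOdd B K))) i

/-! #### Rescaling of the antifields, antifield number -/

/-- Multiplication of the even antifields of antifield number `j` by `c j`. -/
def scaleEven (c : ℕ → ℝ) (q : QEven B K) : QEven B K :=
  (c 1 • q.1, fun i => c (K.ant i) • q.2 i)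

/-- Multiplication of the odd antifields of antifield number `j` by `c j`. -/
def scaleOdd (c : ℕ → ℝ) : QOdd B K →ₗ[ℝ] QOdd B K where
  toFun q := (QOdd.field B K q, c 1 • QOdd.anti B K q, fun i => c (K.ant i) • QOdd.ghost B K i q)
  map_add' q q' := by
    refine Prod.ext rfl (Prod.ext ?_ ?_)
    · exact smul_add (c 1) (QOdd.anti B K q) (QOdd.anti B K q')
    · funext i; exact smul_add (c (K.ant i)) (QOdd.ghost B K i q) (QOdd.ghost B K i q')
  map_smul' r q := by
    refine Prod.ext rfl (Prod.ext ?_ ?_)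
    · exact smul_comm (c 1) r (QOdd.anti B K q)
    · funext i; exact smul_comm (c (K.ant i)) r (QOdd.ghost B K i q)

/-- Substitution into a graded function of the antifields of antifield number `j` multiplied by
`c j`. -/
def subst (c : ℕ → ℝ) : Fun B K →ₐ[Sm n X] Fun B K where
  toFun Φ := fun z =>
    ExteriorAlgebra.map (scaleOdd B K c).dualMap (Φ (z.1, scaleEven B K c z.2))
  map_one' := by funext z; exact map_one _
  map_mul' Φ Ψ := by funext z; exact map_mul _ _ _
  map_zero' := by funext z; exact map_zero _
  map_add' Φ Ψ := by funext z; exact map_add _ _ _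
  commutes' a := by funext z; exact AlgHom.commutes _ _

/-- `Φ` is homogeneous of antifield number `m`. -/
def IsAnt (m : ℕ) (Φ : Fun B K) : Prop :=
  ∀ (t : ℝ) z, subst B K (fun j => t ^ j) Φ z = t ^ m • Φ z

theorem subst_gen (c : ℕ → ℝ) {r l : ℕ} {Φ : Fun B K} (h : Gen B K r l Φ) :
    ∃ a : ℝ, ∀ z, subst B K c Φ z = a • Φ z := by
  cases h with
  | body f hf =>
    refine ⟨1, fun z => ?_⟩
    rw [one_smul]
    exact AlgHom.commutes _ _
  | field t ht κ =>
    refine ⟨1, fun z => ?_⟩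
    rw [one_smul]
    refine (ExteriorAlgebra.map_apply_ι _ _).trans ?_
    rfl
  | antiEven _ t ht v σ =>
    refine ⟨c 1, fun z => ?_⟩
    refine (AlgHom.commutes _ _).trans ?_
    change algebraMap ℝ _ (densEval z.1.x t v σ (c 1 • z.2.1)) = _
    rw [map_smul, smul_eq_mul, map_mul, ← Algebra.smul_def]
    rfl
  | antiOdd _ t ht v σ =>
    refine ⟨c 1, fun z => ?_⟩
    refine (ExteriorAlgebra.map_apply_ι _ _).trans ?_
    refine Eq.trans ?_ (map_smul (ExteriorAlgebra.ι ℝ) (c 1) _)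
    refine congrArg _ (LinearMap.ext fun q => ?_)
    exact map_smul (densEval z.1.x t v σ) (c 1) (QOdd.anti B K q)
  | ghostEven i _ t ht v σ =>
    refine ⟨c (K.ant i), fun z => ?_⟩
    refine (AlgHom.commutes _ _).trans ?_
    change algebraMap ℝ _ (densEval z.1.x t v σ (c (K.ant i) • z.2.2 i)) = _
    rw [map_smul, smul_eq_mul, map_mul, ← Algebra.smul_def]
    rfl
  | ghostOdd i _ t ht v σ =>
    refine ⟨c (K.ant i), fun z => ?_⟩
    refine (ExteriorAlgebra.map_apply_ι _ _).trans ?_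
    refine Eq.trans ?_ (map_smul (ExteriorAlgebra.ι ℝ) (c (K.ant i)) _)
    refine congrArg _ (LinearMap.ext fun q => ?_)
    exact map_smul (densEval z.1.x t v σ) (c (K.ant i)) (QOdd.ghost B K i q)

theorem subst_mem_ordLe (c : ℕ → ℝ) {r l : ℕ} {Φ : Fun B K} (h : Φ ∈ ordLe B K r l) :
    subst B K c Φ ∈ ordLe B K r l := by
  have key : genAlg B K r l ≤ (genAlg B K r l).comap (subst B K c) := by
    refine Algebra.adjoin_le fun Ψ hΨ => ?_
    obtain ⟨a, ha⟩ := subst_gen B K c hΨ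
    have : subst B K c Ψ = (algebraMap ℝ (Sm n X) a) • Ψ := by
      funext z
      rw [ha z, Fun.smul_apply]
      rfl
    change subst B K c Ψ ∈ genAlg B K r l
    rw [this]
    exact Subalgebra.smul_mem _ (Algebra.subset_adjoin hΨ) _
  intro x₀
  obtain ⟨U, hU, Ψ, hΨ, e⟩ := h x₀
  refine ⟨U, hU, subst B K c Ψ, key hΨ, fun z hz => ?_⟩
  exact congrArg _ (e (z.1, scaleEven B K c z.2) hz)

/-- The part of a graded function that does not involve antifields of antifield number greater
than `l`, i.e. the result of setting these antifields to zero. -/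
def restr (l : ℕ) : P B K →ₗ[Sm n X] P B K where
  toFun Φ := ⟨subst B K (fun j => if j ≤ l then 1 else 0) Φ,
    Φ.2.imp fun _ h => h.imp fun _ h => subst_mem_ordLe B K _ h⟩
  map_add' _ _ := Subtype.ext (map_add _ _ _)
  map_smul' _ _ := Subtype.ext (map_smul _ _ _)

/-! #### Total derivatives -/

variable {B K} in
/-- The functional on the exterior algebra that contracts an element successively with the given
odd sections and then takes the scalar part. These functionals separate the elements. -/
def testEval (ks : List (QOdd B K)) (g : Val B K) : ℝ :=
  ExteriorAlgebra.algebraMapInv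
    (ks.foldr (fun k g => CliffordAlgebra.contractLeft (Module.Dual.eval ℝ _ k) g) g)

open Classical in
variable {B K} in
/-- The values of `Φ` along a local section `s` of `Y` and a section `q` of the bundle of even
antifields (set to zero at points near which `s` is not a smooth section). -/
def along (Φ : Fun B K) (s : X → Y) (q : QEven B K) (x : X) :
    Val B K :=
  if h : IsSecAt B s x then Φ (⟨x, s, h⟩, q) else 0

open Classical in
variable {B K} in
/-- The total derivative `d_τ Φ = τ^λ d_λ Φ` along a vector field `τ` on `X`: the function whose
value at the jet of `(s, q)` at `x` is the derivative along `τ` at `x` of the function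
`x' ↦ Φ(j_{x'}(s, q))`, the derivative of this function with values in an exterior algebra being
taken weakly, against the functionals `testEval ks`. -/
def totalDeriv (τ : VF n X) (Φ : Fun B K) : Fun B K := fun z =>
  if h : ∃ γ, ∀ ks : List (QOdd B K), testEval ks γ =
      τ (germExt (fun x => testEval ks (along Φ z.1.s z.2 x)) z.1.x) z.1.x
  then h.choose else 0

variable {B K} in
/-- Iterated total derivatives `d_{τ₁} ⋯ d_{τₖ} Φ`. -/
def totalDerivs (l : List (VF n X)) (Φ : Fun B K) : Fun B K := l.foldr totalDeriv Φ

/-! #### Graded densities -/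

/-- Graded densities (horizontal `n`-forms) `Φ ω` with `Φ` in the ring, as alternating
`C^∞(X)`-multilinear functions of vector fields on `X`. -/
abbrev Dens := (VF n X) [⋀^Fin n]→ₗ[Sm n X] (P B K)

/-- The graded densities of finite jet order and of antifield number `m` which only involve
antifields of antifield number at most `l`. -/
def chains (l m : ℕ) : Submodule (Sm n X) (Dens B K) where
  carrier := {Φ | (∃ r, ∀ σ, (Φ σ : Fun B K) ∈ ordLe B K r l) ∧ ∀ σ, IsAnt B K m (Φ σ)}
  add_mem' := by
    rintro Φ Ψ ⟨⟨r, h⟩, ha⟩ ⟨⟨r', h'⟩, ha'⟩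
    refine ⟨⟨max r r', fun σ => add_mem (ordLe_mono B K (le_max_left _ _) le_rfl (h σ))
      (ordLe_mono B K (le_max_right _ _) le_rfl (h' σ))⟩, fun σ t z => ?_⟩
    change subst B K _ ((Φ σ : Fun B K) + (Ψ σ : Fun B K)) z =
      t ^ m • ((Φ σ : Fun B K) z + (Ψ σ : Fun B K) z)
    rw [map_add, smul_add, ← ha σ t z, ← ha' σ t z]
    rfl
  zero_mem' := by
    refine ⟨⟨0, fun σ => zero_mem _⟩, fun σ t z => ?_⟩
    change subst B K _ (0 : Fun B K) z = t ^ m • (0 : ExteriorAlgebra ℝ _)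
    rw [map_zero, smul_zero]
    rfl
  smul_mem' := by
    rintro a Φ ⟨⟨r, h⟩, ha⟩
    refine ⟨⟨r, fun σ => Subalgebra.smul_mem _ (h σ) a⟩, fun σ t z => ?_⟩
    change subst B K _ (a • (Φ σ : Fun B K)) z = t ^ m • (a • (Φ σ : Fun B K)) z
    rw [map_smul, Fun.smul_apply, Fun.smul_apply, ha σ t z, smul_comm]

variable {B K} in
/-- A graded density of Grassmann parity `i`. -/
def Dens.IsPar (i : ZMod 2) (Φ : Dens B K) : Prop := ∀ σ, KoszulTate.IsPar B K i (Φ σ)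

variable {B K} in
/-- `Ψ` is the Lie derivative of the graded density `Φ` along the total derivative `d_τ`; in local
coordinates, `Ψ = d_λ(τ^λ Φ) ω`. -/
def Dens.IsLieDeriv (τ : VF n X) (Φ Ψ : Dens B K) : Prop :=
  ∀ σ : Fin n → VF n X, (Ψ σ : Fun B K) =
    totalDeriv τ (Φ σ) - ∑ i, (Φ (Function.update σ i ⁅τ, σ i⁆) : Fun B K)

/-! #### Contact derivations -/

variable {B K} in
/-- Odd right contact derivations of the ring of antifield number `-1`, vanishing on the functions
of the fields alone. Such a derivation is determined by its values on the antifields. It acts on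
graded densities by acting on their values. -/
structure IsContactDer (D : P B K →ₗ[Sm n X] P B K) : Prop where
  order : ∀ r l, ∃ r', ∀ Φ : P B K, (Φ : Fun B K) ∈ ordLe B K r l →
    (D Φ : Fun B K) ∈ ordLe B K r' l
  leibniz : ∀ (i : ZMod 2) (Φ Ψ : P B K), IsPar B K i Ψ →
    D (Φ * Ψ) = (-1) ^ i.val * (D Φ * Ψ) + Φ * D Ψ
  parity : ∀ (i : ZMod 2) (Φ : P B K), IsPar B K i Φ → IsPar B K (i + 1) (D Φ)
  ant : ∀ (m : ℕ) (Φ : P B K), IsAnt B K (m + 1) Φ → IsAnt B K m (D Φ)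
  fields : ∀ (r : ℕ) (Φ : P B K), (Φ : Fun B K) ∈ ordLe B K r 0 → D Φ = 0
  contact : ∀ (τ : VF n X) (Φ Ψ : P B K), (Ψ : Fun B K) = totalDeriv τ Φ →
    (D Ψ : Fun B K) = totalDeriv τ (D Φ)

/-! ### The Euler–Lagrange operator -/

/-- The derivative at the point `z` of the graded function `Φ` along the (prolonged) vertical vector
field on `Y` given by a section `w` of `W` is `γ`: for every smooth variation `S` of the local
section with initial velocity `w`. -/
def HasVertDeriv (w : Sec B.W) (Φ : Fun B K) (z : JetPt B × QEven B K)
    (γ : Val B K) : Prop :=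
  ∀ S : ℝ → X → Y,
    (∀ᶠ tx : ℝ × X in 𝓝 ((0 : ℝ), z.1.x),
      ContMDiffAt (𝓘(ℝ, ℝ).prod (𝓡 n)) (𝓡 d) ∞ (fun u : ℝ × X => S u.1 u.2) tx ∧
        B.proj (S tx.1 tx.2) = tx.2) →
    (∀ᶠ x in 𝓝 z.1.x, S 0 x = z.1.s x ∧
      mfderiv 𝓘(ℝ, ℝ) (𝓡 d) (fun t => S t x) 0 (1 : ℝ) =
        B.vert (S 0 x) (w (B.proj (S 0 x)))) →
    ∀ ks : List (QOdd B K),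
      HasDerivAt (fun t => testEval ks (along Φ (S t) z.2 z.1.x)) (testEval ks γ) 0

/-- The left derivative at the point `z` of the graded function `Φ` along a section `f` of the bundle
`F` of odd fields is `γ`. -/
def HasOddDeriv (f : Sec B.F) (Φ : Fun B K) (z : JetPt B × QEven B K)
    (γ : Val B K) : Prop :=
  γ = CliffordAlgebra.contractLeft (Module.Dual.eval ℝ (QOdd B K) (f, 0, 0)) (Φ z)

variable {B K} in
/-- Let `var a Φ z γ` say that the derivative of `Φ` at `z` along the direction `a u` is `γ`, where
`u` is a fixed direction in the space of fields and `a ∈ C^∞(X)`. Then `IsVarDeriv L var e` says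
that the graded density `e` is the contraction of `u` and the Euler–Lagrange operator of `L`: in
suitable local coordinates around any point, if `L = ℒ ω` and if the derivative of `ℒ` along `a u`
is `∑_Λ (∂_Λ a) c^Λ`, then `e = ∑_Λ (-1)^{|Λ|} d_Λ(c^Λ) ω`. (For `u = ∂_A`, the coefficients are
`c^Λ = ∂ ℒ / ∂ s^A_Λ`.) -/
def IsVarDeriv (L : Dens B K)
    (var : Sm n X → Fun B K → JetPt B × QEven B K →
      Val B K → Prop)
    (e : Dens B K) : Prop :=
  ∀ x₀ : X, ∃ τ : Fin n → VF n X, IsCoordFrame x₀ τ ∧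
    ∃ (T : Finset (List (Fin n))) (c : List (Fin n) → Fun B K) (r : ℕ),
      (∀ Λ ∈ T, c Λ ∈ ordLe B K r 0) ∧ ∃ U ∈ 𝓝 x₀, ∀ z : JetPt B × QEven B K, z.1.x ∈ U →
        (∀ a : Sm n X, var a (L τ) z (∑ Λ ∈ T, jetEval z.1.x (Λ.map τ) a • c Λ z)) ∧
        (e τ : Fun B K) z = ∑ Λ ∈ T, (-1 : ℝ) ^ Λ.length • totalDerivs (Λ.map τ) (c Λ) z

variable {B K} in
/-- `L` is a graded Lagrangian: an even graded density of the fields alone. -/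
def IsLagrangian (L : Dens B K) : Prop := L ∈ chains B K 0 0 ∧ L.IsPar 0

variable {B K} in
/-- The values of `D` on the antifields of antifield number one are the variational derivatives
`ℰ_A` of `L`. -/
structure IsELOnAntifields (L : Dens B K) (D : P B K →ₗ[Sm n X] P B K) : Prop where
  even_fields : ∀ w : Sec B.W, ∃ e ∈ chains B K 0 0,
    IsVarDeriv L (fun a => HasVertDeriv B K (a • w)) e ∧
    ∀ (σ : Fin n → VF n X) (Φ : P B K), (Φ : Fun B K) = antiOdd B K [] w σ → D Φ = e σ
  odd_fields : ∀ f : Sec B.F, ∃ e ∈ chains B K 0 0,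
    IsVarDeriv L (fun a => HasOddDeriv B K (a • f)) e ∧
    ∀ (σ : Fin n → VF n X) (Φ : P B K), (Φ : Fun B K) = antiEven B K [] f σ → D Φ = e σ

variable {B K} in
/-- The Koszul–Tate differential `\bar δ` of `L`: its values on the antifields of antifield number
one are the variational derivatives of `L`, and it vanishes on the higher antifields. -/
structure IsKoszulTate (L : Dens B K) (D : P B K →ₗ[Sm n X] P B K) : Prop where
  contactDer : IsContactDer D
  antifields : IsELOnAntifields L D
  ghostEven : ∀ i v (σ : Fin n → VF n X) (Φ : P B K),
    (Φ : Fun B K) = ghostEven B K i [] v σ → D Φ = 0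
  ghostOdd : ∀ i v (σ : Fin n → VF n X) (Φ : P B K),
    (Φ : Fun B K) = ghostOdd B K i [] v σ → D Φ = 0

/-! ### The chain complex -/

variable {B K} in
/-- The action of a derivation on graded densities. -/
abbrev act (D : P B K →ₗ[Sm n X] P B K) (Φ : Dens B K) : Dens B K := D.compAlternatingMap Φ

variable {B K} in
/-- Cycles of antifield number `m` among the graded densities which only involve antifields of
antifield number at most `l`. -/
def cycles (D : P B K →ₗ[Sm n X] P B K) (l m : ℕ) : Submodule (Sm n X) (Dens B K) where
  carrier := {Φ | Φ ∈ chains B K l m ∧ act D Φ = 0}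
  add_mem' := by
    rintro Φ Ψ ⟨h, e⟩ ⟨h', e'⟩
    exact ⟨add_mem h h', (LinearMap.compAlternatingMap_add D Φ Ψ).trans 
      ((congrArg₂ (· + ·) e e').trans (add_zero _))⟩
  zero_mem' := ⟨zero_mem _, by ext σ; simp⟩
  smul_mem' := by
    rintro a Φ ⟨h, e⟩
    refine ⟨Submodule.smul_mem _ a h, ?_⟩
    ext1 σ
    have := congrArg (fun f => f σ) e
    change D (a • Φ σ) = 0
    rw [map_smul]
    exact (congrArg (a • ·) this).trans (smul_zero a)

variable {B K} in
/-- Boundaries of antifield number `m` of graded densities which only involve antifields of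
antifield number at most `l`. -/
def boundaries (D : P B K →ₗ[Sm n X] P B K) (l m : ℕ) : Submodule (Sm n X) (Dens B K) where
  carrier := {Φ | ∃ Ψ ∈ chains B K l (m + 1), act D Ψ = Φ}
  add_mem' := by
    rintro _ _ ⟨Ψ, h, rfl⟩ ⟨Ψ', h', rfl⟩
    exact ⟨Ψ + Ψ', add_mem h h', LinearMap.compAlternatingMap_add _ _ _⟩
  zero_mem' := ⟨0, zero_mem _, by ext σ; simp⟩
  smul_mem' := by
    rintro a _ ⟨Ψ, h, rfl⟩
    refine ⟨a • Ψ, Submodule.smul_mem _ a h, ?_⟩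
    ext1 σ
    exact map_smul D a (Ψ σ)

variable {B K} in
/-- The homology in degree `m` of the complex of all graded densities which only involve antifields
of antifield number at most `l`, graded by the antifield number. -/
abbrev Homology (D : P B K →ₗ[Sm n X] P B K) (l m : ℕ) :=
  Subquot (cycles D l m) (boundaries D l m)

variable {B K} in
/-- The class of a cycle. -/
abbrev hclass (D : P B K →ₗ[Sm n X] P B K) (l m : ℕ) :
    ↥(cycles D l m) →ₗ[Sm n X] Homology D l m :=
  Subquot.mk (cycles D l m) (boundaries D l m)

variable {B K} in
/-- The complex `0 ← Im \bar δ ← 𝒫_1 ← 𝒫_2 ← ⋯` of graded densities which only involve antifields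
of antifield number at most `l` is `k`-exact. (It is always exact in degree `0`.) -/
def IsExactUpTo (D : P B K →ₗ[Sm n X] P B K) (l k : ℕ) : Prop :=
  ∀ m, 1 ≤ m → m ≤ k → cycles D l m ≤ boundaries D l m

variable {B K} in
/-- The `(N+1)`-homology regularity condition. With `𝒫{k}` denoting the densities which involve
antifields of antifield number at most `k + 2` (so `l = k + 2`): for `-1 ≤ k < N - 1`, every cycle in
`𝒫{k}_{k+3}` is the boundary of an element of `𝒫{k+1}_{k+4}`. -/
def IsHomologyRegular (D : P B K →ₗ[Sm n X] P B K) (N : ℕ) : Prop :=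
  ∀ l, 1 ≤ l → l ≤ N → cycles D l (l + 1) ≤ boundaries D (l + 1) (l + 1)

variable {B K} in
/-- The system with Lagrangian `L`, provided with the bundles `K` of higher antifields and the
derivation `δ = δ_N`, is `N`-stage reducible. -/
structure IsReducible (L : Dens B K) (N : ℕ) (δ : P B K →ₗ[Sm n X] P B K) : Prop where
  one_le : 1 ≤ N
  ant_ge : ∀ i, 2 ≤ K.ant i
  ant_le : ∀ i, K.ant i ≤ N + 2
  lagrangian : IsLagrangian L
  contactDer : IsContactDer δ
  antifields : IsELOnAntifields L δ
  nilpotent : ∀ Φ, δ (δ Φ) = 0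
  exact_upTo : IsExactUpTo δ (N + 2) (N + 1)
  regular : IsHomologyRegular δ N

/-! ### Noether identities -/

variable {B K} in
/-- The `k`-stage Noether identity
`∑ G^{r_{k-1},Λ} d_Λ(∑ Δ_{r_{k-1}}^{r_{k-2},Σ} \bar c_{Σ r_{k-2}}) + \bar δ H = 0` (`k ≥ 1`), where
`G` is linear in the antifields `\bar c_{r_{k-1}}` of antifield number `k + 1`, and `H` is of
antifield number `k + 1`, each of its terms containing the antifields `\bar c_{r_{k-2}}` of
antifield number `k`. The first summand is the part of `δ G` that contains the antifields
`\bar c_{r_{k-2}}`. -/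
structure IsNoetherIdentity (δbar δ : P B K →ₗ[Sm n X] P B K) (k : ℕ) (G H : Dens B K) :
    Prop where
  mem_G : G ∈ chains B K (k + 1) (k + 1)
  linear_G : act (restr B K k) G = 0
  mem_H : H ∈ chains B K k (k + 1)
  bilinear_H : act (restr B K (k - 1)) H = 0
  identity : (act δ G - act (restr B K (k - 1)) (act δ G)) + act δbar H = 0

variable {B K} in
/-- The summand of a chain `Φ` of antifield number `m` that is linear in the antifields of
antifield number `m`. -/
def linPart (m : ℕ) (Φ : Dens B K) : Dens B K := Φ - act (restr B K (m - 1)) Φ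

variable {B K} in
/-- The summand of a chain `Φ` of antifield number `m` that consists of the terms whose antifields of
highest antifield number have antifield number `m - 1`. -/
def bilinPart (m : ℕ) (Φ : Dens B K) : Dens B K :=
  act (restr B K (m - 1)) Φ - act (restr B K (m - 2)) Φ

variable {B K} in
/-- An `(N+1)`-stage Noether identity, given by an `(N+2)`-cycle `Φ`, is trivial if `Φ` is a
boundary or if its summand linear in the antifields of antifield number `N + 2` vanishes on the
shell, i.e., is `\bar δ`-exact. -/
def IsTrivialNI (δbar δ : P B K →ₗ[Sm n X] P B K) (N : ℕ) (Φ : Dens B K) : Prop :=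
  Φ ∈ boundaries δ (N + 2) (N + 2) ∨
    ∃ Ψ ∈ chains B K (N + 2) (N + 3), act δbar Ψ = linPart (N + 2) Φ

variable {B K} in
/-- The densities `∑ G^{r,Ξ} d_Ξ Δ_r ω` generated by densities `Δ ∈ S`, with coefficients in the
ring of graded functions of the fields: the smallest set that contains `S` and is closed under
sums, under multiplication by graded functions of the fields and under Lie derivatives along total
derivatives. -/
inductive Generated (S : Set (Dens B K)) : Dens B K → Prop
  | base (Φ) (h : Φ ∈ S) : Generated S Φ
  | zero : Generated S 0
  | add (Φ Ψ) (h : Generated S Φ) (h' : Generated S Ψ) : Generated S (Φ + Ψ)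
  | mul (f : P B K) (r : ℕ) (hf : (f : Fun B K) ∈ ordLe B K r 0) (Φ Ψ) (h : Generated S Φ)
      (e : ∀ σ, Ψ σ = f * Φ σ) : Generated S Ψ
  | lie (τ : VF n X) (Φ Ψ) (h : Generated S Φ) (e : Dens.IsLieDeriv τ Φ Ψ) : Generated S Ψ

variable {B K} in
/-- The homology classes of cycles of Grassmann parity `i`. -/
def parityPart (D : P B K →ₗ[Sm n X] P B K) (l m : ℕ) (i : ZMod 2) : Set (Homology D l m) :=
  {h | ∃ Φ : ↥(cycles D l m), (Φ : Dens B K).IsPar i ∧ hclass D l m Φ = h}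

variable {B K} in
/-- The homology is finitely generated by `C`: `C` is a Grassmann-graded projective
`C^∞(X)`-submodule of finite rank such that every element of the homology factorizes through
elements of `C`. -/
structure IsFinitelyGeneratedBy (D : P B K →ₗ[Sm n X] P B K) (l m : ℕ)
    (C : Submodule (Sm n X) (Homology D l m)) : Prop where
  graded : ∀ c ∈ C, ∃ c₀ ∈ C, ∃ c₁ ∈ C,
    c₀ ∈ parityPart D l m 0 ∧ c₁ ∈ parityPart D l m 1 ∧ c = c₀ + c₁
  projective : Module.Projective (Sm n X) C
  finite : Module.Finite (Sm n X) C
  generates : ∀ Φ ∈ cycles D l m,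
    Generated {Δ | ∃ h : Δ ∈ cycles D l m, hclass D l m ⟨Δ, h⟩ ∈ C} Φ

variable {B K} in
/-- The complete Noether identities and the complete higher-stage Noether identities up to stage
`M`, for the derivation `δ`. For the antifields `\bar c` of antifield number `k + 2`, let
`Δ = δ \bar c`. If `k = 0`, then `\bar δ Δ = 0`, which reads `∑ Δ^{A,Λ} d_Λ ℰ_A = 0`. If
`1 ≤ k ≤ M`, then the corresponding summands of `Δ = G + h` satisfy a `k`-stage Noether identity. -/
def CompleteIdentities (δbar δ : P B K →ₗ[Sm n X] P B K) (M : ℕ) : Prop :=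
  ∀ (i : ι) (k : ℕ), K.ant i = k + 2 → k ≤ M → ∀ Δ ∈ chains B K (k + 1) (k + 1),
    ((∃ v : Sec (K.V i), ∀ σ, ∃ Φ : P B K, (Φ : Fun B K) = ghostEven B K i [] v σ ∧ δ Φ = Δ σ) ∨
     (∃ v : Sec (K.E i), ∀ σ, ∃ Φ : P B K, (Φ : Fun B K) = ghostOdd B K i [] v σ ∧ δ Φ = Δ σ)) →
    (k = 0 → act δbar Δ = 0) ∧
    (1 ≤ k → IsNoetherIdentity δbar δ k (linPart (k + 1) Δ) (bilinPart (k + 1) Δ))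

/-! ### Extension by one more stage of antifields -/

/-- The inclusion of the ring of graded functions into the ring extended by new antifields. -/
def incl (V' E' : VB n X) (a : ℕ) (Φ : Fun B K) : Fun B (K.extend V' E' a) := fun z =>
  ExteriorAlgebra.map
    (LinearMap.dualMap
      ({ toFun := fun q => (QOdd.field _ _ q, QOdd.anti _ _ q, fun i => QOdd.ghost _ _ (some i) q)
         map_add' := fun _ _ => rfl
         map_smul' := fun _ _ => rfl } :
        QOdd B (K.extend V' E' a) →ₗ[ℝ] QOdd B K))
    (Φ (z.1, (z.2.1, fun i => z.2.2 (some i))))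

variable {B K} in
/-- The extension of the complex of `δ = δ_N` (antifields of antifield number at most `N + 2`) by new
antifields of antifield number `N + 3` with values in the density-duals of `V'` (even) and `E'`
(odd), which correspond to generators of the submodule `C` of the `(N+2)`-homology:
`L'` and `δbar'` are the Lagrangian and its Koszul–Tate differential on the extended ring, and
`δ' = δ_{N+1}` is a contact derivation which extends `δ`; its values `Δ` on the new antifields are
`(N+2)`-cycles of opposite Grassmann parity that represent generators of `C`. -/
structure IsExtension (L : Dens B K) (δbar δ : P B K →ₗ[Sm n X] P B K) (N : ℕ)
    (C : Submodule (Sm n X) (Homology δ (N + 2) (N + 2))) (V' E' : VB n X)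
    (L' : Dens B (K.extend V' E' (N + 3)))
    (δbar' δ' : P B (K.extend V' E' (N + 3)) →ₗ[Sm n X] P B (K.extend V' E' (N + 3))) : Prop where
  lagrangian : ∀ σ, (L' σ : Fun B (K.extend V' E' (N + 3))) = incl B K V' E' (N + 3) (L σ)
  koszulTate : IsKoszulTate L' δbar'
  contactDer : IsContactDer δ'
  antifields : IsELOnAntifields L' δ'
  extends_bar : ∀ (Φ : P B K) (Φ' : P B (K.extend V' E' (N + 3))),
    (Φ' : Fun B _) = incl B K V' E' (N + 3) Φ →
      (δbar' Φ' : Fun B _) = incl B K V' E' (N + 3) (δbar Φ)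
  extends_delta : ∀ (Φ : P B K) (Φ' : P B (K.extend V' E' (N + 3))),
    (Φ' : Fun B _) = incl B K V' E' (N + 3) Φ → (δ' Φ' : Fun B _) = incl B K V' E' (N + 3) (δ Φ)
  generators : ∃ (ΔV : Sec V' →ₗ[Sm n X] ↥(cycles δ (N + 2) (N + 2)))
      (ΔE : Sec E' →ₗ[Sm n X] ↥(cycles δ (N + 2) (N + 2))),
    (∀ v, (ΔV v : Dens B K).IsPar 1) ∧ (∀ v, (ΔE v : Dens B K).IsPar 0) ∧
    (∀ v σ (Φ' : P B (K.extend V' E' (N + 3))),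
      (Φ' : Fun B _) = ghostEven B (K.extend V' E' (N + 3)) none [] v σ →
        (δ' Φ' : Fun B _) = incl B K V' E' (N + 3) ((ΔV v : Dens B K) σ)) ∧
    (∀ v σ (Φ' : P B (K.extend V' E' (N + 3))),
      (Φ' : Fun B _) = ghostOdd B (K.extend V' E' (N + 3)) none [] v σ →
        (δ' Φ' : Fun B _) = incl B K V' E' (N + 3) ((ΔE v : Dens B K) σ)) ∧
    LinearMap.range (hclass δ (N + 2) (N + 2) ∘ₗ ΔV) ⊔
      LinearMap.range (hclass δ (N + 2) (N + 2) ∘ₗ ΔE) = C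

end Ring

end KoszulTate

end

set_option linter.unusedSectionVars false
set_option linter.unusedVariables false

noncomputable section

namespace KoszulTate

/-! ### Local properties of functions and vector fields on a manifold -/

/-! The algebra is a count of antifield numbers. Let Φ have antifield number N+2. A term of Φ with
an antifield of number N+2 is linear in it, with coefficients in the fields; a term whose highest
antifield has number N+1 contains exactly one more antifield, of number one. Hence the terms of δΦ
that contain an antifield of number N+1 come from two sources only: δ applied to the linear part G,
and δ hitting the number-one factor in the bilinear part H, where δ and δbar agree. This is
`IsPair.linPart_act`, and δΦ = 0, projected to those terms, is the (N+1)-stage Noether identity.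

Conversely, such an identity says that δ(G + H) contains only antifields of number at most N. It is
a cycle, so regularity writes it as δΨ with Ψ free of antifields of number N+2, and G + H − Ψ is a
cycle with linear part G.

For (ii), if G = δbar Ψ, then δΨ has the same linear part as Φ, so Φ − δΨ is a cycle without
antifields of number N+2, which the next regularity condition makes a boundary. In the other
direction, a cycle without antifields of number N+2 has linear part zero, hence is trivial.

For (iii), the new antifields have number N+3, so chains of degree at most N+2 in the extended
complex are old chains. By construction the chosen representatives are boundaries of the new
antifields, and boundaries are stable under sums, multiplication by functions of the fields and Lie
derivatives along total derivatives; so every (N+2)-cycle becomes a boundary. Nilpotency holds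
because the square of an odd contact derivation satisfies a Leibniz rule, commutes with total
derivatives and vanishes on the antifields.

Two facts behind this need analysis. First, δ and δbar are only known to take, on antifields of
number one, values described by local Euler–Lagrange expressions in some coordinates; that these
values coincide is `IsVarDeriv.unique`, proved by integrating against test functions and comparing
formal adjoints in two coordinate systems. Second, a contact derivation with prescribed values on
the antifields must exist (`AntiValues.exists_contactDer`). At one point it is obtained by linear
algebra: every linear relation between jet functionals also holds for the jets of the prescribed
values, because a section of the density-dual can reproduce them. The derivations at points are then
glued, using that derivatives are unique and that locally the Leibniz rule computes them.

The common tool is the family of test functionals: contract with finitely many odd vectors and take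
the scalar part. They separate the elements of the exterior algebra (`eq_zero_of_tst`) and turn
statements about graded functions into statements about smooth functions on X. -/

/-- Hadamard's lemma. -/
theorem exists_hadamard {k : ℕ} {g : (Fin k → ℝ) → ℝ} (hg : ContDiff ℝ ∞ g) (y₀ : Fin k → ℝ) :
    ∃ h : Fin k → (Fin k → ℝ) → ℝ, (∀ i, ContDiff ℝ ∞ (h i)) ∧
      (∀ y, g y = g y₀ + ∑ i, (y i - y₀ i) * h i y) ∧
      ∀ i, h i y₀ = fderiv ℝ g y₀ (Pi.single i 1) := by
  have hd : ContDiff ℝ ∞ (fderiv ℝ g) := hg.fderiv_right (by simp)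
  have hg1 : Differentiable ℝ g := hg.differentiable (by simp)
  let P : Fin k → (Fin k → ℝ) → ℝ → ℝ := fun i y t =>
    fderiv ℝ g (y₀ + t • (y - y₀)) (Pi.single i 1)
  have hcont : ∀ i y, Continuous (P i y) := fun i y => by
    have := hd.continuous
    fun_prop
  have hP : ∀ i, ContDiff ℝ ∞ (fun q : (Fin k → ℝ) × ℝ => P i q.1 q.2) := fun i => by
    refine ContDiff.clm_apply (hd.comp ?_) contDiff_const
    fun_prop
  refine ⟨fun i y => ∫ t in (0 : ℝ)..1, P i y t, fun i => ?_, fun y => ?_, fun i => ?_⟩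
  -- Smoothness in the parameter is read off from a convolution: for the indicator f of (0, 1] and G
  -- y t = χ(t) P(y, −t), its value at 0 is the integral of P(y, t) over (0, 1]. The bump, equal to
  -- 1 on [−2, 2] and to 0 off (−3, 3), provides the compact support.
  · let χ : ContDiffBump (0 : ℝ) := ⟨2, 3, by norm_num, by norm_num⟩
    let G : (Fin k → ℝ) → ℝ → ℝ := fun y t => χ t * P i y (-t)
    let f : ℝ → ℝ := indicator (Ioc (0 : ℝ) 1) 1
    have hf : MeasureTheory.LocallyIntegrable f MeasureTheory.volume :=
      (MeasureTheory.IntegrableOn.integrable_indicator (by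
        simp [MeasureTheory.integrableOn_const_iff, Pi.one_def]) measurableSet_Ioc).locallyIntegrable
    have key := MeasureTheory.contDiffOn_convolution_right_with_param_comp (𝕜 := ℝ)
      (n := (⊤ : ℕ∞)) (μ := MeasureTheory.volume)
      (ContinuousLinearMap.mul ℝ ℝ) (s := (univ : Set (Fin k → ℝ))) (v := fun _ => (0 : ℝ))
      contDiffOn_const (f := f) (g := G) (k := Metric.closedBall 0 3) isOpen_univ
      (isCompact_closedBall 0 3)
      (by
        intro p x _ hx
        have : χ x = 0 := by
          apply χ.zero_of_le_dist
          simp only [Metric.mem_closedBall, not_le] at hx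
          exact hx.le
        simp [G, this])
      hf
      (by
        refine ContDiff.contDiffOn ?_
        change ContDiff ℝ ∞ (fun q : (Fin k → ℝ) × ℝ => χ q.2 * P i q.1 (-q.2))
        refine ContDiff.mul (χ.contDiff.comp contDiff_snd) ?_
        exact (hP i).comp (contDiff_fst.prodMk contDiff_snd.neg))
    rw [contDiffOn_univ] at key
    convert key using 2 with y
    change ∫ t in (0 : ℝ)..1, P i y t = _
    rw [MeasureTheory.convolution, intervalIntegral.integral_of_le zero_le_one,
      ← MeasureTheory.integral_indicator measurableSet_Ioc]
    refine MeasureTheory.integral_congr_ae (Eventually.of_forall fun t => ?_)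
    by_cases ht : t ∈ Ioc (0 : ℝ) 1
    · have h1 : χ (-t) = 1 := by
        apply χ.one_of_mem_closedBall
        simp only [Metric.mem_closedBall, dist_zero_right, norm_neg, Real.norm_eq_abs]
        rw [abs_of_pos ht.1]
        exact ht.2.trans (by norm_num [χ])
      simp [f, G, ht, h1]
    · simp [f, ht]
  · have hder : ∀ t : ℝ, HasDerivAt (fun t : ℝ => g (y₀ + t • (y - y₀)))
        (∑ i, (y i - y₀ i) * P i y t) t := fun t => by
      have h1 : HasDerivAt (fun t : ℝ => y₀ + t • (y - y₀)) (y - y₀) t := by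
        simpa using ((hasDerivAt_id t).smul_const (y - y₀)).const_add y₀
      have h2 := (hg1 (y₀ + t • (y - y₀))).hasFDerivAt.comp_hasDerivAt t h1
      have h3 : ∀ A : (Fin k → ℝ) →L[ℝ] ℝ, A (y - y₀) = ∑ i, (y i - y₀ i) * A (Pi.single i 1) := by
        intro A
        have h3 : y - y₀ = ∑ i, (y i - y₀ i) • (Pi.single i (1 : ℝ) : Fin k → ℝ) := by
          funext j
          simp [Finset.sum_apply, Pi.single_apply]
        rw [h3, map_sum]
        simp
      rw [h3] at h2
      exact h2
    have hint := intervalIntegral.integral_eq_sub_of_hasDerivAt (a := 0) (b := 1)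
      (fun t _ => hder t)
      (Continuous.intervalIntegrable (by
        have := hcont
        fun_prop) _ _)
    simp only [one_smul, zero_smul, add_zero, add_sub_cancel] at hint
    rw [intervalIntegral.integral_finsetSum] at hint
    · simp only [intervalIntegral.integral_const_mul] at hint
      linarith
    · intro i _
      exact (continuous_const.mul (hcont i y)).intervalIntegrable _ _
  · simp [P]

section Base

variable {n : ℕ} {X : Type} [TopologicalSpace X] [ChartedSpace (EuclideanSpace ℝ (Fin n)) X]

theorem Sm.add_apply (a b : Sm n X) (x : X) : (a + b) x = a x + b x := rfl
theorem Sm.sub_apply (a b : Sm n X) (x : X) : (a - b) x = a x - b x := rfl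
theorem Sm.mul_apply (a b : Sm n X) (x : X) : (a * b) x = a x * b x := rfl
theorem Sm.zero_apply (x : X) : (0 : Sm n X) x = 0 := rfl
theorem Sm.rsmul_apply (r : ℝ) (a : Sm n X) (x : X) : (r • a) x = r * a x := rfl
theorem Sm.algebraMap_apply (r : ℝ) (x : X) : (algebraMap ℝ (Sm n X) r) x = r := rfl

/-- Evaluation at a point, as a ring homomorphism. -/
def Sm.evalHom (x : X) : Sm n X →ₐ[ℝ] ℝ where
  toFun a := a x
  map_one' := rfl
  map_mul' _ _ := rfl
  map_zero' := rfl
  map_add' _ _ := rfl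
  commutes' _ := rfl

theorem Sm.sum_apply {α : Type*} (s : Finset α) (f : α → Sm n X) (x : X) :
    (∑ i ∈ s, f i) x = ∑ i ∈ s, f i x := map_sum (Sm.evalHom x) f s

theorem Sm.prod_apply {α : Type*} (s : Finset α) (f : α → Sm n X) (x : X) :
    (∏ i ∈ s, f i) x = ∏ i ∈ s, f i x := map_prod (Sm.evalHom x) f s

theorem VF.leibniz_apply (τ : VF n X) (a b : Sm n X) (x : X) :
    τ (a * b) x = a x * τ b x + b x * τ a x := by
  rw [Derivation.leibniz]; rfl

theorem VF.smul_apply (a : Sm n X) (τ : VF n X) (b : Sm n X) (x : X) :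
    (a • τ) b x = a x * τ b x := rfl

/-- The composite of a smooth function and a family of functions on the manifold. -/
def Sm.compFun {k : ℕ} (g : (Fin k → ℝ) → ℝ) (hg : ContDiff ℝ ∞ g) (a : Fin k → Sm n X) : Sm n X :=
  ⟨fun x => g fun i => a i x,
    hg.contMDiff.comp (contMDiff_pi_space.2 fun i => (a i).contMDiff)⟩

variable [IsManifold (𝓡 n) ∞ X] [T2Space X]

theorem exists_bump (x : X) {U : Set X} (hU : U ∈ 𝓝 x) :
    ∃ χ : Sm n X, (∀ᶠ x' in 𝓝 x, χ x' = 1) ∧ tsupport χ ⊆ U := by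
  obtain ⟨f, -, hf⟩ := (SmoothBumpFunction.nhds_basis_tsupport (I := 𝓡 n) x).mem_iff.1 hU
  exact ⟨⟨f, f.contMDiff⟩, f.eventuallyEq_one, hf⟩

omit [IsManifold (𝓡 n) ∞ X] [T2Space X] in
theorem Sm.eq_zero_of_tsupport {χ : Sm n X} {U : Set X} (h : tsupport χ ⊆ U) {x : X}
    (hx : x ∉ U) : χ x = 0 :=
  image_eq_zero_of_notMem_tsupport fun h' => hx (h h')

theorem exists_smooth_germ {x : X} {f : X → ℝ}
    (hf : ∀ᶠ x' in 𝓝 x, ContMDiffAt (𝓡 n) 𝓘(ℝ, ℝ) ∞ f x') :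
    ∃ a : Sm n X, (a : X → ℝ) =ᶠ[𝓝 x] f := by
  obtain ⟨χ, h1, h2⟩ := exists_bump (n := n) x hf
  refine ⟨⟨fun x' => χ x' * f x', ?_⟩, ?_⟩
  · refine contMDiff_of_tsupport fun x' hx' => ?_
    have : x' ∈ tsupport χ := tsupport_mul_subset_left hx'
    exact χ.contMDiff.contMDiffAt.mul (h2 this)
  · filter_upwards [h1] with x' h
    change χ x' * f x' = f x'
    rw [h, one_mul]

omit [IsManifold (𝓡 n) ∞ X] [T2Space X] in
theorem germExt_eventuallyEq {x : X} {f : X → ℝ} {a : Sm n X} (h : (a : X → ℝ) =ᶠ[𝓝 x] f) :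
    (germExt (n := n) f x : X → ℝ) =ᶠ[𝓝 x] a := by
  have h' : ∃ a : Sm n X, (a : X → ℝ) =ᶠ[𝓝 x] f := ⟨a, h⟩
  rw [germExt, dif_pos h']
  exact h'.choose_spec.trans h.symm

/-- Derivations are local: if χ is a bump at x supported where a = b, then χ(a − b) = 0, and the
Leibniz rule at x leaves only τ a − τ b. -/
theorem VF.congr_apply (τ : VF n X) {a b : Sm n X} {x : X} (h : (a : X → ℝ) =ᶠ[𝓝 x] b) :
    τ a x = τ b x := by
  obtain ⟨χ, h1, h2⟩ := exists_bump (n := n) x h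
  have hz : χ * (a - b) = 0 := by
    ext x'
    by_cases hx : x' ∈ {x | a x = b x}
    · change χ x' * (a x' - b x') = 0
      rw [hx, sub_self, mul_zero]
    · change χ x' * (a x' - b x') = 0
      rw [Sm.eq_zero_of_tsupport h2 hx, zero_mul]
  have := congrArg (fun c => (τ c) x) hz
  simp only [VF.leibniz_apply, map_zero, map_sub, Sm.sub_apply, Sm.zero_apply] at this
  rw [h1.self_of_nhds, h.self_of_nhds] at this
  linarith

theorem VF.congr (τ : VF n X) {a b : Sm n X} {x : X} (h : (a : X → ℝ) =ᶠ[𝓝 x] b) :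
    (τ a : X → ℝ) =ᶠ[𝓝 x] τ b :=
  (eventually_eventually_nhds.2 h).mono fun _ h => VF.congr_apply τ h

omit [IsManifold (𝓡 n) ∞ X] [T2Space X] in
theorem word_cons (τ : VF n X) (l : List (VF n X)) (a : Sm n X) :
    word (τ :: l) a = τ (word l a) := by
  simp [word]

omit [IsManifold (𝓡 n) ∞ X] [T2Space X] in
theorem word_nil (a : Sm n X) : word [] a = a := by
  simp [word]

theorem word_congr (l : List (VF n X)) {a b : Sm n X} {x : X} (h : (a : X → ℝ) =ᶠ[𝓝 x] b) :
    (word l a : X → ℝ) =ᶠ[𝓝 x] word l b := by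
  induction l with
  | nil => simpa only [word_nil] using h
  | cons τ l ih => simpa only [word_cons] using VF.congr τ ih

omit [IsManifold (𝓡 n) ∞ X] [T2Space X] in
/-- The chain rule for derivations. -/
theorem VF.compFun_apply (τ : VF n X) {k : ℕ} {g : (Fin k → ℝ) → ℝ} (hg : ContDiff ℝ ∞ g)
    (a : Fin k → Sm n X) (x : X) :
    τ (Sm.compFun g hg a) x =
      ∑ i, fderiv ℝ g (fun i => a i x) (Pi.single i 1) * τ (a i) x := by
  obtain ⟨h, hh, e, h0⟩ := exists_hadamard hg (fun i => a i x)
  -- Hadamard's expansion is an identity in the ring of smooth functions, so an algebraic derivation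
  -- can be applied to it; at x the factors a i − a i x vanish and only their derivatives remain.
  have key : Sm.compFun g hg a = algebraMap ℝ (Sm n X) (g fun i => a i x) +
      ∑ i, (a i - algebraMap ℝ (Sm n X) (a i x)) * Sm.compFun (h i) (hh i) a := by
    ext x'
    rw [Sm.add_apply, Sm.sum_apply]
    exact e fun i => a i x'
  rw [key, map_add, Derivation.map_algebraMap, zero_add, map_sum, Sm.sum_apply]
  refine Finset.sum_congr rfl fun i _ => ?_
  rw [VF.leibniz_apply, map_sub, Derivation.map_algebraMap, sub_zero, Sm.sub_apply,
    Sm.algebraMap_apply, sub_self, zero_mul, zero_add]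
  congr 1
  exact h0 i

end Base

end KoszulTate
end

noncomputable section

namespace KoszulTate

/-! ### Exterior algebras of dual spaces -/

section Exterior

variable {V V' : Type} [AddCommGroup V] [Module ℝ V] [AddCommGroup V'] [Module ℝ V']

/-- The exterior algebra generated by the linear functionals on `V`. -/
abbrev Ext (V : Type) [AddCommGroup V] [Module ℝ V] := ExteriorAlgebra ℝ (Module.Dual ℝ V)

/-- Contraction with a vector. -/
def ctr (k : V) : Ext V →ₗ[ℝ] Ext V := CliffordAlgebra.contractLeft (Module.Dual.eval ℝ V k)

/-- The grade involution. -/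
def gr : Ext V →ₐ[ℝ] Ext V := CliffordAlgebra.involute

/-- Successive contraction followed by the scalar part. -/
def tst (ks : List V) (g : Ext V) : ℝ :=
  ExteriorAlgebra.algebraMapInv (ks.foldr (fun k g => ctr k g) g)

theorem gr_ι (l : Module.Dual ℝ V) : gr (ExteriorAlgebra.ι ℝ l) = -ExteriorAlgebra.ι ℝ l :=
  CliffordAlgebra.involute_ι l

theorem gr_gr (a : Ext V) : gr (gr a) = a := CliffordAlgebra.involute_involute a

theorem gr_algebraMap (r : ℝ) : gr (algebraMap ℝ (Ext V) r) = algebraMap ℝ _ r := AlgHom.commutes _ _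

theorem ctr_ι_mul (k : V) (l : Module.Dual ℝ V) (b : Ext V) :
    ctr k (ExteriorAlgebra.ι ℝ l * b) = l k • b - ExteriorAlgebra.ι ℝ l * ctr k b :=
  CliffordAlgebra.contractLeft_ι_mul _ _ _

theorem ctr_ι (k : V) (l : Module.Dual ℝ V) :
    ctr k (ExteriorAlgebra.ι ℝ l) = algebraMap ℝ _ (l k) :=
  CliffordAlgebra.contractLeft_ι (Q := 0) _ _

theorem ctr_algebraMap (k : V) (r : ℝ) : ctr k (algebraMap ℝ (Ext V) r) = 0 :=
  CliffordAlgebra.contractLeft_algebraMap (Q := 0) _ _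

theorem ctr_algebraMap_mul (k : V) (r : ℝ) (b : Ext V) :
    ctr k (algebraMap ℝ (Ext V) r * b) = algebraMap ℝ (Ext V) r * ctr k b :=
  CliffordAlgebra.contractLeft_algebraMap_mul (Q := 0) _ _ _

theorem Ext.left_induction {P : Ext V → Prop} (algebraMap : ∀ r : ℝ, P (algebraMap _ _ r))
    (add : ∀ x y, P x → P y → P (x + y))
    (ι_mul : ∀ x m, P x → P (ExteriorAlgebra.ι ℝ m * x)) (x : Ext V) : P x :=
  by
  induction x using CliffordAlgebra.left_induction with
  | algebraMap r => exact algebraMap r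
  | add x y hx hy => exact add x y hx hy
  | ι_mul x m hx => exact ι_mul x m hx

theorem ctr_mul (k : V) (a b : Ext V) : ctr k (a * b) = ctr k a * b + gr a * ctr k b := by
  induction a using Ext.left_induction with
  | algebraMap r => rw [ctr_algebraMap_mul, ctr_algebraMap, gr_algebraMap, zero_mul, zero_add]
  | add x y hx hy => rw [add_mul, map_add, hx, hy, map_add, map_add, add_mul, add_mul]; abel
  | ι_mul x m hx =>
    rw [mul_assoc, ctr_ι_mul, hx, ctr_ι_mul, map_mul, gr_ι, sub_mul, mul_add, smul_mul_assoc,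
      neg_mul, neg_mul, mul_assoc, mul_assoc]
    abel

theorem ctr_gr (k : V) (a : Ext V) : ctr k (gr a) = -gr (ctr k a) := by
  induction a using Ext.left_induction with
  | algebraMap r => rw [gr_algebraMap, ctr_algebraMap, map_zero, neg_zero]
  | add x y hx hy => rw [map_add, map_add, map_add, map_add, hx, hy, neg_add]
  | ι_mul x m hx =>
    rw [map_mul, gr_ι, neg_mul, map_neg, ctr_ι_mul, ctr_ι_mul, map_sub, map_mul, gr_ι, hx, map_smul]
    simp only [mul_neg, neg_mul]

theorem tst_nil (g : Ext V) : tst [] g = ExteriorAlgebra.algebraMapInv g := rfl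

theorem tst_append (ks : List V) (k : V) (g : Ext V) : tst (ks ++ [k]) g = tst ks (ctr k g) := by
  simp [tst]

theorem tst_add (ks : List V) (g h : Ext V) : tst ks (g + h) = tst ks g + tst ks h := by
  induction ks using List.reverseRecOn generalizing g h with
  | nil => simp [tst_nil]
  | append_singleton ks k ih => rw [tst_append, map_add, ih, ← tst_append, ← tst_append]

theorem tst_smul (ks : List V) (r : ℝ) (g : Ext V) : tst ks (r • g) = r * tst ks g := by
  induction ks using List.reverseRecOn generalizing g with
  | nil => simp [tst_nil]
  | append_singleton ks k ih => rw [tst_append, map_smul, ih, ← tst_append]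

/-- The test functionals are linear. -/
def tstL (ks : List V) : Ext V →ₗ[ℝ] ℝ where
  toFun := tst ks
  map_add' := tst_add ks
  map_smul' r g := tst_smul ks r g

theorem tst_zero (ks : List V) : tst ks (0 : Ext V) = 0 := map_zero (tstL ks)
theorem tst_neg (ks : List V) (g : Ext V) : tst ks (-g) = -tst ks g := map_neg (tstL ks) g
theorem tst_sub (ks : List V) (g h : Ext V) : tst ks (g - h) = tst ks g - tst ks h :=
  map_sub (tstL ks) g h
theorem algebraMapInv_gr (g : Ext V) :
    ExteriorAlgebra.algebraMapInv (gr g) = ExteriorAlgebra.algebraMapInv g := by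
  induction g using Ext.left_induction with
  | algebraMap r => rw [gr_algebraMap]
  | add x y hx hy => rw [map_add, map_add, map_add, hx, hy]
  | ι_mul x m hx =>
    rw [map_mul, map_mul, map_mul, gr_ι, map_neg]
    simp [ExteriorAlgebra.algebraMapInv]

/-- Each contraction anticommutes with the grade involution, and the scalar part is even. Identities
that involve the involution thereby become identities of real numbers with signs. -/
theorem tst_gr (ks : List V) (g : Ext V) : tst ks (gr g) = (-1) ^ ks.length * tst ks g := by
  induction ks using List.reverseRecOn generalizing g with
  | nil => simp [tst_nil, algebraMapInv_gr]
  | append_singleton ks k ih =>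
    rw [tst_append, ctr_gr, tst_neg, ih, tst_append, List.length_append, pow_add]
    simp

theorem ι_mul_comm_gr (l : Module.Dual ℝ V) (h : Ext V) :
    ExteriorAlgebra.ι ℝ l * h = gr h * ExteriorAlgebra.ι ℝ l := by
  induction h using Ext.left_induction with
  | algebraMap r => rw [gr_algebraMap, Algebra.commutes]
  | add x y hx hy => rw [mul_add, hx, hy, map_add, add_mul]
  | ι_mul x m hx =>
    rw [map_mul, gr_ι, ← mul_assoc, eq_neg_of_add_eq_zero_left (ExteriorAlgebra.ι_add_mul_swap l m),
      neg_mul, mul_assoc, hx, neg_mul, neg_mul, mul_assoc]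

theorem eq_zero_of_eq_neg {b : Ext V} (h : b = -b) : b = 0 := by
  have h2 : (2 : ℝ) • b = 0 := by
    rw [two_smul]
    nth_rewrite 2 [h]
    exact add_neg_cancel b
  exact (smul_eq_zero.1 h2).resolve_left two_ne_zero

theorem mem_even_iff (g : Ext V) :
    g ∈ CliffordAlgebra.evenOdd (0 : QuadraticForm ℝ (Module.Dual ℝ V)) 0 ↔ gr g = g := by
  refine ⟨CliffordAlgebra.involute_eq_of_mem_even, fun h => ?_⟩
  have hs : g ∈ CliffordAlgebra.evenOdd (0 : QuadraticForm ℝ (Module.Dual ℝ V)) 0 ⊔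
      CliffordAlgebra.evenOdd 0 1 := by
    rw [(CliffordAlgebra.evenOdd_isCompl _).sup_eq_top]; trivial
  obtain ⟨a, ha, b, hb, rfl⟩ := Submodule.mem_sup.1 hs
  have h1 : gr a = a := CliffordAlgebra.involute_eq_of_mem_even ha
  have h2 : gr b = -b := CliffordAlgebra.involute_eq_of_mem_odd hb
  rw [map_add, h1, h2] at h
  have hb0 : b = 0 := eq_zero_of_eq_neg (add_left_cancel h).symm
  rw [hb0, add_zero]
  exact ha

theorem mem_odd_iff (g : Ext V) :
    g ∈ CliffordAlgebra.evenOdd (0 : QuadraticForm ℝ (Module.Dual ℝ V)) 1 ↔ gr g = -g := by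
  refine ⟨CliffordAlgebra.involute_eq_of_mem_odd, fun h => ?_⟩
  have hs : g ∈ CliffordAlgebra.evenOdd (0 : QuadraticForm ℝ (Module.Dual ℝ V)) 0 ⊔
      CliffordAlgebra.evenOdd 0 1 := by
    rw [(CliffordAlgebra.evenOdd_isCompl _).sup_eq_top]; trivial
  obtain ⟨a, ha, b, hb, rfl⟩ := Submodule.mem_sup.1 hs
  have h1 : gr a = a := CliffordAlgebra.involute_eq_of_mem_even ha
  have h2 : gr b = -b := CliffordAlgebra.involute_eq_of_mem_odd hb
  rw [map_add, h1, h2, neg_add] at h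
  have hb0 : a = 0 := eq_zero_of_eq_neg (add_right_cancel h)
  rw [hb0, zero_add]
  exact hb

theorem mem_evenOdd_iff (i : ZMod 2) (g : Ext V) :
    g ∈ CliffordAlgebra.evenOdd (0 : QuadraticForm ℝ (Module.Dual ℝ V)) i ↔
      gr g = (-1 : ℝ) ^ i.val • g := by
  obtain rfl | rfl : i = 0 ∨ i = 1 := by revert i; decide
  · rw [show ZMod.val (0 : ZMod 2) = 0 from rfl, pow_zero, one_smul]
    exact mem_even_iff g
  · rw [show ZMod.val (1 : ZMod 2) = 1 from rfl, pow_one, neg_one_smul]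
    exact mem_odd_iff g

theorem even_mul_comm {g : Ext V} (hg : gr g = g) (h : Ext V) : g * h = h * g := by
  have hg' := (mem_even_iff g).2 hg
  clear hg
  induction g, hg' using CliffordAlgebra.even_induction with
  | algebraMap r => exact Algebra.commutes r h
  | add x y hx hy ihx ihy => rw [add_mul, mul_add, ihx, ihy]
  | ι_mul_ι_mul m₁ m₂ x hx ih =>
    have h1 := ι_mul_comm_gr m₁ (gr h)
    have h2 := ι_mul_comm_gr m₂ h
    rw [gr_gr] at h1
    calc _ = ExteriorAlgebra.ι ℝ m₁ * (ExteriorAlgebra.ι ℝ m₂ * (x * h)) := by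
          simp only [mul_assoc]
      _ = ExteriorAlgebra.ι ℝ m₁ * (ExteriorAlgebra.ι ℝ m₂ * h) * x := by
          rw [ih]; simp only [mul_assoc]
      _ = _ := by
          rw [h2, ← mul_assoc, h1]; simp only [mul_assoc]

theorem odd_mul_comm {g : Ext V} (hg : gr g = -g) (h : Ext V) : g * h = gr h * g := by
  have hg' := (mem_odd_iff g).2 hg
  clear hg
  induction g, hg' using CliffordAlgebra.odd_induction with
  | ι v => exact ι_mul_comm_gr v h
  | add x y hx hy ihx ihy => rw [add_mul, mul_add, ihx, ihy]
  | ι_mul_ι_mul m₁ m₂ x hx ih =>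
    have h1 := ι_mul_comm_gr m₁ h
    have h2 := ι_mul_comm_gr m₂ (gr h)
    rw [gr_gr] at h2
    calc _ = ExteriorAlgebra.ι ℝ m₁ * (ExteriorAlgebra.ι ℝ m₂ * (x * h)) := by
          simp only [mul_assoc]
      _ = ExteriorAlgebra.ι ℝ m₁ * (ExteriorAlgebra.ι ℝ m₂ * gr h) * x := by
          rw [ih]; simp only [mul_assoc]
      _ = _ := by
          rw [h2, ← mul_assoc, h1]; simp only [mul_assoc]

/-! #### The test functionals separate points -/

theorem gr_mem_adjoin (S : Set (Module.Dual ℝ V)) {a : Ext V}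
    (ha : a ∈ Algebra.adjoin ℝ (ExteriorAlgebra.ι ℝ '' S)) :
    gr a ∈ Algebra.adjoin ℝ (ExteriorAlgebra.ι ℝ '' S) := by
  have : Algebra.adjoin ℝ (ExteriorAlgebra.ι ℝ '' S) ≤
      (Algebra.adjoin ℝ (ExteriorAlgebra.ι ℝ '' S)).comap (gr (V := V)) := by
    refine Algebra.adjoin_le ?_
    rintro _ ⟨l, hl, rfl⟩
    rw [SetLike.mem_coe, Subalgebra.mem_comap, gr_ι]
    exact neg_mem (Algebra.subset_adjoin ⟨l, hl, rfl⟩)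
  exact this ha

/-- Moving `ι l` to the left costs only a grade involution, and its square is zero, so every element
is of degree at most one in `l`. -/
theorem mem_adjoin_insert {S : Set (Module.Dual ℝ V)} {l : Module.Dual ℝ V} {g : Ext V}
    (hg : g ∈ Algebra.adjoin ℝ (ExteriorAlgebra.ι ℝ '' insert l S)) :
    ∃ a ∈ Algebra.adjoin ℝ (ExteriorAlgebra.ι ℝ '' S),
      ∃ b ∈ Algebra.adjoin ℝ (ExteriorAlgebra.ι ℝ '' S), g = a + ExteriorAlgebra.ι ℝ l * b := by
  induction hg using Algebra.adjoin_induction with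
  | mem x hx =>
    obtain ⟨m, rfl | hm, rfl⟩ := hx
    · exact ⟨0, zero_mem _, 1, one_mem _, by simp⟩
    · exact ⟨_, Algebra.subset_adjoin ⟨m, hm, rfl⟩, 0, zero_mem _, by simp⟩
  | algebraMap r => exact ⟨_, Subalgebra.algebraMap_mem _ r, 0, zero_mem _, by simp⟩
  | add x y _ _ hx hy =>
    obtain ⟨a, ha, b, hb, rfl⟩ := hx
    obtain ⟨a', ha', b', hb', rfl⟩ := hy
    exact ⟨a + a', add_mem ha ha', b + b', add_mem hb hb', by rw [mul_add]; abel⟩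
  | mul x y _ _ hx hy =>
    obtain ⟨a, ha, b, hb, rfl⟩ := hx
    obtain ⟨a', ha', b', hb', rfl⟩ := hy
    refine ⟨a * a', mul_mem ha ha', gr a * b' + b * a',
      add_mem (mul_mem (gr_mem_adjoin S ha) hb') (mul_mem hb ha'), ?_⟩
    have h1 := ι_mul_comm_gr l (gr a)
    have h2 := ι_mul_comm_gr l b
    rw [gr_gr] at h1
    have h3 : ExteriorAlgebra.ι ℝ l * b * (ExteriorAlgebra.ι ℝ l * b') = 0 := by
      rw [h2, mul_assoc, ← mul_assoc (ExteriorAlgebra.ι ℝ l), ExteriorAlgebra.ι_sq_zero, zero_mul,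
        mul_zero]
    rw [add_mul, mul_add, mul_add, h3, mul_add, ← mul_assoc (ExteriorAlgebra.ι ℝ l) (gr a), h1]
    simp only [mul_assoc]
    abel

theorem ctr_eq_zero_of_mem_adjoin {S : Set (Module.Dual ℝ V)} {k : V} (hk : ∀ l ∈ S, l k = 0)
    {g : Ext V} (hg : g ∈ Algebra.adjoin ℝ (ExteriorAlgebra.ι ℝ '' S)) : ctr k g = 0 := by
  induction hg using Algebra.adjoin_induction with
  | mem x hx =>
    obtain ⟨m, hm, rfl⟩ := hx
    rw [ctr_ι, hk m hm, map_zero]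
  | algebraMap r => exact ctr_algebraMap k r
  | add x y _ _ hx hy => rw [map_add, hx, hy, add_zero]
  | mul x y _ _ hx hy => rw [ctr_mul, hx, hy, zero_mul, mul_zero, add_zero]

/-- Induction on the set of functionals. Write g = a + l b with a and b free of l. If l depends
linearly on the others it can be dropped. Otherwise some vector k is killed by the others but not by
l, contraction with k turns g into l(k) b, so b = 0 by induction, and then a = 0. -/
theorem eq_zero_of_tst_adjoin (S : Finset (Module.Dual ℝ V)) (g : Ext V)
    (hg : g ∈ Algebra.adjoin ℝ (ExteriorAlgebra.ι ℝ '' (S : Set (Module.Dual ℝ V))))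
    (h : ∀ ks, tst ks g = 0) : g = 0 := by
  classical
  induction S using Finset.induction_on generalizing g with
  | empty =>
    rw [Finset.coe_empty, image_empty, Algebra.adjoin_empty] at hg
    obtain ⟨r, rfl⟩ := Algebra.mem_bot.1 hg
    have := h []
    rw [tst_nil, ExteriorAlgebra.algebraMap_leftInverse] at this
    rw [this, map_zero]
  | insert l S hl ih =>
    rw [Finset.coe_insert] at hg
    by_cases hs : l ∈ Submodule.span ℝ (S : Set (Module.Dual ℝ V))
    · refine ih g ?_ h
      refine Algebra.adjoin_le ?_ hg
      rintro _ ⟨m, rfl | hm, rfl⟩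
      · have h1 := Submodule.mem_map_of_mem (f := ExteriorAlgebra.ι ℝ) hs
        rw [Submodule.map_span] at h1
        exact Algebra.span_le_adjoin _ _ h1
      · exact Algebra.subset_adjoin ⟨m, hm, rfl⟩
    · obtain ⟨a, ha, b, hb, rfl⟩ := mem_adjoin_insert hg
      have : ∃ k : V, (∀ m ∈ S, m k = 0) ∧ l k ≠ 0 := by
        by_contra hne
        push Not at hne
        refine hs ?_
        have := mem_span_of_iInf_ker_le_ker (ι := S) (L := fun m => (m : Module.Dual ℝ V)) (K := l)
          (fun k hk => hne k fun m hm => by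
            simp only [Submodule.mem_iInf, LinearMap.mem_ker] at hk
            exact hk ⟨m, hm⟩)
        simpa using this
      obtain ⟨k, hk, hlk⟩ := this
      have hb0 : b = 0 := by
        refine ih b hb fun ks => ?_
        have h1 := h (ks ++ [k])
        rw [tst_append, map_add, ctr_ι_mul, ctr_eq_zero_of_mem_adjoin hk ha,
          ctr_eq_zero_of_mem_adjoin hk hb, mul_zero, sub_zero, zero_add, tst_smul] at h1
        exact (mul_eq_zero.1 h1).resolve_left hlk
      rw [hb0, mul_zero, add_zero] at h ⊢
      exact ih a ha h

/-- The dual space may have infinite dimension, but each element of the exterior algebra involves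
only finitely many functionals. -/
theorem eq_zero_of_tst {g : Ext V} (h : ∀ ks, tst ks g = 0) : g = 0 := by
  classical
  have : ∃ S : Finset (Module.Dual ℝ V),
      g ∈ Algebra.adjoin ℝ (ExteriorAlgebra.ι ℝ '' (S : Set (Module.Dual ℝ V))) := by
    clear h
    induction g using Ext.left_induction with
    | algebraMap r => exact ⟨∅, Subalgebra.algebraMap_mem _ r⟩
    | add x y hx hy =>
      obtain ⟨S, hS⟩ := hx
      obtain ⟨T, hT⟩ := hy
      exact ⟨S ∪ T, add_mem
        (Algebra.adjoin_mono (image_mono (by simp)) hS)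
        (Algebra.adjoin_mono (image_mono (by simp)) hT)⟩
    | ι_mul x m hx =>
      obtain ⟨S, hS⟩ := hx
      exact ⟨insert m S, mul_mem (Algebra.subset_adjoin ⟨m, by simp, rfl⟩)
        (Algebra.adjoin_mono (image_mono (by simp)) hS)⟩
  obtain ⟨S, hS⟩ := this
  exact eq_zero_of_tst_adjoin S g hS h

theorem eq_of_tst {g h : Ext V} (e : ∀ ks, tst ks g = tst ks h) : g = h :=
  sub_eq_zero.1 (eq_zero_of_tst fun ks => by rw [tst_sub, e, sub_self])

/-! #### Functoriality -/

theorem ctr_map (φ : V' →ₗ[ℝ] V) (k : V') (g : Ext V) :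
    ctr k (ExteriorAlgebra.map φ.dualMap g) = ExteriorAlgebra.map φ.dualMap (ctr (φ k) g) := by
  induction g using Ext.left_induction with
  | algebraMap r => rw [AlgHom.commutes, ctr_algebraMap, ctr_algebraMap, map_zero]
  | add x y hx hy => rw [map_add, map_add, map_add, map_add, hx, hy]
  | ι_mul x m hx =>
    rw [map_mul, ExteriorAlgebra.map_apply_ι, ctr_ι_mul, ctr_ι_mul, map_sub, map_smul, map_mul,
      ExteriorAlgebra.map_apply_ι, hx]
    rfl

theorem algebraMapInv_map (φ : V' →ₗ[ℝ] V) (g : Ext V) :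
    ExteriorAlgebra.algebraMapInv (ExteriorAlgebra.map φ.dualMap g) =
      ExteriorAlgebra.algebraMapInv g := by
  induction g using Ext.left_induction with
  | algebraMap r => rw [AlgHom.commutes, AlgHom.commutes, AlgHom.commutes]
  | add x y hx hy => rw [map_add, map_add, map_add, hx, hy]
  | ι_mul x m hx =>
    rw [map_mul, map_mul, map_mul, ExteriorAlgebra.map_apply_ι]
    simp [ExteriorAlgebra.algebraMapInv]

theorem tst_map (φ : V' →ₗ[ℝ] V) (ks : List V') (g : Ext V) :
    tst ks (ExteriorAlgebra.map φ.dualMap g) = tst (ks.map φ) g := by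
  induction ks using List.reverseRecOn generalizing g with
  | nil => exact algebraMapInv_map φ g
  | append_singleton ks k ih =>
    rw [tst_append, ctr_map, ih, List.map_append, List.map_singleton, tst_append]

theorem gr_map (φ : V' →ₗ[ℝ] V) (g : Ext V) :
    gr (ExteriorAlgebra.map φ.dualMap g) = ExteriorAlgebra.map φ.dualMap (gr g) := by
  refine eq_of_tst fun ks => ?_
  rw [tst_gr, tst_map, tst_map, tst_gr, List.length_map]

/-! #### Weak derivatives -/

/-- The relation `Hd u u'` behaves like: the function `u` has derivative `u'` at the point `t₀`. -/
structure PtDer {T : Type} (t₀ : T) (Hd : (T → ℝ) → ℝ → Prop) : Prop where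
  const : ∀ c, Hd (fun _ => c) 0
  add : ∀ u v u' v', Hd u u' → Hd v v' → Hd (fun t => u t + v t) (u' + v')
  mul : ∀ u v u' v', Hd u u' → Hd v v' → Hd (fun t => u t * v t) (u' * v t₀ + u t₀ * v')

/-- Weak derivatives of functions with values in the exterior algebra. -/
def WD {T : Type} (Hd : (T → ℝ) → ℝ → Prop) (f : T → Ext V) (f' : Ext V) : Prop :=
  ∀ ks, Hd (fun t => tst ks (f t)) (tst ks f')

section WD

variable {T : Type} {t₀ : T} {Hd : (T → ℝ) → ℝ → Prop} (H : PtDer t₀ Hd)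
include H

theorem WD.add {f g : T → Ext V} {f' g' : Ext V} (hf : WD Hd f f') (hg : WD Hd g g') :
    WD Hd (fun t => f t + g t) (f' + g') := fun ks => by
  simp only [tst_add]
  exact H.add _ _ _ _ (hf ks) (hg ks)

theorem WD.gr {f : T → Ext V} {f' : Ext V} (hf : WD Hd f f') :
    WD Hd (fun t => gr (f t)) (gr f') := fun ks => by
  simp only [tst_gr]
  simpa using H.mul _ _ _ _ (H.const ((-1) ^ ks.length)) (hf ks)

theorem WD.const (c : Ext V) : WD Hd (fun _ => c) 0 := fun ks => by
  rw [tst_zero]; exact H.const _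

theorem WD.algebraMap {u : T → ℝ} {u' : ℝ} (hu : Hd u u') :
    WD Hd (fun t => algebraMap ℝ (Ext V) (u t)) (algebraMap ℝ (Ext V) u') := fun ks => by
  have := H.mul _ _ _ _ hu (H.const (tst ks (1 : Ext V)))
  simp only [Algebra.algebraMap_eq_smul_one, tst_smul]
  simpa using this

theorem WD.ι {l : T → Module.Dual ℝ V} {l' : Module.Dual ℝ V}
    (hl : ∀ k, Hd (fun t => l t k) (l' k)) :
    WD Hd (fun t => ExteriorAlgebra.ι ℝ (l t)) (ExteriorAlgebra.ι ℝ l') := fun ks => by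
  induction ks using List.reverseRecOn with
  | nil =>
    have : ∀ m : Module.Dual ℝ V, tst [] (ExteriorAlgebra.ι ℝ m) = 0 := fun m => by
      simp [tst_nil, ExteriorAlgebra.algebraMapInv]
    simp only [this]
    exact H.const 0
  | append_singleton ks k ih =>
    simp only [tst_append, ctr_ι]
    exact WD.algebraMap H (hl k) ks

/-- Weak derivatives are known only through scalar tests, so the product rule is proved by induction
on the number of contractions, for all factors at once: a contraction is an antiderivation and
passes to weak derivatives. The scalar product rule enters only for the empty test. -/
theorem WD.mul {f g : T → Ext V} {f' g' : Ext V} (hf : WD Hd f f') (hg : WD Hd g g') :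
    WD Hd (fun t => f t * g t) (f' * g t₀ + f t₀ * g') := fun ks => by
  induction ks using List.reverseRecOn generalizing f g f' g' with
  | nil =>
    have := H.mul _ _ _ _ (hf []) (hg [])
    simpa [tst_nil] using this
  | append_singleton ks k ih =>
    have hf1 : WD Hd (fun t => ctr k (f t)) (ctr k f') := fun ks => by
      simpa only [tst_append] using hf (ks ++ [k])
    have hg1 : WD Hd (fun t => ctr k (g t)) (ctr k g') := fun ks => by
      simpa only [tst_append] using hg (ks ++ [k])
    have := H.add _ _ _ _ (ih hf1 hg) (ih (WD.gr H hf) hg1)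
    simp only [tst_append, ctr_mul, tst_add] at this ⊢
    convert this using 1
    ring

end WD

/-! #### Odd derivations -/

/-- The derivative in the direction of a linear combination of vectors with coefficients in the
exterior algebra is well defined. -/
theorem sum_mul_eq_zero {U : Type} [AddCommGroup U] [Module ℝ U] {J : Type} (s : Finset J)
    (γ : J → Ext V) (μ : J → Module.Dual ℝ U) (e : Module.Dual ℝ U →ₗ[ℝ] Ext V)
    (h : ∀ k, ∑ j ∈ s, μ j k • γ j = 0) : ∑ j ∈ s, γ j * e (μ j) = 0 := by
  classical
  -- Expanding the coefficients in a basis of the exterior algebra turns the hypothesis into real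
  -- linear relations between the functionals, which the linear map `e` preserves.
  let b := Module.Basis.ofVectorSpace ℝ (Ext V)
  have h1 : ∀ i, ∑ j ∈ s, b.repr (γ j) i • μ j = 0 := fun i => by
    refine LinearMap.ext fun k => ?_
    have := congrArg (fun g => b.repr g i) (h k)
    simp only [map_sum, map_smul, Finsupp.coe_finsetSum, Finset.sum_apply, Finsupp.smul_apply,
      map_zero, Finsupp.coe_zero, Pi.zero_apply, smul_eq_mul] at this
    simp only [LinearMap.coe_sum, Finset.sum_apply, LinearMap.smul_apply, smul_eq_mul,
      LinearMap.zero_apply]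
    rw [← this]
    exact Finset.sum_congr rfl fun j _ => mul_comm _ _
  let F := s.biUnion fun j => (b.repr (γ j)).support
  have h2 : ∀ j ∈ s, γ j = ∑ i ∈ F, b.repr (γ j) i • b i := fun j hj => by
    conv_lhs => rw [← b.linearCombination_repr (γ j), Finsupp.linearCombination_apply]
    refine Finsupp.sum_of_support_subset _ (Finset.subset_biUnion_of_mem
      (fun j => (b.repr (γ j)).support) hj) _ fun i _ => zero_smul _ _
  calc ∑ j ∈ s, γ j * e (μ j) = ∑ j ∈ s, ∑ i ∈ F, b i * e (b.repr (γ j) i • μ j) := by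
        refine Finset.sum_congr rfl fun j hj => ?_
        conv_lhs => rw [h2 j hj, Finset.sum_mul]
        refine Finset.sum_congr rfl fun i _ => ?_
        rw [map_smul, smul_mul_assoc, mul_smul_comm]
    _ = ∑ i ∈ F, b i * e (∑ j ∈ s, b.repr (γ j) i • μ j) := by
        rw [Finset.sum_comm]
        refine Finset.sum_congr rfl fun i _ => ?_
        rw [map_sum, Finset.mul_sum]
    _ = 0 := Finset.sum_eq_zero fun i _ => by rw [h1, map_zero, mul_zero]

/-- Consider upper triangular matrices with diagonal (g, gr g): for an algebra homomorphism g ↦ (g,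
d g; 0, gr g), multiplicativity in the corner is exactly the odd Leibniz rule. The homomorphism
exists by the universal property, since the matrix assigned to l squares to zero when e l is even
and so commutes with l. -/
theorem exists_oddDer (e : Module.Dual ℝ V →ₗ[ℝ] Ext V) (he : ∀ l, gr (e l) = e l) :
    ∃ d : Ext V →ₗ[ℝ] Ext V, (∀ l, d (ExteriorAlgebra.ι ℝ l) = e l) ∧
      (∀ r, d (algebraMap ℝ _ r) = 0) ∧ ∀ a b, d (a * b) = d a * gr b + a * d b := by
  let f : Module.Dual ℝ V →ₗ[ℝ] Matrix (Fin 2) (Fin 2) (Ext V) :=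
    { toFun := fun l => !![ExteriorAlgebra.ι ℝ l, e l; 0, -ExteriorAlgebra.ι ℝ l]
      map_add' := fun l m => by
        ext i j; fin_cases i <;> fin_cases j <;> simp [add_comm]
      map_smul' := fun r m => by
        ext i j; fin_cases i <;> fin_cases j <;> simp }
  have hf : ∀ l, f l * f l = 0 := fun l => by
    ext i j
    have := even_mul_comm (he l) (ExteriorAlgebra.ι ℝ l)
    fin_cases i <;> fin_cases j <;>
      simp [f, Matrix.mul_apply, Fin.sum_univ_two, this]
  let F := ExteriorAlgebra.lift ℝ ⟨f, hf⟩
  have hF : ∀ g, F g = !![g, F g 0 1; 0, gr g] := fun g => by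
    induction g using Ext.left_induction with
    | algebraMap r =>
      rw [AlgHom.commutes, gr_algebraMap]
      ext i j; fin_cases i <;> fin_cases j <;> simp [Matrix.algebraMap_matrix_apply]
    | add x y hx hy =>
      rw [map_add, map_add, hx, hy]
      ext i j; fin_cases i <;> fin_cases j <;> simp
    | ι_mul x m hx =>
      rw [map_mul, map_mul, hx, gr_ι]
      have h1 : F (ExteriorAlgebra.ι ℝ m) = f m := ExteriorAlgebra.lift_ι_apply ℝ f hf m
      rw [h1]
      ext i j; fin_cases i <;> fin_cases j <;> simp [f, Matrix.mul_apply, Fin.sum_univ_two]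
  let d : Ext V →ₗ[ℝ] Ext V :=
    { toFun := fun g => F g 0 1
      map_add' := fun a b => by rw [map_add]; rfl
      map_smul' := fun r a => by rw [map_smul]; rfl }
  have hd : ∀ g, d g = F g 0 1 := fun g => rfl
  refine ⟨d, fun l => ?_, fun r => ?_, fun a b => ?_⟩
  · have h1 : F (ExteriorAlgebra.ι ℝ l) = f l := ExteriorAlgebra.lift_ι_apply ℝ f hf l
    rw [hd, h1]
    simp [f]
  · rw [hd, AlgHom.commutes]
    simp [Matrix.algebraMap_matrix_apply]
  · rw [hd, hd, hd, map_mul, hF a, hF b]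
    simp only [Matrix.mul_apply, Fin.sum_univ_two, Matrix.of_apply, Matrix.cons_val_zero,
      Matrix.cons_val_one, Matrix.cons_val', Matrix.cons_val_fin_one]
    rw [add_comm]

end Exterior

end KoszulTate
end

noncomputable section

namespace KoszulTate

/-! ### Total derivatives -/

section TotalDerivatives

variable {n d : ℕ} {X Y : Type}
  [TopologicalSpace X] [ChartedSpace (EuclideanSpace ℝ (Fin n)) X] [IsManifold (𝓡 n) ∞ X]
  [T2Space X]
  [TopologicalSpace Y] [ChartedSpace (EuclideanSpace ℝ (Fin d)) Y] [IsManifold (𝓡 d) ∞ Y]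
  {B : FieldSpace n d X Y} {ι : Type} {K : Antifields n X ι}

theorem IsSecAt.eventually {s : X → Y} {x : X} (h : IsSecAt B s x) :
    ∀ᶠ x' in 𝓝 x, IsSecAt B s x' := eventually_eventually_nhds.2 h

/-- The function `u` is smooth near `x`, and `u'` is its derivative along `τ` at `x`. -/
def HdT (τ : VF n X) (x : X) (u : X → ℝ) (u' : ℝ) : Prop :=
  ∃ a : Sm n X, (a : X → ℝ) =ᶠ[𝓝 x] u ∧ u' = τ a x

theorem ptDer_HdT (τ : VF n X) (x : X) : PtDer x (HdT τ x) where
  const c := ⟨algebraMap ℝ _ c, Eventually.of_forall fun _ => rfl, by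
    rw [Derivation.map_algebraMap]; rfl⟩
  add := by
    rintro u v _ _ ⟨a, ha, rfl⟩ ⟨b, hb, rfl⟩
    exact ⟨a + b, ha.add hb, by rw [map_add]; rfl⟩
  mul := by
    rintro u v _ _ ⟨a, ha, rfl⟩ ⟨b, hb, rfl⟩
    refine ⟨a * b, ha.mul hb, ?_⟩
    rw [VF.leibniz_apply, ← ha.self_of_nhds, ← hb.self_of_nhds]
    ring

theorem HdT.congr {τ : VF n X} {x : X} {u v : X → ℝ} {u' : ℝ} (h : HdT τ x u u')
    (e : u =ᶠ[𝓝 x] v) : HdT τ x v u' := by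
  obtain ⟨a, ha, h⟩ := h
  exact ⟨a, ha.trans e, h⟩

/-- The weak derivative of a function on `X` with values in an exterior algebra. -/
def HasTD (τ : VF n X) (f : X → Val B K) (x : X) (γ : Val B K) : Prop :=
  WD (V := QOdd B K) (HdT τ x) f γ

theorem HasTD.congr {τ : VF n X} {f g : X → Val B K} {x : X} {γ : Val B K} (h : HasTD τ f x γ)
    (e : f =ᶠ[𝓝 x] g) : HasTD τ g x γ :=
  fun ks => (h ks).congr (e.mono fun x' hx' => by simp only [hx'])

/-- The total derivative is chosen among the elements with prescribed tests. Tests separate points,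
so there is at most one such element, and any weak derivative along the section is it. -/
theorem totalDeriv_eq {τ : VF n X} {Φ : Fun B K} {z : JetPt B × QEven B K} {γ : Val B K}
    (h : HasTD τ (along Φ z.1.s z.2) z.1.x γ) : totalDeriv τ Φ z = γ := by
  have key : ∀ ks : List (QOdd B K), testEval ks γ =
      τ (germExt (fun x => testEval ks (along Φ z.1.s z.2 x)) z.1.x) z.1.x := fun ks => by
    obtain ⟨a, ha, e⟩ := h ks
    exact e.trans (VF.congr_apply τ (germExt_eventuallyEq ha)).symm
  have hex : ∃ γ, ∀ ks : List (QOdd B K), testEval ks γ =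
      τ (germExt (fun x => testEval ks (along Φ z.1.s z.2 x)) z.1.x) z.1.x := ⟨γ, key⟩
  rw [totalDeriv, dif_pos hex]
  exact eq_of_tst fun ks => (hex.choose_spec ks).trans (key ks).symm

/-- The total derivatives of `Φ` exist. -/
def IsTD (Φ : Fun B K) : Prop :=
  ∀ (z : JetPt B × QEven B K) (τ : VF n X),
    HasTD τ (along Φ z.1.s z.2) z.1.x (totalDeriv τ Φ z)

theorem along_of_isSecAt (Φ : Fun B K) {s : X → Y} (q : QEven B K) {x : X} (h : IsSecAt B s x) :
    along Φ s q x = Φ (⟨x, s, h⟩, q) := dif_pos h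

theorem along_self (Φ : Fun B K) (z : JetPt B × QEven B K) :
    along Φ z.1.s z.2 z.1.x = Φ z := dif_pos z.1.isSec

theorem isTD_of_hasTD {Φ' : VF n X → Fun B K} {Ψ : Fun B K}
    (h : ∀ (z : JetPt B × QEven B K) (τ : VF n X), HasTD τ (along Ψ z.1.s z.2) z.1.x (Φ' τ z)) :
    IsTD Ψ ∧ ∀ τ, totalDeriv τ Ψ = Φ' τ :=
  ⟨fun z τ => by rw [totalDeriv_eq (h z τ)]; exact h z τ, fun τ => funext fun z => totalDeriv_eq (h z τ)⟩

theorem along_add (Φ Ψ : Fun B K) (s : X → Y) (q : QEven B K) :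
    along (Φ + Ψ) s q = fun x => along Φ s q x + along Ψ s q x := by
  funext x
  by_cases h : IsSecAt B s x
  · rw [along_of_isSecAt _ _ h, along_of_isSecAt _ _ h, along_of_isSecAt _ _ h]; rfl
  · simp [along, h]

theorem along_mul (Φ Ψ : Fun B K) (s : X → Y) (q : QEven B K) :
    along (Φ * Ψ) s q = fun x => along Φ s q x * along Ψ s q x := by
  funext x
  by_cases h : IsSecAt B s x
  · rw [along_of_isSecAt _ _ h, along_of_isSecAt _ _ h, along_of_isSecAt _ _ h]; rfl
  · simp [along, h]

theorem IsTD.add {Φ Ψ : Fun B K} (h : IsTD Φ) (h' : IsTD Ψ) :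
    IsTD (Φ + Ψ) ∧ ∀ τ, totalDeriv τ (Φ + Ψ) = totalDeriv τ Φ + totalDeriv τ Ψ := by
  refine isTD_of_hasTD fun z τ => ?_
  rw [along_add]
  exact WD.add (ptDer_HdT τ z.1.x) (h z τ) (h' z τ)

theorem IsTD.mul {Φ Ψ : Fun B K} (h : IsTD Φ) (h' : IsTD Ψ) :
    IsTD (Φ * Ψ) ∧ ∀ τ, totalDeriv τ (Φ * Ψ) = totalDeriv τ Φ * Ψ + Φ * totalDeriv τ Ψ := by
  refine isTD_of_hasTD (Φ' := fun τ => totalDeriv τ Φ * Ψ + Φ * totalDeriv τ Ψ)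
    fun z τ => ?_
  rw [along_mul]
  have := WD.mul (ptDer_HdT τ z.1.x) (h z τ) (h' z τ)
  rw [along_self, along_self] at this
  exact this

theorem isTD_even (A : QEven B K → Sm n X) (Φ : Fun B K)
    (h : ∀ z, Φ z = algebraMap ℝ _ (A z.2 z.1.x)) :
    IsTD Φ ∧ ∀ τ, totalDeriv τ Φ = fun z => algebraMap ℝ _ (τ (A z.2) z.1.x) := by
  refine isTD_of_hasTD fun z τ => ?_
  refine HasTD.congr (WD.algebraMap (ptDer_HdT τ z.1.x) ⟨A z.2, EventuallyEq.rfl, rfl⟩) ?_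
  filter_upwards [z.1.isSec.eventually] with x' hx'
  rw [along_of_isSecAt _ _ hx', h]

theorem isTD_odd (A : QOdd B K → Sm n X) (Φ : Fun B K) (l : X → Module.Dual ℝ (QOdd B K))
    (l' : VF n X → X → Module.Dual ℝ (QOdd B K))
    (h : ∀ z, Φ z = ExteriorAlgebra.ι ℝ (l z.1.x)) (hl : ∀ x k, l x k = A k x)
    (hl' : ∀ τ x k, l' τ x k = τ (A k) x) :
    IsTD Φ ∧ ∀ τ, totalDeriv τ Φ = fun z => ExteriorAlgebra.ι ℝ (l' τ z.1.x) := by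
  refine isTD_of_hasTD (Φ' := fun τ z => ExteriorAlgebra.ι ℝ (l' τ z.1.x)) fun z τ => ?_
  refine HasTD.congr (WD.ι (ptDer_HdT τ z.1.x) (l := l) fun k =>
    ⟨A k, Eventually.of_forall fun x => (hl x k).symm, hl' τ z.1.x k⟩) ?_
  filter_upwards [z.1.isSec.eventually] with x' hx'
  rw [along_of_isSecAt _ _ hx', h]

theorem isTD_algebraMap (a : Sm n X) :
    IsTD (algebraMap (Sm n X) (Fun B K) a) ∧
      ∀ τ, totalDeriv τ (algebraMap (Sm n X) (Fun B K) a) = algebraMap _ _ (τ a) :=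
  isTD_even (fun _ => a) _ fun _ => rfl

theorem IsTD.smul {Φ : Fun B K} (h : IsTD Φ) (a : Sm n X) :
    IsTD (a • Φ) ∧ ∀ τ, totalDeriv τ (a • Φ) = τ a • Φ + a • totalDeriv τ Φ := by
  have := (isTD_algebraMap (B := B) (K := K) a).1.mul h
  rw [← Algebra.smul_def] at this
  refine ⟨this.1, fun τ => ?_⟩
  rw [this.2, (isTD_algebraMap a).2, ← Algebra.smul_def, ← Algebra.smul_def]

theorem isTD_fieldGen (t : List (VF n X)) (κ : Sec B.F →ₗ[Sm n X] Sm n X) :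
    IsTD (fieldGen B K t κ) ∧ ∀ τ, totalDeriv τ (fieldGen B K t κ) = fieldGen B K (τ :: t) κ :=
  isTD_odd (fun k => word t (κ (QOdd.field B K k))) _
    (fun x => jetEval x t ∘ₗ κ.restrictScalars ℝ ∘ₗ QOdd.field B K)
    (fun τ x => jetEval x (τ :: t) ∘ₗ κ.restrictScalars ℝ ∘ₗ QOdd.field B K)
    (fun _ => rfl) (fun _ _ => rfl)
    fun τ x k => congrArg (fun a : Sm n X => a x) (word_cons τ t (κ (QOdd.field B K k)))

theorem isTD_antiEven (t : List (VF n X)) (v : Sec B.F) (σ : Fin n → VF n X) :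
    IsTD (antiEven B K t v σ) ∧
      ∀ τ, totalDeriv τ (antiEven B K t v σ) = antiEven B K (τ :: t) v σ := by
  refine ⟨(isTD_even (fun q => word t (DensDual.pair v σ q.1)) (antiEven B K t v σ) fun _ => rfl).1, fun τ => ?_⟩
  rw [(isTD_even (fun q => word t (DensDual.pair v σ q.1)) (antiEven B K t v σ) fun _ => rfl).2]
  funext z
  simp only [← word_cons]
  rfl

theorem isTD_ghostEven (i : ι) (t : List (VF n X)) (v : Sec (K.V i)) (σ : Fin n → VF n X) :
    IsTD (ghostEven B K i t v σ) ∧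
      ∀ τ, totalDeriv τ (ghostEven B K i t v σ) = ghostEven B K i (τ :: t) v σ := by
  refine ⟨(isTD_even (fun q => word t (DensDual.pair v σ (q.2 i))) (ghostEven B K i t v σ) fun _ => rfl).1, fun τ => ?_⟩
  rw [(isTD_even (fun q => word t (DensDual.pair v σ (q.2 i))) (ghostEven B K i t v σ) fun _ => rfl).2]
  funext z
  simp only [← word_cons]
  rfl

theorem isTD_antiOdd (t : List (VF n X)) (v : Sec B.W) (σ : Fin n → VF n X) :
    IsTD (antiOdd B K t v σ) ∧
      ∀ τ, totalDeriv τ (antiOdd B K t v σ) = antiOdd B K (τ :: t) v σ :=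
  isTD_odd (fun k => word t (DensDual.pair v σ (QOdd.anti B K k))) _
    (fun x => densEval x t v σ ∘ₗ QOdd.anti B K)
    (fun τ x => densEval x (τ :: t) v σ ∘ₗ QOdd.anti B K) (fun _ => rfl) (fun _ _ => rfl)
    fun τ x k => congrArg (fun a : Sm n X => a x) (word_cons τ t _)

theorem isTD_ghostOdd (i : ι) (t : List (VF n X)) (v : Sec (K.E i)) (σ : Fin n → VF n X) :
    IsTD (ghostOdd B K i t v σ) ∧
      ∀ τ, totalDeriv τ (ghostOdd B K i t v σ) = ghostOdd B K i (τ :: t) v σ :=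
  isTD_odd (fun k => word t (DensDual.pair v σ (QOdd.ghost B K i k))) _
    (fun x => densEval x t v σ ∘ₗ QOdd.ghost B K i)
    (fun τ x => densEval x (τ :: t) v σ ∘ₗ QOdd.ghost B K i) (fun _ => rfl) (fun _ _ => rfl)
    fun τ x k => congrArg (fun a : Sm n X => a x) (word_cons τ t _)

/-! #### Functions on jet manifolds -/

/-- The germ of `h ∘ s` is extended anew at every point in the definition of `jetFun`. One extension
b serves all points near x, so that along the section every jet coordinate is the smooth function
`word l b`. -/
theorem jetFun_eventually (h : Sm d Y) {s : X → Y} {x : X} (hs : IsSecAt B s x) :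
    ∃ b : Sm n X, ∀ᶠ x' in 𝓝 x, ∀ (hs' : IsSecAt B s x') (l : List (VF n X)),
      jetFun B h l ⟨x', s, hs'⟩ = word l b x' := by
  obtain ⟨b, hb⟩ := exists_smooth_germ (n := n) (x := x) (f := fun x => h (s x))
    (hs.mono fun x' hx' => h.contMDiff.contMDiffAt.comp x' hx'.1)
  refine ⟨b, (eventually_eventually_nhds.2 hb).mono fun x' hx' hs' l => ?_⟩
  exact (word_congr l (germExt_eventuallyEq hx')).self_of_nhds

/-- A version of `SmoothJet` with an arbitrary finite index type. -/
theorem smoothJet_of_fintype {r : ℕ} {f : JetPt B → ℝ}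
    (h : ∀ p : JetPt B, ∃ (J : Type) (_ : Fintype J) (h : J → Sm d Y) (l : J → List (VF n X))
      (g : (J → ℝ) → ℝ) (ε : ℝ), (∀ i, (l i).length ≤ r) ∧ ContDiff ℝ ∞ g ∧ 0 < ε ∧
      ∀ p' : JetPt B, (∀ i, |jetFun B (h i) (l i) p' - jetFun B (h i) (l i) p| < ε) →
        f p' = g fun i => jetFun B (h i) (l i) p') : SmoothJet B r f := by
  intro p
  obtain ⟨J, _, h, l, g, ε, hl, hg, hε, e⟩ := h p
  let φ := Fintype.equivFin J
  refine ⟨Fintype.card J, h ∘ φ.symm, l ∘ φ.symm, fun y => g (y ∘ φ), ε, fun i => hl _, ?_, hε,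
    fun p' hp' => ?_⟩
  · exact hg.comp (contDiff_pi.2 fun j => contDiff_apply ℝ ℝ (φ j))
  · rw [e p' fun j => by simpa using hp' (φ j)]
    congr 1
    funext j
    simp

open Classical in
/-- The total derivative of a function on a jet manifold. -/
def bodyDeriv (τ : VF n X) (f : JetPt B → ℝ) (p : JetPt B) : ℝ :=
  τ (germExt (fun x => if h : IsSecAt B p.s x then f ⟨x, p.s, h⟩ else 0) p.x) p.x

-- The chain rule: along a section, f is g of finitely many smooth functions of the base point, and
-- τ is prepended to each of their words. It is stated at all p' near p, with g fixed, since it must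
-- exhibit the derivative itself as a smooth function of jet coordinates.
open Classical in
theorem bodyDeriv_spec {f : JetPt B → ℝ} {k : ℕ} {h : Fin k → Sm d Y}
    {l : Fin k → List (VF n X)} {g : (Fin k → ℝ) → ℝ} {ε : ℝ} (hg : ContDiff ℝ ∞ g) {p : JetPt B}
    (e : ∀ p' : JetPt B, (∀ i, |jetFun B (h i) (l i) p' - jetFun B (h i) (l i) p| < ε) →
      f p' = g fun i => jetFun B (h i) (l i) p')
    {p' : JetPt B} (hp' : ∀ i, |jetFun B (h i) (l i) p' - jetFun B (h i) (l i) p| < ε)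
    (τ : VF n X) :
    HdT τ p'.x (fun x => if h : IsSecAt B p'.s x then f ⟨x, p'.s, h⟩ else 0) (bodyDeriv τ f p') ∧
    bodyDeriv τ f p' = ∑ i, fderiv ℝ g (fun i => jetFun B (h i) (l i) p') (Pi.single i 1) *
      jetFun B (h i) (τ :: l i) p' := by
  choose b hb using fun i => jetFun_eventually (B := B) (h i) p'.isSec
  have hb' : ∀ᶠ x' in 𝓝 p'.x, ∀ i, ∀ (hs' : IsSecAt B p'.s x') (l : List (VF n X)),
      jetFun B (h i) l ⟨x', p'.s, hs'⟩ = word l (b i) x' := eventually_all.2 hb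
  have h0 : ∀ i (l : List (VF n X)), jetFun B (h i) l p' = word l (b i) p'.x := fun i =>
    hb'.self_of_nhds i p'.isSec
  have hnear : ∀ᶠ x' in 𝓝 p'.x, ∀ i, |word (l i) (b i) x' - jetFun B (h i) (l i) p| < ε := by
    refine eventually_all.2 fun i => ?_
    have hc : Continuous fun x' => |word (l i) (b i) x' - jetFun B (h i) (l i) p| :=
      ((word (l i) (b i)).contMDiff.continuous.sub continuous_const).abs
    refine hc.continuousAt.eventually_lt continuousAt_const ?_
    rw [← h0]
    exact hp' i
  have ha : (Sm.compFun g hg (fun i => word (l i) (b i)) : X → ℝ) =ᶠ[𝓝 p'.x]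
      fun x => if h : IsSecAt B p'.s x then f ⟨x, p'.s, h⟩ else 0 := by
    filter_upwards [hb', hnear, p'.isSec.eventually] with x' h1 h2 h3
    rw [dif_pos h3, e ⟨x', p'.s, h3⟩ fun i => by rw [h1 i h3]; exact h2 i]
    change g _ = g _
    congr 1
    funext i
    exact (h1 i h3 _).symm
  have hval : bodyDeriv τ f p' = τ (Sm.compFun g hg (fun i => word (l i) (b i))) p'.x :=
    VF.congr_apply τ (germExt_eventuallyEq ha)
  refine ⟨⟨_, ha, hval⟩, ?_⟩
  rw [hval, VF.compFun_apply]
  refine Finset.sum_congr rfl fun i _ => ?_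
  rw [h0, word_cons]
  simp only [h0]

theorem smoothJet_bodyDeriv {r : ℕ} {f : JetPt B → ℝ} (hf : SmoothJet B r f) (τ : VF n X) :
    SmoothJet B (r + 1) (bodyDeriv τ f) := by
  refine smoothJet_of_fintype fun p => ?_
  obtain ⟨k, h, l, g, ε, hl, hg, hε, e⟩ := hf p
  refine ⟨Fin k ⊕ Fin k, inferInstance, Sum.elim h h, Sum.elim l fun i => τ :: l i,
    fun y => ∑ i, fderiv ℝ g (fun i => y (Sum.inl i)) (Pi.single i 1) * y (Sum.inr i), ε,
    ?_, ?_, hε, fun p' hp' => ?_⟩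
  · rintro (i | i)
    · exact (hl i).trans (Nat.le_succ r)
    · simpa using hl i
  · refine ContDiff.sum fun i _ => ContDiff.mul ?_ (contDiff_apply ℝ ℝ _)
    refine ContDiff.clm_apply ?_ contDiff_const
    have hd : ContDiff ℝ ∞ (fderiv ℝ g) := hg.fderiv_right (by simp)
    exact hd.comp (contDiff_pi.2 fun i => contDiff_apply ℝ ℝ _)
  · exact (bodyDeriv_spec hg e (fun i => hp' (Sum.inl i)) τ).2

theorem isTD_bodyFun {r : ℕ} {f : JetPt B → ℝ} (hf : SmoothJet B r f) :
    IsTD (bodyFun B K f) ∧ ∀ τ, totalDeriv τ (bodyFun B K f) = bodyFun B K (bodyDeriv τ f) := by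
  refine isTD_of_hasTD fun z τ => ?_
  obtain ⟨k, h, l, g, ε, hl, hg, hε, e⟩ := hf z.1
  have := (bodyDeriv_spec hg e (p' := z.1) (fun i => by simpa using hε) τ).1
  refine HasTD.congr (WD.algebraMap (ptDer_HdT τ z.1.x) this) ?_
  filter_upwards [z.1.isSec.eventually] with x' hx'
  rw [along_of_isSecAt _ _ hx', dif_pos hx']
  rfl

/-! #### Total derivatives of graded functions -/

theorem Gen.isTD {r l : ℕ} {Φ : Fun B K} (h : Gen B K r l Φ) :
    IsTD Φ ∧ ∀ τ, Gen B K (r + 1) l (totalDeriv τ Φ) := by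
  cases h with
  | body f hf =>
    refine ⟨(isTD_bodyFun hf).1, fun τ => ?_⟩
    rw [(isTD_bodyFun hf).2]
    exact Gen.body _ (smoothJet_bodyDeriv hf τ)
  | field t ht κ =>
    refine ⟨(isTD_fieldGen t κ).1, fun τ => ?_⟩
    rw [(isTD_fieldGen t κ).2]
    exact Gen.field _ (by simpa using ht) κ
  | antiEven hl t ht v σ =>
    refine ⟨(isTD_antiEven t v σ).1, fun τ => ?_⟩
    rw [(isTD_antiEven t v σ).2]
    exact Gen.antiEven hl _ (by simpa using ht) v σ
  | antiOdd hl t ht v σ =>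
    refine ⟨(isTD_antiOdd t v σ).1, fun τ => ?_⟩
    rw [(isTD_antiOdd t v σ).2]
    exact Gen.antiOdd hl _ (by simpa using ht) v σ
  | ghostEven i hl t ht v σ =>
    refine ⟨(isTD_ghostEven i t v σ).1, fun τ => ?_⟩
    rw [(isTD_ghostEven i t v σ).2]
    exact Gen.ghostEven i hl _ (by simpa using ht) v σ
  | ghostOdd i hl t ht v σ =>
    refine ⟨(isTD_ghostOdd i t v σ).1, fun τ => ?_⟩
    rw [(isTD_ghostOdd i t v σ).2]
    exact Gen.ghostOdd i hl _ (by simpa using ht) v σ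

theorem genAlg_mono {r r' l l' : ℕ} (hr : r ≤ r') (hl : l ≤ l') :
    genAlg B K r l ≤ genAlg B K r' l' :=
  Algebra.adjoin_mono fun _ hx => Gen.mono B K hr hl hx

theorem genAlg_isTD {r l : ℕ} {Φ : Fun B K} (h : Φ ∈ genAlg B K r l) :
    IsTD Φ ∧ ∀ τ, totalDeriv τ Φ ∈ genAlg B K (r + 1) l := by
  have hm := genAlg_mono (B := B) (K := K) (Nat.le_succ r) (le_refl l)
  induction h using Algebra.adjoin_induction with
  | mem Φ hΦ => exact ⟨(Gen.isTD hΦ).1, fun τ => Algebra.subset_adjoin ((Gen.isTD hΦ).2 τ)⟩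
  | algebraMap a =>
    refine ⟨(isTD_algebraMap a).1, fun τ => ?_⟩
    rw [(isTD_algebraMap a).2]
    exact Subalgebra.algebraMap_mem _ _
  | add Φ Ψ _ _ h h' =>
    refine ⟨(h.1.add h'.1).1, fun τ => ?_⟩
    rw [(h.1.add h'.1).2]
    exact add_mem (h.2 τ) (h'.2 τ)
  | mul Φ Ψ hΦ hΨ h h' =>
    refine ⟨(h.1.mul h'.1).1, fun τ => ?_⟩
    rw [(h.1.mul h'.1).2]
    exact add_mem (mul_mem (h.2 τ) (hm hΨ)) (mul_mem (hm hΦ) (h'.2 τ))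

/-- `Φ` and `Ψ` agree over `U`. -/
def EqOver (U : Set X) (Φ Ψ : Fun B K) : Prop := ∀ z, z.1.x ∈ U → Φ z = Ψ z

theorem hasTD_congr_over {U : Set X} {Φ Ψ : Fun B K} (h : EqOver U Φ Ψ) {z : JetPt B × QEven B K}
    (hz : U ∈ 𝓝 z.1.x) {τ : VF n X} {γ : Val B K} (hΨ : HasTD τ (along Ψ z.1.s z.2) z.1.x γ) :
    HasTD τ (along Φ z.1.s z.2) z.1.x γ := by
  refine hΨ.congr ?_
  filter_upwards [hz, z.1.isSec.eventually] with x' h1 h2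
  rw [along_of_isSecAt _ _ h2, along_of_isSecAt _ _ h2, h _ h1]

theorem ordLe_isTD {r l : ℕ} {Φ : Fun B K} (h : Φ ∈ ordLe B K r l) :
    IsTD Φ ∧ ∀ τ, totalDeriv τ Φ ∈ ordLe B K (r + 1) l := by
  constructor
  · intro z τ
    obtain ⟨U, hU, Ψ, hΨ, e⟩ := h z.1.x
    have := hasTD_congr_over e hU ((genAlg_isTD hΨ).1 z τ)
    rwa [totalDeriv_eq this]
  · intro τ x₀
    obtain ⟨U, hU, Ψ, hΨ, e⟩ := h x₀
    refine ⟨interior U, interior_mem_nhds.2 hU, _, (genAlg_isTD hΨ).2 τ, fun z hz => ?_⟩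
    exact totalDeriv_eq (hasTD_congr_over e (mem_interior_iff_mem_nhds.1 hz)
      ((genAlg_isTD hΨ).1 z τ))

theorem P_isTD {Φ : Fun B K} (h : Φ ∈ P B K) : IsTD Φ := by
  obtain ⟨r, l, h⟩ := h
  exact (ordLe_isTD h).1

theorem totalDeriv_mem_P {Φ : Fun B K} (h : Φ ∈ P B K) (τ : VF n X) : totalDeriv τ Φ ∈ P B K := by
  obtain ⟨r, l, h⟩ := h
  exact ⟨r + 1, l, (ordLe_isTD h).2 τ⟩

theorem totalDeriv_congr_over {U : Set X} {Φ Ψ : Fun B K} (hΨ : IsTD Ψ) (h : EqOver U Φ Ψ)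
    {z : JetPt B × QEven B K} (hz : U ∈ 𝓝 z.1.x) (τ : VF n X) :
    totalDeriv τ Φ z = totalDeriv τ Ψ z :=
  totalDeriv_eq (hasTD_congr_over h hz (hΨ z τ))

/-- The total derivative, as a map of the ring of graded functions. -/
def tdP (τ : VF n X) (Φ : P B K) : P B K := ⟨totalDeriv τ Φ, totalDeriv_mem_P Φ.2 τ⟩

theorem tdP_add (τ : VF n X) (Φ Ψ : P B K) : tdP τ (Φ + Ψ) = tdP τ Φ + tdP τ Ψ :=
  Subtype.ext (((P_isTD Φ.2).add (P_isTD Ψ.2)).2 τ)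

theorem tdP_smul (τ : VF n X) (a : Sm n X) (Φ : P B K) :
    tdP τ (a • Φ) = τ a • Φ + a • tdP τ Φ :=
  Subtype.ext (((P_isTD Φ.2).smul a).2 τ)

theorem tdP_mul (τ : VF n X) (Φ Ψ : P B K) : tdP τ (Φ * Ψ) = tdP τ Φ * Ψ + Φ * tdP τ Ψ :=
  Subtype.ext (((P_isTD Φ.2).mul (P_isTD Ψ.2)).2 τ)

/-- Iterated total derivatives, as maps of the ring of graded functions. -/
def tdsP (t : List (VF n X)) (Φ : P B K) : P B K := t.foldr tdP Φ

theorem tdsP_cons (τ : VF n X) (t : List (VF n X)) (Φ : P B K) :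
    tdsP (τ :: t) Φ = tdP τ (tdsP t Φ) := rfl

theorem coe_tdsP (t : List (VF n X)) (Φ : P B K) :
    ((tdsP t Φ : P B K) : Fun B K) = totalDerivs t Φ := by
  induction t with
  | nil => rfl
  | cons τ t ih =>
    rw [tdsP_cons]
    change totalDeriv τ (tdsP t Φ : P B K) = totalDeriv τ (totalDerivs t (Φ : Fun B K))
    rw [ih]

theorem totalDerivs_mem_ordLe {r l : ℕ} {Φ : Fun B K} (h : Φ ∈ ordLe B K r l)
    (t : List (VF n X)) : totalDerivs t Φ ∈ ordLe B K (r + t.length) l := by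
  induction t with
  | nil => exact h
  | cons τ t ih => exact (ordLe_isTD ih).2 τ

/-- Tests commute with total derivatives. An iterated total derivative at z is thereby reduced to
iterated derivatives of one smooth function on X, which is how identities between total derivatives
are checked. The induction needs equality of germs, not only of values at z. -/
theorem totalDerivs_tst {Φ : Fun B K} (h : Φ ∈ P B K) (t : List (VF n X))
    (z : JetPt B × QEven B K) (ks : List (QOdd B K)) {a : Sm n X}
    (ha : (a : X → ℝ) =ᶠ[𝓝 z.1.x] fun x => testEval ks (along Φ z.1.s z.2 x)) :
    testEval ks (totalDerivs t Φ z) = jetEval z.1.x t a := by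
  suffices H : (word t a : X → ℝ) =ᶠ[𝓝 z.1.x]
      fun x => testEval ks (along (totalDerivs t Φ) z.1.s z.2 x) by
    rw [← along_self (totalDerivs t Φ) z]
    exact H.self_of_nhds.symm
  induction t with
  | nil => exact ha
  | cons τ t ih =>
    have hP : totalDerivs t Φ ∈ P B K := by
      obtain ⟨r, l, h⟩ := h
      exact ⟨_, l, totalDerivs_mem_ordLe h t⟩
    rw [word_cons]
    filter_upwards [eventually_eventually_nhds.2 ih, z.1.isSec.eventually] with x' h1 h2
    rw [along_of_isSecAt _ _ h2]
    have h1' : (word t a : X → ℝ) =ᶠ[𝓝 x']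
      fun x => testEval ks (along (totalDerivs t Φ) z.1.s z.2 x) := h1
    obtain ⟨b, hb, e⟩ := P_isTD hP (⟨x', z.1.s, h2⟩, z.2) τ ks
    exact (VF.congr_apply τ (hb.trans h1'.symm)).symm.trans e.symm

theorem exists_smooth_tst {Φ : Fun B K} (h : Φ ∈ P B K) (z : JetPt B × QEven B K)
    (ks : List (QOdd B K)) :
    ∃ a : Sm n X, (a : X → ℝ) =ᶠ[𝓝 z.1.x] fun x => testEval ks (along Φ z.1.s z.2 x) := by
  obtain ⟨a, ha, -⟩ := P_isTD h z 0 ks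
  exact ⟨a, ha⟩

end TotalDerivatives

end KoszulTate
end

noncomputable section

namespace KoszulTate

/-! ### Parity, homogeneity and restriction -/

section Homogeneity

variable {n d : ℕ} {X Y : Type}
  [TopologicalSpace X] [ChartedSpace (EuclideanSpace ℝ (Fin n)) X]
  [TopologicalSpace Y] [ChartedSpace (EuclideanSpace ℝ (Fin d)) Y] [IsManifold (𝓡 d) ∞ Y]
  {B : FieldSpace n d X Y} {ι : Type} {K : Antifields n X ι}

theorem Fun.neg_apply (Φ : Fun B K) (z) : (-Φ) z = -Φ z := rfl
theorem Fun.zero_apply (z) : (0 : Fun B K) z = 0 := rfl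
/-- Evaluation at a point, as a ring homomorphism. -/
def Fun.evalHom (z : JetPt B × QEven B K) : Fun B K →+* Val B K where
  toFun Φ := Φ z
  map_one' := rfl
  map_mul' _ _ := rfl
  map_zero' := rfl
  map_add' _ _ := rfl

theorem Fun.sum_apply {α : Type*} (s : Finset α) (f : α → Fun B K) (z) :
    (∑ i ∈ s, f i) z = ∑ i ∈ s, f i z := map_sum (Fun.evalHom z) f s

theorem Fun.neg_one_pow_mul_apply (k : ℕ) (Φ : Fun B K) (z) :
    ((-1) ^ k * Φ) z = (-1 : ℝ) ^ k • Φ z := by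
  rcases neg_one_pow_eq_or ℝ k with h | h
  · rcases Nat.even_or_odd k with hk | hk
    · rw [hk.neg_one_pow, hk.neg_one_pow, one_mul, one_smul]
    · rw [hk.neg_one_pow] at h; norm_num at h
  · rcases Nat.even_or_odd k with hk | hk
    · rw [hk.neg_one_pow] at h; norm_num at h
    · rw [hk.neg_one_pow, hk.neg_one_pow, neg_one_mul, neg_one_smul]; rfl

/-- The grade involution. -/
def grF : Fun B K →ₐ[Sm n X] Fun B K where
  toFun Φ := fun z => gr (Φ z)
  map_one' := by funext z; exact map_one _
  map_mul' Φ Ψ := by funext z; exact map_mul _ _ _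
  map_zero' := by funext z; exact map_zero _
  map_add' Φ Ψ := by funext z; exact map_add _ _ _
  commutes' a := by funext z; exact AlgHom.commutes _ _

theorem grF_grF (Φ : Fun B K) : grF (grF Φ) = Φ := funext fun z => gr_gr (Φ z)

theorem isPar_iff (i : ZMod 2) (Φ : Fun B K) : IsPar B K i Φ ↔ grF Φ = (-1) ^ i.val * Φ := by
  constructor
  · intro h
    funext z
    rw [Fun.neg_one_pow_mul_apply]
    exact (mem_evenOdd_iff i _).1 (h z)
  · intro h z
    have := congrFun h z
    rw [Fun.neg_one_pow_mul_apply] at this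
    exact (mem_evenOdd_iff i _).2 this

theorem isPar_zero_iff (Φ : Fun B K) : IsPar B K 0 Φ ↔ grF Φ = Φ := by
  rw [isPar_iff, show ZMod.val (0 : ZMod 2) = 0 from rfl, pow_zero, one_mul]

theorem isPar_one_iff (Φ : Fun B K) : IsPar B K 1 Φ ↔ grF Φ = -Φ := by
  rw [isPar_iff, show ZMod.val (1 : ZMod 2) = 1 from rfl, pow_one, neg_one_mul]

/-- `Φ` is a generator of antifield number `a` and Grassmann parity `i`. -/
structure GenAt (r a : ℕ) (i : ZMod 2) (Φ : Fun B K) : Prop where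
  gen : Gen B K r a Φ
  par : IsPar B K i Φ
  subst : ∀ c : ℕ → ℝ, c 0 = 1 → ∀ z, subst B K c Φ z = c a • Φ z

theorem isPar_algebraMap (f : JetPt B × QEven B K → ℝ) :
    IsPar B K 0 (fun z => algebraMap ℝ (Val B K) (f z)) := fun z =>
  (mem_even_iff _).2 (gr_algebraMap _)

theorem isPar_ι (f : JetPt B × QEven B K → Module.Dual ℝ (QOdd B K)) :
    IsPar B K 1 (fun z => ExteriorAlgebra.ι ℝ (f z)) := fun z => (mem_odd_iff _).2 (gr_ι _)

theorem Gen.exists_genAt {r l : ℕ} {Φ : Fun B K} (h : Gen B K r l Φ) :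
    ∃ a ≤ l, ∃ i, GenAt r a i Φ := by
  cases h with
  | body f hf =>
    refine ⟨0, Nat.zero_le l, 0, Gen.body f hf, isPar_algebraMap _, fun c hc z => ?_⟩
    rw [hc, one_smul]
    exact AlgHom.commutes _ _
  | field t ht κ =>
    refine ⟨0, Nat.zero_le l, 1, Gen.field t ht κ, isPar_ι _, fun c hc z => ?_⟩
    rw [hc, one_smul]
    exact (ExteriorAlgebra.map_apply_ι _ _).trans rfl
  | antiEven h t ht v σ =>
    refine ⟨1, h, 0, Gen.antiEven le_rfl t ht v σ, isPar_algebraMap _, fun c hc z => ?_⟩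
    refine (AlgHom.commutes _ _).trans ?_
    change algebraMap ℝ _ (densEval z.1.x t v σ (c 1 • z.2.1)) = _
    rw [map_smul, smul_eq_mul, map_mul, ← Algebra.smul_def]
    rfl
  | antiOdd h t ht v σ =>
    refine ⟨1, h, 1, Gen.antiOdd le_rfl t ht v σ, isPar_ι _, fun c hc z => ?_⟩
    refine (ExteriorAlgebra.map_apply_ι _ _).trans ?_
    refine Eq.trans ?_ (map_smul (ExteriorAlgebra.ι ℝ) (c 1) _)
    refine congrArg _ (LinearMap.ext fun q => ?_)
    exact map_smul (densEval z.1.x t v σ) (c 1) (QOdd.anti B K q)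
  | ghostEven i h t ht v σ =>
    refine ⟨K.ant i, h, 0, Gen.ghostEven i le_rfl t ht v σ, isPar_algebraMap _, fun c hc z => ?_⟩
    refine (AlgHom.commutes _ _).trans ?_
    change algebraMap ℝ _ (densEval z.1.x t v σ (c (K.ant i) • z.2.2 i)) = _
    rw [map_smul, smul_eq_mul, map_mul, ← Algebra.smul_def]
    rfl
  | ghostOdd i h t ht v σ =>
    refine ⟨K.ant i, h, 1, Gen.ghostOdd i le_rfl t ht v σ, isPar_ι _, fun c hc z => ?_⟩
    refine (ExteriorAlgebra.map_apply_ι _ _).trans ?_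
    refine Eq.trans ?_ (map_smul (ExteriorAlgebra.ι ℝ) (c (K.ant i)) _)
    refine congrArg _ (LinearMap.ext fun q => ?_)
    exact map_smul (densEval z.1.x t v σ) (c (K.ant i)) (QOdd.ghost B K i q)

theorem genAlg_le_ordLe (r l : ℕ) : genAlg B K r l ≤ ordLe B K r l := fun Φ h x₀ =>
  ⟨univ, univ_mem, Φ, h, fun _ _ => rfl⟩

theorem ordLe_le_P (r l : ℕ) : ordLe B K r l ≤ P B K := fun Φ h => ⟨r, l, h⟩

theorem GenAt.mem_ordLe {r a : ℕ} {i : ZMod 2} {Φ : Fun B K} (h : GenAt r a i Φ) :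
    Φ ∈ ordLe B K r a := genAlg_le_ordLe r a (Algebra.subset_adjoin h.gen)

theorem mem_ordLe_of_local {r l : ℕ} {Φ : Fun B K}
    (h : ∀ x₀ : X, ∃ U ∈ 𝓝 x₀, ∃ Ψ ∈ ordLe B K r l, EqOver U Φ Ψ) : Φ ∈ ordLe B K r l := by
  intro x₀
  obtain ⟨U, hU, Ψ, hΨ, e⟩ := h x₀
  obtain ⟨U', hU', Ψ', hΨ', e'⟩ := hΨ x₀
  exact ⟨U ∩ U', inter_mem hU hU', Ψ', hΨ', fun z hz => (e z hz.1).trans (e' z hz.2)⟩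

theorem grF_mem_ordLe {r l : ℕ} {Φ : Fun B K} (h : Φ ∈ ordLe B K r l) :
    grF Φ ∈ ordLe B K r l := by
  have key : genAlg B K r l ≤ (genAlg B K r l).comap (grF (B := B) (K := K)) := by
    refine Algebra.adjoin_le fun Ψ hΨ => ?_
    obtain ⟨a, ha, i, hi⟩ := Gen.exists_genAt hΨ
    rw [SetLike.mem_coe, Subalgebra.mem_comap, (isPar_iff i Ψ).1 hi.par]
    exact mul_mem (pow_mem (neg_mem (one_mem _)) _) (Algebra.subset_adjoin hΨ)
  intro x₀
  obtain ⟨U, hU, Ψ, hΨ, e⟩ := h x₀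
  exact ⟨U, hU, grF Ψ, key hΨ, fun z hz => congrArg _ (e z hz)⟩

/-- The grade involution on the ring of graded functions. -/
def grP (Φ : P B K) : P B K := ⟨grF Φ, by
  obtain ⟨r, l, h⟩ := Φ.2
  exact ⟨r, l, grF_mem_ordLe h⟩⟩

/-- Monomials of antifield number `m` in the generators. -/
inductive Mon (r l : ℕ) : ℕ → Fun B K → Prop
  | one : Mon r l 0 1
  | mul {m a : ℕ} {i : ZMod 2} {Φ g : Fun B K} (h : Mon r l m Φ) (ha : a ≤ l)
      (hg : GenAt r a i g) : Mon r l (m + a) (Φ * g)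

theorem Mon.mem_genAlg {r l m : ℕ} {Φ : Fun B K} (h : Mon r l m Φ) : Φ ∈ genAlg B K r l := by
  induction h with
  | one => exact one_mem _
  | mul _ ha hg ih =>
    exact mul_mem ih (Algebra.subset_adjoin (Gen.mono B K le_rfl ha hg.gen))

theorem Mon.isAnt {r l m : ℕ} {Φ : Fun B K} (h : Mon r l m Φ) : IsAnt B K m Φ := by
  intro t z
  induction h with
  | one => rw [map_one, pow_zero, one_smul]
  | mul _ ha hg ih =>
    rw [map_mul, Fun.mul_apply, ih, hg.subst _ (pow_zero t), Fun.mul_apply, pow_add, smul_mul_smul_comm]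

/-- Polynomials in the generators that are homogeneous of antifield number `m`. -/
def homog (B : FieldSpace n d X Y) (K : Antifields n X ι) (r l m : ℕ) :
    Submodule (Sm n X) (Fun B K) := Submodule.span (Sm n X) {Φ | Mon r l m Φ}

theorem IsAnt.add {m : ℕ} {Φ Ψ : Fun B K} (h : IsAnt B K m Φ) (h' : IsAnt B K m Ψ) :
    IsAnt B K m (Φ + Ψ) := fun t z => by
  rw [map_add, Fun.add_apply, h, h', ← smul_add]; rfl

theorem IsAnt.zero {m : ℕ} : IsAnt B K m (0 : Fun B K) := fun t z => by
  rw [map_zero, Fun.zero_apply, smul_zero]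

theorem IsAnt.smul {m : ℕ} {Φ : Fun B K} (h : IsAnt B K m Φ) (a : Sm n X) :
    IsAnt B K m (a • Φ) := fun t z => by
  rw [map_smul, Fun.smul_apply, Fun.smul_apply, h, smul_comm]

theorem IsAnt.neg {m : ℕ} {Φ : Fun B K} (h : IsAnt B K m Φ) : IsAnt B K m (-Φ) := fun t z => by
  rw [map_neg, Fun.neg_apply, Fun.neg_apply, h, smul_neg]

theorem IsAnt.sub {m : ℕ} {Φ Ψ : Fun B K} (h : IsAnt B K m Φ) (h' : IsAnt B K m Ψ) :
    IsAnt B K m (Φ - Ψ) := by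
  rw [sub_eq_add_neg]; exact h.add h'.neg

theorem IsAnt.mul {m m' : ℕ} {Φ Ψ : Fun B K} (h : IsAnt B K m Φ) (h' : IsAnt B K m' Ψ) :
    IsAnt B K (m + m') (Φ * Ψ) := fun t z => by
  rw [map_mul, Fun.mul_apply, h, h', Fun.mul_apply, pow_add, smul_mul_smul_comm]

theorem homog_isAnt {r l m : ℕ} {Φ : Fun B K} (h : Φ ∈ homog B K r l m) : IsAnt B K m Φ := by
  induction h using Submodule.span_induction with
  | mem Φ h => exact Mon.isAnt h
  | zero => exact IsAnt.zero
  | add _ _ _ _ h h' => exact h.add h'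
  | smul a _ _ h => exact h.smul a

theorem genAlg_le_iSup_homog {r l : ℕ} {Φ : Fun B K} (h : Φ ∈ genAlg B K r l) :
    Φ ∈ ⨆ m, homog B K r l m := by
  have h' : Φ ∈ (genAlg B K r l).toSubmodule := h
  rw [Algebra.adjoin_eq_span] at h'
  refine Submodule.span_le.2 (fun Ψ hΨ => ?_) h'
  have : ∃ m, Mon r l m Ψ := by
    induction hΨ using Submonoid.closure_induction_right with
    | one => exact ⟨0, Mon.one⟩
    | mul_right Φ hΦ g hg ih =>
      obtain ⟨m, hm⟩ := ih
      obtain ⟨a, ha, i, hi⟩ := Gen.exists_genAt hg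
      exact ⟨m + a, Mon.mul hm ha hi⟩
  obtain ⟨m, hm⟩ := this
  exact Submodule.mem_iSup_of_mem m (Submodule.subset_span hm)

/-- Linear functionals reduce this to two real polynomials that agree at every nonzero argument,
hence have equal coefficients. -/
theorem eq_coeff_of_sum_pow_smul {E : Type} [AddCommGroup E] [Module ℝ E] (s : Finset ℕ)
    (v : ℕ → E) (hv : ∀ j ∉ s, v j = 0) (m : ℕ) (w : E)
    (h : ∀ t : ℝ, t ≠ 0 → ∑ j ∈ s, t ^ j • v j = t ^ m • w) : w = v m := by
  rw [← sub_eq_zero, ← Module.forall_dual_apply_eq_zero_iff ℝ]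
  intro φ
  let p : Polynomial ℝ := ∑ j ∈ s, Polynomial.monomial j (φ (v j)) - Polynomial.monomial m (φ w)
  have hp : p = 0 := by
    refine Polynomial.eq_zero_of_infinite_isRoot p (Set.Infinite.mono (s := {0}ᶜ) ?_
      (Set.finite_singleton 0).infinite_compl)
    intro t ht
    have := congrArg φ (h t ht)
    simp only [map_sum, map_smul, smul_eq_mul] at this
    simp only [p, Set.mem_ofPred_eq, Polynomial.IsRoot, Polynomial.eval_sub,
      Polynomial.eval_finsetSum, Polynomial.eval_monomial]
    rw [sub_eq_zero, mul_comm, ← this]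
    exact Finset.sum_congr rfl fun j _ => mul_comm _ _
  have hc := congrArg (fun q => q.coeff m) hp
  simp only [p, Polynomial.coeff_sub, Polynomial.finsetSum_coeff, Polynomial.coeff_monomial,
    Finset.sum_ite_eq', Polynomial.coeff_zero] at hc
  by_cases hm : m ∈ s
  · simp only [hm, if_true] at hc
    rw [map_sub]; linarith
  · simp only [hm, if_false, if_true] at hc
    rw [map_sub, hv m hm, map_zero]; linarith

/-- Locally Φ is a polynomial in the generators, a priori with components of all antifield numbers.
Comparing powers of t in the rescaling shows that Φ equals its component of number m over the same
neighbourhood. -/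
theorem local_homog {r l m : ℕ} {Φ : Fun B K} (h : Φ ∈ ordLe B K r l)
    (ha : ∀ t : ℝ, t ≠ 0 → ∀ z, subst B K (fun j => t ^ j) Φ z = t ^ m • Φ z) (x₀ : X) :
    ∃ U ∈ 𝓝 x₀, ∃ Ψ ∈ homog B K r l m, EqOver U Φ Ψ := by
  obtain ⟨U, hU, Ψ, hΨ, e⟩ := h x₀
  obtain ⟨f, hf, rfl⟩ := (Submodule.mem_iSup_iff_exists_finsupp _ _).1 (genAlg_le_iSup_homog hΨ)
  refine ⟨U, hU, f m, hf m, fun z hz => ?_⟩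
  refine eq_coeff_of_sum_pow_smul f.support (fun j => f j z)
    (fun j hj => by rw [Finsupp.notMem_support_iff.1 hj]; rfl) m (Φ z) fun t ht => ?_
  rw [← ha t ht z]
  have h1 : subst B K (fun j => t ^ j) Φ z =
      subst B K (fun j => t ^ j) (f.sum fun _ xi => xi) z :=
    congrArg _ (e (z.1, scaleEven B K _ z.2) hz)
  rw [h1, Finsupp.sum, map_sum, Fun.sum_apply]
  exact Finset.sum_congr rfl fun j _ => (homog_isAnt (hf j) t z).symm

/-- The case t = 0 comes for free, because locally Φ is a homogeneous polynomial, for which the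
rescaling rule holds for every t. This permits division by t when homogeneity is verified. -/
theorem isAnt_of_ne_zero {m : ℕ} {Φ : Fun B K} (h : Φ ∈ P B K)
    (ha : ∀ t : ℝ, t ≠ 0 → ∀ z, subst B K (fun j => t ^ j) Φ z = t ^ m • Φ z) :
    IsAnt B K m Φ := by
  obtain ⟨r, l, h⟩ := h
  intro t z
  obtain ⟨U, hU, Ψ, hΨ, e⟩ := local_homog h ha z.1.x
  have h1 : subst B K (fun j => t ^ j) Φ z = subst B K (fun j => t ^ j) Ψ z :=
    congrArg _ (e (z.1, scaleEven B K _ z.2) (mem_of_mem_nhds hU))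
  rw [h1, homog_isAnt hΨ t z, e z (mem_of_mem_nhds hU)]

/-- To prove a local property of all homogeneous graded functions it suffices to consider
monomials. -/
theorem isAnt_induction {r l m : ℕ} {Q : P B K → Prop} (mon : ∀ Φ : P B K, Mon r l m (Φ : Fun B K) → Q Φ)
    (zero : Q 0) (add : ∀ Φ Ψ, Q Φ → Q Ψ → Q (Φ + Ψ)) (smul : ∀ (a : Sm n X) Φ, Q Φ → Q (a • Φ))
    (loc : ∀ Φ : P B K, (∀ x₀ : X, ∃ U ∈ 𝓝 x₀, ∃ Ψ : P B K, Q Ψ ∧ EqOver U (Φ : Fun B K) Ψ) → Q Φ)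
    {Φ : P B K} (h : (Φ : Fun B K) ∈ ordLe B K r l) (ha : IsAnt B K m Φ) : Q Φ := by
  refine loc Φ fun x₀ => ?_
  obtain ⟨U, hU, Ψ, hΨ, e⟩ := local_homog h (fun t _ => ha t) x₀
  suffices H : ∃ h : Ψ ∈ P B K, Q ⟨Ψ, h⟩ by
    obtain ⟨h, hQ⟩ := H
    exact ⟨U, hU, ⟨Ψ, h⟩, hQ, e⟩
  clear e
  induction hΨ using Submodule.span_induction with
  | mem Φ h =>
    have hP := ordLe_le_P r l (genAlg_le_ordLe r l (Mon.mem_genAlg h))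
    exact ⟨hP, mon ⟨Φ, hP⟩ h⟩
  | zero => exact ⟨zero_mem _, zero⟩
  | add Φ Ψ _ _ h h' =>
    obtain ⟨h, hQ⟩ := h
    obtain ⟨h', hQ'⟩ := h'
    exact ⟨add_mem h h', add _ _ hQ hQ'⟩
  | smul a Φ _ h =>
    obtain ⟨h, hQ⟩ := h
    exact ⟨Subalgebra.smul_mem _ h a, smul a _ hQ⟩

/-- Induction for local properties of graded functions. -/
theorem ordLe_induction {r l : ℕ} {Q : P B K → Prop} (one : Q 1)
    (mul : ∀ (Φ g : P B K) (a : ℕ) (i : ZMod 2), Q Φ → a ≤ l → GenAt r a i (g : Fun B K) →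
      Q (Φ * g))
    (zero : Q 0) (add : ∀ Φ Ψ, Q Φ → Q Ψ → Q (Φ + Ψ)) (smul : ∀ (a : Sm n X) Φ, Q Φ → Q (a • Φ))
    (loc : ∀ Φ : P B K, (∀ x₀ : X, ∃ U ∈ 𝓝 x₀, ∃ Ψ : P B K, Q Ψ ∧ EqOver U (Φ : Fun B K) Ψ) → Q Φ)
    {Φ : P B K} (h : (Φ : Fun B K) ∈ ordLe B K r l) : Q Φ := by
  refine loc Φ fun x₀ => ?_
  obtain ⟨U, hU, Ψ, hΨ, e⟩ := h x₀
  suffices H : ∃ h : Ψ ∈ P B K, Q ⟨Ψ, h⟩ by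
    obtain ⟨h, hQ⟩ := H
    exact ⟨U, hU, ⟨Ψ, h⟩, hQ, e⟩
  clear e
  have h' : Ψ ∈ (genAlg B K r l).toSubmodule := hΨ
  rw [Algebra.adjoin_eq_span] at h'
  clear hΨ
  induction h' using Submodule.span_induction with
  | mem Ψ hΨ =>
    induction hΨ using Submonoid.closure_induction_right with
    | one => exact ⟨one_mem _, one⟩
    | mul_right Φ hΦ g hg ih =>
      obtain ⟨h, hQ⟩ := ih
      obtain ⟨a, ha, i, hi⟩ := Gen.exists_genAt hg
      have hP := ordLe_le_P _ _ hi.mem_ordLe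
      exact ⟨mul_mem h hP, mul ⟨Φ, h⟩ ⟨g, hP⟩ a i hQ ha hi⟩
  | zero => exact ⟨zero_mem _, zero⟩
  | add Φ Ψ _ _ h h' =>
    obtain ⟨h, hQ⟩ := h
    obtain ⟨h', hQ'⟩ := h'
    exact ⟨add_mem h h', add _ _ hQ hQ'⟩
  | smul a Φ _ h =>
    obtain ⟨h, hQ⟩ := h
    exact ⟨Subalgebra.smul_mem _ h a, smul a _ hQ⟩

/-! #### Restriction -/

theorem subst_apply (c : ℕ → ℝ) (Φ : Fun B K) (z) : subst B K c Φ z =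
    ExteriorAlgebra.map (scaleOdd B K c).dualMap (Φ (z.1, scaleEven B K c z.2)) := rfl

theorem subst_subst (c c' : ℕ → ℝ) (Φ : Fun B K) :
    subst B K c (subst B K c' Φ) = subst B K (fun j => c' j * c j) Φ := by
  funext z
  change ExteriorAlgebra.map (scaleOdd B K c).dualMap (ExteriorAlgebra.map (scaleOdd B K c').dualMap
    (Φ (z.1, scaleEven B K c' (scaleEven B K c z.2)))) =
      ExteriorAlgebra.map (scaleOdd B K fun j => c' j * c j).dualMap (Φ (z.1, scaleEven B K _ z.2))
  have h1 : scaleEven B K c' (scaleEven B K c z.2) = scaleEven B K (fun j => c' j * c j) z.2 :=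
    Prod.ext (smul_smul _ _ _) (funext fun i => smul_smul _ _ _)
  have h2 : (scaleOdd B K c).dualMap ∘ₗ (scaleOdd B K c').dualMap =
      (scaleOdd B K fun j => c' j * c j).dualMap := by
    rw [LinearMap.dualMap_comp_dualMap]
    congr 1
    refine LinearMap.ext fun q => ?_
    exact Prod.ext rfl (Prod.ext (smul_smul _ _ _) (funext fun i => smul_smul _ _ _))
  rw [h1, ← h2, ← ExteriorAlgebra.map_comp_map]
  rfl

theorem coe_restr (l : ℕ) (Φ : P B K) :
    (restr B K l Φ : Fun B K) = subst B K (fun j => if j ≤ l then 1 else 0) Φ := rfl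

theorem restr_mul (l : ℕ) (Φ Ψ : P B K) : restr B K l (Φ * Ψ) = restr B K l Φ * restr B K l Ψ :=
  Subtype.ext (map_mul _ _ _)

theorem restr_one (l : ℕ) : restr B K l 1 = 1 := Subtype.ext (map_one _)

theorem restr_restr (l l' : ℕ) (Φ : P B K) :
    restr B K l (restr B K l' Φ) = restr B K (min l l') Φ := by
  refine Subtype.ext ?_
  rw [coe_restr, coe_restr, coe_restr, subst_subst]
  congr 2
  funext j
  by_cases h : j ≤ l <;> by_cases h' : j ≤ l' <;> simp [h, h']

theorem restr_isAnt {m : ℕ} (l : ℕ) {Φ : P B K} (h : IsAnt B K m Φ) :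
    IsAnt B K m (restr B K l Φ) := fun t z => by
  rw [coe_restr, subst_subst]
  simp only [mul_comm]
  rw [← subst_subst]
  rw [subst_apply, h t, map_smul, subst_apply]

theorem restr_genAt {r a : ℕ} {i : ZMod 2} (l : ℕ) {g : P B K} (hg : GenAt r a i (g : Fun B K)) :
    restr B K l g = if a ≤ l then g else 0 := by
  refine Subtype.ext (funext fun z => ?_)
  rw [coe_restr, hg.subst _ (by simp)]
  by_cases h : a ≤ l
  · rw [if_pos h, if_pos h, one_smul]
  · rw [if_neg h, if_neg h, zero_smul]; rfl

theorem restr_eqOver (l : ℕ) {U : Set X} {Φ Ψ : P B K} (e : EqOver U (Φ : Fun B K) Ψ) :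
    EqOver U (restr B K l Φ : Fun B K) (restr B K l Ψ) := fun z hz =>
  congrArg _ (e (z.1, scaleEven B K _ z.2) hz)

theorem P.ext_local {Φ Ψ : P B K}
    (h : ∀ x₀ : X, ∃ U ∈ 𝓝 x₀, EqOver U (Φ : Fun B K) Ψ) : Φ = Ψ :=
  Subtype.ext (funext fun z => by
    obtain ⟨U, hU, e⟩ := h z.1.x
    exact e z (mem_of_mem_nhds hU))

theorem restr_mem {r l' : ℕ} (l : ℕ) {Φ : P B K} (h : (Φ : Fun B K) ∈ ordLe B K r l') :
    (restr B K l Φ : Fun B K) ∈ ordLe B K r l := by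
  refine ordLe_induction (Q := fun Φ => (restr B K l Φ : Fun B K) ∈ ordLe B K r l)
    ?_ ?_ ?_ ?_ ?_ ?_ h
  · rw [restr_one]; exact one_mem _
  · intro Φ g a i hΦ _ hg
    rw [restr_mul, restr_genAt l hg]
    refine mul_mem hΦ ?_
    by_cases hal : a ≤ l
    · rw [if_pos hal]; exact ordLe_mono B K le_rfl hal hg.mem_ordLe
    · rw [if_neg hal]; exact zero_mem _
  · rw [map_zero]; exact zero_mem _
  · intro Φ Ψ h h'
    rw [map_add]; exact add_mem h h'
  · intro a Φ h
    rw [map_smul]; exact Subalgebra.smul_mem _ h a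
  · intro Φ h
    refine mem_ordLe_of_local fun x₀ => ?_
    obtain ⟨U, hU, Ψ, hΨ, e⟩ := h x₀
    exact ⟨U, hU, _, hΨ, restr_eqOver l e⟩

theorem restr_eq_self {r l l' : ℕ} (hl : l' ≤ l) {Φ : P B K}
    (h : (Φ : Fun B K) ∈ ordLe B K r l') : restr B K l Φ = Φ := by
  refine ordLe_induction (Q := fun Φ => restr B K l Φ = Φ) ?_ ?_ ?_ ?_ ?_ ?_ h
  · exact restr_one l
  · intro Φ g a i hΦ ha hg
    rw [restr_mul, restr_genAt l hg, hΦ, if_pos (ha.trans hl)]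
  · exact map_zero _
  · intro Φ Ψ h h'
    rw [map_add, h, h']
  · intro a Φ h
    rw [map_smul, h]
  · intro Φ h
    refine P.ext_local fun x₀ => ?_
    obtain ⟨U, hU, Ψ, hΨ, e⟩ := h x₀
    refine ⟨U, hU, fun z hz => ?_⟩
    rw [restr_eqOver l e z hz, hΨ, e z hz]

/-- Antifield numbers of the factors add up, so a monomial of antifield number m contains no
antifield of number greater than m. -/
theorem restr_eq_self_of_isAnt {m l : ℕ} (hl : m ≤ l) {Φ : P B K} (h : IsAnt B K m Φ) :
    restr B K l Φ = Φ := by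
  obtain ⟨r, l', hr⟩ := Φ.2
  refine isAnt_induction (Q := fun Φ => restr B K l Φ = Φ) ?_ ?_ ?_ ?_ ?_ hr h
  · clear hr h
    rintro ⟨Φ, hP⟩ (hm : Mon r l' m Φ)
    induction hm with
    | one => exact restr_one l
    | @mul m a i Φ g hΦ ha hg ih =>
      have h1 := ordLe_le_P _ _ (genAlg_le_ordLe r l' (Mon.mem_genAlg hΦ))
      have h2 := ordLe_le_P _ _ hg.mem_ordLe
      have h3 : (⟨Φ * g, hP⟩ : P B K) = ⟨Φ, h1⟩ * ⟨g, h2⟩ := rfl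
      rw [h3, restr_mul, ih (by omega) h1, restr_genAt (g := ⟨g, h2⟩) l hg,
        if_pos (by omega)]
  · exact map_zero _
  · intro Φ Ψ h h'
    rw [map_add, h, h']
  · intro a Φ h
    rw [map_smul, h]
  · intro Φ h
    refine P.ext_local fun x₀ => ?_
    obtain ⟨U, hU, Ψ, hΨ, e⟩ := h x₀
    refine ⟨U, hU, fun z hz => ?_⟩
    rw [restr_eqOver l e z hz, hΨ, e z hz]

theorem mem_ordLe_of_isAnt {r l m : ℕ} {Φ : P B K} (h : (Φ : Fun B K) ∈ ordLe B K r l)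
    (ha : IsAnt B K m Φ) : (Φ : Fun B K) ∈ ordLe B K r m := by
  rw [← restr_eq_self_of_isAnt le_rfl ha]
  exact restr_mem m h

theorem restr_zero_of_isAnt {m : ℕ} (hm : m ≠ 0) {Φ : P B K} (h : IsAnt B K m Φ) :
    restr B K 0 Φ = 0 := by
  refine Subtype.ext (funext fun z => ?_)
  -- Since 0 ^ 0 = 1, setting all antifields to zero is the rescaling with t = 0.
  have h1 : (fun j : ℕ => if j ≤ 0 then (1 : ℝ) else 0) = fun j => (0 : ℝ) ^ j := by
    funext j
    cases j <;> simp
  rw [coe_restr, h1, h 0 z, zero_pow hm, zero_smul]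
  rfl

end Homogeneity

end KoszulTate
end

noncomputable section

namespace KoszulTate

/-! ### Contact derivations -/

section Contact

variable {n d : ℕ} {X Y : Type}
  [TopologicalSpace X] [ChartedSpace (EuclideanSpace ℝ (Fin n)) X] [IsManifold (𝓡 n) ∞ X]
  [T2Space X]
  [TopologicalSpace Y] [ChartedSpace (EuclideanSpace ℝ (Fin d)) Y] [IsManifold (𝓡 d) ∞ Y]
  {B : FieldSpace n d X Y} {ι : Type} {K : Antifields n X ι}

theorem P.coe_smul_apply (a : Sm n X) (Φ : P B K) (z) :
    ((a • Φ : P B K) : Fun B K) z = a z.1.x • (Φ : Fun B K) z := Fun.smul_apply B K a Φ z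

/-- Linearity over the smooth functions already makes D local over X: multiply both arguments by a
bump at the base point, supported where they agree. -/
theorem linear_local (D : P B K →ₗ[Sm n X] P B K) {U : Set X} {Φ Ψ : P B K}
    (e : EqOver U (Φ : Fun B K) Ψ) {z : JetPt B × QEven B K} (hz : U ∈ 𝓝 z.1.x) :
    (D Φ : Fun B K) z = (D Ψ : Fun B K) z := by
  obtain ⟨χ, h1, h2⟩ := exists_bump (n := n) z.1.x hz
  have h3 : χ • Φ = χ • Ψ := by
    refine Subtype.ext (funext fun w => ?_)
    rw [P.coe_smul_apply, P.coe_smul_apply]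
    by_cases hw : w.1.x ∈ U
    · rw [e w hw]
    · rw [Sm.eq_zero_of_tsupport h2 hw, zero_smul, zero_smul]
  have h4 := congrArg (fun Θ : P B K => (Θ : Fun B K) z) (congrArg D h3)
  simp only [map_smul, P.coe_smul_apply] at h4
  rwa [h1.self_of_nhds, one_smul, one_smul] at h4

theorem linear_eqOver (D : P B K →ₗ[Sm n X] P B K) {U : Set X} {Φ Ψ : P B K}
    (e : EqOver U (Φ : Fun B K) Ψ) : EqOver (interior U) (D Φ : Fun B K) (D Ψ) :=
  fun z hz => linear_local D e (mem_interior_iff_mem_nhds.1 hz)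

theorem linear_eq_of_local (D D' : P B K →ₗ[Sm n X] P B K) (Φ : P B K)
    (h : ∀ x₀ : X, ∃ U ∈ 𝓝 x₀, ∃ Ψ : P B K, D Ψ = D' Ψ ∧ EqOver U (Φ : Fun B K) Ψ) :
    D Φ = D' Φ := by
  refine P.ext_local fun x₀ => ?_
  obtain ⟨U, hU, Ψ, hΨ, e⟩ := h x₀
  refine ⟨interior U, interior_mem_nhds.2 hU, fun z hz => ?_⟩
  rw [linear_eqOver D e z hz, linear_eqOver D' e z hz, hΨ]

theorem grP_mul (Φ Ψ : P B K) : grP (Φ * Ψ) = grP Φ * grP Ψ := Subtype.ext (map_mul _ _ _)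
theorem grP_add (Φ Ψ : P B K) : grP (Φ + Ψ) = grP Φ + grP Ψ := Subtype.ext (map_add _ _ _)
theorem grP_sub (Φ Ψ : P B K) : grP (Φ - Ψ) = grP Φ - grP Ψ := Subtype.ext (map_sub _ _ _)
theorem grP_zero : grP (0 : P B K) = 0 := Subtype.ext (map_zero _)
theorem grP_one : grP (1 : P B K) = 1 := Subtype.ext (map_one _)
theorem grP_smul (a : Sm n X) (Φ : P B K) : grP (a • Φ) = a • grP Φ := Subtype.ext (map_smul _ _ _)
theorem grP_grP (Φ : P B K) : grP (grP Φ) = Φ := Subtype.ext (grF_grF _)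

theorem isPar_coe_iff (i : ZMod 2) (Φ : P B K) :
    IsPar B K i Φ ↔ grP Φ = (-1) ^ i.val * Φ := by
  rw [isPar_iff, Subtype.ext_iff]; rfl

theorem restr_grP (l : ℕ) (Φ : P B K) : restr B K l (grP Φ) = grP (restr B K l Φ) :=
  Subtype.ext (funext fun z => (gr_map _ _).symm)

variable {D δbar : P B K →ₗ[Sm n X] P B K}

/-- The sign rule is given for factors of definite parity. Any Ψ is the sum of its parity parts, the
halves of Ψ ± gr Ψ, and the two signs together form the grade involution. -/
theorem IsContactDer.map_mul (hD : IsContactDer D) (Φ Ψ : P B K) :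
    D (Φ * Ψ) = D Φ * grP Ψ + Φ * D Ψ := by
  have key : ∀ (i : ZMod 2) (Ψ : P B K), IsPar B K i Ψ → D (Φ * Ψ) = D Φ * grP Ψ + Φ * D Ψ := by
    intro i Ψ hΨ
    rw [hD.leibniz i Φ Ψ hΨ, (isPar_coe_iff i Ψ).1 hΨ]
    rcases neg_one_pow_eq_or (P B K) i.val with h | h <;> rw [h] <;> simp
  let c : Sm n X := algebraMap ℝ _ (1 / 2)
  have hc : c + c = 1 := by
    rw [← map_add]; norm_num
  have h0 : IsPar B K 0 (c • (Ψ + grP Ψ) : P B K) := by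
    rw [isPar_zero_iff]
    exact congrArg Subtype.val (show grP (c • (Ψ + grP Ψ)) = c • (Ψ + grP Ψ) by
      rw [grP_smul, grP_add, grP_grP, add_comm])
  have h1 : IsPar B K 1 (c • (Ψ - grP Ψ) : P B K) := by
    rw [isPar_one_iff]
    exact congrArg Subtype.val (show grP (c • (Ψ - grP Ψ)) = -(c • (Ψ - grP Ψ)) by
      rw [grP_smul, grP_sub, grP_grP, ← smul_neg, neg_sub])
  have e : Ψ = c • (Ψ + grP Ψ) + c • (Ψ - grP Ψ) := by
    rw [← smul_add, add_add_sub_cancel, smul_add, ← add_smul, hc, one_smul]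
  have := congrArg₂ (· + ·) (key 0 _ h0) (key 1 _ h1)
  simp only [← mul_add, ← map_add] at this
  rw [← e] at this
  rw [this, add_add_add_comm, ← mul_add, ← mul_add, ← grP_add, ← map_add, ← e]

theorem IsContactDer.map_tdP (hD : IsContactDer D) (τ : VF n X) (Φ : P B K) :
    D (tdP τ Φ) = tdP τ (D Φ) := Subtype.ext (hD.contact τ Φ _ rfl)

theorem IsContactDer.map_one (hD : IsContactDer D) : D 1 = 0 := hD.fields 0 1 (one_mem _)

/-! #### The antifields as elements of the ring -/

theorem antiEven_mem (t : List (VF n X)) (v : Sec B.F) (σ : Fin n → VF n X) :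
    antiEven B K t v σ ∈ ordLe B K t.length 1 :=
  genAlg_le_ordLe _ _ (Algebra.subset_adjoin (Gen.antiEven le_rfl t le_rfl v σ))

theorem antiOdd_mem (t : List (VF n X)) (v : Sec B.W) (σ : Fin n → VF n X) :
    antiOdd B K t v σ ∈ ordLe B K t.length 1 :=
  genAlg_le_ordLe _ _ (Algebra.subset_adjoin (Gen.antiOdd le_rfl t le_rfl v σ))

theorem ghostEven_mem (i : ι) (t : List (VF n X)) (v : Sec (K.V i)) (σ : Fin n → VF n X) :
    ghostEven B K i t v σ ∈ ordLe B K t.length (K.ant i) :=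
  genAlg_le_ordLe _ _ (Algebra.subset_adjoin (Gen.ghostEven i le_rfl t le_rfl v σ))

theorem ghostOdd_mem (i : ι) (t : List (VF n X)) (v : Sec (K.E i)) (σ : Fin n → VF n X) :
    ghostOdd B K i t v σ ∈ ordLe B K t.length (K.ant i) :=
  genAlg_le_ordLe _ _ (Algebra.subset_adjoin (Gen.ghostOdd i le_rfl t le_rfl v σ))

/-- Maps which vanish as soon as they vanish on the antifields. -/
structure IsDerLike (T : P B K →ₗ[Sm n X] P B K) : Prop where
  one : T 1 = 0
  mul : ∀ (Φ g : P B K) (r a : ℕ) (i : ZMod 2), GenAt r a i (g : Fun B K) → T Φ = 0 → T g = 0 →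
    T (Φ * g) = 0
  fields : ∀ (r : ℕ) (Φ : P B K), (Φ : Fun B K) ∈ ordLe B K r 0 → T Φ = 0
  contact : ∀ (τ : VF n X) (Φ : P B K), T (tdP τ Φ) = tdP τ (T Φ)

theorem tdP_zero (τ : VF n X) : tdP τ (0 : P B K) = 0 := by
  have := tdP_smul τ 0 (0 : P B K)
  rwa [smul_zero, smul_zero, zero_smul, zero_add] at this

theorem tdP_neg (τ : VF n X) (Φ : P B K) : tdP τ (-Φ) = -tdP τ Φ := by
  rw [eq_neg_iff_add_eq_zero, ← tdP_add, neg_add_cancel, tdP_zero]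

theorem tdP_sub (τ : VF n X) (Φ Ψ : P B K) : tdP τ (Φ - Ψ) = tdP τ Φ - tdP τ Ψ := by
  rw [sub_eq_add_neg, tdP_add, tdP_neg, ← sub_eq_add_neg]

theorem IsContactDer.isDerLike_sub {D' : P B K →ₗ[Sm n X] P B K} (hD : IsContactDer D)
    (hD' : IsContactDer D') : IsDerLike (D - D') where
  one := by rw [LinearMap.sub_apply, hD.map_one, hD'.map_one, sub_zero]
  mul Φ g r a i hg h h' := by
    rw [LinearMap.sub_apply] at h h' ⊢
    rw [hD.map_mul, hD'.map_mul, sub_eq_zero.1 h, sub_eq_zero.1 h', sub_self]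
  fields r Φ h := by rw [LinearMap.sub_apply, hD.fields r Φ h, hD'.fields r Φ h, sub_zero]
  contact τ Φ := by
    rw [LinearMap.sub_apply, LinearMap.sub_apply, hD.map_tdP, hD'.map_tdP, tdP_sub]

theorem IsContactDer.isDerLike (hD : IsContactDer D) : IsDerLike D where
  one := hD.map_one
  mul Φ g r a i hg h h' := by rw [hD.map_mul, h, h', zero_mul, mul_zero, add_zero]
  fields := hD.fields
  contact := hD.map_tdP

section IsDerLike

variable {T : P B K →ₗ[Sm n X] P B K} (hT : IsDerLike T)
include hT

theorem IsDerLike.jets {f : List (VF n X) → Fun B K} (hf : f [] ∈ P B K)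
    (hstep : ∀ τ t, totalDeriv τ (f t) = f (τ :: t))
    (h0 : ∀ Φ : P B K, (Φ : Fun B K) = f [] → T Φ = 0) (t : List (VF n X)) (Φ : P B K)
    (hΦ : (Φ : Fun B K) = f t) : T Φ = 0 := by
  have : ∃ Ψ : P B K, (Ψ : Fun B K) = f t ∧ T Ψ = 0 := by
    clear hΦ
    induction t with
    | nil => exact ⟨⟨f [], hf⟩, rfl, h0 _ rfl⟩
    | cons τ t ih =>
      obtain ⟨Ψ, h1, h2⟩ := ih
      refine ⟨tdP τ Ψ, ?_, by rw [hT.contact, h2, tdP_zero]⟩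
      change totalDeriv τ (Ψ : Fun B K) = _
      rw [h1, hstep]
  obtain ⟨Ψ, h1, h2⟩ := this
  rwa [show Φ = Ψ from Subtype.ext (hΦ.trans h1.symm)]

theorem IsDerLike.antiEven {v : Sec B.F} {σ : Fin n → VF n X}
    (h0 : ∀ Φ : P B K, (Φ : Fun B K) = antiEven B K [] v σ → T Φ = 0) (t : List (VF n X))
    (Φ : P B K) (hΦ : (Φ : Fun B K) = KoszulTate.antiEven B K t v σ) : T Φ = 0 :=
  hT.jets (f := fun t => KoszulTate.antiEven B K t v σ) (ordLe_le_P _ _ (antiEven_mem _ v σ))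
    (fun τ t => (isTD_antiEven t v σ).2 τ) h0 t Φ hΦ

theorem IsDerLike.antiOdd {v : Sec B.W} {σ : Fin n → VF n X}
    (h0 : ∀ Φ : P B K, (Φ : Fun B K) = antiOdd B K [] v σ → T Φ = 0) (t : List (VF n X))
    (Φ : P B K) (hΦ : (Φ : Fun B K) = KoszulTate.antiOdd B K t v σ) : T Φ = 0 :=
  hT.jets (f := fun t => KoszulTate.antiOdd B K t v σ) (ordLe_le_P _ _ (antiOdd_mem _ v σ))
    (fun τ t => (isTD_antiOdd t v σ).2 τ) h0 t Φ hΦ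

theorem IsDerLike.ghostEven {i : ι} {v : Sec (K.V i)} {σ : Fin n → VF n X}
    (h0 : ∀ Φ : P B K, (Φ : Fun B K) = ghostEven B K i [] v σ → T Φ = 0) (t : List (VF n X))
    (Φ : P B K) (hΦ : (Φ : Fun B K) = KoszulTate.ghostEven B K i t v σ) : T Φ = 0 :=
  hT.jets (f := fun t => KoszulTate.ghostEven B K i t v σ)
    (ordLe_le_P _ _ (ghostEven_mem i _ v σ)) (fun τ t => (isTD_ghostEven i t v σ).2 τ) h0 t Φ hΦ

theorem IsDerLike.ghostOdd {i : ι} {v : Sec (K.E i)} {σ : Fin n → VF n X}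
    (h0 : ∀ Φ : P B K, (Φ : Fun B K) = ghostOdd B K i [] v σ → T Φ = 0) (t : List (VF n X))
    (Φ : P B K) (hΦ : (Φ : Fun B K) = KoszulTate.ghostOdd B K i t v σ) : T Φ = 0 :=
  hT.jets (f := fun t => KoszulTate.ghostOdd B K i t v σ)
    (ordLe_le_P _ _ (ghostOdd_mem i _ v σ)) (fun τ t => (isTD_ghostOdd i t v σ).2 τ) h0 t Φ hΦ

/-- The principle behind uniqueness, nilpotency and extension: it applies to differences of contact
derivations, to their squares and to the defect of an extension. Commuting with total derivatives
carries vanishing from the antifields to their jets, the product condition carries it to monomials,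
and linearity with locality to all graded functions. -/
theorem IsDerLike.eq_zero {l : ℕ}
    (anti_even : 1 ≤ l → ∀ v (σ : Fin n → VF n X) (Φ : P B K),
      (Φ : Fun B K) = KoszulTate.antiEven B K [] v σ → T Φ = 0)
    (anti_odd : 1 ≤ l → ∀ v (σ : Fin n → VF n X) (Φ : P B K),
      (Φ : Fun B K) = KoszulTate.antiOdd B K [] v σ → T Φ = 0)
    (ghost_even : ∀ i, K.ant i ≤ l → ∀ v (σ : Fin n → VF n X) (Φ : P B K),
      (Φ : Fun B K) = KoszulTate.ghostEven B K i [] v σ → T Φ = 0)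
    (ghost_odd : ∀ i, K.ant i ≤ l → ∀ v (σ : Fin n → VF n X) (Φ : P B K),
      (Φ : Fun B K) = KoszulTate.ghostOdd B K i [] v σ → T Φ = 0)
    {r : ℕ} {Φ : P B K} (h : (Φ : Fun B K) ∈ ordLe B K r l) : T Φ = 0 := by
  have hgen : ∀ g : P B K, Gen B K r l (g : Fun B K) → T g = 0 := by
    rintro ⟨g, hP⟩ (hg : Gen B K r l g)
    cases hg with
    | body f hf =>
      exact hT.fields r _ (genAlg_le_ordLe _ _ (Algebra.subset_adjoin (Gen.body f hf)))
    | field t ht κ =>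
      exact hT.fields r _ (genAlg_le_ordLe _ _ (Algebra.subset_adjoin (Gen.field t ht κ)))
    | antiEven hl t ht v σ => exact hT.antiEven (anti_even hl v σ) t _ rfl
    | antiOdd hl t ht v σ => exact hT.antiOdd (anti_odd hl v σ) t _ rfl
    | ghostEven i hl t ht v σ => exact hT.ghostEven (ghost_even i hl v σ) t _ rfl
    | ghostOdd i hl t ht v σ => exact hT.ghostOdd (ghost_odd i hl v σ) t _ rfl
  refine ordLe_induction (Q := fun Φ => T Φ = 0) hT.one ?_ (map_zero T) ?_ ?_ ?_ h
  · intro Φ g a i hΦ ha hg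
    exact hT.mul Φ g r a i hg hΦ (hgen g (Gen.mono B K le_rfl ha hg.gen))
  · intro Φ Ψ h h'
    rw [map_add, h, h', add_zero]
  · intro a Φ h
    rw [map_smul, h, smul_zero]
  · intro Φ h
    exact linear_eq_of_local T 0 Φ h

end IsDerLike

/-! #### The terms of highest antifield number -/

theorem GenAt.isAnt {r a : ℕ} {i : ZMod 2} {g : Fun B K} (hg : GenAt r a i g) : IsAnt B K a g :=
  fun t z => hg.subst _ (pow_zero t) z

theorem IsContactDer.restr_apply (hD : IsContactDer D) {m l : ℕ} (hm : m ≤ l + 1) {Φ : P B K}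
    (h : IsAnt B K m Φ) : restr B K l (D Φ) = D Φ := by
  cases m with
  | zero =>
    obtain ⟨r, l', hr⟩ := Φ.2
    rw [hD.fields r Φ (mem_ordLe_of_isAnt hr h), map_zero]
  | succ m => exact restr_eq_self_of_isAnt (Nat.le_of_succ_le_succ hm) (hD.ant m Φ h)

theorem GenAt.map_eq_zero_of_ghosts {T : P B K →ₗ[Sm n X] P B K} (hT : IsDerLike T)
    (ghost_even : ∀ i v (σ : Fin n → VF n X) (Φ : P B K),
      (Φ : Fun B K) = KoszulTate.ghostEven B K i [] v σ → T Φ = 0)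
    (ghost_odd : ∀ i v (σ : Fin n → VF n X) (Φ : P B K),
      (Φ : Fun B K) = KoszulTate.ghostOdd B K i [] v σ → T Φ = 0)
    {r a : ℕ} {i : ZMod 2} {g : P B K} (hg : GenAt r a i (g : Fun B K)) (ha : 2 ≤ a) : T g = 0 := by
  -- `Gen` only bounds the antifield number, so g might be written as an antifield of number one.
  -- Rescaling by a sequence that vanishes at 1 and equals 1 elsewhere then multiplies g both by 0
  -- and by 1, which forces g = 0.
  have hzero : ∀ g' : Fun B K, GenAt r 1 i g' → (g : Fun B K) = g' → T g = 0 := by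
    intro g' hg' e
    have : g = 0 := by
      refine Subtype.ext (funext fun z => ?_)
      have h1 := hg.subst (fun j => if j = 1 then 0 else 1) (by simp) z
      have h2 := hg'.subst (fun j => if j = 1 then 0 else 1) (by simp) z
      rw [← e] at h2
      rw [h2, if_pos rfl, zero_smul, if_neg (by omega), one_smul] at h1
      exact h1.symm
    rw [this, map_zero]
  obtain ⟨g, hP⟩ := g
  have hgen : Gen B K r a g := hg.gen
  have hpar : IsPar B K i g := hg.par
  cases hgen with
  | body f hf =>
    exact hT.fields r _ (genAlg_le_ordLe _ _ (Algebra.subset_adjoin (Gen.body f hf)))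
  | field t ht κ =>
    exact hT.fields r _ (genAlg_le_ordLe _ _ (Algebra.subset_adjoin (Gen.field t ht κ)))
  | antiEven hl t ht v σ =>
    refine hzero _ ⟨Gen.antiEven le_rfl t ht v σ, hpar, fun c hc z => ?_⟩ rfl
    refine (AlgHom.commutes _ _).trans ?_
    change algebraMap ℝ _ (densEval z.1.x t v σ (c 1 • z.2.1)) = _
    rw [map_smul, smul_eq_mul, _root_.map_mul, ← Algebra.smul_def]
    rfl
  | antiOdd hl t ht v σ =>
    refine hzero _ ⟨Gen.antiOdd le_rfl t ht v σ, hpar, fun c hc z => ?_⟩ rfl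
    refine (ExteriorAlgebra.map_apply_ι _ _).trans ?_
    refine Eq.trans ?_ (map_smul (ExteriorAlgebra.ι ℝ) (c 1) _)
    refine congrArg _ (LinearMap.ext fun q => ?_)
    exact map_smul (densEval z.1.x t v σ) (c 1) (QOdd.anti B K q)
  | ghostEven i hl t ht v σ => exact hT.ghostEven (ghost_even i v σ) t _ rfl
  | ghostOdd i hl t ht v σ => exact hT.ghostOdd (ghost_odd i v σ) t _ rfl

/-- `D` and `δbar` are contact derivations which agree on antifields of antifield number one, and
`δbar` vanishes on the higher antifields. -/
structure IsPair (D δbar : P B K →ₗ[Sm n X] P B K) : Prop where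
  left : IsContactDer D
  right : IsContactDer δbar
  agree : ∀ (r : ℕ) (Φ : P B K), (Φ : Fun B K) ∈ ordLe B K r 1 → D Φ = δbar Φ
  ghost_even : ∀ i v (σ : Fin n → VF n X) (Φ : P B K),
    (Φ : Fun B K) = ghostEven B K i [] v σ → δbar Φ = 0
  ghost_odd : ∀ i v (σ : Fin n → VF n X) (Φ : P B K),
    (Φ : Fun B K) = ghostOdd B K i [] v σ → δbar Φ = 0

theorem IsPair.genAt_eq_zero (H : IsPair D δbar) {r a : ℕ} {i : ZMod 2} {g : P B K}
    (hg : GenAt r a i (g : Fun B K)) (ha : 2 ≤ a) : δbar g = 0 :=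
  GenAt.map_eq_zero_of_ghosts H.right.isDerLike H.ghost_even H.ghost_odd hg ha

/-- In total number k + 1, a term with an antifield of number k + 1 is a function of the fields
times that single antifield, of number at least two, and δbar annihilates both factors. -/
theorem IsPair.bar_linPart_eq_zero (H : IsPair D δbar) {k r l : ℕ} (hk : 1 ≤ k) {Φ : P B K}
    (h : (Φ : Fun B K) ∈ ordLe B K r l) (ha : IsAnt B K (k + 1) Φ) :
    δbar (Φ - restr B K k Φ) = 0 := by
  refine isAnt_induction (Q := fun Φ => δbar (Φ - restr B K k Φ) = 0) ?_ ?_ ?_ ?_ ?_ h ha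
  · clear h ha
    rintro ⟨Φ, hP⟩ (hm : Mon r l (k + 1) Φ)
    generalize hj : k + 1 = j at hm
    induction hm with
    | one => omega
    | @mul m b i Φ g hΦ hb hg ih =>
      have h1 := ordLe_le_P _ _ (genAlg_le_ordLe r l (Mon.mem_genAlg hΦ))
      have h2 := ordLe_le_P _ _ hg.mem_ordLe
      have h3 : (⟨Φ * g, hP⟩ : P B K) = ⟨Φ, h1⟩ * ⟨g, h2⟩ := rfl
      rw [h3, restr_mul, restr_genAt (g := ⟨g, h2⟩) k hg]
      by_cases hb0 : b = 0
      · rw [if_pos (by omega), ← sub_mul, H.right.map_mul, ih h1 (by omega), zero_mul, zero_add,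
          H.right.fields r ⟨g, h2⟩ (hb0 ▸ hg.mem_ordLe), mul_zero]
      by_cases hbk : b ≤ k
      · rw [if_pos hbk, restr_eq_self_of_isAnt (m := m) (by omega) (Φ := ⟨Φ, h1⟩) hΦ.isAnt,
          sub_self, map_zero]
      · have hm0 : m = 0 := by omega
        subst hm0
        rw [if_neg hbk, mul_zero, sub_zero, H.right.map_mul,
          H.right.fields r ⟨Φ, h1⟩ (mem_ordLe_of_isAnt (Φ := ⟨Φ, h1⟩)
            (genAlg_le_ordLe r l (Mon.mem_genAlg hΦ)) hΦ.isAnt),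
          H.genAt_eq_zero (g := ⟨g, h2⟩) hg (by omega), zero_mul, mul_zero, add_zero]
  · rw [map_zero, sub_zero, map_zero]
  · intro Φ Ψ h h'
    rw [map_add, add_sub_add_comm, map_add, h, h', add_zero]
  · intro a Φ h
    rw [map_smul, ← smul_sub, map_smul, h, smul_zero]
  · intro Φ h
    exact linear_eq_of_local (δbar ∘ₗ (LinearMap.id - restr B K k)) 0 Φ h

/-- The central count. In total number k + 2, a term containing an antifield of number k + 1 has
just one more antifield, of number one when k ≥ 1. An antifield of number k + 1 survives in D Φ only
if D hits that other factor, where D is δbar. Terms without antifields of number k + 1 cannot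
produce one. -/
theorem IsPair.linPart_apply (H : IsPair D δbar) {k r : ℕ} {Φ : P B K}
    (h : (Φ : Fun B K) ∈ ordLe B K r (k + 1)) (ha : IsAnt B K (k + 2) Φ) :
    D Φ - restr B K k (D Φ) = δbar (Φ - restr B K k Φ) := by
  -- For k = 0 both restrictions vanish, as the antifield numbers are positive, and Φ involves only
  -- antifields of number one.
  rcases Nat.eq_zero_or_pos k with rfl | hk
  · rw [restr_zero_of_isAnt (by omega) (H.left.ant 1 Φ ha), restr_zero_of_isAnt (by omega) ha,
      sub_zero, sub_zero]
    exact H.agree r Φ h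
  refine isAnt_induction (Q := fun Φ => D Φ - restr B K k (D Φ) = δbar (Φ - restr B K k Φ))
    ?_ ?_ ?_ ?_ ?_ h ha
  · clear h ha
    rintro ⟨Φ, hP⟩ (hm : Mon r (k + 1) (k + 2) Φ)
    generalize hj : k + 2 = j at hm
    induction hm with
    | one => omega
    | @mul m b i Φ g hΦ hb hg ih =>
      have h0 := genAlg_le_ordLe r (k + 1) (Mon.mem_genAlg hΦ)
      have h1 := ordLe_le_P _ _ h0
      have h2 := ordLe_le_P _ _ hg.mem_ordLe
      have h3 : (⟨Φ * g, hP⟩ : P B K) = ⟨Φ, h1⟩ * ⟨g, h2⟩ := rfl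
      have hg' : restr B K k ⟨g, h2⟩ = _ := restr_genAt (g := ⟨g, h2⟩) k hg
      rw [h3, restr_mul, H.left.map_mul, map_add, restr_mul, restr_mul, restr_grP, hg',
        H.left.restr_apply (m := b) (by omega) (Φ := ⟨g, h2⟩) hg.isAnt]
      by_cases hbk : b ≤ k
      · rw [if_pos hbk, ← sub_mul, H.right.map_mul, add_sub_add_comm, ← sub_mul, ← sub_mul]
        by_cases hb0 : b = 0
        · rw [ih h1 (by omega), H.right.fields r ⟨g, h2⟩ (hb0 ▸ hg.mem_ordLe),
            H.left.fields r ⟨g, h2⟩ (hb0 ▸ hg.mem_ordLe)]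
        rw [H.left.restr_apply (m := m) (by omega) (Φ := ⟨Φ, h1⟩) hΦ.isAnt, sub_self, zero_mul]
        -- If b = 1, the other factor has number k + 1 and its linear part is δbar-closed, so only D
        -- g contributes. If 2 ≤ b ≤ k, the other factor has number at most k and there is no
        -- antifield of number k + 1 at all.
        by_cases hb1 : b = 1
        · have hm : m = k + 1 := by omega
          subst hm
          rw [H.bar_linPart_eq_zero hk (Φ := ⟨Φ, h1⟩) h0 hΦ.isAnt, zero_mul,
            H.agree r ⟨g, h2⟩ (hb1 ▸ hg.mem_ordLe)]
        · rw [restr_eq_self_of_isAnt (m := m) (by omega) (Φ := ⟨Φ, h1⟩) hΦ.isAnt, sub_self,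
            zero_mul, zero_mul, map_zero, zero_mul]
      -- Here b = k + 1, so g is the top antifield and the other factor has number one. D g is free
      -- of antifields of number k + 1 and drops out, while D and δbar agree on the other factor.
      · have hm1 : m = 1 := by omega
        subst hm1
        rw [if_neg hbk, grP_zero, mul_zero, mul_zero, sub_zero, zero_add,
          restr_eq_self_of_isAnt hk (Φ := ⟨Φ, h1⟩) hΦ.isAnt, add_sub_cancel_right,
          H.right.map_mul, H.genAt_eq_zero (g := ⟨g, h2⟩) hg (by omega), mul_zero, add_zero,
          H.agree r ⟨Φ, h1⟩ (mem_ordLe_of_isAnt (Φ := ⟨Φ, h1⟩) h0 hΦ.isAnt)]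
  · simp only [map_zero, sub_zero]
  · intro Φ Ψ h h'
    simp only [map_add, map_sub] at h h' ⊢
    rw [add_sub_add_comm, h, h']; abel
  · intro a Φ h
    simp only [map_smul, ← smul_sub, h]
  · intro Φ h
    exact linear_eq_of_local ((LinearMap.id - restr B K k) ∘ₗ D)
      (δbar ∘ₗ (LinearMap.id - restr B K k)) Φ h

/-! ### Noether identities and cycles -/

theorem act_apply (D : P B K →ₗ[Sm n X] P B K) (Φ : Dens B K) (σ) : act D Φ σ = D (Φ σ) := rfl

theorem chains_mono {l l' m : ℕ} (h : l ≤ l') : chains B K l m ≤ chains B K l' m := by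
  rintro Φ ⟨⟨r, hr⟩, ha⟩
  exact ⟨⟨r, fun σ => ordLe_mono B K le_rfl h (hr σ)⟩, ha⟩

theorem restr_chains {l' m : ℕ} (l : ℕ) {Φ : Dens B K} (h : Φ ∈ chains B K l' m) :
    act (restr B K l) Φ ∈ chains B K l m := by
  obtain ⟨⟨r, hr⟩, ha⟩ := h
  exact ⟨⟨r, fun σ => restr_mem l (hr σ)⟩, fun σ => restr_isAnt l (ha σ)⟩

theorem restr_chains' {l' m : ℕ} (l : ℕ) {Φ : Dens B K} (h : Φ ∈ chains B K l' m) :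
    act (restr B K l) Φ ∈ chains B K l' m := by
  obtain ⟨⟨r, hr⟩, ha⟩ := h
  exact ⟨⟨r, fun σ => subst_mem_ordLe B K _ (hr σ)⟩, fun σ => restr_isAnt l (ha σ)⟩

theorem restr_chains_eq_self {l l' m : ℕ} (hl : l' ≤ l) {Φ : Dens B K} (h : Φ ∈ chains B K l' m) :
    act (restr B K l) Φ = Φ := by
  obtain ⟨⟨r, hr⟩, ha⟩ := h
  exact AlternatingMap.ext fun σ => restr_eq_self hl (hr σ)

theorem mem_chains_of_restr {l l' m : ℕ} {Φ : Dens B K} (h : Φ ∈ chains B K l' m)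
    (e : act (restr B K l) Φ = Φ) : Φ ∈ chains B K l m := e ▸ restr_chains l h

theorem IsContactDer.act_chains (hD : IsContactDer D) {l m : ℕ} {Φ : Dens B K}
    (h : Φ ∈ chains B K l (m + 1)) : act D Φ ∈ chains B K l m := by
  obtain ⟨⟨r, hr⟩, ha⟩ := h
  obtain ⟨r', hr'⟩ := hD.order r l
  exact ⟨⟨r', fun σ => hr' _ (hr σ)⟩, fun σ => hD.ant m _ (ha σ)⟩

theorem IsPair.linPart_act (H : IsPair D δbar) {k : ℕ} {Φ : Dens B K}
    (h : Φ ∈ chains B K (k + 1) (k + 2)) :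
    act D Φ - act (restr B K k) (act D Φ) = act δbar (Φ - act (restr B K k) Φ) := by
  obtain ⟨⟨r, hr⟩, ha⟩ := h
  exact AlternatingMap.ext fun σ => H.linPart_apply (hr σ) (ha σ)

theorem act_sub (D : P B K →ₗ[Sm n X] P B K) (Φ Ψ : Dens B K) :
    act D (Φ - Ψ) = act D Φ - act D Ψ := AlternatingMap.ext fun σ => map_sub D _ _

theorem act_add (D : P B K →ₗ[Sm n X] P B K) (Φ Ψ : Dens B K) :
    act D (Φ + Ψ) = act D Φ + act D Ψ := AlternatingMap.ext fun σ => map_add D _ _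

theorem act_zero (D : P B K →ₗ[Sm n X] P B K) : act D (0 : Dens B K) = 0 :=
  AlternatingMap.ext fun σ => map_zero D

theorem act_restr_restr (l l' : ℕ) (Φ : Dens B K) :
    act (restr B K l) (act (restr B K l') Φ) = act (restr B K (min l l')) Φ :=
  AlternatingMap.ext fun σ => restr_restr l l' _

/-- A cycle gives rise to a Noether identity. -/
theorem IsPair.noetherIdentity_of_cycle (H : IsPair D δbar) {k : ℕ} {Φ : Dens B K}
    (h : Φ ∈ cycles D (k + 2) (k + 2)) :
    IsNoetherIdentity δbar D (k + 1) (linPart (k + 2) Φ) (bilinPart (k + 2) Φ) := by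
  obtain ⟨hc, h0⟩ := h
  have e1 : linPart (k + 2) Φ = Φ - act (restr B K (k + 1)) Φ := rfl
  have e2 : bilinPart (k + 2) Φ = act (restr B K (k + 1)) Φ - act (restr B K k) Φ := rfl
  refine ⟨?_, ?_, ?_, ?_, ?_⟩
  · rw [e1]
    exact sub_mem hc (restr_chains' _ hc)
  · rw [e1, act_sub, act_restr_restr, min_self, sub_self]
  · rw [e2]
    exact sub_mem (restr_chains _ hc) (chains_mono (Nat.le_succ k) (restr_chains _ hc))
  · change act (restr B K k) _ = 0
    rw [e2, act_sub, act_restr_restr, act_restr_restr, min_self, min_eq_left (Nat.le_succ k),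
      sub_self]
  · change act D _ - act (restr B K k) (act D _) + _ = 0
    -- The count is applied to Φ with its top antifields removed; the part of it that contains
    -- antifields of number k + 1 is precisely the bilinear part.
    have h1 := H.linPart_act (restr_chains (k + 1) hc)
    rw [act_restr_restr, min_eq_left (Nat.le_succ k)] at h1
    rw [e1, e2, ← h1, act_sub, h0, act_sub, act_zero]
    abel

/-- A Noether identity is given by a cycle, under a regularity condition. -/
theorem IsPair.exists_cycle_of_noetherIdentity (H : IsPair D δbar) (hD2 : ∀ Φ, D (D Φ) = 0) {k : ℕ}
    (hreg : cycles D k (k + 1) ≤ boundaries D (k + 1) (k + 1)) {G Hd : Dens B K}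
    (h : IsNoetherIdentity δbar D (k + 1) G Hd) :
    ∃ Φ ∈ cycles D (k + 2) (k + 2), linPart (k + 2) Φ = G := by
  have hH : Hd - act (restr B K k) Hd = Hd := by
    have : act (restr B K k) Hd = 0 := h.bilinear_H
    rw [this, sub_zero]
  have h1 := H.linPart_act h.mem_H
  rw [hH] at h1
  have hid : act D G - act (restr B K k) (act D G) + act δbar Hd = 0 := h.identity
  rw [← h1, ← add_sub_add_comm, ← act_add, ← act_add, ← act_add, sub_eq_zero] at hid
  have hmem : G + Hd ∈ chains B K (k + 2) (k + 2) :=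
    add_mem h.mem_G (chains_mono (Nat.le_succ _) h.mem_H)
  -- The Noether identity now says that D (G + H) is fixed by restriction to antifields of number at
  -- most k. Being a cycle, it is D Ψ by regularity, with Ψ free of antifields of number k + 2, so
  -- that subtracting Ψ does not change the linear part G.
  have hcyc : act D (G + Hd) ∈ cycles D k (k + 1) :=
    ⟨mem_chains_of_restr (H.left.act_chains hmem) hid.symm,
      AlternatingMap.ext fun σ => hD2 _⟩
  obtain ⟨Ψ, hΨ, e⟩ := hreg hcyc
  refine ⟨G + Hd - Ψ, ⟨sub_mem hmem (chains_mono (Nat.le_succ _) hΨ), ?_⟩, ?_⟩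
  · rw [act_sub, e, sub_self]
  · change (G + Hd - Ψ) - act (restr B K (k + 1)) (G + Hd - Ψ) = G
    have hG : act (restr B K (k + 1)) G = 0 := h.linear_G
    rw [act_sub, act_add, hG, restr_chains_eq_self le_rfl hΨ, restr_chains_eq_self le_rfl h.mem_H]
    abel

/-- Under the homology regularity condition, a cycle is a boundary if its linear part is
`δbar`-exact. -/
theorem IsPair.mem_boundaries_of_linPart (H : IsPair D δbar) (hD2 : ∀ Φ, D (D Φ) = 0) {k : ℕ}
    (hreg : cycles D (k + 1) (k + 2) ≤ boundaries D (k + 2) (k + 2)) {Φ Ψ : Dens B K}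
    (h : Φ ∈ cycles D (k + 2) (k + 2)) (hΨ : Ψ ∈ chains B K (k + 2) (k + 3))
    (e : act δbar Ψ = linPart (k + 2) Φ) : Φ ∈ boundaries D (k + 2) (k + 2) := by
  have e' : act δbar Ψ = Φ - act (restr B K (k + 1)) Φ := e
  have h1 := H.linPart_act (k := k + 1) hΨ
  rw [act_sub, e'] at h1
  have h2 : act (restr B K (k + 1)) (act δbar (act (restr B K (k + 1)) Ψ)) =
      act δbar (act (restr B K (k + 1)) Ψ) :=
    restr_chains_eq_self le_rfl (H.right.act_chains (restr_chains (k + 1) hΨ))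
  -- Restriction annihilates the linear parts on both sides and leaves δbar (restr Ψ) = 0: the terms
  -- of Ψ without top antifields do not contribute to δbar Ψ.
  have h3 := congrArg (act (restr B K (k + 1))) h1
  simp only [act_sub, act_restr_restr, min_self, sub_self, zero_sub, h2] at h3
  have h4 : act D Ψ - act (restr B K (k + 1)) (act D Ψ) = Φ - act (restr B K (k + 1)) Φ := by
    rw [h1, neg_eq_zero.1 h3.symm, sub_zero]
  have hb : act D Ψ ∈ boundaries D (k + 2) (k + 2) := ⟨Ψ, hΨ, rfl⟩
  -- Φ and D Ψ have the same terms with antifields of number k + 2, so their difference is a cycle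
  -- to which regularity applies.
  have hmem : Φ - act D Ψ ∈ cycles D (k + 1) (k + 2) := by
    refine ⟨mem_chains_of_restr (sub_mem h.1 (H.left.act_chains hΨ)) ?_, ?_⟩
    · rw [act_sub, sub_eq_sub_iff_sub_eq_sub, ← neg_sub, ← h4, neg_sub]
    · rw [act_sub, h.2, zero_sub, neg_eq_zero]
      exact AlternatingMap.ext fun σ => hD2 _
  have := add_mem (hreg hmem) hb
  rwa [sub_add_cancel] at this

end Contact

end KoszulTate
end

noncomputable section

namespace KoszulTate

/-! ### Coordinate frames -/

/-- A germ of a smooth function on a normed space extends to a smooth function. -/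
theorem exists_contDiff_germ {k : ℕ} {h : (Fin k → ℝ) → ℝ} {w : Fin k → ℝ}
    (hh : ∀ᶠ w' in 𝓝 w, ContDiffAt ℝ ∞ h w') :
    ∃ g : (Fin k → ℝ) → ℝ, ContDiff ℝ ∞ g ∧ g =ᶠ[𝓝 w] h := by
  obtain ⟨ε, hε, hb⟩ := Metric.eventually_nhds_iff_ball.1 hh
  let χ : ContDiffBump w := ⟨ε / 4, ε / 2, by positivity, by linarith⟩
  refine ⟨fun w' => χ w' * h w', ?_, ?_⟩
  · rw [contDiff_iff_contDiffAt]
    intro w'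
    by_cases hw : w' ∈ Metric.ball w ε
    · exact χ.contDiff.contDiffAt.mul (hb w' hw)
    · have : (fun w' => χ w' * h w') =ᶠ[𝓝 w'] fun _ => 0 := by
        have h0 : ∀ᶠ v in 𝓝 w', ε / 2 < dist v w := by
          refine (continuous_id.dist continuous_const).continuousAt.eventually_const_lt ?_
          simp only [Metric.mem_ball, not_lt] at hw
          change ε / 2 < dist w' w
          linarith
        filter_upwards [h0] with v hv
        rw [χ.zero_of_le_dist hv.le, zero_mul]
      exact contDiffAt_const.congr_of_eventuallyEq this
  · filter_upwards [χ.eventuallyEq_one] with w' hw'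
    rw [hw']; exact one_mul _

section

variable {n : ℕ} {X : Type} [TopologicalSpace X] [ChartedSpace (EuclideanSpace ℝ (Fin n)) X]
  [IsManifold (𝓡 n) ∞ X] [T2Space X]

/-- The chain rule in local coordinates `y`, with inverse `Θ`. -/
theorem VF.apply_eq_sum_fderiv (σ : VF n X) (a : Sm n X) {x : X} (y : Fin n → Sm n X)
    {Θ : (Fin n → ℝ) → X} (h : ∀ᶠ x' in 𝓝 x, Θ (fun j => y j x') = x')
    (hs : ∀ᶠ w in 𝓝 (fun j => y j x), ContDiffAt ℝ ∞ (fun w => a (Θ w)) w) :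
    σ a x = ∑ j, fderiv ℝ (fun w => a (Θ w)) (fun j => y j x) (Pi.single j 1) * σ (y j) x := by
  obtain ⟨g, hg, e⟩ := exists_contDiff_germ hs
  have hy : Continuous (fun x' : X => fun j => y j x') :=
    continuous_pi fun j => (y j).contMDiff.continuous
  have h1 : (a : X → ℝ) =ᶠ[𝓝 x] Sm.compFun g hg y := by
    filter_upwards [h, hy.continuousAt.eventually e] with x' h1 h2
    change a x' = g fun j => y j x'
    rw [h2, h1]
  rw [VF.congr_apply σ h1, VF.compFun_apply, e.fderiv_eq]

theorem contDiffOn_comp_chart_symm (a : Sm n X) (x : X) :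
    ContDiffOn ℝ ∞ (fun e => a ((chartAt (EuclideanSpace ℝ (Fin n)) x).symm e))
      (chartAt (EuclideanSpace ℝ (Fin n)) x).target :=
  contMDiffOn_iff_contDiffOn.1 <|
    a.contMDiff.comp_contMDiffOn (contMDiffOn_chart_symm (I := 𝓡 n) (n := ∞) (x := x))

/-- Germs of the chart coordinates extend to global smooth functions, and the chain rule expresses
the derivation at x through its values on them; these values are the components of the vector. -/
theorem VF.exists_vector (σ : VF n X) {x₀ x : X}
    (hx : x ∈ (chartAt (EuclideanSpace ℝ (Fin n)) x₀).source) :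
    ∃ v : EuclideanSpace ℝ (Fin n), ∀ a : Sm n X, σ a x =
      fderiv ℝ (fun e => a ((chartAt (EuclideanSpace ℝ (Fin n)) x₀).symm e))
        (chartAt (EuclideanSpace ℝ (Fin n)) x₀ x) v := by
  set φ := chartAt (EuclideanSpace ℝ (Fin n)) x₀ with hφ
  let ε := EuclideanSpace.equiv (Fin n) ℝ
  have hu : ∀ j, ∃ u : Sm n X, (u : X → ℝ) =ᶠ[𝓝 x] fun x' => φ x' j := fun j => by
    refine exists_smooth_germ ?_
    filter_upwards [φ.open_source.mem_nhds hx] with x' hx'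
    have h1 : ContMDiffAt (𝓡 n) (𝓡 n) ∞ φ x' :=
      (contMDiffOn_chart (I := 𝓡 n) (n := ∞) (x := x₀)).contMDiffAt (φ.open_source.mem_nhds hx')
    have h2 : ContMDiff (𝓡 n) 𝓘(ℝ, ℝ) ∞ (fun e : EuclideanSpace ℝ (Fin n) => ε e j) :=
      ContDiff.contMDiff (by fun_prop)
    exact h2.contMDiffAt.comp x' h1
  choose u hu using hu
  have hall : ∀ᶠ x' in 𝓝 x, (fun j => u j x') = ε (φ x') := by
    filter_upwards [eventually_all.2 hu] with x' h
    exact funext h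
  refine ⟨ε.symm (fun j => σ (u j) x), fun a => ?_⟩
  have key := VF.apply_eq_sum_fderiv σ a u (x := x) (Θ := fun w => φ.symm (ε.symm w))
    (by
      filter_upwards [hall, φ.open_source.mem_nhds hx] with x' h1 h2
      rw [h1, ε.symm_apply_apply, φ.left_inv h2])
    (by
      rw [hall.self_of_nhds]
      have : ε.symm ⁻¹' φ.target ∈ 𝓝 (ε (φ x)) :=
        (φ.open_target.preimage ε.symm.continuous).mem_nhds (by
          simpa using φ.map_source hx)
      filter_upwards [this] with w hw
      have := ((contDiffOn_comp_chart_symm a x₀).contDiffAt (φ.open_target.mem_nhds hw))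
      exact this.comp w ε.symm.contDiff.contDiffAt)
  rw [key, hall.self_of_nhds]
  have hd : DifferentiableAt ℝ (fun e => a (φ.symm e)) (φ x) :=
    ((contDiffOn_comp_chart_symm a x₀).contDiffAt
      (φ.open_target.mem_nhds (φ.map_source hx))).differentiableAt (by simp)
  have hc : HasFDerivAt (fun w => a (φ.symm (ε.symm w)))
      ((fderiv ℝ (fun e => a (φ.symm e)) (φ x)).comp (ε.symm : (Fin n → ℝ) →L[ℝ] EuclideanSpace ℝ (Fin n)))
      (ε (φ x)) := by
    refine HasFDerivAt.comp (g := fun e => a (φ.symm e)) (f := ε.symm) (ε (φ x)) ?_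
      ε.symm.hasFDerivAt
    rw [ε.symm_apply_apply]
    exact hd.hasFDerivAt
  rw [hc.fderiv]
  have : (fun j => σ (u j) x) = ∑ j, σ (u j) x • (Pi.single j (1 : ℝ) : Fin n → ℝ) := by
    funext i; simp [Finset.sum_apply, Pi.single_apply]
  rw [this, map_sum, map_sum]
  refine Finset.sum_congr rfl fun j _ => ?_
  simp [mul_comm]

/-- `y` are local coordinates near `x₀` with coordinate fields `τ`. -/
def CoordOn (x₀ : X) (τ : Fin n → VF n X) (y : Fin n → Sm n X) : Prop :=
  ∀ᶠ x in 𝓝 x₀, ∀ i j, τ i (y j) x = if i = j then 1 else 0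

/-- A coordinate frame comes from a chart. -/
theorem CoordOn.exists_chart {x₀ : X} {τ : Fin n → VF n X} {y : Fin n → Sm n X}
    (h : CoordOn x₀ τ y) : ∃ ψ : OpenPartialHomeomorph X (Fin n → ℝ), x₀ ∈ ψ.source ∧
      (∀ x ∈ ψ.source, ψ x = fun j => y j x) ∧
      (∀ x ∈ ψ.source, ∀ i j, τ i (y j) x = if i = j then 1 else 0) ∧
      ∀ a : Sm n X, ContDiffOn ℝ ∞ (fun w => a (ψ.symm w)) ψ.target := by
  set φ := chartAt (EuclideanSpace ℝ (Fin n)) x₀ with hφ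
  obtain ⟨O, hO, hOo, hxO⟩ := eventually_nhds_iff.1 h
  let G : EuclideanSpace ℝ (Fin n) → Fin n → ℝ := fun e j => y j (φ.symm e)
  have hG : ContDiffOn ℝ ∞ G φ.target := contDiffOn_pi.2 fun j => contDiffOn_comp_chart_symm _ _
  -- Invertibility is needed at every point of the neighbourhood and not only at x₀, where the
  -- inverse function theorem is applied: it makes the inverse chart smooth on its whole target.
  have heq : ∀ x ∈ φ.source ∩ O, ∃ f' : EuclideanSpace ℝ (Fin n) ≃L[ℝ] (Fin n → ℝ),
      HasFDerivAt G (f' : EuclideanSpace ℝ (Fin n) →L[ℝ] (Fin n → ℝ)) (φ x) := fun x hx => by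
    have hd : HasFDerivAt G (fderiv ℝ G (φ x)) (φ x) :=
      ((hG.contDiffAt (φ.open_target.mem_nhds (φ.map_source hx.1))).differentiableAt
        (by simp)).hasFDerivAt
    -- The vector that represents the i-th frame field in the chart is mapped to the i-th basis
    -- vector; equality of dimensions gives injectivity.
    have hsurj : Function.Surjective (fderiv ℝ G (φ x)).toLinearMap := by
      rw [← LinearMap.range_eq_top, eq_top_iff, ← (Pi.basisFun ℝ (Fin n)).span_eq,
        Submodule.span_le]
      rintro _ ⟨i, rfl⟩
      obtain ⟨v, hv⟩ := VF.exists_vector (τ i) hx.1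
      refine ⟨v, ?_⟩
      funext j
      have h1 : HasFDerivAt (fun e => y j (φ.symm e))
          ((ContinuousLinearMap.proj j).comp (fderiv ℝ G (φ x))) (φ x) :=
        hasFDerivAt_pi'.1 hd j
      have h2 := hv (y j)
      rw [h1.fderiv, hO x hx.2 i j] at h2
      simp only [Pi.basisFun_apply]
      rw [Pi.single_apply]
      simp only [eq_comm (a := j)]
      exact h2.symm
    have hinj := (LinearMap.injective_iff_surjective_of_finrank_eq_finrank (by simp)).2 hsurj
    refine ⟨(LinearEquiv.ofBijective _ ⟨hinj, hsurj⟩).toContinuousLinearEquiv, ?_⟩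
    convert hd using 1
    exact ContinuousLinearMap.ext fun v => rfl
  have hx₀ : x₀ ∈ φ.source := mem_chart_source _ x₀
  obtain ⟨f', hf'⟩ := heq x₀ ⟨hx₀, hxO⟩
  have hGa : ContDiffAt ℝ ∞ G (φ x₀) :=
    hG.contDiffAt (φ.open_target.mem_nhds (φ.map_source hx₀))
  let g := hGa.toOpenPartialHomeomorph G hf' (by simp)
  let ψ := ((φ.restrOpen O hOo).trans g)
  refine ⟨ψ, ?_, ?_, ?_, ?_⟩
  · simp only [ψ, OpenPartialHomeomorph.trans_source, mem_inter_iff, mem_preimage]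
    refine ⟨?_, ?_⟩
    · simp [hx₀, hxO]
    · exact hGa.mem_toOpenPartialHomeomorph_source hf' (by simp)
  · intro x hx
    have : x ∈ φ.source := by
      have := hx.1
      simp at this
      exact this.1
    change G (φ x) = _
    funext j
    simp only [G, φ.left_inv this]
  · intro x hx
    have := hx.1
    simp at this
    exact hO x this.2
  · intro a w hw
    have hw1 : w ∈ g.target := by
      simp only [ψ, OpenPartialHomeomorph.trans_target] at hw
      exact hw.1
    have hws : ψ.symm w ∈ ψ.source := ψ.map_target hw
    have hsrc : ψ.symm w ∈ φ.source ∩ O := by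
      have := hws.1
      simpa using this
    have hsm : g.symm w = φ (ψ.symm w) := by
      have h2 : g.symm w ∈ (φ.restrOpen O hOo).target := by
        simp only [ψ, OpenPartialHomeomorph.trans_target] at hw
        exact hw.2
      exact ((φ.restrOpen O hOo).right_inv h2).symm
    obtain ⟨f'', hf''⟩ := heq _ hsrc
    have h3 : ContDiffAt ℝ ∞ g.symm w := by
      refine g.contDiffAt_symm hw1 (f₀' := f'') ?_ ?_
      · rw [hsm]; exact hf''
      · rw [hsm]
        exact hG.contDiffAt (φ.open_target.mem_nhds (φ.map_source hsrc.1))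
    have h4 : ContDiffAt ℝ ∞ (fun e => a (φ.symm e)) (g.symm w) := by
      rw [hsm]
      exact (contDiffOn_comp_chart_symm a x₀).contDiffAt
        (φ.open_target.mem_nhds (φ.map_source hsrc.1))
    exact (h4.comp w h3).contDiffWithinAt

/-- The components of a vector field with respect to a coordinate frame. -/
theorem CoordOn.exists_open {x₀ : X} {τ : Fin n → VF n X} {y : Fin n → Sm n X}
    (h : CoordOn x₀ τ y) : ∃ ψ : OpenPartialHomeomorph X (Fin n → ℝ), x₀ ∈ ψ.source ∧
      (∀ (a : Sm n X), ContDiffOn ℝ ∞ (fun w => a (ψ.symm w)) ψ.target) ∧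
      (∀ x ∈ ψ.source, ∀ (σ : VF n X) (a : Sm n X), σ a x = ∑ j, σ (y j) x * τ j a x) ∧
      ∀ x ∈ ψ.source, ∀ (a : Sm n X) (i : Fin n),
        τ i a x = fderiv ℝ (fun w => a (ψ.symm w)) (ψ x) (Pi.single i 1) := by
  obtain ⟨ψ, hx, hy, hτ, hs⟩ := h.exists_chart
  have key : ∀ x ∈ ψ.source, ∀ (σ : VF n X) (a : Sm n X), σ a x =
      ∑ j, fderiv ℝ (fun w => a (ψ.symm w)) (ψ x) (Pi.single j 1) * σ (y j) x := by
    intro x hx σ a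
    rw [hy x hx]
    refine VF.apply_eq_sum_fderiv σ a y (Θ := ψ.symm) ?_ ?_
    · filter_upwards [ψ.open_source.mem_nhds hx] with x' hx'
      rw [← hy x' hx', ψ.left_inv hx']
    · rw [← hy x hx]
      filter_upwards [ψ.open_target.mem_nhds (ψ.map_source hx)] with w hw
      exact (hs a).contDiffAt (ψ.open_target.mem_nhds hw)
  have key2 : ∀ x ∈ ψ.source, ∀ (a : Sm n X) (i : Fin n),
        τ i a x = fderiv ℝ (fun w => a (ψ.symm w)) (ψ x) (Pi.single i 1) := by
    intro x hx a i
    rw [key x hx (τ i) a]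
    simp [hτ x hx]
  refine ⟨ψ, hx, hs, fun x hx σ a => ?_, key2⟩
  rw [key x hx]
  refine Finset.sum_congr rfl fun j _ => ?_
  rw [key2 x hx, mul_comm]

end

end KoszulTate
end

noncomputable section

namespace KoszulTate

/-! ### Integration in local coordinates -/

section

variable {n : ℕ} {X : Type} [TopologicalSpace X] [ChartedSpace (EuclideanSpace ℝ (Fin n)) X]
  [IsManifold (𝓡 n) ∞ X] [T2Space X]

theorem VF.eq_zero_of_notMem_tsupport (τ : VF n X) {f : Sm n X} {x : X} (hx : x ∉ tsupport f) :
    τ f x = 0 := by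
  have h : (f : X → ℝ) =ᶠ[𝓝 x] (0 : Sm n X) := notMem_tsupport_iff_eventuallyEq.1 hx
  rw [VF.congr_apply τ h, map_zero, Sm.zero_apply]

theorem VF.tsupport_subset (τ : VF n X) (f : Sm n X) : tsupport (τ f) ⊆ tsupport f := by
  refine closure_minimal (fun x hx => ?_) (isClosed_tsupport _)
  by_contra h
  exact hx (τ.eq_zero_of_notMem_tsupport h)

omit [IsManifold (𝓡 n) ∞ X] [T2Space X] in
theorem Sm.tsupport_mul_left {f g : Sm n X} {U : Set X} (h : tsupport f ⊆ U) :
    tsupport (f * g : Sm n X) ⊆ U := (tsupport_mul_subset_left).trans h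

omit [IsManifold (𝓡 n) ∞ X] [T2Space X] in
theorem Sm.tsupport_mul_right {f g : Sm n X} {U : Set X} (h : tsupport g ⊆ U) :
    tsupport (f * g : Sm n X) ⊆ U := (tsupport_mul_subset_right).trans h

/-- A function in local coordinates, extended by zero. -/
def inChart (ψ : OpenPartialHomeomorph X (Fin n → ℝ)) (f : Sm n X) : (Fin n → ℝ) → ℝ :=
  ψ.target.indicator fun w => f (ψ.symm w)

variable {ψ : OpenPartialHomeomorph X (Fin n → ℝ)} {f g : Sm n X}

theorem inChart_of_notMem {w : Fin n → ℝ} (hw : w ∉ ψ '' tsupport f) : inChart ψ f w = 0 := by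
  classical
  rw [inChart, indicator_apply]
  split_ifs with h
  · refine image_eq_zero_of_notMem_tsupport fun h' => hw ⟨_, h', ψ.right_inv h⟩
  · rfl

theorem hasCompactSupport_inChart (hf : tsupport f ⊆ ψ.source) (hc : IsCompact (tsupport f)) :
    IsCompact (ψ '' tsupport f) :=
  hc.image_of_continuousOn (ψ.continuousOn.mono hf)

theorem contDiff_inChart (hs : ContDiffOn ℝ ∞ (fun w => f (ψ.symm w)) ψ.target)
    (hf : tsupport f ⊆ ψ.source) (hc : IsCompact (tsupport f)) : ContDiff ℝ ∞ (inChart ψ f) := by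
  rw [contDiff_iff_contDiffAt]
  intro w
  by_cases hw : w ∈ ψ.target
  · refine (hs.contDiffAt (ψ.open_target.mem_nhds hw)).congr_of_eventuallyEq ?_
    filter_upwards [ψ.open_target.mem_nhds hw] with w' hw'
    exact indicator_of_mem hw' _
  · have hcl : IsClosed (ψ '' tsupport f) := (hasCompactSupport_inChart hf hc).isClosed
    have hw' : w ∉ ψ '' tsupport f := by
      rintro ⟨x, hx, rfl⟩
      exact hw (ψ.map_source (hf hx))
    refine (contDiffAt_const (c := (0 : ℝ))).congr_of_eventuallyEq ?_
    filter_upwards [hcl.isOpen_compl.mem_nhds hw'] with v hv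
    exact inChart_of_notMem hv

theorem integrable_inChart (hs : ContDiffOn ℝ ∞ (fun w => f (ψ.symm w)) ψ.target)
    (hf : tsupport f ⊆ ψ.source) (hc : IsCompact (tsupport f)) :
    MeasureTheory.Integrable (inChart ψ f) :=
  (contDiff_inChart hs hf hc).continuous.integrable_of_hasCompactSupport
    (HasCompactSupport.intro (hasCompactSupport_inChart hf hc) fun _ h => inChart_of_notMem h)

/-- The integral of a derivative vanishes. -/
theorem integral_fderiv_inChart (hs : ContDiffOn ℝ ∞ (fun w => f (ψ.symm w)) ψ.target)
    (hf : tsupport f ⊆ ψ.source) (hc : IsCompact (tsupport f)) (v : Fin n → ℝ) :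
    ∫ w, fderiv ℝ (inChart ψ f) w v = 0 := by
  have h1 := contDiff_inChart hs hf hc
  have hcs : HasCompactSupport (inChart ψ f) :=
    HasCompactSupport.intro (hasCompactSupport_inChart hf hc) fun _ h => inChart_of_notMem h
  have h2 : Continuous fun w => fderiv ℝ (inChart ψ f) w v :=
    (h1.continuous_fderiv (by simp)).clm_apply continuous_const
  -- Integration by parts against the constant function 1.
  have h3 := integral_mul_fderiv_eq_neg_fderiv_mul_of_integrable
    (μ := MeasureTheory.volume) (f := fun _ : Fin n → ℝ => (1 : ℝ)) (g := inChart ψ f) (v := v)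
    (by simp) (by
      simp only [one_mul]
      exact h2.integrable_of_hasCompactSupport (hcs.fderiv_apply ℝ v))
    (by simpa using integrable_inChart hs hf hc)
    (fun _ _ => differentiableAt_const _)
    (fun w _ => (h1.differentiable (by simp)).differentiableAt)
  simpa using h3

theorem inChart_add : inChart ψ (f + g) = inChart ψ f + inChart ψ g := by
  exact indicator_add' _ _ _

theorem inChart_smul (r : ℝ) : inChart ψ (r • f) = r • inChart ψ f := by
  exact indicator_const_smul ψ.target r fun w => f (ψ.symm w)

/-- Near a point, there is an integral which is invariant under the coordinate fields. -/
theorem CoordOn.exists_integral {x₀ : X} {τ : Fin n → VF n X} {y : Fin n → Sm n X}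
    (h : CoordOn x₀ τ y) : ∃ U : Set X, IsOpen U ∧ x₀ ∈ U ∧
      (∀ x ∈ U, ∀ (σ : VF n X) (a : Sm n X), σ a x = ∑ j, σ (y j) x * τ j a x) ∧
      ∃ I : Sm n X →ₗ[ℝ] ℝ,
      (∀ f i, tsupport (f : Sm n X) ⊆ U → I (τ i f) = 0) ∧
      ∀ V ∈ 𝓝 x₀, ∀ g : Sm n X, (∀ a : Sm n X, tsupport a ⊆ V → I (a * g) = 0) → g x₀ = 0 := by
  obtain ⟨ψ, hx, hs, hF, hτ⟩ := h.exists_open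
  have : LocallyCompactSpace X := Manifold.locallyCompact_of_finiteDimensional (𝓡 n)
  obtain ⟨Q, hQ, hQs, hQc⟩ := local_compact_nhds (ψ.open_source.mem_nhds hx)
  obtain ⟨ρ, hρ, hρs⟩ := exists_bump (n := n) x₀ hQ
  obtain ⟨U, hU, hUo, hxU⟩ := eventually_nhds_iff.1 hρ
  have hUQ : U ⊆ tsupport ρ := fun x hx => subset_tsupport _ (by
    rw [Function.mem_support, hU x hx]; exact one_ne_zero)
  have hsub : ∀ f : Sm n X, tsupport f ⊆ Q → tsupport f ⊆ ψ.source ∧ IsCompact (tsupport f) :=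
    fun f hf => ⟨hf.trans hQs, hQc.of_isClosed_subset (isClosed_tsupport _) hf⟩
  have hρU : ∀ f : Sm n X, tsupport f ⊆ U → ρ * f = f := fun f hf => by
    ext x
    by_cases hx : x ∈ U
    · change ρ x * f x = f x
      rw [hU x hx, one_mul]
    · change ρ x * f x = f x
      rw [Sm.eq_zero_of_tsupport hf hx, mul_zero]
  have hmul : ∀ f : Sm n X, tsupport (ρ * f : Sm n X) ⊆ Q := fun f => Sm.tsupport_mul_left hρs
  -- The cut-off ρ, supported in a compact part of the chart, makes the integral a linear functional
  -- on all smooth functions. On functions supported in U, where ρ = 1, it is the plain coordinate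
  -- integral.
  let I : Sm n X →ₗ[ℝ] ℝ :=
    { toFun := fun f => ∫ w, inChart ψ (ρ * f) w
      map_add' := fun f g => by
        rw [mul_add, inChart_add]
        exact MeasureTheory.integral_add
          (integrable_inChart (hs _) (hsub _ (hmul f)).1 (hsub _ (hmul f)).2)
          (integrable_inChart (hs _) (hsub _ (hmul g)).1 (hsub _ (hmul g)).2)
      map_smul' := fun r f => by
        rw [mul_smul_comm, inChart_smul]
        exact MeasureTheory.integral_smul r _ }
  have hI : ∀ f : Sm n X, tsupport f ⊆ U → I f = ∫ w, inChart ψ f w := fun f hf => by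
    change ∫ w, inChart ψ (ρ * f) w = _
    rw [hρU f hf]
  refine ⟨U, hUo, hxU, fun x hx => hF x (hQs (hρs (hUQ hx))), I, fun f i hf => ?_,
    fun V hV g hg => ?_⟩
  · rw [hI _ ((VF.tsupport_subset _ _).trans hf)]
    obtain ⟨h1, h2⟩ := hsub f ((hf.trans hUQ).trans hρs)
    rw [← integral_fderiv_inChart (hs f) h1 h2 (Pi.single i 1)]
    congr 1
    funext w
    by_cases hw : w ∈ ψ.target
    · have he : inChart ψ f =ᶠ[𝓝 w] fun w => f (ψ.symm w) := by
        filter_upwards [ψ.open_target.mem_nhds hw] with w' hw'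
        exact indicator_of_mem hw' _
      rw [he.fderiv_eq, inChart, indicator_of_mem hw, hτ _ (ψ.map_target hw), ψ.right_inv hw]
    · have hcl : IsClosed (ψ '' tsupport f) := (hasCompactSupport_inChart h1 h2).isClosed
      have hw' : w ∉ ψ '' tsupport f := by
        rintro ⟨x, hx, rfl⟩
        exact hw (ψ.map_source (h1 hx))
      have he : inChart ψ f =ᶠ[𝓝 w] fun _ => 0 := by
        filter_upwards [hcl.isOpen_compl.mem_nhds hw'] with v hv
        exact inChart_of_notMem hv
      rw [he.fderiv_eq, inChart, indicator_of_notMem hw]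
      simp
  -- The fundamental lemma of the calculus of variations: the test function χ² g gives a vanishing
  -- integral of (χ g)², a continuous nonnegative function.
  · obtain ⟨χ, hχ, hχs⟩ := exists_bump (n := n) x₀ (inter_mem hV (hUo.mem_nhds hxU))
    have h1 := hg (χ * χ * g) (Sm.tsupport_mul_left (Sm.tsupport_mul_left
      (hχs.trans inter_subset_left)))
    have e1 : χ * χ * g * g = (χ * g) * (χ * g) := by ring
    have hsup : tsupport ((χ * g) * (χ * g) : Sm n X) ⊆ U :=
      Sm.tsupport_mul_left (Sm.tsupport_mul_left (hχs.trans inter_subset_right))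
    rw [e1, hI _ hsup] at h1
    obtain ⟨h2, h3⟩ := hsub _ ((hsup.trans hUQ).trans hρs)
    have hc := contDiff_inChart (hs _) h2 h3
    have hnn : 0 ≤ inChart ψ ((χ * g) * (χ * g)) := fun w =>
      indicator_nonneg (fun w _ => mul_self_nonneg ((χ * g) (ψ.symm w))) w
    have h4 := (MeasureTheory.integral_eq_zero_iff_of_nonneg hnn
      (integrable_inChart (hs _) h2 h3)).1 h1
    have h5 := (hc.continuous.ae_eq_iff_eq MeasureTheory.volume continuous_zero).1 h4
    have h6 := congrFun h5 (ψ x₀)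
    rw [inChart, indicator_of_mem (ψ.map_source hx), ψ.left_inv hx] at h6
    have h7 : (χ x₀ * g x₀) * (χ x₀ * g x₀) = 0 := h6
    rw [hχ.self_of_nhds, one_mul] at h7
    exact mul_self_eq_zero.1 h7

/-! ### The change of a coordinate frame -/

theorem Derivation.map_prod {R A : Type*} [CommRing R] [CommRing A] [Algebra R A]
    (D : Derivation R A A) {α : Type*} [DecidableEq α] (s : Finset α) (f : α → A) :
    D (∏ i ∈ s, f i) = ∑ i ∈ s, D (f i) * ∏ j ∈ s.erase i, f j := by
  induction s using Finset.induction_on with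
  | empty => simp
  | insert a s ha ih =>
    rw [Finset.prod_insert ha, Derivation.leibniz, ih, Finset.sum_insert ha,
      Finset.erase_insert ha, smul_eq_mul, smul_eq_mul, Finset.mul_sum, add_comm]
    congr 1
    · ring
    · refine Finset.sum_congr rfl fun i hi => ?_
      have hne : a ≠ i := fun h => ha (h ▸ hi)
      rw [Finset.erase_insert_of_ne hne, Finset.prod_insert (by simp [ha])]
      ring

theorem Derivation.map_det {R A : Type*} [CommRing R] [CommRing A] [Algebra R A]
    (D : Derivation R A A) (M : Matrix (Fin n) (Fin n) A) :
    D M.det = ∑ j, (M.updateCol j fun k => D (M k j)).det := by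
  simp only [Matrix.det_apply, map_sum]
  rw [Finset.sum_comm]
  refine Finset.sum_congr rfl fun p _ => ?_
  rw [← Finset.smul_sum]
  have : D (Equiv.Perm.sign p • ∏ i, M (p i) i) = Equiv.Perm.sign p • D (∏ i, M (p i) i) := by
    rcases Int.units_eq_one_or (Equiv.Perm.sign p) with h | h <;> simp [h]
  rw [this, Derivation.map_prod]
  congr 1
  refine Finset.sum_congr rfl fun j _ => ?_
  rw [← Finset.mul_prod_erase _ _ (Finset.mem_univ j), Matrix.updateCol_self]
  congr 1
  refine Finset.prod_congr rfl fun i hi => ?_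
  rw [Matrix.updateCol_ne (Finset.ne_of_mem_erase hi)]

/-- The matrix of the components of the vector fields `τ` in the coordinates `y`. -/
def frameMatrix (τ : Fin n → VF n X) (y : Fin n → Sm n X) : Matrix (Fin n) (Fin n) (Sm n X) :=
  Matrix.of fun i j => τ i (y j)

/-- The vector fields `τ` commute on `U`. -/
def CommOn (U : Set X) (τ : Fin n → VF n X) : Prop :=
  ∀ x ∈ U, ∀ i j a, τ i (τ j a) x = τ j (τ i a) x

/-- Differentiate the determinant column by column. Since the fields τ' commute, τ'_i A_kj = τ'_k
(τ'_i y_j), which is the sum over l of (τ_l A_ij) A_kl. The new column j is thus a combination of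
the old columns, and the determinant retains only the coefficient with l = j; the sum over j is the
divergence of τ'_i. -/
theorem apply_frameMatrix_det {U : Set X} {τ τ' : Fin n → VF n X} {y : Fin n → Sm n X}
    (hF : ∀ x ∈ U, ∀ (σ : VF n X) (a : Sm n X), σ a x = ∑ j, σ (y j) x * τ j a x)
    (hc : CommOn U τ') {x : X} (hx : x ∈ U) (i : Fin n) :
    τ' i (frameMatrix τ' y).det x =
      (frameMatrix τ' y).det x * ∑ l, τ l (frameMatrix τ' y i l) x := by
  rw [Derivation.map_det, Sm.sum_apply, Finset.mul_sum]
  refine Finset.sum_congr rfl fun j _ => ?_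
  have hdet : ∀ M : Matrix (Fin n) (Fin n) (Sm n X), M.det x = (M.map fun a => a x).det :=
    fun M => RingHom.map_det (Sm.evalHom (n := n) x).toRingHom M
  rw [hdet, hdet]
  have key : (((frameMatrix τ' y).updateCol j fun k => τ' i (frameMatrix τ' y k j)).map
      fun a => a x) = ((frameMatrix τ' y).map fun a => a x).updateCol j
        fun k => ∑ l, τ l (frameMatrix τ' y i j) x • (frameMatrix τ' y).map (fun a => a x) k l := by
    ext k l
    rw [Matrix.map_apply, Matrix.updateCol_apply, Matrix.updateCol_apply]
    split_ifs with h
    · change τ' i (τ' k (y j)) x = _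
      rw [hc x hx, hF x hx (τ' k)]
      refine Finset.sum_congr rfl fun l _ => ?_
      rw [smul_eq_mul, mul_comm]
      rfl
    · rfl
  rw [key, Matrix.det_updateCol_sum, smul_eq_mul, mul_comm]

theorem word_append (l l' : List (VF n X)) (a : Sm n X) :
    word (l ++ l') a = word l (word l' a) := by
  simp [word]

theorem word_perm {U : Set X} (hU : IsOpen U) {τ : Fin n → VF n X} (hc : CommOn U τ)
    {Λ Λ' : List (Fin n)} (h : Λ.Perm Λ') (a : Sm n X) :
    ∀ x ∈ U, word (Λ.map τ) a x = word (Λ'.map τ) a x := by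
  induction h with
  | nil => exact fun _ _ => rfl
  | cons i _ ih =>
    intro x hx
    rw [List.map_cons, List.map_cons, word_cons, word_cons]
    refine VF.congr_apply _ ?_
    filter_upwards [hU.mem_nhds hx] with x' hx'
    exact ih x' hx'
  | swap i j l =>
    intro x hx
    simp only [List.map_cons, word_cons]
    exact hc x hx _ _ _
  | trans _ _ ih ih' => exact fun x hx => (ih x hx).trans (ih' x hx)

theorem tsupport_word {U : Set X} (l : List (VF n X)) {f : Sm n X} (hf : tsupport f ⊆ U) :
    tsupport (word l f) ⊆ U := by
  induction l with
  | nil => rwa [word_nil]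
  | cons τ l ih => rw [word_cons]; exact (VF.tsupport_subset _ _).trans ih

/-- Repeated integration by parts. -/
theorem integral_word {U : Set X} (hU : IsOpen U) {τ : Fin n → VF n X} (hc : CommOn U τ)
    {I : Sm n X →ₗ[ℝ] ℝ} {m : Sm n X}
    (hI : ∀ f i, tsupport (f : Sm n X) ⊆ U → I (m * τ i f) = 0) (Λ : List (Fin n)) (g : Sm n X)
    {f : Sm n X} (hf : tsupport f ⊆ U) :
    I (m * (g * word (Λ.map τ) f)) = (-1) ^ Λ.length * I (m * (f * word (Λ.map τ) g)) := by
  -- Each integration by parts moves the outermost derivative, so the word arrives in reversed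
  -- order; commutativity of the fields on U restores the order afterwards.
  have key : I (m * (g * word (Λ.map τ) f)) =
      (-1) ^ Λ.length * I (m * (f * word (Λ.reverse.map τ) g)) := by
    induction Λ generalizing g with
    | nil =>
      simp only [List.map_nil, word_nil, List.length_nil, pow_zero, one_mul, List.reverse_nil]
      rw [mul_comm g]
    | cons i Λ ih =>
      have h1 := hI (g * word (Λ.map τ) f) i (Sm.tsupport_mul_right (tsupport_word _ hf))
      rw [Derivation.leibniz, smul_eq_mul, smul_eq_mul, mul_add, map_add,
        mul_comm (word (Λ.map τ) f), ih (τ i g)] at h1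
      rw [List.map_cons, word_cons, List.reverse_cons, List.map_append, word_append,
        List.map_cons, List.map_nil, word_cons, word_nil, List.length_cons, pow_succ]
      linarith
  rw [key]
  congr 3
  ext x
  change f x * _ = f x * _
  by_cases hx : x ∈ U
  · rw [word_perm hU hc Λ.reverse_perm g x hx]
  · rw [Sm.eq_zero_of_tsupport hf hx, zero_mul, zero_mul]

/-- The components of the bracket in the frame are its values on the coordinates, and these are
derivatives of locally constant functions. -/
theorem CoordOn.commOn {x₀ : X} {τ : Fin n → VF n X} {y : Fin n → Sm n X} (h : CoordOn x₀ τ y) :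
    ∀ᶠ x in 𝓝 x₀, ∀ i j a, τ i (τ j a) x = τ j (τ i a) x := by
  obtain ⟨ψ, hx, -, hF, -⟩ := h.exists_open
  filter_upwards [ψ.open_source.mem_nhds hx, eventually_eventually_nhds.2 h] with x hx h i j a
  have h0 : ∀ i j k, τ i (τ j (y k)) x = 0 := fun i j k => by
    have : (τ j (y k) : X → ℝ) =ᶠ[𝓝 x] algebraMap ℝ (Sm n X) (if j = k then 1 else 0) := by
      filter_upwards [h] with x' h'
      exact h' j k
    rw [VF.congr_apply _ this, Derivation.map_algebraMap, Sm.zero_apply]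
  have h1 := hF x hx ⁅τ i, τ j⁆ a
  rw [Finset.sum_eq_zero, Derivation.commutator_apply, Sm.sub_apply] at h1
  · linarith
  · intro k _
    rw [Derivation.commutator_apply, Sm.sub_apply, h0, h0, sub_self, zero_mul]

/-- The formal adjoints with respect to two coordinate volume forms are the same up to the
Jacobian. -/
theorem CoordOn.adjoint_eq {x₀ : X} {τ τ' : Fin n → VF n X} {y y' : Fin n → Sm n X}
    (h : CoordOn x₀ τ y) (h' : CoordOn x₀ τ' y') (T T' : Finset (List (Fin n)))
    (C C' : List (Fin n) → Sm n X)
    (hP : ∀ᶠ x in 𝓝 x₀, ∀ a : Sm n X,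
      (frameMatrix τ' y).det x * ∑ Λ ∈ T, C Λ x * word (Λ.map τ) a x =
        ∑ Λ ∈ T', C' Λ x * word (Λ.map τ') a x) :
    (frameMatrix τ' y).det x₀ * ∑ Λ ∈ T, (-1) ^ Λ.length * word (Λ.map τ) (C Λ) x₀ =
      ∑ Λ ∈ T', (-1) ^ Λ.length * word (Λ.map τ') (C' Λ) x₀ := by
  obtain ⟨U₁, hU₁, hx₁, hF, I, hI, hI0⟩ := h.exists_integral
  obtain ⟨U₂, hU₂, hx₂, hF', -⟩ := h'.exists_integral
  obtain ⟨U, hUs, hUo, hxU⟩ := eventually_nhds_iff.1 ((hU₁.eventually_mem hx₁).and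
    ((hU₂.eventually_mem hx₂).and (h.commOn.and (h'.commOn.and (h'.and hP)))))
  set A := frameMatrix τ' y with hA
  set J := A.det with hJ
  set m := (frameMatrix τ y').det with hm
  -- The Jacobian matrices of the coordinate change and of its inverse are mutually inverse by the
  -- chain rule.
  have hJm : ∀ x ∈ U, J x * m x = 1 := fun x hx => by
    have hdet : ∀ M : Matrix (Fin n) (Fin n) (Sm n X), M.det x = (M.map fun a => a x).det :=
      fun M => RingHom.map_det (Sm.evalHom (n := n) x).toRingHom M
    rw [hJ, hm, hdet, hdet, ← Matrix.det_mul]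
    have : (A.map fun a => a x) * ((frameMatrix τ y').map fun a => a x) = 1 := by
      ext i j
      rw [Matrix.mul_apply, Matrix.one_apply, ← (hUs x hx).2.2.2.2.1 i j,
        hF x (hUs x hx).1 (τ' i) (y' j)]
      rfl
    rw [this, Matrix.det_one]
  have hcU : CommOn U τ := fun x hx => (hUs x hx).2.2.1
  have hcU' : CommOn U τ' := fun x hx => (hUs x hx).2.2.2.1
  have hUU₁ : U ⊆ U₁ := fun x hx => (hUs x hx).1
  -- Weighted by m, the integral is invariant under the fields τ' too: m τ'_i f is a divergence in
  -- the frame τ, because the formula for τ'_i J together with J m = 1 gives τ'_i m + m Σ_l τ_l A_il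
  -- = 0.
  have hI' : ∀ f i, tsupport (f : Sm n X) ⊆ U → I (m * τ' i f) = 0 := fun f i hf => by
    have e : m * τ' i f = ∑ j, τ j (m * (A i j * f)) := by
      ext x
      by_cases hx : x ∈ U
      · rw [Sm.sum_apply]
        simp only [VF.leibniz_apply, Sm.mul_apply]
        have p1 := apply_frameMatrix_det (fun x hx => hF x (hUU₁ hx)) hcU' hx i
        have p2 : τ' i (J * m) x = 0 := by
          have : ((J * m : Sm n X) : X → ℝ) =ᶠ[𝓝 x] (1 : Sm n X) := by
            filter_upwards [hUo.mem_nhds hx] with x' hx'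
            exact hJm x' hx'
          rw [VF.congr_apply _ this, Derivation.map_one_eq_zero, Sm.zero_apply]
        rw [VF.leibniz_apply, p1] at p2
        have p3 := hF x (hUU₁ hx) (τ' i) m
        have p4 := hF x (hUU₁ hx) (τ' i) f
        have p5 : τ' i m x + m x * ∑ l, τ l (A i l) x = 0 := by
          have e2 := hJm x hx
          have hJ0 : J x ≠ 0 := fun h => by rw [h, zero_mul] at e2; exact zero_ne_one e2
          refine mul_left_cancel₀ hJ0 ?_
          rw [mul_zero, ← p2]
          ring
        calc m x * τ' i f x = m x * τ' i f x + f x * (τ' i m x + m x * ∑ l, τ l (A i l) x) := by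
              rw [p5]; ring
          _ = _ := by
              rw [p3, p4, Finset.mul_sum, Finset.mul_sum, ← Finset.sum_add_distrib, Finset.mul_sum,
                ← Finset.sum_add_distrib]
              refine Finset.sum_congr rfl fun j _ => ?_
              change m x * (A i j x * _) + f x * (A i j x * _ + _) = _
              ring
      · have hx' : x ∉ tsupport f := fun h => hx (hf h)
        rw [Sm.mul_apply, VF.eq_zero_of_notMem_tsupport _ hx', mul_zero, Sm.sum_apply]
        refine (Finset.sum_eq_zero fun j _ => VF.eq_zero_of_notMem_tsupport _ fun h => hx ?_).symm
        exact Sm.tsupport_mul_right (Sm.tsupport_mul_right hf) h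
    rw [e, map_sum]
    refine Finset.sum_eq_zero fun j _ => hI _ _ ?_
    exact (Sm.tsupport_mul_right (Sm.tsupport_mul_right hf)).trans hUU₁
  -- Test the difference with a supported near x₀. By hypothesis the two differential operators
  -- applied to a agree up to the factor m, and integration by parts, in the frame τ on one side and
  -- in τ' on the other, moves all derivatives off a.
  have hz : (∑ Λ ∈ T, (-1 : ℝ) ^ Λ.length • word (Λ.map τ) (C Λ) -
      m * ∑ Λ ∈ T', (-1 : ℝ) ^ Λ.length • word (Λ.map τ') (C' Λ)) x₀ = 0 := by
    refine hI0 U (hUo.mem_nhds hxU) _ fun a ha => ?_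
    have e1 : ∑ Λ ∈ T, C Λ * word (Λ.map τ) a = m * ∑ Λ ∈ T', C' Λ * word (Λ.map τ') a := by
      ext x
      by_cases hx : x ∈ U
      · have := (hUs x hx).2.2.2.2.2 a
        rw [Sm.mul_apply, Sm.sum_apply, Sm.sum_apply]
        simp only [Sm.mul_apply]
        rw [← this, ← mul_assoc, mul_comm (m x), hJm x hx, one_mul]
      · have hw : ∀ l : List (VF n X), word l a x = 0 := fun l =>
          Sm.eq_zero_of_tsupport (tsupport_word l ha) hx
        rw [Sm.mul_apply, Sm.sum_apply, Sm.sum_apply]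
        simp [Sm.mul_apply, hw]
    have e2 := congrArg I e1
    have e3 : I (∑ Λ ∈ T, C Λ * word (Λ.map τ) a) =
        I (a * ∑ Λ ∈ T, (-1 : ℝ) ^ Λ.length • word (Λ.map τ) (C Λ)) := by
      rw [map_sum, Finset.mul_sum, map_sum]
      refine Finset.sum_congr rfl fun Λ _ => ?_
      have := integral_word hUo hcU (I := I) (m := 1)
        (fun f i hf => by rw [one_mul]; exact hI f i (hf.trans hUU₁)) Λ (C Λ) ha
      rw [one_mul, one_mul] at this
      rw [this, mul_smul_comm, map_smul, smul_eq_mul]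
    have e4 : I (m * ∑ Λ ∈ T', C' Λ * word (Λ.map τ') a) =
        I (a * (m * ∑ Λ ∈ T', (-1 : ℝ) ^ Λ.length • word (Λ.map τ') (C' Λ))) := by
      rw [Finset.mul_sum, map_sum, Finset.mul_sum, Finset.mul_sum, map_sum]
      refine Finset.sum_congr rfl fun Λ _ => ?_
      rw [integral_word hUo hcU' hI' Λ (C' Λ) ha, mul_smul_comm, mul_smul_comm, map_smul,
        smul_eq_mul, mul_left_comm a m]
    rw [mul_sub, map_sub, ← e3, ← e4, e2, sub_self]
  rw [Sm.sub_apply, Sm.mul_apply, Sm.sum_apply, Sm.sum_apply, sub_eq_zero] at hz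
  simp only [Sm.rsmul_apply] at hz
  rw [hz, ← mul_assoc, hJm x₀ hxU, one_mul]

end

end KoszulTate
end

noncomputable section

namespace KoszulTate

/-! ### Uniqueness of variational derivatives -/

/-- Pulled back to the free module on n generators, an alternating n-form is its value on the
standard basis times the determinant. It gives the Jacobian factor between components of a density
in two frames. -/
theorem AlternatingMap.map_matrix_mul {R M M' : Type*} [CommRing R] [AddCommGroup M] [Module R M]
    [AddCommGroup M'] [Module R M'] {n : ℕ} (L : M [⋀^Fin n]→ₗ[R] M')
    (A : Matrix (Fin n) (Fin n) R) (τ : Fin n → M) :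
    L (fun i => ∑ j, A i j • τ j) = A.det • L τ := by
  let f : (Fin n → R) →ₗ[R] M := (Pi.basisFun R (Fin n)).constr R τ
  have hf : ∀ v : Fin n → R, f v = ∑ j, v j • τ j := fun v => by
    simp [f, Module.Basis.constr_apply_fintype]
  have key : L.compLinearMap f =
      (LinearMap.toSpanSingleton R M' (L τ)).compAlternatingMap (Pi.basisFun R (Fin n)).det := by
    refine Module.Basis.ext_alternating (Pi.basisFun R (Fin n)) fun v hv => ?_
    let p : Equiv.Perm (Fin n) := Equiv.ofBijective v (Finite.injective_iff_bijective.1 hv)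
    have e : (fun i => (Pi.basisFun R (Fin n)) (v i)) = (Pi.basisFun R (Fin n)) ∘ p := rfl
    rw [e, AlternatingMap.map_perm, AlternatingMap.map_perm]
    congr 1
    change L (fun i => f _) = (Pi.basisFun R (Fin n)).det (Pi.basisFun R (Fin n)) • L τ
    rw [Module.Basis.det_self, one_smul]
    congr 1
    funext i
    exact Module.Basis.constr_basis _ _ _ _
  have h := congrArg (fun g => g A) key
  change L (fun i => f (A i)) = (Pi.basisFun R (Fin n)).det A • L τ at h
  simp only [hf] at h
  rw [h, Pi.basisFun_det]
  rfl

variable {n d : ℕ} {X Y : Type}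
  [TopologicalSpace X] [ChartedSpace (EuclideanSpace ℝ (Fin n)) X] [IsManifold (𝓡 n) ∞ X]
  [T2Space X] [TopologicalSpace Y] [ChartedSpace (EuclideanSpace ℝ (Fin d)) Y]
  [IsManifold (𝓡 d) ∞ Y] {B : FieldSpace n d X Y} {ι : Type} {K : Antifields n X ι}

omit [IsManifold (𝓡 n) ∞ X] [T2Space X] in
theorem VF.sum_apply {α : Type*} (s : Finset α) (f : α → VF n X) (a : Sm n X) (x : X) :
    (∑ i ∈ s, f i) a x = ∑ i ∈ s, f i a x :=
  map_sum ({ toFun := fun τ => τ a x, map_zero' := rfl, map_add' := fun _ _ => rfl } :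
    VF n X →+ ℝ) f s

/-- The components of a density with respect to vector fields `σ` and a coordinate frame. -/
theorem CoordOn.dens_apply {x₀ : X} {τ : Fin n → VF n X} {y : Fin n → Sm n X}
    (h : CoordOn x₀ τ y) : ∀ᶠ x in 𝓝 x₀, ∀ (σ : Fin n → VF n X) (L : Dens B K)
      (z : JetPt B × QEven B K), z.1.x = x →
      (L σ : Fun B K) z = (frameMatrix σ y).det x • (L τ : Fun B K) z := by
  obtain ⟨U, hU, hx, hF, -⟩ := h.exists_integral
  obtain ⟨χ, h1, h2⟩ := exists_bump (n := n) x₀ (hU.mem_nhds hx)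
  filter_upwards [h1] with x hx σ L z hz
  -- The frame spans the vector fields only near x₀, so they are cut off before being expanded. The
  -- price is a factor χ ^ n, equal to 1 at the points considered.
  have e : (fun i => χ • σ i) = fun i => ∑ j, (χ • frameMatrix σ y) i j • τ j := by
    funext i
    ext a x'
    have hs : (∑ j, (χ • frameMatrix σ y) i j • τ j : VF n X) a x' =
        ∑ j, χ x' * σ i (y j) x' * τ j a x' := by
      rw [VF.sum_apply]
      rfl
    rw [hs, VF.smul_apply]
    by_cases hx' : x' ∈ U
    · rw [hF x' hx', Finset.mul_sum]
      exact Finset.sum_congr rfl fun j _ => (mul_assoc _ _ _).symm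
    · rw [Sm.eq_zero_of_tsupport h2 hx', zero_mul]
      simp
  have h3 := AlternatingMap.map_matrix_mul L (χ • frameMatrix σ y) τ
  rw [← e] at h3
  have h4 := L.toMultilinearMap.map_smul_univ (fun _ => χ) σ
  have h6 : (∏ _i : Fin n, χ) • L σ = (χ • frameMatrix σ y).det • L τ := h4.symm.trans h3
  have h7 := congrArg (fun Φ : P B K => (Φ : Fun B K) z) h6
  simp only [P.coe_smul_apply, Matrix.det_smul, hz] at h7
  rw [Sm.prod_apply, hx] at h7
  have hpow : (χ ^ Fintype.card (Fin n) * (frameMatrix σ y).det) x = (frameMatrix σ y).det x := by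
    have : (χ ^ Fintype.card (Fin n)) x = 1 :=
      (map_pow (Sm.evalHom (n := n) x) χ _).trans (by
        change (χ x) ^ _ = 1
        rw [hx, one_pow])
    rw [Sm.mul_apply, this, one_mul]
  rw [hpow] at h7
  simpa using h7

/-- Two derivatives of functions which are proportional over a point are proportional. -/
def VarScale (var : Sm n X → Fun B K → JetPt B × QEven B K → Val B K → Prop) : Prop :=
  ∀ (a : Sm n X) (Φ Ψ : Fun B K) (z : JetPt B × QEven B K) (γ γ' : Val B K) (r : ℝ),
    var a Φ z γ → var a Ψ z γ' → (∀ z' : JetPt B × QEven B K, z'.1.x = z.1.x → Ψ z' = r • Φ z') →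
    γ' = r • γ

theorem varScale_oddDeriv (f : Sec B.F) :
    VarScale (B := B) (K := K) (fun a => HasOddDeriv B K (a • f)) := by
  intro a Φ Ψ z γ γ' r h h' e
  rw [HasOddDeriv] at h h'
  rw [h, h', e z rfl, map_smul]

/-- The components of L in two frames differ by the Jacobian, hence so do the first variations,
viewed as differential operators in a. Each Euler–Lagrange expression is the formal adjoint of such
an operator applied to 1, so `CoordOn.adjoint_eq` shows that both define the same density. Test
functionals reduce the graded coefficients to smooth functions along a section. -/
theorem IsVarDeriv.unique {L e e' : Dens B K}
    {var : Sm n X → Fun B K → JetPt B × QEven B K → Val B K → Prop} (hvar : VarScale var)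
    (h : IsVarDeriv L var e) (h' : IsVarDeriv L var e') : e = e' := by
  ext1 σ
  refine Subtype.ext (funext fun z => ?_)
  obtain ⟨τ, ⟨y, hy⟩, T, c, r, hc, U, hU, H⟩ := h z.1.x
  obtain ⟨τ', ⟨y', hy'⟩, T', c', r', hc', U', hU', H'⟩ := h' z.1.x
  have hy : CoordOn z.1.x τ y := hy
  have hy' : CoordOn z.1.x τ' y' := hy'
  -- Only the coefficients with Λ in the finite set are known to be graded functions; the others are
  -- replaced by 0 so that smooth tests can be chosen for all Λ.
  have hcP : ∀ Λ : List (Fin n), ∃ b ∈ P B K, Λ ∈ T → b = c Λ := fun Λ => by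
    by_cases hΛ : Λ ∈ T
    · exact ⟨c Λ, ⟨_, _, hc Λ hΛ⟩, fun _ => rfl⟩
    · exact ⟨0, zero_mem _, fun h => absurd h hΛ⟩
  have hcP' : ∀ Λ : List (Fin n), ∃ b ∈ P B K, Λ ∈ T' → b = c' Λ := fun Λ => by
    by_cases hΛ : Λ ∈ T'
    · exact ⟨c' Λ, ⟨_, _, hc' Λ hΛ⟩, fun _ => rfl⟩
    · exact ⟨0, zero_mem _, fun h => absurd h hΛ⟩
  choose b hbP hbc using hcP
  choose b' hbP' hbc' using hcP'
  have key : (e' τ' : Fun B K) z = (frameMatrix τ' y).det z.1.x • (e τ : Fun B K) z := by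
    refine eq_of_tst fun ks => ?_
    change testEval ks _ = testEval ks _
    choose C hC using fun Λ => exists_smooth_tst (hbP Λ) z ks
    choose C' hC' using fun Λ => exists_smooth_tst (hbP' Λ) z ks
    have hadj := CoordOn.adjoint_eq hy hy' T T' C C' (by
      filter_upwards [hU, hU', hy.dens_apply (B := B) (K := K), z.1.isSec.eventually,
        (Finset.eventually_all T).2 fun Λ _ => hC Λ, (Finset.eventually_all T').2 fun Λ _ => hC' Λ]
        with x h1 h1' h2 h3 h4 h4' a
      have hz := hvar a _ _ (⟨x, z.1.s, h3⟩, z.2) _ _ _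
        ((H (⟨x, z.1.s, h3⟩, z.2) h1).1 a) ((H' (⟨x, z.1.s, h3⟩, z.2) h1').1 a)
        (fun z' hz' => h2 τ' L z' hz')
      have hz2 := congrArg (tstL ks) hz
      simp only [map_sum, map_smul, smul_eq_mul] at hz2
      refine Eq.trans ?_ (hz2.symm.trans ?_)
      · congr 1
        refine Finset.sum_congr rfl fun Λ hΛ => ?_
        rw [h4 Λ hΛ, along_of_isSecAt _ _ h3, hbc Λ hΛ, mul_comm]
        rfl
      · refine Finset.sum_congr rfl fun Λ hΛ => ?_
        rw [h4' Λ hΛ, along_of_isSecAt _ _ h3, hbc' Λ hΛ, mul_comm]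
        rfl)
    rw [(H z (mem_of_mem_nhds hU)).2, (H' z (mem_of_mem_nhds hU')).2]
    change tstL ks _ = tstL ks _
    rw [map_smul]
    simp only [map_sum, map_smul, smul_eq_mul]
    refine Eq.trans ?_ (hadj.symm.trans ?_)
    · refine Finset.sum_congr rfl fun Λ hΛ => ?_
      congr 1
      rw [← hbc' Λ hΛ]
      exact totalDerivs_tst (hbP' Λ) _ z ks (hC' Λ)
    · congr 1
      refine Finset.sum_congr rfl fun Λ hΛ => ?_
      congr 1
      rw [← hbc Λ hΛ]
      exact (totalDerivs_tst (hbP Λ) _ z ks (hC Λ)).symm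
  rw [hy'.dens_apply.self_of_nhds σ e z rfl, hy'.dens_apply.self_of_nhds σ e' z rfl, key,
    ← hy.dens_apply.self_of_nhds τ' e z rfl]

end KoszulTate
end

noncomputable section

namespace KoszulTate

/-! ### Variations of a section -/

variable {n d : ℕ} {X Y : Type}
  [TopologicalSpace X] [ChartedSpace (EuclideanSpace ℝ (Fin n)) X] [IsManifold (𝓡 n) ∞ X]
  [T2Space X] [TopologicalSpace Y] [ChartedSpace (EuclideanSpace ℝ (Fin d)) Y]
  [IsManifold (𝓡 d) ∞ Y] {B : FieldSpace n d X Y} {ι : Type} {K : Antifields n X ι}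

/-- A vertical vector at a point of `Y`, in the model space. -/
def FieldSpace.vertAt (B : FieldSpace n d X Y) (w : Sec B.W) (y : Y) : EuclideanSpace ℝ (Fin d) :=
  B.vert y (w (B.proj y))

/-- In a chart of Y the section is moved along a straight line in the direction of the coordinate
expression of the vertical vector. The velocity is right, but the moved maps need not be sections.
-/
theorem exists_moved_section (B : FieldSpace n d X Y) (w : Sec B.W) (p : JetPt B) :
    ∃ c : ℝ → X → Y,
      (∀ᶠ u : ℝ × X in 𝓝 ((0 : ℝ), p.x),
        ContMDiffAt (𝓘(ℝ, ℝ).prod (𝓡 n)) (𝓡 d) ∞ (fun u : ℝ × X => c u.1 u.2) u) ∧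
      ∀ᶠ x in 𝓝 p.x, c 0 x = p.s x ∧
        (mfderiv 𝓘(ℝ, ℝ) (𝓡 d) (fun t => c t x) 0 (1 : ℝ) : EuclideanSpace ℝ (Fin d)) =
          B.vertAt w (p.s x) := by
  set y₀ := p.s p.x with hy₀
  set φ := extChartAt (𝓡 d) y₀ with hφ
  let T := trivializationAt (EuclideanSpace ℝ (Fin d)) (TangentSpace (𝓡 d) (M := Y)) y₀
  let ξ : X → TangentBundle (𝓡 d) Y := fun x => ⟨p.s x, B.vert (p.s x) (w (B.proj (p.s x)))⟩
  let v : X → EuclideanSpace ℝ (Fin d) := fun x => (T (ξ x)).2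
  have hs : ∀ᶠ x in 𝓝 p.x, ContMDiffAt (𝓡 n) (𝓡 d) ∞ p.s x := p.isSec.mono fun _ h => h.1
  have hsc : ContinuousAt p.s p.x := hs.self_of_nhds.continuousAt
  have hsrc : ∀ᶠ x in 𝓝 p.x, p.s x ∈ (chartAt (EuclideanSpace ℝ (Fin d)) y₀).source :=
    hsc.eventually ((chartAt _ y₀).open_source.mem_nhds (mem_chart_source _ y₀))
  have hv : ∀ᶠ x in 𝓝 p.x, ContMDiffAt (𝓡 n) 𝓘(ℝ, EuclideanSpace ℝ (Fin d)) ∞ v x := by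
    filter_upwards [hs, hsrc] with x h1 h2
    have h3 : ContMDiffAt (𝓡 n) (𝓡 d).tangent ∞ ξ x :=
      (B.vert_smooth w).contMDiffAt.comp x h1
    exact ((T.contMDiffAt_iff (by simpa [T, Trivialization.mem_source] using h2)).1 h3).2
  have hφs : ∀ᶠ x in 𝓝 p.x,
      ContMDiffAt (𝓡 n) 𝓘(ℝ, EuclideanSpace ℝ (Fin d)) ∞ (fun x => φ (p.s x)) x := by
    filter_upwards [hs, hsrc] with x h1 h2
    exact (contMDiffAt_extChartAt' h2).comp x h1
  let κ : ℝ × X → EuclideanSpace ℝ (Fin d) := fun u => φ (p.s u.2) + u.1 • v u.2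
  have hκ : ∀ᶠ u : ℝ × X in 𝓝 ((0 : ℝ), p.x),
      ContMDiffAt (𝓘(ℝ, ℝ).prod (𝓡 n)) 𝓘(ℝ, EuclideanSpace ℝ (Fin d)) ∞ κ u := by
    have hsnd : Tendsto (Prod.snd : ℝ × X → X) (𝓝 (0, p.x)) (𝓝 p.x) := continuousAt_snd
    filter_upwards [hsnd.eventually hv, hsnd.eventually hφs] with u h1 h2
    exact (ContMDiffAt.comp (g := fun x => φ (p.s x)) u h2 contMDiffAt_snd).add
      (contMDiffAt_fst.smul (ContMDiffAt.comp (g := v) u h1 contMDiffAt_snd))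
  have hκt : ∀ᶠ u : ℝ × X in 𝓝 ((0 : ℝ), p.x), κ u ∈ φ.target := by
    have h0 : κ (0, p.x) = φ y₀ := by simp [κ, hy₀]
    have := hκ.self_of_nhds.continuousAt
    refine this.eventually ?_
    rw [h0]
    exact extChartAt_target_mem_nhds y₀
  refine ⟨fun t x => φ.symm (κ (t, x)), ?_, ?_⟩
  · filter_upwards [hκ, hκt] with u h1 h2
    have h3 := (contMDiffOn_extChartAt_symm (I := 𝓡 d) (n := ∞) y₀).contMDiffAt
      ((isOpen_extChartAt_target y₀).mem_nhds h2)
    exact ContMDiffAt.comp u h3 h1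
  · filter_upwards [hsrc] with x h1
    have h1' : p.s x ∈ φ.source := by rwa [hφ, extChartAt_source]
    have e0 : φ.symm (φ (p.s x)) = p.s x := φ.left_inv h1'
    refine ⟨by simp [κ, e0], ?_⟩
    have hvx : v x = mfderiv (𝓡 d) 𝓘(ℝ, EuclideanSpace ℝ (Fin d)) φ (p.s x)
        (B.vert (p.s x) (w (B.proj (p.s x)))) := by
      have h2 : T.continuousLinearMapAt ℝ (p.s x) (B.vert (p.s x) (w (B.proj (p.s x)))) = v x := by
        rw [T.continuousLinearMapAt_apply ℝ, T.coe_linearMapAt_of_mem (by simpa [T] using h1)]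
      rw [← h2]
      exact congrArg (fun f => f (B.vert (p.s x) (w (B.proj (p.s x)))))
        (TangentBundle.continuousLinearMapAt_trivializationAt (𝕜 := ℝ) (I := 𝓡 d) h1)
    have hd1 : HasMFDerivAt 𝓘(ℝ, ℝ) 𝓘(ℝ, EuclideanSpace ℝ (Fin d)) (fun t : ℝ => κ (t, x)) 0
        ((ContinuousLinearMap.id ℝ ℝ).smulRight (v x)) := by
      refine HasFDerivAt.hasMFDerivAt ?_
      exact ((hasFDerivAt_id (𝕜 := ℝ) (0 : ℝ)).smul_const (v x)).const_add (φ (p.s x))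
    have hk0 : κ (0, x) = φ (p.s x) := by simp [κ]
    have ht : φ (p.s x) ∈ φ.target := φ.map_source h1'
    have hd2 : MDifferentiableAt 𝓘(ℝ, EuclideanSpace ℝ (Fin d)) (𝓡 d) φ.symm (φ (p.s x)) :=
      ((contMDiffOn_extChartAt_symm (I := 𝓡 d) (n := ∞) y₀).contMDiffAt
        ((isOpen_extChartAt_target y₀).mem_nhds ht)).mdifferentiableAt (by simp)
    have hd3 : MDifferentiableAt (𝓡 d) 𝓘(ℝ, EuclideanSpace ℝ (Fin d)) φ (p.s x) :=
      (contMDiffAt_extChartAt' (n := ∞) h1).mdifferentiableAt (by simp)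
    have hid : (mfderiv 𝓘(ℝ, EuclideanSpace ℝ (Fin d)) (𝓡 d) φ.symm (φ (p.s x))).comp
        (mfderiv (𝓡 d) 𝓘(ℝ, EuclideanSpace ℝ (Fin d)) φ (p.s x)) =
        ContinuousLinearMap.id ℝ (TangentSpace (𝓡 d) (p.s x)) := by
      have h5 : (fun y => φ.symm (φ y)) =ᶠ[𝓝 (p.s x)] id := by
        filter_upwards [(isOpen_extChartAt_source (I := 𝓡 d) y₀).mem_nhds h1'] with y hy
        exact φ.left_inv hy
      rw [← mfderiv_comp (p.s x) hd2 hd3, ← mfderiv_id]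
      exact h5.mfderiv_eq
    have hd2' : MDifferentiableAt 𝓘(ℝ, EuclideanSpace ℝ (Fin d)) (𝓡 d) φ.symm (κ (0, x)) := by
      rw [hk0]; exact hd2
    have hcomp := mfderiv_comp (I := 𝓘(ℝ, ℝ)) (0 : ℝ) hd2' hd1.mdifferentiableAt
    change mfderiv 𝓘(ℝ, ℝ) (𝓡 d) (φ.symm ∘ fun t : ℝ => κ (t, x)) 0 (1 : ℝ) = _
    rw [hcomp, hd1.mfderiv]
    change mfderiv 𝓘(ℝ, EuclideanSpace ℝ (Fin d)) (𝓡 d) φ.symm (κ (0, x)) ((1 : ℝ) • v x) = _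
    rw [one_smul, hvx]
    have := congrArg (fun f => f (B.vert (p.s x) (w (B.proj (p.s x))))) hid
    rw [hk0]
    exact this

/-- Every vertical vector field is the initial velocity of a variation. -/
theorem exists_variation (B : FieldSpace n d X Y) (w : Sec B.W) (p : JetPt B) :
    ∃ S : ℝ → X → Y,
      (∀ᶠ tx : ℝ × X in 𝓝 ((0 : ℝ), p.x),
        ContMDiffAt (𝓘(ℝ, ℝ).prod (𝓡 n)) (𝓡 d) ∞ (fun u : ℝ × X => S u.1 u.2) tx ∧
          B.proj (S tx.1 tx.2) = tx.2) ∧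
      (∀ᶠ x in 𝓝 p.x, S 0 x = p.s x ∧
        mfderiv 𝓘(ℝ, ℝ) (𝓡 d) (fun t => S t x) 0 (1 : ℝ) =
          B.vert (S 0 x) (w (B.proj (S 0 x)))) := by
  let _ := B.topM
  let _ := B.chM
  let _ := B.manM
  obtain ⟨c, hc, hc0⟩ := exists_moved_section B w p
  obtain ⟨e, hxe, he, hes⟩ := B.locTriv p.x
  have hcs : ∀ᶠ u : ℝ × X in 𝓝 ((0 : ℝ), p.x), c u.1 u.2 ∈ e.source := by
    refine hc.self_of_nhds.continuousAt.eventually (e.open_source.mem_nhds ?_)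
    change c 0 p.x ∈ e.source
    rw [hc0.self_of_nhds.1, e.mem_source, p.isSec.self_of_nhds.2]
    exact hxe
  have hsnd : Tendsto (Prod.snd : ℝ × X → X) (𝓝 (0, p.x)) (𝓝 p.x) := continuousAt_snd
  have hb : ∀ᶠ x in 𝓝 p.x, x ∈ e.baseSet := e.open_baseSet.mem_nhds hxe
  -- In a local trivialization, keep the fibre component of the moved map and reset its base
  -- component to x. The result is a section, and since the velocity was vertical it is not changed.
  refine ⟨fun t x => e.toOpenPartialHomeomorph.symm (x, (e (c t x)).2), ?_, ?_⟩
  · filter_upwards [hc, hcs, hsnd.eventually hb] with u h1 h2 h3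
    have h4 : ContMDiffAt (𝓘(ℝ, ℝ).prod (𝓡 n)) ((𝓡 n).prod (𝓡 B.m)) ∞
        (fun u : ℝ × X => e (c u.1 u.2)) u :=
      ContMDiffAt.comp u (he.contMDiffAt (e.open_source.mem_nhds h2)) h1
    have h5 : ContMDiffAt (𝓘(ℝ, ℝ).prod (𝓡 n)) ((𝓡 n).prod (𝓡 B.m)) ∞
        (fun u : ℝ × X => (u.2, (e (c u.1 u.2)).2)) u :=
      contMDiffAt_snd.prodMk (ContMDiffAt.comp u contMDiffAt_snd h4)
    have h6 : (u.2, (e (c u.1 u.2)).2) ∈ e.target := e.mem_target.2 h3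
    exact ⟨ContMDiffAt.comp u (hes.contMDiffAt (e.open_target.mem_nhds h6)) h5,
      e.proj_symm_apply' h3⟩
  · have hin : Tendsto (fun x : X => ((0 : ℝ), x)) (𝓝 p.x) (𝓝 (0, p.x)) :=
      (continuous_const.prodMk continuous_id).continuousAt
    filter_upwards [hc0, hb, p.isSec, eventually_eventually_nhds.2 hc |> hin.eventually,
      hin.eventually (eventually_eventually_nhds.2 hcs)] with x h1 h2 h3 h4 h5
    have hsrc : p.s x ∈ e.source := by rw [e.mem_source, h3.2]; exact h2
    have e0 : e.toOpenPartialHomeomorph.symm (x, (e (c 0 x)).2) = p.s x := by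
      rw [h1.1]
      have : (x, (e (p.s x)).2) = e (p.s x) := by
        rw [← e.mk_proj_snd hsrc, h3.2]
      rw [this]
      exact e.toOpenPartialHomeomorph.left_inv hsrc
    refine ⟨e0, ?_⟩
    change (mfderiv 𝓘(ℝ, ℝ) (𝓡 d)
      (fun t => e.toOpenPartialHomeomorph.symm (x, (e (c t x)).2)) 0 (1 : ℝ) :
        EuclideanSpace ℝ (Fin d)) = B.vertAt w (e.toOpenPartialHomeomorph.symm (x, (e (c 0 x)).2))
    rw [e0, ← h1.2]
    have hcx : MDifferentiableAt 𝓘(ℝ, ℝ) (𝓡 d) (fun t => c t x) 0 := by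
      have h6 := h4.self_of_nhds
      have h7 : ContMDiffAt 𝓘(ℝ, ℝ) (𝓘(ℝ, ℝ).prod (𝓡 n)) ∞ (fun t : ℝ => (t, x)) 0 :=
        contMDiffAt_id.prodMk contMDiffAt_const
      exact (ContMDiffAt.comp (0 : ℝ) (g := fun u : ℝ × X => c u.1 u.2) h6 h7).mdifferentiableAt
        (by simp)
    have hc0s : c 0 x ∈ e.source := by rw [h1.1]; exact hsrc
    have hde : MDifferentiableAt (𝓡 d) ((𝓡 n).prod (𝓡 B.m)) e (c 0 x) :=
      (he.contMDiffAt (e.open_source.mem_nhds hc0s)).mdifferentiableAt (by simp)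
    have hec : MDifferentiableAt 𝓘(ℝ, ℝ) ((𝓡 n).prod (𝓡 B.m)) (fun t => e (c t x)) 0 :=
      MDifferentiableAt.comp (0 : ℝ) hde hcx
    have hec2 : MDifferentiableAt 𝓘(ℝ, ℝ) (𝓡 B.m) (fun t => (e (c t x)).2) 0 :=
      MDifferentiableAt.comp (0 : ℝ) mdifferentiableAt_snd hec
    have hpc : MDifferentiableAt 𝓘(ℝ, ℝ) (𝓡 n) (fun t => B.proj (c t x)) 0 :=
      MDifferentiableAt.comp (0 : ℝ)
        (B.contMDiff_proj.contMDiffAt.mdifferentiableAt (by simp)) hcx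
    have hct : ∀ᶠ t in 𝓝 (0 : ℝ), c t x ∈ e.source := by
      have : Tendsto (fun t : ℝ => (t, x)) (𝓝 0) (𝓝 (0, x)) :=
        (continuous_id.prodMk continuous_const).continuousAt
      exact this.eventually h5
    have hproj0 : mfderiv 𝓘(ℝ, ℝ) (𝓡 n) (fun t => B.proj (c t x)) 0 (1 : ℝ) = 0 := by
      have h8 := mfderiv_comp (I := 𝓘(ℝ, ℝ)) (0 : ℝ)
        (B.contMDiff_proj.contMDiffAt.mdifferentiableAt (x := c 0 x) (by simp)) hcx
      change mfderiv 𝓘(ℝ, ℝ) (𝓡 n) (B.proj ∘ fun t => c t x) 0 (1 : ℝ) = 0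
      rw [h8]
      change mfderiv (𝓡 d) (𝓡 n) B.proj (c 0 x)
        (mfderiv 𝓘(ℝ, ℝ) (𝓡 d) (fun t => c t x) 0 (1 : ℝ)) = 0
      rw [show (mfderiv 𝓘(ℝ, ℝ) (𝓡 d) (fun t => c t x) 0 (1 : ℝ) : EuclideanSpace ℝ (Fin d)) =
        B.vert (c 0 x) (w (B.proj (c 0 x))) from by rw [h1.2, ← h1.1]; rfl]
      exact (B.vert_range _ _).1 ⟨_, rfl⟩
    -- The base component has velocity zero, so the constant x may replace it without changing the
    -- derivative.
    have hE1 : mfderiv 𝓘(ℝ, ℝ) ((𝓡 n).prod (𝓡 B.m)) (fun t => e (c t x)) 0 (1 : ℝ) =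
        mfderiv 𝓘(ℝ, ℝ) ((𝓡 n).prod (𝓡 B.m)) (fun t => (x, (e (c t x)).2)) 0 (1 : ℝ) := by
      have h9 : (fun t => e (c t x)) =ᶠ[𝓝 (0 : ℝ)] fun t => (B.proj (c t x), (e (c t x)).2) := by
        filter_upwards [hct] with t ht
        exact (e.mk_proj_snd ht).symm
      rw [h9.mfderiv_eq, mfderiv_prodMk hpc hec2, mfderiv_prodMk mdifferentiableAt_const hec2]
      refine Prod.ext ?_ rfl
      refine hproj0.trans ?_
      change _ = mfderiv 𝓘(ℝ, ℝ) (𝓡 n) (fun _ => x) 0 (1 : ℝ)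
      rw [mfderiv_const]
      rfl
    have hpt : (x, (e (c 0 x)).2) = e (c 0 x) := by
      rw [← e.mk_proj_snd hc0s, h1.1, h3.2]
    have hes0 : MDifferentiableAt ((𝓡 n).prod (𝓡 B.m)) (𝓡 d) e.toOpenPartialHomeomorph.symm
        (e (c 0 x)) :=
      (hes.contMDiffAt (e.open_target.mem_nhds (e.map_source hc0s))).mdifferentiableAt (by simp)
    have hes1 : MDifferentiableAt ((𝓡 n).prod (𝓡 B.m)) (𝓡 d) e.toOpenPartialHomeomorph.symm
        (x, (e (c 0 x)).2) := by rw [hpt]; exact hes0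
    have hA := mfderiv_comp (I := 𝓘(ℝ, ℝ)) (f := fun t => (x, (e (c t x)).2)) (0 : ℝ) hes1
      (mdifferentiableAt_const.prodMk hec2)
    have hB := mfderiv_comp (I := 𝓘(ℝ, ℝ)) (f := fun t => e (c t x)) (0 : ℝ) hes0 hec
    have hC : (e.toOpenPartialHomeomorph.symm ∘ fun t => e (c t x)) =ᶠ[𝓝 (0 : ℝ)]
        fun t => c t x := by
      filter_upwards [hct] with t ht
      exact e.toOpenPartialHomeomorph.left_inv ht
    change mfderiv 𝓘(ℝ, ℝ) (𝓡 d)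
      (e.toOpenPartialHomeomorph.symm ∘ fun t => (x, (e (c t x)).2)) 0 (1 : ℝ) = _
    rw [← hC.mfderiv_eq, hA, hB]
    change mfderiv ((𝓡 n).prod (𝓡 B.m)) (𝓡 d) e.toOpenPartialHomeomorph.symm (x, (e (c 0 x)).2)
      (mfderiv 𝓘(ℝ, ℝ) ((𝓡 n).prod (𝓡 B.m)) (fun t => (x, (e (c t x)).2)) 0 (1 : ℝ)) =
      mfderiv ((𝓡 n).prod (𝓡 B.m)) (𝓡 d) e.toOpenPartialHomeomorph.symm (e (c 0 x))
      (mfderiv 𝓘(ℝ, ℝ) ((𝓡 n).prod (𝓡 B.m)) (fun t => e (c t x)) 0 (1 : ℝ))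
    rw [hE1, hpt]

/-- `HasVertDeriv` quantifies over all variations and would say nothing if there were none. An
actual variation pins the derivative down, and the proportionality passes to it. -/
theorem varScale_vertDeriv (w : Sec B.W) :
    VarScale (B := B) (K := K) (fun a => HasVertDeriv B K (a • w)) := by
  intro a Φ Ψ z γ γ' r h h' e
  obtain ⟨S, h1, h2⟩ := exists_variation B (a • w) z.1
  refine eq_of_tst fun ks => ?_
  have h3 := h S h1 h2 ks
  have h4 := h' S h1 h2 ks
  have h5 : (fun t => testEval ks (along Ψ (S t) z.2 z.1.x)) =
      fun t => r * testEval ks (along Φ (S t) z.2 z.1.x) := by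
    funext t
    by_cases hS : IsSecAt B (S t) z.1.x
    · rw [along_of_isSecAt _ _ hS, along_of_isSecAt _ _ hS, e (⟨z.1.x, S t, hS⟩, z.2) rfl]
      exact tst_smul ks r _
    · rw [along, along, dif_neg hS, dif_neg hS]
      have : testEval ks (0 : Val B K) = 0 := map_zero (tstL ks)
      rw [this, mul_zero]
  rw [h5] at h4
  exact (h4.unique (h3.const_mul r)).trans (tst_smul ks r γ).symm

/-- The values on the antifields of antifield number one are determined by the Lagrangian. -/
theorem IsELOnAntifields.antiOdd_eq {L : Dens B K} {D D' : P B K →ₗ[Sm n X] P B K}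
    (h : IsELOnAntifields L D) (h' : IsELOnAntifields L D') {w : Sec B.W} {σ : Fin n → VF n X}
    {Φ : P B K} (hΦ : (Φ : Fun B K) = antiOdd B K [] w σ) : D Φ = D' Φ := by
  obtain ⟨e, -, he, hD⟩ := h.even_fields w
  obtain ⟨e', -, he', hD'⟩ := h'.even_fields w
  rw [hD σ Φ hΦ, hD' σ Φ hΦ, he.unique (varScale_vertDeriv w) he']

theorem IsELOnAntifields.antiEven_eq {L : Dens B K} {D D' : P B K →ₗ[Sm n X] P B K}
    (h : IsELOnAntifields L D) (h' : IsELOnAntifields L D') {f : Sec B.F} {σ : Fin n → VF n X}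
    {Φ : P B K} (hΦ : (Φ : Fun B K) = antiEven B K [] f σ) : D Φ = D' Φ := by
  obtain ⟨e, -, he, hD⟩ := h.odd_fields f
  obtain ⟨e', -, he', hD'⟩ := h'.odd_fields f
  rw [hD σ Φ hΦ, hD' σ Φ hΦ, he.unique (varScale_oddDeriv f) he']

end KoszulTate
end

noncomputable section

namespace KoszulTate

/-! ### Cycles and Noether identities -/

variable {n d : ℕ} {X Y : Type}
  [TopologicalSpace X] [ChartedSpace (EuclideanSpace ℝ (Fin n)) X] [IsManifold (𝓡 n) ∞ X]
  [T2Space X] [TopologicalSpace Y] [ChartedSpace (EuclideanSpace ℝ (Fin d)) Y]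
  [IsManifold (𝓡 d) ∞ Y] {B : FieldSpace n d X Y} {ι : Type} {K : Antifields n X ι}

/-- Both derivations send the antifields of number one to the variational derivatives of L, which
are unique, and the higher antifields have number at least two. -/
theorem IsKoszulTate.isPair {L : Dens B K} {D δbar : P B K →ₗ[Sm n X] P B K}
    (hbar : IsKoszulTate L δbar) (hK : ∀ i, 2 ≤ K.ant i) (hD : IsContactDer D)
    (hL : IsELOnAntifields L D) : IsPair D δbar where
  left := hD
  right := hbar.contactDer
  agree r Φ hΦ := by
    have h := hD.isDerLike_sub hbar.contactDer
    refine sub_eq_zero.1 (h.eq_zero (l := 1) ?_ ?_ ?_ ?_ hΦ)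
    · intro _ v σ Φ hΦ
      exact sub_eq_zero.2 (hL.antiEven_eq hbar.antifields hΦ)
    · intro _ v σ Φ hΦ
      exact sub_eq_zero.2 (hL.antiOdd_eq hbar.antifields hΦ)
    · intro i hi
      have := hK i
      omega
    · intro i hi
      have := hK i
      omega
  ghost_even := hbar.ghostEven
  ghost_odd := hbar.ghostOdd

theorem hclass_eq_zero_iff {D : P B K →ₗ[Sm n X] P B K} {l m : ℕ} (Φ : ↥(cycles D l m)) :
    hclass D l m Φ = 0 ↔ (Φ : Dens B K) ∈ boundaries D l m :=
  Submodule.Quotient.mk_eq_zero _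

theorem hclass_eq_iff {D : P B K →ₗ[Sm n X] P B K} {l m : ℕ} (Φ Φ' : ↥(cycles D l m)) :
    hclass D l m Φ = hclass D l m Φ' ↔ (Φ : Dens B K) - Φ' ∈ boundaries D l m := by
  rw [← sub_eq_zero, ← map_sub, hclass_eq_zero_iff]
  rfl

section

variable {D δbar : P B K →ₗ[Sm n X] P B K} {N : ℕ}

theorem IsPair.boundary_of_trivial (H : IsPair D δbar) (hD2 : ∀ Φ, D (D Φ) = 0)
    (hreg : IsHomologyRegular D (N + 1)) {Φ : Dens B K} (h : Φ ∈ cycles D (N + 2) (N + 2))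
    (ht : IsTrivialNI δbar D N Φ) : Φ ∈ boundaries D (N + 2) (N + 2) := by
  rcases ht with ht | ⟨Ψ, hΨ, e⟩
  · exact ht
  · exact H.mem_boundaries_of_linPart hD2 (hreg (N + 1) (by omega) le_rfl) h hΨ e

/-- The stronger regularity condition adds only the cycles of degree N + 2 without antifields of
number N + 2. Their linear part is zero, so they give trivial identities with Ψ = 0. -/
theorem trivial_boundary_iff_regular (H : IsPair D δbar) (hD2 : ∀ Φ, D (D Φ) = 0)
    (hreg : IsHomologyRegular D N) :
    (∀ Φ ∈ cycles D (N + 2) (N + 2), IsTrivialNI δbar D N Φ → Φ ∈ boundaries D (N + 2) (N + 2)) ↔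
      IsHomologyRegular D (N + 1) := by
  refine ⟨fun h l h1 h2 => ?_, fun h Φ hΦ ht => H.boundary_of_trivial hD2 h hΦ ht⟩
  rcases Nat.lt_or_ge N l with hl | hl
  · obtain rfl : l = N + 1 := le_antisymm h2 hl
    intro Φ hΦ
    refine h Φ ⟨chains_mono (Nat.le_succ _) hΦ.1, hΦ.2⟩ (Or.inr ⟨0, zero_mem _, ?_⟩)
    change act δbar 0 = Φ - act (restr B K (N + 1)) Φ
    rw [restr_chains_eq_self le_rfl hΦ.1, sub_self, act_zero]
  · exact hreg l h1 hl

end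

end KoszulTate
end

open scoped Manifold ContDiff TensorProduct

noncomputable section

namespace KoszulTate

/-! ### Existence of contact derivations with given values on the antifields -/

/-- Prescribed values on a family extend linearly if they satisfy all linear relations of the
family: define the map on the span through a section of the presentation, then extend it to the
whole space. -/
theorem exists_linearMap_of_relations {J U W : Type*} [AddCommGroup U] [Module ℝ U]
    [AddCommGroup W] [Module ℝ W] (a : J → U) (b : J → W)
    (h : ∀ c : J →₀ ℝ, Finsupp.linearCombination ℝ a c = 0 → Finsupp.linearCombination ℝ b c = 0) :
    ∃ f : U →ₗ[ℝ] W, ∀ j, f (a j) = b j := by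
  obtain ⟨s, hs⟩ := (Finsupp.linearCombination ℝ a).rangeRestrict.exists_rightInverse_of_surjective
    (LinearMap.range_rangeRestrict _)
  obtain ⟨f, hf⟩ := LinearMap.exists_extend (Finsupp.linearCombination ℝ b ∘ₗ s)
  refine ⟨f, fun j => ?_⟩
  have hj : a j ∈ LinearMap.range (Finsupp.linearCombination ℝ a) :=
    ⟨Finsupp.single j 1, by simp⟩
  have h1 : f (a j) = Finsupp.linearCombination ℝ b (s ⟨a j, hj⟩) :=
    LinearMap.congr_fun hf ⟨a j, hj⟩
  have h2 : Finsupp.linearCombination ℝ a (s ⟨a j, hj⟩) = a j :=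
    congrArg Subtype.val (LinearMap.congr_fun hs ⟨a j, hj⟩)
  have h3 := h (s ⟨a j, hj⟩ - Finsupp.single j 1) (by rw [map_sub, h2]; simp)
  rw [map_sub, sub_eq_zero] at h3
  rw [h1, h3]
  simp

section Tensor

variable {V U : Type} [AddCommGroup V] [Module ℝ V] [AddCommGroup U] [Module ℝ U]

/-- The contraction `g ⊗ μ ↦ μ(k) g`. -/
def ctrT (k : U) : Ext V ⊗[ℝ] Module.Dual ℝ U →ₗ[ℝ] Ext V :=
  TensorProduct.lift (LinearMap.mk₂ ℝ (fun g μ => μ k • g)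
    (fun g g' μ => smul_add _ _ _) (fun r g μ => smul_comm _ _ _)
    (fun g μ μ' => add_smul _ _ _) (fun r g μ => by simp [mul_smul]))

/-- The map `g ⊗ μ ↦ g e(μ)`. -/
def mulT (e : Module.Dual ℝ U →ₗ[ℝ] Ext V) : Ext V ⊗[ℝ] Module.Dual ℝ U →ₗ[ℝ] Ext V :=
  TensorProduct.lift (LinearMap.mk₂ ℝ (fun g μ => g * e μ)
    (fun g g' μ => add_mul _ _ _) (fun r g μ => smul_mul_assoc _ _ _)
    (fun g μ μ' => by rw [map_add, mul_add]) (fun r g μ => by rw [map_smul, mul_smul_comm]))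

/-- Right multiplication. -/
def rmulT (a : Ext V) : Ext V ⊗[ℝ] Module.Dual ℝ U →ₗ[ℝ] Ext V ⊗[ℝ] Module.Dual ℝ U :=
  TensorProduct.map (LinearMap.mulRight ℝ a) LinearMap.id

/-- Left multiplication. -/
def lmulT (a : Ext V) : Ext V ⊗[ℝ] Module.Dual ℝ U →ₗ[ℝ] Ext V ⊗[ℝ] Module.Dual ℝ U :=
  TensorProduct.map (LinearMap.mulLeft ℝ a) LinearMap.id

theorem ctrT_tmul (k : U) (g : Ext V) (μ : Module.Dual ℝ U) : ctrT k (g ⊗ₜ μ) = μ k • g := rfl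

theorem mulT_tmul (e : Module.Dual ℝ U →ₗ[ℝ] Ext V) (g : Ext V) (μ : Module.Dual ℝ U) :
    mulT e (g ⊗ₜ μ) = g * e μ := rfl

theorem ctrT_rmulT (k : U) (a : Ext V) (θ : Ext V ⊗[ℝ] Module.Dual ℝ U) :
    ctrT k (rmulT a θ) = ctrT k θ * a := by
  induction θ with
  | zero => simp
  | tmul g μ => exact (smul_mul_assoc (μ k) g a).symm
  | add x y hx hy => rw [map_add, map_add, hx, hy, map_add, add_mul]

theorem ctrT_lmulT (k : U) (a : Ext V) (θ : Ext V ⊗[ℝ] Module.Dual ℝ U) :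
    ctrT k (lmulT a θ) = a * ctrT k θ := by
  induction θ with
  | zero => simp
  | tmul g μ => exact (mul_smul_comm (μ k) a g).symm
  | add x y hx hy => rw [map_add, map_add, hx, hy, map_add, mul_add]

theorem mulT_rmulT {e : Module.Dual ℝ U →ₗ[ℝ] Ext V} (he : ∀ μ, gr (e μ) = -e μ) (a : Ext V)
    (θ : Ext V ⊗[ℝ] Module.Dual ℝ U) : mulT e (rmulT a θ) = mulT e θ * gr a := by
  induction θ with
  | zero => simp
  | tmul g μ =>
    change g * a * e μ = g * e μ * gr a
    rw [mul_assoc, mul_assoc, odd_mul_comm (he μ), gr_gr]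
  | add x y hx hy => rw [map_add, map_add, hx, hy, map_add, add_mul]

theorem mulT_lmulT (e : Module.Dual ℝ U →ₗ[ℝ] Ext V) (a : Ext V)
    (θ : Ext V ⊗[ℝ] Module.Dual ℝ U) : mulT e (lmulT a θ) = a * mulT e θ := by
  induction θ with
  | zero => simp
  | tmul g μ => exact mul_assoc a g (e μ)
  | add x y hx hy => rw [map_add, map_add, hx, hy, map_add, mul_add]

/-- A tensor represents a differential in the directions of the even antifields. Its value under
`mulT e` depends only on the directional derivatives, so it does not matter which tensor represents
the differential. -/
theorem mulT_eq_zero (e : Module.Dual ℝ U →ₗ[ℝ] Ext V) {θ : Ext V ⊗[ℝ] Module.Dual ℝ U}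
    (h : ∀ k, ctrT k θ = 0) : mulT e θ = 0 := by
  obtain ⟨s, rfl⟩ := TensorProduct.exists_finset θ
  rw [map_sum]
  refine sum_mul_eq_zero s (fun j => j.1) (fun j => j.2) e fun k => ?_
  have := h k
  rw [map_sum] at this
  exact this

/-- A linear extension from the jet functionals is arbitrary elsewhere, and its parity must be
corrected. Averaging with the grade involution does so and leaves values that already have the right
parity untouched. -/
theorem exists_parity_part {e : Module.Dual ℝ U →ₗ[ℝ] Ext V} (s : ℝ) (hs : s * s = 1) :
    ∃ e' : Module.Dual ℝ U →ₗ[ℝ] Ext V, (∀ μ, gr (e' μ) = s • e' μ) ∧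
      ∀ μ, gr (e μ) = s • e μ → e' μ = e μ := by
  refine ⟨(2⁻¹ : ℝ) • (e + s • (gr.toLinearMap ∘ₗ e)), fun μ => ?_, fun μ h => ?_⟩
  · change gr ((2⁻¹ : ℝ) • (e μ + s • gr (e μ))) = s • ((2⁻¹ : ℝ) • (e μ + s • gr (e μ)))
    rw [map_smul, map_add, map_smul, gr_gr, smul_comm s, smul_add s, smul_smul, hs, one_smul,
      add_comm]
  · change (2⁻¹ : ℝ) • (e μ + s • gr (e μ)) = e μ
    rw [h, smul_smul, hs, one_smul, ← two_smul ℝ (e μ), smul_smul]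
    norm_num

end Tensor

variable {n d : ℕ} {X Y : Type}
  [TopologicalSpace X] [ChartedSpace (EuclideanSpace ℝ (Fin n)) X] [IsManifold (𝓡 n) ∞ X]
  [T2Space X] [TopologicalSpace Y] [ChartedSpace (EuclideanSpace ℝ (Fin d)) Y]
  [IsManifold (𝓡 d) ∞ Y] {B : FieldSpace n d X Y} {ι : Type} {K : Antifields n X ι}

/-- The coefficient functions of graded functions along a section, cut off. -/
theorem exists_cutoff_test (z : JetPt B × QEven B K) (ks : List (QOdd B K)) :
    ∃ κ : P B K →ₗ[Sm n X] Sm n X, ∀ Φ : P B K, (κ Φ : X → ℝ) =ᶠ[𝓝 z.1.x]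
      fun x => testEval ks (along (Φ : Fun B K) z.1.s z.2 x) := by
  obtain ⟨χ, h1, h2⟩ := exists_bump (n := n) z.1.x z.1.isSec.eventually
  have hadd : ∀ (g h : Val B K), testEval ks (g + h) = testEval ks g + testEval ks h := tst_add ks
  let f : P B K → Sm n X := fun Φ =>
    ⟨fun x => χ x * testEval ks (along (Φ : Fun B K) z.1.s z.2 x), by
      refine contMDiff_of_tsupport fun x' hx' => ?_
      have hx : x' ∈ tsupport χ := tsupport_mul_subset_left hx'
      have hs : IsSecAt B z.1.s x' := h2 hx
      obtain ⟨a, ha⟩ := exists_smooth_tst Φ.2 (⟨x', z.1.s, hs⟩, z.2) ks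
      exact χ.contMDiff.contMDiffAt.mul (a.contMDiff.contMDiffAt.congr_of_eventuallyEq ha.symm)⟩
  refine ⟨{ toFun := f, map_add' := fun Φ Ψ => ?_, map_smul' := fun a Φ => ?_ }, fun Φ => ?_⟩
  · ext x
    change χ x * testEval ks (along ((Φ : Fun B K) + (Ψ : Fun B K)) z.1.s z.2 x) =
      χ x * testEval ks (along (Φ : Fun B K) z.1.s z.2 x) +
      χ x * testEval ks (along (Ψ : Fun B K) z.1.s z.2 x)
    rw [along_add, ← mul_add, ← hadd]
  · ext x
    change χ x * testEval ks (along (a • (Φ : Fun B K)) z.1.s z.2 x) =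
      a x * (χ x * testEval ks (along (Φ : Fun B K) z.1.s z.2 x))
    by_cases hS : IsSecAt B z.1.s x
    · rw [along_of_isSecAt _ _ hS, along_of_isSecAt _ _ hS, Fun.smul_apply]
      have : testEval ks (a x • (Φ : Fun B K) (⟨x, z.1.s, hS⟩, z.2)) =
        a x * testEval ks ((Φ : Fun B K) (⟨x, z.1.s, hS⟩, z.2)) := tst_smul ks _ _
      rw [mul_left_comm, ← this]
    · rw [Sm.eq_zero_of_tsupport h2 hS, zero_mul, zero_mul, mul_zero]
  · filter_upwards [h1] with x hx
    change χ x * testEval ks (along (Φ : Fun B K) z.1.s z.2 x) = _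
    rw [hx, one_mul]

/-- The jets of a density at a point are tested by a section of the density-dual. -/
theorem exists_test_section {C : VB n X} (Δ : Sec C →ₗ[Sm n X] Dens B K)
    (z : JetPt B × QEven B K) (ks : List (QOdd B K)) :
    ∃ k : DensDual C, ∀ l v σ, densEval z.1.x l v σ k =
      testEval ks (totalDerivs l (Δ v σ : Fun B K) z) := by
  obtain ⟨κ, hκ⟩ := exists_cutoff_test z ks
  let k : Sec C →ₗ[Sm n X] TopForm n X :=
    { toFun := fun v => κ.compAlternatingMap (Δ v)
      map_add' := fun v w => by
        rw [map_add]; exact LinearMap.compAlternatingMap_add _ _ _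
      map_smul' := fun a v => by
        ext1 σ
        change κ (Δ (a • v) σ) = a • κ (Δ v σ)
        rw [map_smul Δ]
        exact map_smul κ a (Δ v σ) }
  refine ⟨k, fun l v σ => ?_⟩
  rw [totalDerivs_tst (Δ v σ).2 l z ks (hκ (Δ v σ))]
  rfl

/-- The linear functionals of the jets of a density at a point. -/
theorem exists_jet_values {C : VB n X} (Δ : Sec C →ₗ[Sm n X] Dens B K)
    (z : JetPt B × QEven B K) :
    ∃ e : Module.Dual ℝ (DensDual C) →ₗ[ℝ] Val B K, ∀ l v σ, e (densEval z.1.x l v σ) =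
      totalDerivs l (Δ v σ : Fun B K) z := by
  -- A linear relation among the jet functionals holds in particular on the section k of the
  -- density-dual whose jets are the tested jets of Δ. Hence every test of the same relation among
  -- the jets of Δ vanishes, and so does the relation itself.
  obtain ⟨e, he⟩ := exists_linearMap_of_relations
    (J := List (VF n X) × Sec C × (Fin n → VF n X))
    (fun j => (densEval z.1.x j.1 j.2.1 j.2.2 : Module.Dual ℝ (DensDual C)))
    (fun j => totalDerivs j.1 (Δ j.2.1 j.2.2 : Fun B K) z) (fun c hc => by
      refine eq_zero_of_tst fun ks => ?_
      obtain ⟨k, hk⟩ := exists_test_section Δ z ks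
      change tstL ks _ = 0
      have h1 := LinearMap.congr_fun hc k
      rw [Finsupp.linearCombination_apply, Finsupp.sum] at h1 ⊢
      rw [map_sum]
      rw [LinearMap.sum_apply] at h1
      refine Eq.trans (Finset.sum_congr rfl fun j _ => ?_) h1
      rw [map_smul, LinearMap.smul_apply, hk]
      rfl)
  exact ⟨e, fun l v σ => he (l, v, σ)⟩

end KoszulTate
end

noncomputable section

namespace KoszulTate

variable {n d : ℕ} {X Y : Type}
  [TopologicalSpace X] [ChartedSpace (EuclideanSpace ℝ (Fin n)) X] [IsManifold (𝓡 n) ∞ X]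
  [T2Space X] [TopologicalSpace Y] [ChartedSpace (EuclideanSpace ℝ (Fin d)) Y]
  [IsManifold (𝓡 d) ∞ Y] {B : FieldSpace n d X Y} {ι : Type} {K : Antifields n X ι}

/-! #### All the antifields at once -/

/-- The bundles whose density-duals are the even antifields. -/
def evenVB (B : FieldSpace n d X Y) (K : Antifields n X ι) : Option ι → VB n X
  | none => B.F
  | some i => K.V i

/-- The bundles whose density-duals are the odd antifields. -/
def oddVB (B : FieldSpace n d X Y) (K : Antifields n X ι) : Option ι → VB n X
  | none => B.W
  | some i => K.E i

/-- The antifield numbers. -/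
def antNum (K : Antifields n X ι) : Option ι → ℕ
  | none => 1
  | some i => K.ant i

/-- The components of a section of the bundle of even antifields. -/
def evenProj (B : FieldSpace n d X Y) (K : Antifields n X ι) :
    ∀ o : Option ι, QEven B K →ₗ[ℝ] DensDual (evenVB B K o)
  | none => LinearMap.fst ℝ (DensDual B.F) (∀ i, DensDual (K.V i))
  | some i => LinearMap.proj i ∘ₗ LinearMap.snd ℝ (DensDual B.F) (∀ i, DensDual (K.V i))

/-- The antifield components of a section of the bundle of odd variables. -/
def oddProj (B : FieldSpace n d X Y) (K : Antifields n X ι) :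
    ∀ o : Option ι, QOdd B K →ₗ[ℝ] DensDual (oddVB B K o)
  | none => QOdd.anti B K
  | some i => QOdd.ghost B K i

open Classical in
/-- The inclusion of a component. -/
def evenInj (B : FieldSpace n d X Y) (K : Antifields n X ι) :
    ∀ o : Option ι, DensDual (evenVB B K o) →ₗ[ℝ] QEven B K
  | none => LinearMap.inl ℝ (DensDual B.F) (∀ i, DensDual (K.V i))
  | some i => LinearMap.inr ℝ (DensDual B.F) (∀ i, DensDual (K.V i)) ∘ₗ
      LinearMap.single ℝ (fun i => DensDual (K.V i)) i

open Classical in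
/-- The inclusion of a component. -/
def oddInj (B : FieldSpace n d X Y) (K : Antifields n X ι) :
    ∀ o : Option ι, DensDual (oddVB B K o) →ₗ[ℝ] QOdd B K
  | none => LinearMap.inr ℝ (Sec B.F) (DensDual B.W × ∀ i, DensDual (K.E i)) ∘ₗ
      LinearMap.inl ℝ (DensDual B.W) (∀ i, DensDual (K.E i))
  | some i => LinearMap.inr ℝ (Sec B.F) (DensDual B.W × ∀ i, DensDual (K.E i)) ∘ₗ
      LinearMap.inr ℝ (DensDual B.W) (∀ i, DensDual (K.E i)) ∘ₗ
      LinearMap.single ℝ (fun i => DensDual (K.E i)) i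

theorem evenProj_evenInj (o : Option ι) : evenProj B K o ∘ₗ evenInj B K o = LinearMap.id := by
  cases o with
  | none => rfl
  | some i =>
    classical
    exact LinearMap.ext fun k => Pi.single_eq_same (M := fun i => DensDual (K.V i)) i k

theorem evenProj_evenInj_ne {o o' : Option ι} (h : o ≠ o') :
    evenProj B K o ∘ₗ evenInj B K o' = 0 := by
  cases o with
  | none =>
    cases o' with
    | none => exact absurd rfl h
    | some i => rfl
  | some i =>
    cases o' with
    | none => rfl
    | some j =>
      classical
      exact LinearMap.ext fun k => Pi.single_eq_of_ne (M := fun i => DensDual (K.V i))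
        (fun e => h (congrArg some e)) k

theorem oddProj_oddInj (o : Option ι) : oddProj B K o ∘ₗ oddInj B K o = LinearMap.id := by
  cases o with
  | none => rfl
  | some i =>
    classical
    exact LinearMap.ext fun k => Pi.single_eq_same (M := fun i => DensDual (K.E i)) i k

theorem oddProj_oddInj_ne {o o' : Option ι} (h : o ≠ o') :
    oddProj B K o ∘ₗ oddInj B K o' = 0 := by
  cases o with
  | none =>
    cases o' with
    | none => exact absurd rfl h
    | some i => rfl
  | some i =>
    cases o' with
    | none => rfl
    | some j =>
      classical
      exact LinearMap.ext fun k => Pi.single_eq_of_ne (M := fun i => DensDual (K.E i))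
        (fun e => h (congrArg some e)) k

theorem field_oddInj (o : Option ι) : QOdd.field B K ∘ₗ oddInj B K o = 0 := by
  cases o <;> rfl

/-- The even antifields and their derivatives. -/
def genEven (B : FieldSpace n d X Y) (K : Antifields n X ι) (o : Option ι) (l : List (VF n X))
    (v : Sec (evenVB B K o)) (σ : Fin n → VF n X) : Fun B K := fun z =>
  algebraMap ℝ _ (densEval z.1.x l v σ (evenProj B K o z.2))

/-- The odd antifields and their derivatives. -/
def genOdd (B : FieldSpace n d X Y) (K : Antifields n X ι) (o : Option ι) (l : List (VF n X))
    (v : Sec (oddVB B K o)) (σ : Fin n → VF n X) : Fun B K := fun z =>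
  ExteriorAlgebra.ι ℝ (densEval z.1.x l v σ ∘ₗ oddProj B K o)

theorem Gen.cases_antifield {r l : ℕ} {Φ : Fun B K} (h : Gen B K r l Φ) :
    Φ ∈ ordLe B K r 0 ∨
    (∃ o t v σ, antNum K o ≤ l ∧ t.length ≤ r ∧ Φ = genEven B K o t v σ) ∨
    (∃ o t v σ, antNum K o ≤ l ∧ t.length ≤ r ∧ Φ = genOdd B K o t v σ) := by
  cases h with
  | body f hf =>
    exact Or.inl (genAlg_le_ordLe _ _ (Algebra.subset_adjoin (Gen.body f hf)))
  | field t ht κ =>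
    exact Or.inl (genAlg_le_ordLe _ _ (Algebra.subset_adjoin (Gen.field t ht κ)))
  | antiEven hl t ht v σ => exact Or.inr (Or.inl ⟨none, t, v, σ, hl, ht, rfl⟩)
  | antiOdd hl t ht v σ => exact Or.inr (Or.inr ⟨none, t, v, σ, hl, ht, rfl⟩)
  | ghostEven i hl t ht v σ => exact Or.inr (Or.inl ⟨some i, t, v, σ, hl, ht, rfl⟩)
  | ghostOdd i hl t ht v σ => exact Or.inr (Or.inr ⟨some i, t, v, σ, hl, ht, rfl⟩)

theorem gen_genEven {r : ℕ} (o : Option ι) {t : List (VF n X)} (ht : t.length ≤ r)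
    (v : Sec (evenVB B K o)) (σ : Fin n → VF n X) : Gen B K r (antNum K o) (genEven B K o t v σ) := by
  cases o with
  | none => exact Gen.antiEven le_rfl t ht v σ
  | some i => exact Gen.ghostEven i le_rfl t ht v σ

theorem gen_genOdd {r : ℕ} (o : Option ι) {t : List (VF n X)} (ht : t.length ≤ r)
    (v : Sec (oddVB B K o)) (σ : Fin n → VF n X) : Gen B K r (antNum K o) (genOdd B K o t v σ) := by
  cases o with
  | none => exact Gen.antiOdd le_rfl t ht v σ
  | some i => exact Gen.ghostOdd i le_rfl t ht v σ

theorem genEven_mem (o : Option ι) (t : List (VF n X)) (v : Sec (evenVB B K o))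
    (σ : Fin n → VF n X) : genEven B K o t v σ ∈ P B K :=
  ordLe_le_P _ _ (genAlg_le_ordLe _ _ (Algebra.subset_adjoin (gen_genEven o le_rfl v σ)))

theorem genOdd_mem (o : Option ι) (t : List (VF n X)) (v : Sec (oddVB B K o))
    (σ : Fin n → VF n X) : genOdd B K o t v σ ∈ P B K :=
  ordLe_le_P _ _ (genAlg_le_ordLe _ _ (Algebra.subset_adjoin (gen_genOdd o le_rfl v σ)))

theorem totalDeriv_genEven (o : Option ι) (t : List (VF n X)) (v : Sec (evenVB B K o))
    (σ : Fin n → VF n X) (τ : VF n X) :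
    totalDeriv τ (genEven B K o t v σ) = genEven B K o (τ :: t) v σ := by
  cases o with
  | none => exact (isTD_antiEven t v σ).2 τ
  | some i => exact (isTD_ghostEven i t v σ).2 τ

theorem totalDeriv_genOdd (o : Option ι) (t : List (VF n X)) (v : Sec (oddVB B K o))
    (σ : Fin n → VF n X) (τ : VF n X) :
    totalDeriv τ (genOdd B K o t v σ) = genOdd B K o (τ :: t) v σ := by
  cases o with
  | none => exact (isTD_antiOdd t v σ).2 τ
  | some i => exact (isTD_ghostOdd i t v σ).2 τ

theorem grF_genEven (o : Option ι) (t : List (VF n X)) (v : Sec (evenVB B K o))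
    (σ : Fin n → VF n X) : grF (genEven B K o t v σ) = genEven B K o t v σ :=
  funext fun z => gr_algebraMap _

theorem grF_genOdd (o : Option ι) (t : List (VF n X)) (v : Sec (oddVB B K o))
    (σ : Fin n → VF n X) : grF (genOdd B K o t v σ) = -genOdd B K o t v σ :=
  funext fun z => gr_ι _

theorem isAnt_genEven (o : Option ι) (t : List (VF n X)) (v : Sec (evenVB B K o))
    (σ : Fin n → VF n X) : IsAnt B K (antNum K o) (genEven B K o t v σ) := by
  intro s z
  refine (AlgHom.commutes _ _).trans ?_
  have h : evenProj B K o (scaleEven B K (fun j => s ^ j) z.2) = s ^ antNum K o • evenProj B K o z.2 := by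
    cases o <;> rfl
  rw [h, map_smul, smul_eq_mul, map_mul, ← Algebra.smul_def]
  rfl

theorem isAnt_genOdd (o : Option ι) (t : List (VF n X)) (v : Sec (oddVB B K o))
    (σ : Fin n → VF n X) : IsAnt B K (antNum K o) (genOdd B K o t v σ) := by
  intro s z
  refine (ExteriorAlgebra.map_apply_ι _ _).trans ?_
  refine Eq.trans ?_ (map_smul (ExteriorAlgebra.ι ℝ) (s ^ antNum K o) _)
  refine congrArg _ (LinearMap.ext fun q => ?_)
  have h : oddProj B K o (scaleOdd B K (fun j => s ^ j) q) = s ^ antNum K o • oddProj B K o q := by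
    cases o <;> rfl
  change densEval z.1.x t v σ (oddProj B K o (scaleOdd B K (fun j => s ^ j) q)) = _
  rw [h, map_smul]
  rfl

/-! #### The derivation at a point -/

theorem ptDer_hasDerivAt : PtDer (0 : ℝ) (fun u u' => HasDerivAt u u' 0) where
  const c := hasDerivAt_const 0 c
  add u v u' v' h h' := h.add h'
  mul u v u' v' h h' := h.mul h'

/-- The derivative of `Φ` at `z` is `γ`, for the derivation with values `e` on the linear
functions of the even antifields and with values `δ` on the exterior algebra. -/
def DerRel (e : Module.Dual ℝ (QEven B K) →ₗ[ℝ] Val B K) (δ : Val B K →ₗ[ℝ] Val B K)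
    (Φ : Fun B K) (z : JetPt B × QEven B K) (γ : Val B K) : Prop :=
  ∃ θ : Ext (QOdd B K) ⊗[ℝ] Module.Dual ℝ (QEven B K),
    (∀ k, WD (fun u u' => HasDerivAt u u' 0) (fun t : ℝ => Φ (z.1, z.2 + t • k)) (ctrT k θ)) ∧
      γ = δ (Φ z) + mulT e θ

section

variable {e : Module.Dual ℝ (QEven B K) →ₗ[ℝ] Val B K} {δ : Val B K →ₗ[ℝ] Val B K}
  {Φ Ψ : Fun B K} {z : JetPt B × QEven B K} {γ γ' : Val B K}

/-- The tensor is not unique, but its contractions are, being derivatives of real functions under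
all tests; by `mulT_eq_zero` they determine the value. -/
theorem DerRel.unique (h : DerRel e δ Φ z γ) (h' : DerRel e δ Φ z γ') : γ = γ' := by
  obtain ⟨θ, h1, rfl⟩ := h
  obtain ⟨θ', h1', rfl⟩ := h'
  rw [add_right_inj, ← sub_eq_zero, ← map_sub]
  refine mulT_eq_zero e fun k => ?_
  rw [map_sub, sub_eq_zero]
  exact eq_of_tst fun ks => (h1 k ks).unique (h1' k ks)

theorem DerRel.add (h : DerRel e δ Φ z γ) (h' : DerRel e δ Ψ z γ') :
    DerRel e δ (Φ + Ψ) z (γ + γ') := by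
  obtain ⟨θ, h1, rfl⟩ := h
  obtain ⟨θ', h1', rfl⟩ := h'
  refine ⟨θ + θ', fun k => ?_, ?_⟩
  · rw [map_add]
    exact WD.add ptDer_hasDerivAt (h1 k) (h1' k)
  · rw [Fun.add_apply, map_add, map_add]
    abel

theorem DerRel.mul (he : ∀ μ, gr (e μ) = -e μ)
    (hδ : ∀ a b : Val B K, δ (a * b) = δ a * gr b + a * δ b)
    (h : DerRel e δ Φ z γ) (h' : DerRel e δ Ψ z γ') :
    DerRel e δ (Φ * Ψ) z (γ * gr (Ψ z) + Φ z * γ') := by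
  obtain ⟨θ, h1, rfl⟩ := h
  obtain ⟨θ', h1', rfl⟩ := h'
  refine ⟨rmulT (Ψ z) θ + lmulT (Φ z) θ', fun k => ?_, ?_⟩
  · rw [map_add, ctrT_rmulT, ctrT_lmulT]
    have hz : (z.1, z.2 + (0 : ℝ) • k) = z := by simp
    have := WD.mul ptDer_hasDerivAt (h1 k) (h1' k)
    rw [hz] at this
    exact this
  · rw [Fun.mul_apply, hδ, map_add, mulT_rmulT he, mulT_lmulT, add_mul, mul_add]
    abel

theorem DerRel.of_const (h0 : ∀ q, Φ (z.1, q) = Φ z) : DerRel e δ Φ z (δ (Φ z)) := by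
  refine ⟨0, fun k => ?_, by rw [map_zero, add_zero]⟩
  rw [map_zero]
  simp only [h0]
  exact WD.const ptDer_hasDerivAt _

theorem DerRel.of_linear (h0 : ∀ r, δ (algebraMap ℝ _ r) = 0) (μ : Module.Dual ℝ (QEven B K))
    (hΦ : ∀ q, Φ (z.1, q) = algebraMap ℝ _ (μ q)) : DerRel e δ Φ z (e μ) := by
  refine ⟨(1 : Ext (QOdd B K)) ⊗ₜ[ℝ] μ, fun k => ?_, ?_⟩
  · have hμ : ∀ t : ℝ, μ (z.2 + t • k) = μ z.2 + t * μ k := fun t => by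
      rw [map_add, map_smul, smul_eq_mul]
    simp only [hΦ, ctrT_tmul, ← Algebra.algebraMap_eq_smul_one, hμ]
    refine WD.algebraMap (V := QOdd B K) ptDer_hasDerivAt (u' := μ k) (u := fun t : ℝ => μ z.2 + t * μ k) ?_
    simpa using ((hasDerivAt_id (0 : ℝ)).mul_const (μ k)).const_add (μ z.2)
  · rw [show Φ z = algebraMap ℝ _ (μ z.2) from hΦ z.2, h0, zero_add, mulT_tmul, one_mul]

theorem DerRel.congr (h : DerRel e δ Φ z γ) (hΨ : ∀ q, Ψ (z.1, q) = Φ (z.1, q)) :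
    DerRel e δ Ψ z γ := by
  obtain ⟨θ, h1, rfl⟩ := h
  refine ⟨θ, fun k => ?_, ?_⟩
  · simp only [hΨ]
    exact h1 k
  · rw [show Ψ z = Φ z from hΨ z.2]

end

end KoszulTate
end

/-! ### Gluing the derivations at points into a linear map of the ring. -/

noncomputable section

namespace KoszulTate

variable {n d : ℕ} {X Y : Type}
  [TopologicalSpace X] [ChartedSpace (EuclideanSpace ℝ (Fin n)) X] [IsManifold (𝓡 n) ∞ X]
  [T2Space X] [TopologicalSpace Y] [ChartedSpace (EuclideanSpace ℝ (Fin d)) Y]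
  [IsManifold (𝓡 d) ∞ Y] {B : FieldSpace n d X Y} {ι : Type} {K : Antifields n X ι}

theorem tdP_grP (τ : VF n X) (Φ : P B K) : tdP τ (grP Φ) = grP (tdP τ Φ) := by
  refine Subtype.ext (funext fun z => ?_)
  refine eq_of_tst fun ks => ?_
  change testEval ks (totalDerivs [τ] (grP Φ : Fun B K) z) =
    tst ks (gr (totalDerivs [τ] (Φ : Fun B K) z))
  obtain ⟨a, ha⟩ := exists_smooth_tst Φ.2 z ks
  rw [tst_gr, show tst ks (totalDerivs [τ] (Φ : Fun B K) z) = _ from totalDerivs_tst Φ.2 [τ] z ks ha,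
    totalDerivs_tst (grP Φ).2 [τ] z ks (a := ((-1 : ℝ) ^ ks.length) • a) ?_, map_smul]
  · rfl
  · filter_upwards [ha, z.1.isSec.eventually] with x hx hs
    rw [Sm.rsmul_apply, hx, along_of_isSecAt _ _ hs, along_of_isSecAt _ _ hs]
    exact (tst_gr ks _).symm

/-- Values of an odd derivation of antifield number `-1` on the antifields. -/
structure AntiValues (B : FieldSpace n d X Y) (K : Antifields n X ι) where
  even : ∀ o, Sec (evenVB B K o) →ₗ[Sm n X] Dens B K
  odd : ∀ o, Sec (oddVB B K o) →ₗ[Sm n X] Dens B K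
  ord : ℕ
  ant_pos : ∀ o, 1 ≤ antNum K o
  even_mem : ∀ o v σ, (even o v σ : Fun B K) ∈ ordLe B K ord (antNum K o)
  odd_mem : ∀ o v σ, (odd o v σ : Fun B K) ∈ ordLe B K ord (antNum K o)
  even_par : ∀ o v σ, grP (even o v σ) = -even o v σ
  odd_par : ∀ o v σ, grP (odd o v σ) = odd o v σ
  even_ant : ∀ o v σ, IsAnt B K (antNum K o - 1) (even o v σ : Fun B K)
  odd_ant : ∀ o v σ, IsAnt B K (antNum K o - 1) (odd o v σ : Fun B K)

theorem grP_tdsP (t : List (VF n X)) (Φ : P B K) : grP (tdsP t Φ) = tdsP t (grP Φ) := by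
  induction t with
  | nil => rfl
  | cons τ t ih => rw [tdsP_cons, tdsP_cons, ← tdP_grP, ih]

theorem tdsP_neg (t : List (VF n X)) (Φ : P B K) : tdsP t (-Φ) = -tdsP t Φ := by
  induction t with
  | nil => rfl
  | cons τ t ih => rw [tdsP_cons, tdsP_cons, ih, tdP_neg]

/-- At a fixed point everything is linear algebra: the prescribed jets define linear maps on the jet
functionals of each bundle of antifields, and finitely many bundles allow these to be summed. The
values on odd functionals then generate an odd derivation of the exterior algebra. -/
theorem AntiValues.exists_point [Finite ι] (A : AntiValues B K) (z : JetPt B × QEven B K) :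
    ∃ (e : Module.Dual ℝ (QEven B K) →ₗ[ℝ] Val B K) (δ : Val B K →ₗ[ℝ] Val B K),
      (∀ μ, gr (e μ) = -e μ) ∧ (∀ a b : Val B K, δ (a * b) = δ a * gr b + a * δ b) ∧
      (∀ r, δ (algebraMap ℝ _ r) = 0) ∧
      (∀ l (κ : Sec B.F →ₗ[Sm n X] Sm n X), δ (ExteriorAlgebra.ι ℝ
        (jetEval z.1.x l ∘ₗ κ.restrictScalars ℝ ∘ₗ QOdd.field B K)) = 0) ∧
      (∀ o t v σ, e (densEval z.1.x t v σ ∘ₗ evenProj B K o) =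
        (tdsP t (A.even o v σ) : Fun B K) z) ∧
      (∀ o t v σ, δ (ExteriorAlgebra.ι ℝ (densEval z.1.x t v σ ∘ₗ oddProj B K o)) =
        (tdsP t (A.odd o v σ) : Fun B K) z) := by
  classical
  have := Fintype.ofFinite ι
  choose e0 he0 using fun o => exists_jet_values (A.even o) z
  choose e1 he1 using fun o => exists_jet_values (A.odd o) z
  let E0 : Module.Dual ℝ (QEven B K) →ₗ[ℝ] Val B K := ∑ o, e0 o ∘ₗ (evenInj B K o).dualMap
  let E1 : Module.Dual ℝ (QOdd B K) →ₗ[ℝ] Val B K := ∑ o, e1 o ∘ₗ (oddInj B K o).dualMap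
  have hE0 : ∀ o t v σ, E0 (densEval z.1.x t v σ ∘ₗ evenProj B K o) =
      (tdsP t (A.even o v σ) : Fun B K) z := fun o t v σ => by
    rw [LinearMap.sum_apply, Finset.sum_eq_single o]
    · rw [coe_tdsP, ← he0]
      change e0 o (densEval z.1.x t v σ ∘ₗ (evenProj B K o ∘ₗ evenInj B K o)) = _
      rw [evenProj_evenInj, LinearMap.comp_id]
    · intro o' _ ho
      change e0 o' (densEval z.1.x t v σ ∘ₗ (evenProj B K o ∘ₗ evenInj B K o')) = 0
      rw [evenProj_evenInj_ne ho.symm, LinearMap.comp_zero, map_zero]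
    · exact fun h => absurd (Finset.mem_univ _) h
  have hE1 : ∀ o t v σ, E1 (densEval z.1.x t v σ ∘ₗ oddProj B K o) =
      (tdsP t (A.odd o v σ) : Fun B K) z := fun o t v σ => by
    rw [LinearMap.sum_apply, Finset.sum_eq_single o]
    · rw [coe_tdsP, ← he1]
      change e1 o (densEval z.1.x t v σ ∘ₗ (oddProj B K o ∘ₗ oddInj B K o)) = _
      rw [oddProj_oddInj, LinearMap.comp_id]
    · intro o' _ ho
      change e1 o' (densEval z.1.x t v σ ∘ₗ (oddProj B K o ∘ₗ oddInj B K o')) = 0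
      rw [oddProj_oddInj_ne ho.symm, LinearMap.comp_zero, map_zero]
    · exact fun h => absurd (Finset.mem_univ _) h
  have hE1f : ∀ l (κ : Sec B.F →ₗ[Sm n X] Sm n X),
      E1 (jetEval z.1.x l ∘ₗ κ.restrictScalars ℝ ∘ₗ QOdd.field B K) = 0 := fun l κ => by
    rw [LinearMap.sum_apply]
    refine Finset.sum_eq_zero fun o _ => ?_
    change e1 o (jetEval z.1.x l ∘ₗ κ.restrictScalars ℝ ∘ₗ (QOdd.field B K ∘ₗ oddInj B K o)) = 0
    rw [field_oddInj, LinearMap.comp_zero, LinearMap.comp_zero, map_zero]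
  -- The derivation is odd, so its values on even antifields are odd (sign −1), while those on odd
  -- antifields are even (sign 1), as `exists_oddDer` requires.
  obtain ⟨F0, hF0, hF0'⟩ := exists_parity_part (e := E0) (-1) (by norm_num)
  obtain ⟨F1, hF1, hF1'⟩ := exists_parity_part (e := E1) 1 (by norm_num)
  obtain ⟨δ, h1, h2, h3⟩ := exists_oddDer F1 fun l => by rw [hF1, one_smul]
  refine ⟨F0, δ, fun μ => by rw [hF0, neg_one_smul], h3, h2, fun l κ => ?_, fun o t v σ => ?_,
    fun o t v σ => ?_⟩
  · rw [h1, hF1', hE1f]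
    rw [hE1f, map_zero, smul_zero]
  · rw [hF0', hE0]
    rw [hE0, neg_one_smul]
    have := congrArg (fun Φ : P B K => (Φ : Fun B K) z) (grP_tdsP t (A.even o v σ))
    rw [A.even_par, tdsP_neg] at this
    exact this
  · rw [h1, hF1', hE1]
    rw [hE1, one_smul]
    have := congrArg (fun Φ : P B K => (Φ : Fun B K) z) (grP_tdsP t (A.odd o v σ))
    rw [A.odd_par] at this
    exact this

/-- The values of a derivation at all the points. -/
structure AntiValues.PointDer (A : AntiValues B K) where
  e : JetPt B × QEven B K → Module.Dual ℝ (QEven B K) →ₗ[ℝ] Val B K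
  δ : JetPt B × QEven B K → Val B K →ₗ[ℝ] Val B K
  odd : ∀ z μ, gr (e z μ) = -e z μ
  mul : ∀ z (a b : Val B K), δ z (a * b) = δ z a * gr b + a * δ z b
  const : ∀ z r, δ z (algebraMap ℝ _ r) = 0
  field : ∀ z l (κ : Sec B.F →ₗ[Sm n X] Sm n X), δ z (ExteriorAlgebra.ι ℝ
        (jetEval z.1.x l ∘ₗ κ.restrictScalars ℝ ∘ₗ QOdd.field B K)) = 0
  genEven : ∀ z o t v σ, e z (densEval z.1.x t v σ ∘ₗ evenProj B K o) =
        (tdsP t (A.even o v σ) : Fun B K) z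
  genOdd : ∀ z o t v σ, δ z (ExteriorAlgebra.ι ℝ (densEval z.1.x t v σ ∘ₗ oddProj B K o)) =
        (tdsP t (A.odd o v σ) : Fun B K) z

theorem AntiValues.nonempty_pointDer [Finite ι] (A : AntiValues B K) : Nonempty A.PointDer := by
  choose e δ h1 h2 h3 h4 h5 h6 using A.exists_point
  exact ⟨⟨e, δ, h1, h2, h3, h4, h5, h6⟩⟩

/-- The derivative of `Φ` is `Ψ`. -/
def AntiValues.PointDer.Rel {A : AntiValues B K} (D : A.PointDer) (Φ Ψ : Fun B K) : Prop :=
  ∀ z, DerRel (D.e z) (D.δ z) Φ z (Ψ z)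

namespace AntiValues.PointDer

variable {A : AntiValues B K} (D : A.PointDer)

theorem rel_unique {Φ Ψ Ψ' : Fun B K} (h : D.Rel Φ Ψ) (h' : D.Rel Φ Ψ') : Ψ = Ψ' :=
  funext fun z => (h z).unique (h' z)

theorem rel_add {Φ Φ' Ψ Ψ' : Fun B K} (h : D.Rel Φ Φ') (h' : D.Rel Ψ Ψ') :
    D.Rel (Φ + Ψ) (Φ' + Ψ') := fun z => (h z).add (h' z)

theorem rel_mul {Φ Φ' Ψ Ψ' : Fun B K} (h : D.Rel Φ Φ') (h' : D.Rel Ψ Ψ') :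
    D.Rel (Φ * Ψ) (Φ' * grF Ψ + Φ * Ψ') := fun z =>
  DerRel.mul (D.odd z) (D.mul z) (h z) (h' z)

theorem rel_body (f : JetPt B → ℝ) : D.Rel (bodyFun B K f) 0 := fun z => by
  have h : DerRel (D.e z) (D.δ z) (bodyFun B K f) z _ := DerRel.of_const fun q => rfl
  rwa [show D.δ z (bodyFun B K f z) = 0 from D.const z _] at h

theorem rel_algebraMap (a : Sm n X) : D.Rel (algebraMap (Sm n X) (Fun B K) a) 0 :=
  D.rel_body fun p => a p.x

theorem rel_smul {Φ Φ' : Fun B K} (h : D.Rel Φ Φ') (a : Sm n X) : D.Rel (a • Φ) (a • Φ') := by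
  have := D.rel_mul (D.rel_algebraMap a) h
  rwa [zero_mul, zero_add, ← Algebra.smul_def, ← Algebra.smul_def] at this

theorem rel_genEven (o : Option ι) (t : List (VF n X)) (v : Sec (evenVB B K o))
    (σ : Fin n → VF n X) : D.Rel (KoszulTate.genEven B K o t v σ) (tdsP t (A.even o v σ) : Fun B K) :=
  fun z => by
    rw [← D.genEven z]
    exact DerRel.of_linear (D.const z) _ fun q => rfl

theorem rel_genOdd (o : Option ι) (t : List (VF n X)) (v : Sec (oddVB B K o))
    (σ : Fin n → VF n X) : D.Rel (KoszulTate.genOdd B K o t v σ) (tdsP t (A.odd o v σ) : Fun B K) :=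
  fun z => by
    rw [← D.genOdd z]
    exact DerRel.of_const fun q => rfl

theorem rel_field (t : List (VF n X)) (κ : Sec B.F →ₗ[Sm n X] Sm n X) :
    D.Rel (fieldGen B K t κ) 0 := fun z => by
  rw [show (0 : Fun B K) z = D.δ z (fieldGen B K t κ z) from (D.field z t κ).symm]
  exact DerRel.of_const fun q => rfl

theorem exists_rel_gen {r l : ℕ} {Φ : Fun B K} (h : Gen B K r l Φ) :
    ∃ Ψ ∈ ordLe B K (A.ord + r) l, D.Rel Φ Ψ := by
  cases h with
  | body f hf => exact ⟨0, zero_mem _, D.rel_body f⟩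
  | field t ht κ => exact ⟨0, zero_mem _, D.rel_field t κ⟩
  | antiEven hl t ht v σ =>
    refine ⟨_, ?_, D.rel_genEven none t v σ⟩
    rw [coe_tdsP]
    exact ordLe_mono B K (by omega) hl (totalDerivs_mem_ordLe (A.even_mem none v σ) t)
  | antiOdd hl t ht v σ =>
    refine ⟨_, ?_, D.rel_genOdd none t v σ⟩
    rw [coe_tdsP]
    exact ordLe_mono B K (by omega) hl (totalDerivs_mem_ordLe (A.odd_mem none v σ) t)
  | ghostEven i hl t ht v σ =>
    refine ⟨_, ?_, D.rel_genEven (some i) t v σ⟩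
    rw [coe_tdsP]
    exact ordLe_mono B K (by omega) hl (totalDerivs_mem_ordLe (A.even_mem (some i) v σ) t)
  | ghostOdd i hl t ht v σ =>
    refine ⟨_, ?_, D.rel_genOdd (some i) t v σ⟩
    rw [coe_tdsP]
    exact ordLe_mono B K (by omega) hl (totalDerivs_mem_ordLe (A.odd_mem (some i) v σ) t)

theorem exists_rel_genAlg {r l : ℕ} {Φ : Fun B K} (h : Φ ∈ genAlg B K r l) :
    ∃ Ψ ∈ ordLe B K (A.ord + r) l, D.Rel Φ Ψ := by
  induction h using Algebra.adjoin_induction with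
  | mem Φ h => exact D.exists_rel_gen h
  | algebraMap a => exact ⟨0, zero_mem _, D.rel_algebraMap a⟩
  | add Φ Ψ _ _ h h' =>
    obtain ⟨Φ', h1, h2⟩ := h
    obtain ⟨Ψ', h1', h2'⟩ := h'
    exact ⟨_, add_mem h1 h1', D.rel_add h2 h2'⟩
  | mul Φ Ψ hΦ hΨ h h' =>
    obtain ⟨Φ', h1, h2⟩ := h
    obtain ⟨Ψ', h1', h2'⟩ := h'
    have hle : ordLe B K r l ≤ ordLe B K (A.ord + r) l := ordLe_mono B K (by omega) le_rfl
    exact ⟨_, add_mem (mul_mem h1 (grF_mem_ordLe (hle (genAlg_le_ordLe _ _ hΨ))))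
      (mul_mem (hle (genAlg_le_ordLe _ _ hΦ)) h1'), D.rel_mul h2 h2'⟩

/-- The data at different points are chosen independently, yet the derivative is a graded function:
locally the Leibniz rule computes it from the prescribed values and their total derivatives. The
local answers agree by uniqueness at each point, so they glue. -/
theorem exists_rel {r l : ℕ} {Φ : Fun B K} (h : Φ ∈ ordLe B K r l) :
    ∃ Ψ ∈ ordLe B K (A.ord + r) l, D.Rel Φ Ψ := by
  have key : ∀ x₀ : X, ∃ U ∈ 𝓝 x₀, ∃ Ψ ∈ ordLe B K (A.ord + r) l,
      ∀ z : JetPt B × QEven B K, z.1.x ∈ U → DerRel (D.e z) (D.δ z) Φ z (Ψ z) := fun x₀ => by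
    obtain ⟨U, hU, Φ₀, hΦ₀, e⟩ := h x₀
    obtain ⟨Ψ, hΨ, hr⟩ := D.exists_rel_genAlg hΦ₀
    exact ⟨U, hU, Ψ, hΨ, fun z hz => (hr z).congr fun q => e (z.1, q) hz⟩
  choose U hU Ψ hΨ hr using key
  refine ⟨fun z => Ψ z.1.x z, mem_ordLe_of_local fun x₀ => ⟨U x₀, hU x₀, Ψ x₀, hΨ x₀, fun z hz => ?_⟩,
    fun z => hr _ z (mem_of_mem_nhds (hU _))⟩
  exact (hr _ z (mem_of_mem_nhds (hU _))).unique (hr x₀ z hz)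

theorem exists_rel_P (Φ : P B K) : ∃ Ψ : P B K, D.Rel (Φ : Fun B K) Ψ := by
  obtain ⟨r, l, h⟩ := Φ.2
  obtain ⟨Ψ, h1, h2⟩ := D.exists_rel h
  exact ⟨⟨Ψ, ordLe_le_P _ _ h1⟩, h2⟩

/-- The derivation as a linear map. -/
def toLin : P B K →ₗ[Sm n X] P B K where
  toFun Φ := (D.exists_rel_P Φ).choose
  map_add' Φ Ψ := Subtype.ext <| D.rel_unique (D.exists_rel_P (Φ + Ψ)).choose_spec
    (D.rel_add (D.exists_rel_P Φ).choose_spec (D.exists_rel_P Ψ).choose_spec)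
  map_smul' a Φ := Subtype.ext <| D.rel_unique (D.exists_rel_P (a • Φ)).choose_spec
    (D.rel_smul (D.exists_rel_P Φ).choose_spec a)

theorem rel_toLin (Φ : P B K) : D.Rel (Φ : Fun B K) (D.toLin Φ : Fun B K) :=
  (D.exists_rel_P Φ).choose_spec

theorem toLin_eq {Φ Ψ : P B K} (h : D.Rel (Φ : Fun B K) Ψ) : D.toLin Φ = Ψ :=
  Subtype.ext (D.rel_unique (D.rel_toLin Φ) h)

theorem toLin_mul (Φ Ψ : P B K) : D.toLin (Φ * Ψ) = D.toLin Φ * grP Ψ + Φ * D.toLin Ψ :=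
  D.toLin_eq (D.rel_mul (D.rel_toLin Φ) (D.rel_toLin Ψ))

theorem toLin_one : D.toLin 1 = 0 := by
  have := D.rel_algebraMap 1
  rw [map_one] at this
  exact D.toLin_eq this

theorem toLin_fields {r : ℕ} {Φ : P B K} (h : (Φ : Fun B K) ∈ ordLe B K r 0) : D.toLin Φ = 0 := by
  refine ordLe_induction (Q := fun Φ => D.toLin Φ = 0) D.toLin_one ?_ (map_zero _) ?_ ?_ ?_ h
  · intro Φ g a i hΦ ha hg
    have h0 : D.toLin g = 0 := by
      refine D.toLin_eq ?_
      have hgen := hg.gen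
      obtain rfl := Nat.le_zero.1 ha
      have ap := A.ant_pos
      generalize (g : Fun B K) = g' at hgen
      cases hgen with
      | body f hf => exact D.rel_body f
      | field t ht κ => exact D.rel_field t κ
      | antiEven hl t ht v σ => omega
      | antiOdd hl t ht v σ => omega
      | ghostEven i hl t ht v σ => exact absurd (ap (some i)) (by simp only [antNum]; omega)
      | ghostOdd i hl t ht v σ => exact absurd (ap (some i)) (by simp only [antNum]; omega)
    rw [D.toLin_mul, hΦ, h0, zero_mul, mul_zero, add_zero]
  · intro Φ Ψ h h'
    rw [map_add, h, h', add_zero]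
  · intro a Φ h
    rw [map_smul, h, smul_zero]
  · intro Φ h
    exact linear_eq_of_local D.toLin 0 Φ h

/-- To prove an identity for the derivation it suffices to consider generators. -/
theorem induction_gen {T T' : P B K →ₗ[Sm n X] P B K} (h0 : T 1 = T' 1)
    (hmul : ∀ Φ g, T Φ = T' Φ → T g = T' g → T (Φ * g) = T' (Φ * g))
    (hfield : ∀ r (Φ : P B K), (Φ : Fun B K) ∈ ordLe B K r 0 → T Φ = T' Φ)
    (heven : ∀ o t v σ, T ⟨_, genEven_mem o t v σ⟩ = T' ⟨_, genEven_mem o t v σ⟩)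
    (hodd : ∀ o t v σ, T ⟨_, genOdd_mem o t v σ⟩ = T' ⟨_, genOdd_mem o t v σ⟩) : T = T' := by
  refine LinearMap.ext fun Φ => ?_
  obtain ⟨r, l, h⟩ := Φ.2
  refine ordLe_induction (Q := fun Φ => T Φ = T' Φ) h0 ?_ (by rw [map_zero, map_zero]) ?_ ?_ ?_ h
  · rintro Φ ⟨g, hgP⟩ a i hΦ ha hg
    refine hmul Φ _ hΦ ?_
    rcases hg.gen.cases_antifield with h | ⟨o, t, v, σ, -, -, e⟩ | ⟨o, t, v, σ, -, -, e⟩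
    · exact hfield _ _ h
    · subst e; exact heven o t v σ
    · subst e; exact hodd o t v σ
  · intro Φ Ψ h h'
    rw [map_add, h, h', map_add]
  · intro a Φ h
    rw [map_smul, h, map_smul]
  · intro Φ h
    exact linear_eq_of_local T T' Φ h

end AntiValues.PointDer

end KoszulTate
end

/-! ### The glued map is a contact derivation. -/

noncomputable section

namespace KoszulTate

variable {n d : ℕ} {X Y : Type}
  [TopologicalSpace X] [ChartedSpace (EuclideanSpace ℝ (Fin n)) X] [IsManifold (𝓡 n) ∞ X]
  [T2Space X] [TopologicalSpace Y] [ChartedSpace (EuclideanSpace ℝ (Fin d)) Y]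
  [IsManifold (𝓡 d) ∞ Y] {B : FieldSpace n d X Y} {ι : Type} {K : Antifields n X ι}

/-- The grade involution as a linear map. -/
def grL : P B K →ₗ[Sm n X] P B K where
  toFun := grP
  map_add' := grP_add
  map_smul' := grP_smul

/-- Rescaling of the antifields, on the ring of graded functions. -/
def substP (c : ℕ → ℝ) : P B K →ₗ[Sm n X] P B K where
  toFun Φ := ⟨subst B K c Φ, Φ.2.imp fun _ h => h.imp fun _ h => subst_mem_ordLe B K _ h⟩
  map_add' _ _ := Subtype.ext (map_add _ _ _)
  map_smul' _ _ := Subtype.ext (map_smul _ _ _)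

theorem substP_mul (c : ℕ → ℝ) (Φ Ψ : P B K) : substP c (Φ * Ψ) = substP c Φ * substP c Ψ :=
  Subtype.ext (map_mul _ _ _)

theorem substP_grP (c : ℕ → ℝ) (Φ : P B K) : substP c (grP Φ) = grP (substP c Φ) :=
  Subtype.ext (funext fun z => (gr_map _ _).symm)

theorem substP_isAnt {m : ℕ} {Φ : P B K} (h : IsAnt B K m (Φ : Fun B K)) (t : ℝ) :
    substP (fun j => t ^ j) Φ = algebraMap ℝ (Sm n X) (t ^ m) • Φ :=
  Subtype.ext (funext fun z => (h t z).trans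
    (P.coe_smul_apply (algebraMap ℝ (Sm n X) (t ^ m)) Φ z).symm)

theorem isAnt_tdP {m : ℕ} {Φ : P B K} (h : IsAnt B K m (Φ : Fun B K)) (τ : VF n X) :
    IsAnt B K m (tdP τ Φ : Fun B K) := by
  refine fun s z => eq_of_tst fun ks => ?_
  rw [subst_apply, tst_map]
  obtain ⟨a, ha⟩ := exists_smooth_tst Φ.2 z ks
  have h1 : (((s ^ m) • a : Sm n X) : X → ℝ) =ᶠ[𝓝 z.1.x] fun x =>
      testEval (ks.map (scaleOdd B K fun j => s ^ j))
        (along (Φ : Fun B K) z.1.s (scaleEven B K (fun j => s ^ j) z.2) x) := by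
    filter_upwards [ha, z.1.isSec.eventually] with x hx hs
    rw [Sm.rsmul_apply, hx, along_of_isSecAt _ _ hs, along_of_isSecAt _ _ hs]
    refine (tst_smul ks _ _).symm.trans ?_
    rw [← h s, subst_apply]
    exact tst_map _ _ _
  refine (totalDerivs_tst Φ.2 [τ] (z.1, scaleEven B K (fun j => s ^ j) z.2) _ h1).trans ?_
  rw [map_smul, tst_smul]
  congr 1
  exact (totalDerivs_tst Φ.2 [τ] z ks ha).symm

theorem isAnt_tdsP {m : ℕ} {Φ : P B K} (h : IsAnt B K m (Φ : Fun B K)) (t : List (VF n X)) :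
    IsAnt B K m (tdsP t Φ : Fun B K) := by
  induction t with
  | nil => exact h
  | cons τ t ih => exact isAnt_tdP ih τ

namespace AntiValues.PointDer

variable {A : AntiValues B K} (D : A.PointDer)

theorem toLin_genEven (o : Option ι) (t : List (VF n X)) (v : Sec (evenVB B K o))
    (σ : Fin n → VF n X) : D.toLin ⟨_, genEven_mem o t v σ⟩ = tdsP t (A.even o v σ) :=
  D.toLin_eq (D.rel_genEven o t v σ)

theorem toLin_genOdd (o : Option ι) (t : List (VF n X)) (v : Sec (oddVB B K o))
    (σ : Fin n → VF n X) : D.toLin ⟨_, genOdd_mem o t v σ⟩ = tdsP t (A.odd o v σ) :=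
  D.toLin_eq (D.rel_genOdd o t v σ)

theorem toLin_grP (Φ : P B K) : D.toLin (grP Φ) = -grP (D.toLin Φ) := by
  have hneg : ∀ Φ : P B K, grP (-Φ) = -grP Φ := fun Φ => Subtype.ext (map_neg _ _)
  have := induction_gen (T := D.toLin ∘ₗ grL) (T' := -(grL ∘ₗ D.toLin)) ?_ ?_ ?_ ?_ ?_
  · exact LinearMap.congr_fun this Φ
  · change D.toLin (grP 1) = -grP (D.toLin 1)
    rw [grP_one, D.toLin_one, grP_zero, neg_zero]
  · intro Φ g (h : D.toLin (grP Φ) = -grP (D.toLin Φ)) (h' : D.toLin (grP g) = -grP (D.toLin g))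
    change D.toLin (grP (Φ * g)) = -grP (D.toLin (Φ * g))
    rw [D.toLin_mul, grP_mul, D.toLin_mul, grP_add, grP_mul, grP_mul, h, h', grP_grP, neg_mul,
      mul_neg, neg_add]
  · intro r Φ h
    change D.toLin (grP Φ) = -grP (D.toLin Φ)
    rw [D.toLin_fields h, grP_zero, neg_zero]
    exact D.toLin_fields (Φ := grP Φ) (grF_mem_ordLe h)
  · intro o t v σ
    change D.toLin (grP _) = -grP (D.toLin _)
    have h1 : grP (⟨_, genEven_mem o t v σ⟩ : P B K) = ⟨_, genEven_mem o t v σ⟩ :=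
      Subtype.ext (grF_genEven o t v σ)
    rw [h1, D.toLin_genEven, grP_tdsP, A.even_par, tdsP_neg, neg_neg]
  · intro o t v σ
    change D.toLin (grP _) = -grP (D.toLin _)
    have h1 : grP (⟨_, genOdd_mem o t v σ⟩ : P B K) = -⟨_, genOdd_mem o t v σ⟩ :=
      Subtype.ext (grF_genOdd o t v σ)
    rw [h1, map_neg, D.toLin_genOdd, grP_tdsP, A.odd_par]

/-- The global form of lowering the antifield number by one: rescaling before the derivation gives
one more factor t than rescaling after it. In this form it only has to be checked on generators. -/
theorem toLin_substP (t : ℝ) (Φ : P B K) : D.toLin (substP (fun j => t ^ j) Φ) =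
    algebraMap ℝ (Sm n X) t • substP (fun j => t ^ j) (D.toLin Φ) := by
  have := induction_gen (T := D.toLin ∘ₗ substP (fun j => t ^ j))
    (T' := algebraMap ℝ (Sm n X) t • (substP (fun j => t ^ j) ∘ₗ D.toLin)) ?_ ?_ ?_ ?_ ?_
  · exact LinearMap.congr_fun this Φ
  · change D.toLin (substP _ 1) = algebraMap ℝ (Sm n X) t • substP _ (D.toLin 1)
    rw [D.toLin_one, map_zero, smul_zero, show substP (fun j => t ^ j) (1 : P B K) = 1 from
      Subtype.ext (map_one _), D.toLin_one]
  · intro Φ g (h : D.toLin (substP _ Φ) = algebraMap ℝ (Sm n X) t • substP _ (D.toLin Φ))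
      (h' : D.toLin (substP _ g) = algebraMap ℝ (Sm n X) t • substP _ (D.toLin g))
    change D.toLin (substP _ (Φ * g)) = algebraMap ℝ (Sm n X) t • substP _ (D.toLin (Φ * g))
    rw [D.toLin_mul, substP_mul, D.toLin_mul, map_add, substP_mul, substP_mul, h, h', smul_add,
      substP_grP, smul_mul_assoc, mul_smul_comm]
  · intro r Φ h
    change D.toLin (substP _ Φ) = algebraMap ℝ (Sm n X) t • substP _ (D.toLin Φ)
    rw [D.toLin_fields h, map_zero, smul_zero]
    exact D.toLin_fields (Φ := substP _ Φ) (subst_mem_ordLe B K _ h)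
  · intro o s v σ
    change D.toLin (substP _ _) = algebraMap ℝ (Sm n X) t • substP _ (D.toLin _)
    rw [substP_isAnt (isAnt_genEven o s v σ), map_smul, D.toLin_genEven,
      substP_isAnt (isAnt_tdsP (A.even_ant o v σ) s), smul_smul, ← map_mul, ← pow_succ',
      Nat.sub_add_cancel (A.ant_pos o)]
  · intro o s v σ
    change D.toLin (substP _ _) = algebraMap ℝ (Sm n X) t • substP _ (D.toLin _)
    rw [substP_isAnt (isAnt_genOdd o s v σ), map_smul, D.toLin_genOdd,
      substP_isAnt (isAnt_tdsP (A.odd_ant o v σ) s), smul_smul, ← map_mul, ← pow_succ',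
      Nat.sub_add_cancel (A.ant_pos o)]

theorem toLin_tdP (τ : VF n X) (Φ : P B K) : D.toLin (tdP τ Φ) = tdP τ (D.toLin Φ) := by
  obtain ⟨r, l, h⟩ := Φ.2
  have hf : ∀ (r : ℕ) (Φ : P B K), (Φ : Fun B K) ∈ ordLe B K r 0 →
      D.toLin (tdP τ Φ) = tdP τ (D.toLin Φ) := fun r Φ h => by
    rw [D.toLin_fields h, tdP_zero]
    exact D.toLin_fields (Φ := tdP τ Φ) ((ordLe_isTD h).2 τ)
  refine ordLe_induction (Q := fun Φ => D.toLin (tdP τ Φ) = tdP τ (D.toLin Φ)) ?_ ?_ ?_ ?_ ?_ ?_ h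
  · exact hf 0 1 (one_mem _)
  · rintro Φ ⟨g, hgP⟩ a i hΦ ha hg
    have hgen : D.toLin (tdP τ ⟨g, hgP⟩) = tdP τ (D.toLin ⟨g, hgP⟩) := by
      rcases hg.gen.cases_antifield with h | ⟨o, t, v, σ, -, -, e⟩ | ⟨o, t, v, σ, -, -, e⟩
      · exact hf _ _ h
      · subst e
        have h1 : tdP τ (⟨_, hgP⟩ : P B K) = ⟨_, genEven_mem o (τ :: t) v σ⟩ :=
          Subtype.ext (totalDeriv_genEven o t v σ τ)
        rw [h1, D.toLin_genEven, D.toLin_genEven]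
        rfl
      · subst e
        have h1 : tdP τ (⟨_, hgP⟩ : P B K) = ⟨_, genOdd_mem o (τ :: t) v σ⟩ :=
          Subtype.ext (totalDeriv_genOdd o t v σ τ)
        rw [h1, D.toLin_genOdd, D.toLin_genOdd]
        rfl
    rw [tdP_mul, map_add, D.toLin_mul, D.toLin_mul, D.toLin_mul, tdP_add, tdP_mul, tdP_mul, hΦ,
      hgen, tdP_grP]
    abel
  · rw [tdP_zero, map_zero, tdP_zero]
  · intro Φ Ψ h h'
    rw [tdP_add, map_add, h, h', map_add, tdP_add]
  · intro a Φ h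
    rw [tdP_smul, map_add, map_smul, map_smul, h, map_smul, tdP_smul]
  · intro Φ h
    refine P.ext_local fun x₀ => ?_
    obtain ⟨U, hU, Ψ, hΨ, e⟩ := h x₀
    -- Both total derivatives and the derivation depend only on the values over a neighbourhood, so
    -- U is replaced by an open set on which they can be compared at every point.
    obtain ⟨U', hU'U, hU'o, hx⟩ := mem_nhds_iff.1 hU
    have e' : EqOver U' (Φ : Fun B K) Ψ := fun z hz => e z (hU'U hz)
    have htd : ∀ {Φ Ψ : P B K}, EqOver U' (Φ : Fun B K) Ψ →
        EqOver U' (tdP τ Φ : Fun B K) (tdP τ Ψ) := fun {Φ Ψ} e z hz =>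
      totalDeriv_congr_over (P_isTD Ψ.2) e (hU'o.mem_nhds hz) τ
    refine ⟨U', hU'o.mem_nhds hx, fun z hz => ?_⟩
    rw [linear_local D.toLin (htd e') (hU'o.mem_nhds hz), hΨ]
    exact (htd (fun z hz => linear_local D.toLin e' (hU'o.mem_nhds hz)) z hz).symm

theorem isContactDer : IsContactDer D.toLin where
  order r l := ⟨A.ord + r, fun Φ h => by
    obtain ⟨Ψ, h1, h2⟩ := D.exists_rel h
    rwa [D.rel_unique (D.rel_toLin Φ) h2]⟩
  leibniz i Φ Ψ h := by
    rw [D.toLin_mul, (isPar_coe_iff i Ψ).1 h]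
    have : Commute (D.toLin Φ) ((-1) ^ i.val) := (Commute.neg_one_right _).pow_right _
    rw [← mul_assoc, this.eq, mul_assoc]
  parity i Φ h := by
    rw [isPar_coe_iff] at h ⊢
    have h1 := D.toLin_grP Φ
    rw [h] at h1
    fin_cases i
    · change D.toLin ((-1) ^ 0 * Φ) = _ at h1
      change grP _ = (-1) ^ 1 * _
      rw [pow_zero, one_mul] at h1
      rw [pow_one, neg_one_mul]
      exact (neg_eq_iff_eq_neg.2 h1).symm
    · change D.toLin ((-1) ^ 1 * Φ) = _ at h1
      change grP _ = (-1) ^ 0 * _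
      rw [pow_one, neg_one_mul, map_neg, neg_inj] at h1
      rw [pow_zero, one_mul]
      exact h1.symm
  ant m Φ h := by
    -- The commutation rule gives the homogeneity of D Φ multiplied by t, so only t ≠ 0 can be
    -- treated directly.
    refine isAnt_of_ne_zero (D.toLin Φ).2 fun t ht z => ?_
    have h1 := D.toLin_substP t Φ
    rw [substP_isAnt h, map_smul, pow_succ', map_mul, mul_smul] at h1
    have h2 := congrArg (fun Ψ : P B K => (Ψ : Fun B K) z) h1
    simp only [P.coe_smul_apply, Sm.algebraMap_apply] at h2
    exact (smul_right_injective _ ht h2).symm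
  fields r Φ h := D.toLin_fields h
  contact τ Φ Ψ h := by
    have : Ψ = tdP τ Φ := Subtype.ext h
    rw [this, D.toLin_tdP]
    rfl

end AntiValues.PointDer

/-- There is a contact derivation with given values on the antifields. -/
theorem AntiValues.exists_contactDer [Finite ι] (A : AntiValues B K) :
    ∃ D : P B K →ₗ[Sm n X] P B K, IsContactDer D ∧
      (∀ o v σ (Φ : P B K), (Φ : Fun B K) = genEven B K o [] v σ → D Φ = A.even o v σ) ∧
      (∀ o v σ (Φ : P B K), (Φ : Fun B K) = genOdd B K o [] v σ → D Φ = A.odd o v σ) := by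
  obtain ⟨D⟩ := A.nonempty_pointDer
  refine ⟨D.toLin, D.isContactDer, fun o v σ Φ h => ?_, fun o v σ Φ h => ?_⟩
  · obtain rfl : Φ = ⟨_, genEven_mem o [] v σ⟩ := Subtype.ext h
    exact D.toLin_genEven o [] v σ
  · obtain rfl : Φ = ⟨_, genOdd_mem o [] v σ⟩ := Subtype.ext h
    exact D.toLin_genOdd o [] v σ

end KoszulTate
end

noncomputable section

namespace KoszulTate

/-! ### Pull-back of graded functions along linear maps of the antifields -/

variable {n d : ℕ} {X Y : Type}
  [TopologicalSpace X] [ChartedSpace (EuclideanSpace ℝ (Fin n)) X] [IsManifold (𝓡 n) ∞ X]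
  [T2Space X] [TopologicalSpace Y] [ChartedSpace (EuclideanSpace ℝ (Fin d)) Y]
  [IsManifold (𝓡 d) ∞ Y] {B : FieldSpace n d X Y} {ι ι' : Type} {K : Antifields n X ι}
  {K' : Antifields n X ι'}

section Pull

variable (φ : QOdd B K' →ₗ[ℝ] QOdd B K) (ψ : QEven B K' → QEven B K)

/-- The pull-back of graded functions along maps of the odd variables and of the even
antifields. -/
def pull : Fun B K →ₐ[Sm n X] Fun B K' where
  toFun Φ := fun z => ExteriorAlgebra.map φ.dualMap (Φ (z.1, ψ z.2))
  map_one' := by funext z; exact map_one _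
  map_mul' Φ Ψ := by funext z; exact map_mul _ _ _
  map_zero' := by funext z; exact map_zero _
  map_add' Φ Ψ := by funext z; exact map_add _ _ _
  commutes' a := by funext z; exact AlgHom.commutes _ _

theorem pull_apply (Φ : Fun B K) (z) :
    pull φ ψ Φ z = ExteriorAlgebra.map φ.dualMap (Φ (z.1, ψ z.2)) := rfl

theorem grF_pull (Φ : Fun B K) : grF (pull φ ψ Φ) = pull φ ψ (grF Φ) :=
  funext fun z => gr_map φ _

theorem tst_along_pull (Φ : Fun B K) (s : X → Y) (q : QEven B K') (x : X) (ks : List (QOdd B K')) :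
    testEval ks (along (pull φ ψ Φ) s q x) = testEval (ks.map φ) (along Φ s (ψ q) x) := by
  by_cases h : IsSecAt B s x
  · rw [along_of_isSecAt _ _ h, along_of_isSecAt _ _ h]
    exact tst_map φ ks _
  · rw [along, dif_neg h, along, dif_neg h]
    exact (tst_zero ks).trans (tst_zero (ks.map φ)).symm

/-- A pull-back along maps of the antifields does not move the base point, and a test of the
pull-back is a test of the original function with the vectors mapped forward. Both sides thus have
the same tests along a section. -/
theorem pull_totalDerivs {Φ : Fun B K} (h : Φ ∈ P B K) (h' : pull φ ψ Φ ∈ P B K')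
    (t : List (VF n X)) : pull φ ψ (totalDerivs t Φ) = totalDerivs t (pull φ ψ Φ) := by
  funext z
  refine eq_of_tst fun ks => ?_
  obtain ⟨a, ha⟩ := exists_smooth_tst h (z.1, ψ z.2) (ks.map φ)
  rw [pull_apply, tst_map]
  refine (totalDerivs_tst h t (z.1, ψ z.2) _ ha).trans (totalDerivs_tst h' t z ks (a := a) ?_).symm
  filter_upwards [ha] with x hx
  rw [hx, tst_along_pull]

theorem pull_mem_ordLe {r l l' : ℕ} (hg : ∀ g, Gen B K r l g → pull φ ψ g ∈ genAlg B K' r l')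
    {Φ : Fun B K} (h : Φ ∈ ordLe B K r l) : pull φ ψ Φ ∈ ordLe B K' r l' := by
  have key : genAlg B K r l ≤ (genAlg B K' r l').comap (pull φ ψ) := Algebra.adjoin_le hg
  intro x₀
  obtain ⟨U, hU, Ψ, hΨ, e⟩ := h x₀
  exact ⟨U, hU, pull φ ψ Ψ, key hΨ, fun z hz => congrArg _ (e (z.1, ψ z.2) hz)⟩

theorem pull_eqOver {U : Set X} {Φ Ψ : Fun B K} (e : EqOver U Φ Ψ) :
    EqOver U (pull φ ψ Φ) (pull φ ψ Ψ) := fun z hz => congrArg _ (e (z.1, ψ z.2) hz)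

theorem HasVertDeriv.pull {w : Sec B.W} {Φ : Fun B K} {z : JetPt B × QEven B K'} {γ : Val B K}
    (h : HasVertDeriv B K w Φ (z.1, ψ z.2) γ) :
    HasVertDeriv B K' w (pull φ ψ Φ) z (ExteriorAlgebra.map φ.dualMap γ) := by
  intro S h1 h2 ks
  have h3 := h S h1 h2 (ks.map φ)
  have h4 : testEval ks (ExteriorAlgebra.map φ.dualMap γ) = testEval (ks.map φ) γ := tst_map φ ks γ
  rw [h4]
  exact h3.congr_of_eventuallyEq (Eventually.of_forall fun t => tst_along_pull φ ψ Φ _ _ _ ks)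

theorem HasOddDeriv.pull (hφ : ∀ f : Sec B.F, φ (f, 0, 0) = ((f, 0, 0) : Sec B.F × _ × _))
    {f : Sec B.F} {Φ : Fun B K} {z : JetPt B × QEven B K'}
    {γ : Val B K} (h : HasOddDeriv B K f Φ (z.1, ψ z.2) γ) :
    HasOddDeriv B K' f (pull φ ψ Φ) z (ExteriorAlgebra.map φ.dualMap γ) := by
  refine (congrArg (ExteriorAlgebra.map φ.dualMap) h).trans ?_
  refine Eq.trans ?_ (ctr_map φ ((f, 0, 0) : Sec B.F × _ × _) (Φ (z.1, ψ z.2))).symm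
  rw [hφ]
  rfl

theorem IsVarDeriv.pull {L e : Dens B K} {L' e' : Dens B K'}
    {var : Sm n X → Fun B K → JetPt B × QEven B K → Val B K → Prop}
    {var' : Sm n X → Fun B K' → JetPt B × QEven B K' → Val B K' → Prop}
    (hvar : ∀ a Φ z γ, var a Φ (z.1, ψ z.2) γ →
      var' a (pull φ ψ Φ) z (ExteriorAlgebra.map φ.dualMap γ))
    (hg : ∀ r g, Gen B K r 0 g → KoszulTate.pull φ ψ g ∈ genAlg B K' r 0)
    (hL : ∀ σ, (L' σ : Fun B K') = KoszulTate.pull φ ψ (L σ))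
    (he : ∀ σ, (e' σ : Fun B K') = KoszulTate.pull φ ψ (e σ))
    (h : IsVarDeriv L var e) : IsVarDeriv L' var' e' := by
  intro x₀
  obtain ⟨τ, hτ, T, c, r, hc, U, hU, h⟩ := h x₀
  refine ⟨τ, hτ, T, fun Λ => KoszulTate.pull φ ψ (c Λ), r,
    fun Λ hΛ => pull_mem_ordLe φ ψ (hg r) (hc Λ hΛ), U, hU, fun z hz => ?_⟩
  obtain ⟨h1, h2⟩ := h (z.1, ψ z.2) hz
  refine ⟨fun a => ?_, ?_⟩
  · have := hvar a (L τ) z _ (h1 a)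
    rw [hL]
    rw [map_sum] at this
    convert this using 1
    refine Finset.sum_congr rfl fun Λ _ => ?_
    exact (map_smul (ExteriorAlgebra.map φ.dualMap) (jetEval z.1.x (Λ.map τ) a)
      (c Λ (z.1, ψ z.2))).symm
  · rw [he, pull_apply, h2, map_sum]
    refine Finset.sum_congr rfl fun Λ hΛ => ?_
    rw [map_smul, ← pull_totalDerivs φ ψ (ordLe_le_P _ _ (hc Λ hΛ))
      (ordLe_le_P _ _ (pull_mem_ordLe φ ψ (hg r) (hc Λ hΛ)))]
    rfl

end Pull

/-! ### Inclusion and restriction of rings of graded functions -/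

section Extend

variable {V' E' : VB n X} {a : ℕ}

/-- Forgetting the new odd antifields. -/
def forgetOdd (B : FieldSpace n d X Y) (K : Antifields n X ι) (V' E' : VB n X) (a : ℕ) :
    QOdd B (K.extend V' E' a) →ₗ[ℝ] QOdd B K where
  toFun q := (QOdd.field _ _ q, QOdd.anti _ _ q, fun i => QOdd.ghost _ _ (some i) q)
  map_add' := fun _ _ => rfl
  map_smul' := fun _ _ => rfl

/-- Forgetting the new even antifields. -/
def forgetEven (B : FieldSpace n d X Y) (K : Antifields n X ι) (V' E' : VB n X) (a : ℕ)
    (q : QEven B (K.extend V' E' a)) : QEven B K := (q.1, fun i => q.2 (some i))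

/-- Extension by zero of the odd variables. -/
def zeroOdd (B : FieldSpace n d X Y) (K : Antifields n X ι) (V' E' : VB n X) (a : ℕ) :
    QOdd B K →ₗ[ℝ] QOdd B (K.extend V' E' a) where
  toFun q := (QOdd.field _ _ q, QOdd.anti _ _ q, fun o => match o with
    | none => (0 : DensDual E')
    | some i => QOdd.ghost _ _ i q)
  map_add' q q' := by
    refine Prod.ext rfl (Prod.ext rfl (funext fun o => ?_))
    cases o with
    | none => exact (add_zero (0 : DensDual E')).symm
    | some i => rfl
  map_smul' r q := by
    refine Prod.ext rfl (Prod.ext rfl (funext fun o => ?_))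
    cases o with
    | none => exact (smul_zero (A := DensDual E') r).symm
    | some i => rfl

/-- Extension by zero of the even antifields. -/
def zeroEven (B : FieldSpace n d X Y) (K : Antifields n X ι) (V' E' : VB n X) (a : ℕ)
    (q : QEven B K) : QEven B (K.extend V' E' a) :=
  (q.1, fun o => match o with
    | none => (0 : DensDual V')
    | some i => q.2 i)

/-- The inclusion, as a homomorphism of algebras. -/
def inclF (B : FieldSpace n d X Y) (K : Antifields n X ι) (V' E' : VB n X) (a : ℕ) :
    Fun B K →ₐ[Sm n X] Fun B (K.extend V' E' a) :=
  pull (forgetOdd B K V' E' a) (forgetEven B K V' E' a)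

/-- The result of setting the new antifields to zero. -/
def resF (B : FieldSpace n d X Y) (K : Antifields n X ι) (V' E' : VB n X) (a : ℕ) :
    Fun B (K.extend V' E' a) →ₐ[Sm n X] Fun B K :=
  pull (zeroOdd B K V' E' a) (zeroEven B K V' E' a)

theorem resF_inclF (Φ : Fun B K) : resF B K V' E' a (inclF B K V' E' a Φ) = Φ := by
  funext z
  refine eq_of_tst fun ks => ?_
  rw [resF, pull_apply, tst_map, inclF, pull_apply, tst_map, List.map_map]
  have : ⇑(forgetOdd B K V' E' a) ∘ ⇑(zeroOdd B K V' E' a) = id := rfl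
  rw [this, List.map_id]
  rfl

theorem subst_inclF (c : ℕ → ℝ) (Φ : Fun B K) :
    subst B (K.extend V' E' a) c (inclF B K V' E' a Φ) = inclF B K V' E' a (subst B K c Φ) := by
  funext z
  refine eq_of_tst fun ks => ?_
  rw [subst_apply, tst_map, inclF, pull_apply, tst_map, pull_apply, tst_map, subst_apply, tst_map,
    List.map_map, List.map_map]
  rfl

theorem isAnt_iff_subst {m : ℕ} {Φ : Fun B K} : IsAnt B K m Φ ↔
    ∀ t : ℝ, subst B K (fun j => t ^ j) Φ = algebraMap ℝ (Sm n X) (t ^ m) • Φ :=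
  ⟨fun h t => funext fun z =>
      (h t z).trans (Fun.smul_apply B K (algebraMap ℝ (Sm n X) (t ^ m)) Φ z).symm,
    fun h t z => (congrFun (h t) z).trans (Fun.smul_apply B K (algebraMap ℝ (Sm n X) (t ^ m)) Φ z)⟩

theorem isAnt_inclF_iff {m : ℕ} {Φ : Fun B K} :
    IsAnt B (K.extend V' E' a) m (inclF B K V' E' a Φ) ↔ IsAnt B K m Φ := by
  rw [isAnt_iff_subst, isAnt_iff_subst]
  refine forall_congr' fun t => ?_
  rw [subst_inclF, ← map_smul]
  exact ⟨fun h => by rw [← resF_inclF (V' := V') (E' := E') (a := a) (subst _ _ _ Φ), h, resF_inclF],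
    fun h => by rw [h]⟩

theorem inclF_bodyFun (f : JetPt B → ℝ) :
    inclF B K V' E' a (bodyFun B K f) = bodyFun B (K.extend V' E' a) f :=
  funext fun z => AlgHom.commutes _ _

theorem inclF_fieldGen (t : List (VF n X)) (κ : Sec B.F →ₗ[Sm n X] Sm n X) :
    inclF B K V' E' a (fieldGen B K t κ) = fieldGen B (K.extend V' E' a) t κ :=
  funext fun z => ExteriorAlgebra.map_apply_ι _ _

theorem inclF_antiEven (t : List (VF n X)) (v : Sec B.F) (σ : Fin n → VF n X) :
    inclF B K V' E' a (antiEven B K t v σ) = antiEven B (K.extend V' E' a) t v σ :=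
  funext fun z => AlgHom.commutes _ _

theorem inclF_antiOdd (t : List (VF n X)) (v : Sec B.W) (σ : Fin n → VF n X) :
    inclF B K V' E' a (antiOdd B K t v σ) = antiOdd B (K.extend V' E' a) t v σ :=
  funext fun z => ExteriorAlgebra.map_apply_ι _ _

theorem inclF_ghostEven (i : ι) (t : List (VF n X)) (v : Sec (K.V i)) (σ : Fin n → VF n X) :
    inclF B K V' E' a (ghostEven B K i t v σ) = ghostEven B (K.extend V' E' a) (some i) t v σ :=
  funext fun z => AlgHom.commutes _ _

theorem inclF_ghostOdd (i : ι) (t : List (VF n X)) (v : Sec (K.E i)) (σ : Fin n → VF n X) :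
    inclF B K V' E' a (ghostOdd B K i t v σ) = ghostOdd B (K.extend V' E' a) (some i) t v σ :=
  funext fun z => ExteriorAlgebra.map_apply_ι _ _

theorem gen_inclF {r l : ℕ} {g : Fun B K} (hg : Gen B K r l g) :
    Gen B (K.extend V' E' a) r l (inclF B K V' E' a g) := by
  cases hg with
  | body f hf => exact inclF_bodyFun (K := K) f ▸ Gen.body f hf
  | field t ht κ => exact inclF_fieldGen (K := K) t κ ▸ Gen.field t ht κ
  | antiEven hl t ht v σ => exact inclF_antiEven (K := K) t v σ ▸ Gen.antiEven hl t ht v σ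
  | antiOdd hl t ht v σ => exact inclF_antiOdd (K := K) t v σ ▸ Gen.antiOdd hl t ht v σ
  | ghostEven i hl t ht v σ =>
    rw [inclF_ghostEven]
    exact Gen.ghostEven (K := K.extend V' E' a) (some i) hl t ht v σ
  | ghostOdd i hl t ht v σ =>
    rw [inclF_ghostOdd]
    exact Gen.ghostOdd (K := K.extend V' E' a) (some i) hl t ht v σ

theorem gen_resF {r l : ℕ} {g : Fun B (K.extend V' E' a)} (hg : Gen B (K.extend V' E' a) r l g) :
    resF B K V' E' a g ∈ genAlg B K r l ∧ (l < a → inclF B K V' E' a (resF B K V' E' a g) = g) := by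
  have key : ∀ (g : Fun B (K.extend V' E' a)) (g' : Fun B K), Gen B K r l g' →
      inclF B K V' E' a g' = g → resF B K V' E' a g ∈ genAlg B K r l ∧
        (l < a → inclF B K V' E' a (resF B K V' E' a g) = g) := by
    rintro g g' h rfl
    rw [resF_inclF]
    exact ⟨Algebra.subset_adjoin h, fun _ => rfl⟩
  cases hg with
  | body f hf => exact key _ _ (Gen.body f hf) (inclF_bodyFun f)
  | field t ht κ => exact key _ _ (Gen.field t ht κ) (inclF_fieldGen t κ)
  | antiEven hl t ht v σ => exact key _ _ (Gen.antiEven hl t ht v σ) (inclF_antiEven t v σ)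
  | antiOdd hl t ht v σ => exact key _ _ (Gen.antiOdd hl t ht v σ) (inclF_antiOdd t v σ)
  | ghostEven o hl t ht v σ =>
    cases o with
    | none =>
      refine ⟨?_, fun h => absurd hl (not_le.2 h)⟩
      convert zero_mem (genAlg B K r l)
      funext z
      refine (AlgHom.commutes _ _).trans ?_
      rw [show densEval z.1.x t v σ ((zeroEven B K V' E' a z.2).2 none) = 0 from map_zero _, map_zero]
      rfl
    | some i => exact key _ _ (Gen.ghostEven (K := K) i hl t ht v σ) (inclF_ghostEven i t v σ)
  | ghostOdd o hl t ht v σ =>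
    cases o with
    | none =>
      refine ⟨?_, fun h => absurd hl (not_le.2 h)⟩
      convert zero_mem (genAlg B K r l)
      funext z
      refine (ExteriorAlgebra.map_apply_ι _ _).trans ?_
      refine (congrArg (ExteriorAlgebra.ι ℝ) ?_).trans (map_zero _)
      exact LinearMap.ext fun q => map_zero (densEval z.1.x t v σ)
    | some i => exact key _ _ (Gen.ghostOdd (K := K) i hl t ht v σ) (inclF_ghostOdd i t v σ)

theorem inclF_mem {r l : ℕ} {Φ : Fun B K} (h : Φ ∈ ordLe B K r l) :
    inclF B K V' E' a Φ ∈ ordLe B (K.extend V' E' a) r l :=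
  pull_mem_ordLe _ _ (fun _ hg => Algebra.subset_adjoin (gen_inclF hg)) h

theorem resF_mem {r l : ℕ} {Φ : Fun B (K.extend V' E' a)} (h : Φ ∈ ordLe B (K.extend V' E' a) r l) :
    resF B K V' E' a Φ ∈ ordLe B K r l :=
  pull_mem_ordLe _ _ (fun _ hg => (gen_resF hg).1) h

/-- Generators of antifield number less than a are not new antifields, and setting the new ones to
zero does not affect them. Two algebra homomorphisms that agree on generators agree on polynomials,
and locally there is nothing else. -/
theorem inclF_resF {r l : ℕ} (hl : l < a) {Φ : Fun B (K.extend V' E' a)}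
    (h : Φ ∈ ordLe B (K.extend V' E' a) r l) : inclF B K V' E' a (resF B K V' E' a Φ) = Φ := by
  have key : genAlg B (K.extend V' E' a) r l ≤ AlgHom.equalizer
      ((inclF B K V' E' a).comp (resF B K V' E' a)) (AlgHom.id _ _) :=
    Algebra.adjoin_le fun g hg => (gen_resF hg).2 hl
  funext z
  obtain ⟨U, hU, Ψ, hΨ, e⟩ := h z.1.x
  have hz := mem_of_mem_nhds hU
  exact (pull_eqOver _ _ (pull_eqOver _ _ e) z hz).trans ((congrFun (key hΨ) z).trans (e z hz).symm)

/-- The inclusion, as a linear map. -/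
def inclP (B : FieldSpace n d X Y) (K : Antifields n X ι) (V' E' : VB n X) (a : ℕ) :
    P B K →ₗ[Sm n X] P B (K.extend V' E' a) where
  toFun Φ := ⟨inclF B K V' E' a Φ, Φ.2.imp fun _ h => h.imp fun _ h => inclF_mem h⟩
  map_add' _ _ := Subtype.ext (map_add _ _ _)
  map_smul' _ _ := Subtype.ext (map_smul _ _ _)

/-- Setting the new antifields to zero, as a linear map. -/
def resP (B : FieldSpace n d X Y) (K : Antifields n X ι) (V' E' : VB n X) (a : ℕ) :
    P B (K.extend V' E' a) →ₗ[Sm n X] P B K where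
  toFun Φ := ⟨resF B K V' E' a Φ, Φ.2.imp fun _ h => h.imp fun _ h => resF_mem h⟩
  map_add' _ _ := Subtype.ext (map_add _ _ _)
  map_smul' _ _ := Subtype.ext (map_smul _ _ _)

theorem resP_inclP (Φ : P B K) : resP B K V' E' a (inclP B K V' E' a Φ) = Φ :=
  Subtype.ext (resF_inclF _)

theorem inclP_injective : Function.Injective (inclP B K V' E' a) :=
  Function.LeftInverse.injective resP_inclP

theorem inclP_mul (Φ Ψ : P B K) :
    inclP B K V' E' a (Φ * Ψ) = inclP B K V' E' a Φ * inclP B K V' E' a Ψ :=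
  Subtype.ext (map_mul _ _ _)

theorem resP_mul (Φ Ψ : P B (K.extend V' E' a)) :
    resP B K V' E' a (Φ * Ψ) = resP B K V' E' a Φ * resP B K V' E' a Ψ :=
  Subtype.ext (map_mul _ _ _)

theorem inclP_grP (Φ : P B K) : grP (inclP B K V' E' a Φ) = inclP B K V' E' a (grP Φ) :=
  Subtype.ext (grF_pull _ _ _)

theorem inclP_tdP (τ : VF n X) (Φ : P B K) :
    inclP B K V' E' a (tdP τ Φ) = tdP τ (inclP B K V' E' a Φ) :=
  Subtype.ext (pull_totalDerivs _ _ Φ.2 (inclP B K V' E' a Φ).2 [τ])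

theorem resP_tdP (τ : VF n X) (Φ : P B (K.extend V' E' a)) :
    resP B K V' E' a (tdP τ Φ) = tdP τ (resP B K V' E' a Φ) :=
  Subtype.ext (pull_totalDerivs _ _ Φ.2 (resP B K V' E' a Φ).2 [τ])

theorem inclP_resP {r l : ℕ} (hl : l < a) {Φ : P B (K.extend V' E' a)}
    (h : (Φ : Fun B _) ∈ ordLe B (K.extend V' E' a) r l) :
    inclP B K V' E' a (resP B K V' E' a Φ) = Φ := Subtype.ext (inclF_resF hl h)

theorem ordLe_le_of_ant_le {l : ℕ} (hK : ∀ i, K.ant i ≤ l) (hl : 1 ≤ l) (r l' : ℕ) :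
    ordLe B K r l' ≤ ordLe B K r l := by
  intro Φ h x₀
  obtain ⟨U, hU, Ψ, hΨ, e⟩ := h x₀
  refine ⟨U, hU, Ψ, Algebra.adjoin_mono (fun g hg => ?_) hΨ, e⟩
  cases (show Gen B K r l' g from hg) with
  | body f hf => exact Gen.body f hf
  | field t ht κ => exact Gen.field t ht κ
  | antiEven _ t ht v σ => exact Gen.antiEven hl t ht v σ
  | antiOdd _ t ht v σ => exact Gen.antiOdd hl t ht v σ
  | ghostEven i _ t ht v σ => exact Gen.ghostEven i (hK i) t ht v σ
  | ghostOdd i _ t ht v σ => exact Gen.ghostOdd i (hK i) t ht v σ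

end Extend

end KoszulTate
end

noncomputable section

namespace KoszulTate

/-! ### The antifields as graded densities -/

variable {n d : ℕ} {X Y : Type}
  [TopologicalSpace X] [ChartedSpace (EuclideanSpace ℝ (Fin n)) X] [IsManifold (𝓡 n) ∞ X]
  [T2Space X] [TopologicalSpace Y] [ChartedSpace (EuclideanSpace ℝ (Fin d)) Y]
  [IsManifold (𝓡 d) ∞ Y] {B : FieldSpace n d X Y} {ι : Type} {K : Antifields n X ι}

/-- The graded densities which are linear images of the values of a section of a density-dual. -/
def densOf {C : VB n X} (ev : JetPt B × QEven B K → Module.Dual ℝ (DensDual C) →ₗ[ℝ] Val B K)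
    (h : ∀ v σ, (fun z => ev z (densEval z.1.x [] v σ) : Fun B K) ∈ P B K) :
    Sec C →ₗ[Sm n X] Dens B K where
  toFun v :=
    { toFun := fun σ => ⟨_, h v σ⟩
      map_update_add' := fun σ i τ τ' => Subtype.ext (funext fun z => by
        refine Eq.trans (congrArg (ev z) (LinearMap.ext fun k => ?_)) (map_add (ev z) _ _)
        exact congrArg (fun f : Sm n X => f z.1.x)
          (((show Sec C →ₗ[Sm n X] TopForm n X from k) v).map_update_add σ i τ τ'))
      map_update_smul' := fun σ i f τ => Subtype.ext (funext fun z => by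
        refine Eq.trans ?_ (Fun.smul_apply B K f _ z).symm
        refine Eq.trans (congrArg (ev z) (LinearMap.ext fun k => ?_)) (map_smul (ev z) (f z.1.x) _)
        exact congrArg (fun f : Sm n X => f z.1.x)
          (((show Sec C →ₗ[Sm n X] TopForm n X from k) v).map_update_smul σ i f τ))
      map_eq_zero_of_eq' := fun σ i j e hij => Subtype.ext (funext fun z => by
        refine Eq.trans (congrArg (ev z) (LinearMap.ext fun k => ?_)) (map_zero (ev z))
        exact congrArg (fun f : Sm n X => f z.1.x)
          (((show Sec C →ₗ[Sm n X] TopForm n X from k) v).map_eq_zero_of_eq σ e hij)) }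
  map_add' v w := AlternatingMap.ext fun σ => Subtype.ext (funext fun z => by
    refine Eq.trans (congrArg (ev z) (LinearMap.ext fun k => ?_)) (map_add (ev z) _ _)
    exact congrArg (fun f : TopForm n X => f σ z.1.x)
      (map_add (show Sec C →ₗ[Sm n X] TopForm n X from k) v w))
  map_smul' f v := AlternatingMap.ext fun σ => Subtype.ext (funext fun z => by
    refine Eq.trans ?_ (Fun.smul_apply B K f _ z).symm
    refine Eq.trans (congrArg (ev z) (LinearMap.ext fun k => ?_)) (map_smul (ev z) (f z.1.x) _)
    exact congrArg (fun f : TopForm n X => f σ z.1.x)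
      (map_smul (show Sec C →ₗ[Sm n X] TopForm n X from k) f v))

/-- The even antifields, as densities. -/
def densEven (B : FieldSpace n d X Y) (K : Antifields n X ι) (o : Option ι) :
    Sec (evenVB B K o) →ₗ[Sm n X] Dens B K :=
  densOf (fun z => Algebra.linearMap ℝ (Val B K) ∘ₗ Module.Dual.eval ℝ _ (evenProj B K o z.2))
    fun v σ => genEven_mem o [] v σ

/-- The odd antifields, as densities. -/
def densOdd (B : FieldSpace n d X Y) (K : Antifields n X ι) (o : Option ι) :
    Sec (oddVB B K o) →ₗ[Sm n X] Dens B K :=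
  densOf (fun z => ExteriorAlgebra.ι ℝ ∘ₗ (oddProj B K o).dualMap)
    fun v σ => genOdd_mem o [] v σ

theorem densEven_mem (o : Option ι) (v : Sec (evenVB B K o)) (σ : Fin n → VF n X) :
    (densEven B K o v σ : Fun B K) ∈ ordLe B K 0 (antNum K o) :=
  genAlg_le_ordLe _ _ (Algebra.subset_adjoin (gen_genEven (t := []) o le_rfl v σ))

theorem densOdd_mem (o : Option ι) (v : Sec (oddVB B K o)) (σ : Fin n → VF n X) :
    (densOdd B K o v σ : Fun B K) ∈ ordLe B K 0 (antNum K o) :=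
  genAlg_le_ordLe _ _ (Algebra.subset_adjoin (gen_genOdd (t := []) o le_rfl v σ))

theorem densEven_chain (o : Option ι) (v : Sec (evenVB B K o)) :
    densEven B K o v ∈ chains B K (antNum K o) (antNum K o) :=
  ⟨⟨0, densEven_mem o v⟩, isAnt_genEven o [] v⟩

theorem densOdd_chain (o : Option ι) (v : Sec (oddVB B K o)) :
    densOdd B K o v ∈ chains B K (antNum K o) (antNum K o) :=
  ⟨⟨0, densOdd_mem o v⟩, isAnt_genOdd o [] v⟩

theorem grP_eq_neg_iff {Φ : P B K} : grP Φ = -Φ ↔ IsPar B K 1 (Φ : Fun B K) := by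
  rw [isPar_coe_iff, show (1 : ZMod 2).val = 1 from rfl, pow_one, neg_one_mul]

theorem grP_eq_self_iff {Φ : P B K} : grP Φ = Φ ↔ IsPar B K 0 (Φ : Fun B K) := by
  rw [isPar_coe_iff, show (0 : ZMod 2).val = 0 from rfl, pow_zero, one_mul]

/-! ### Extension of contact derivations to new antifields -/

section Extend

variable {V' E' : VB n X} {a : ℕ}

/-- The action of a linear map on densities, as a linear map. -/
def actL {K' : Antifields n X (Option ι)} (T : P B K →ₗ[Sm n X] P B K') :
    Dens B K →ₗ[Sm n X] Dens B K' where
  toFun Φ := T.compAlternatingMap Φ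
  map_add' Φ Ψ := AlternatingMap.ext fun σ => map_add T _ _
  map_smul' f Φ := AlternatingMap.ext fun σ => map_smul T _ _

/-- The values on all the antifields of an extension of `D`, given those on the new ones. -/
def extendEven (D : P B K →ₗ[Sm n X] P B K) (ΔV : Sec V' →ₗ[Sm n X] Dens B K) :
    ∀ o : Option (Option ι), Sec (evenVB B (K.extend V' E' a) o) →ₗ[Sm n X]
      Dens B (K.extend V' E' a)
  | none => actL (inclP B K V' E' a ∘ₗ D) ∘ₗ densEven B K none
  | some none => actL (inclP B K V' E' a) ∘ₗ ΔV
  | some (some i) => actL (inclP B K V' E' a ∘ₗ D) ∘ₗ densEven B K (some i)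

/-- The values on all the antifields of an extension of `D`, given those on the new ones. -/
def extendOdd (D : P B K →ₗ[Sm n X] P B K) (ΔE : Sec E' →ₗ[Sm n X] Dens B K) :
    ∀ o : Option (Option ι), Sec (oddVB B (K.extend V' E' a) o) →ₗ[Sm n X]
      Dens B (K.extend V' E' a)
  | none => actL (inclP B K V' E' a ∘ₗ D) ∘ₗ densOdd B K none
  | some none => actL (inclP B K V' E' a) ∘ₗ ΔE
  | some (some i) => actL (inclP B K V' E' a ∘ₗ D) ∘ₗ densOdd B K (some i)

variable {D : P B K →ₗ[Sm n X] P B K}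

theorem IsContactDer.isAnt_pred (hD : IsContactDer D) {m : ℕ} (hm : 1 ≤ m) {Φ : P B K}
    (h : IsAnt B K m (Φ : Fun B K)) : IsAnt B K (m - 1) (D Φ : Fun B K) := by
  obtain ⟨m, rfl⟩ := Nat.exists_eq_add_of_le' hm
  exact hD.ant m Φ h

theorem IsContactDer.exists_antiValues [Finite ι] (hD : IsContactDer D) (hK : ∀ i, 1 ≤ K.ant i)
    (ha : 1 ≤ a) (ΔV : Sec V' →ₗ[Sm n X] Dens B K) (ΔE : Sec E' →ₗ[Sm n X] Dens B K) {r : ℕ}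
    (hV : ∀ v σ, (ΔV v σ : Fun B K) ∈ ordLe B K r (a - 1))
    (hE : ∀ v σ, (ΔE v σ : Fun B K) ∈ ordLe B K r (a - 1))
    (pV : ∀ v, (ΔV v).IsPar 1) (pE : ∀ v, (ΔE v).IsPar 0)
    (aV : ∀ v σ, IsAnt B K (a - 1) (ΔV v σ : Fun B K))
    (aE : ∀ v σ, IsAnt B K (a - 1) (ΔE v σ : Fun B K)) :
    ∃ A : AntiValues B (K.extend V' E' a), A.even = extendEven D ΔV ∧ A.odd = extendOdd D ΔE := by
  have hpos : ∀ o, 1 ≤ antNum K o := fun o => by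
    cases o with
    | none => exact le_rfl
    | some i => exact hK i
  choose R hR using fun o => hD.order 0 (antNum K o)
  have := Fintype.ofFinite ι
  let r' := max r (Finset.univ.sup R)
  have hr' : ∀ o, R o ≤ r' := fun o => (Finset.le_sup (Finset.mem_univ o)).trans (le_max_right _ _)
  have mem : ∀ o (Φ : P B K), (Φ : Fun B K) ∈ ordLe B K 0 (antNum K o) →
      (inclP B K V' E' a (D Φ) : Fun B _) ∈ ordLe B (K.extend V' E' a) r' (antNum K o) :=
    fun o Φ h => inclF_mem (ordLe_mono B K (hr' o) le_rfl (hR o Φ h))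
  have mem' : ∀ Φ : P B K, (Φ : Fun B K) ∈ ordLe B K r (a - 1) →
      (inclP B K V' E' a Φ : Fun B _) ∈ ordLe B (K.extend V' E' a) r' a :=
    fun Φ h => inclF_mem (ordLe_mono B K (le_max_left _ _) (Nat.sub_le _ _) h)
  have par0 : ∀ Φ : P B K, grP Φ = Φ →
      grP (inclP B K V' E' a (D Φ)) = -inclP B K V' E' a (D Φ) := fun Φ h => by
    rw [inclP_grP, grP_eq_neg_iff.2 (hD.parity 0 Φ (grP_eq_self_iff.1 h)), map_neg]
  have par1 : ∀ Φ : P B K, grP Φ = -Φ →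
      grP (inclP B K V' E' a (D Φ)) = inclP B K V' E' a (D Φ) := fun Φ h => by
    rw [inclP_grP, grP_eq_self_iff.2 (hD.parity 1 Φ (grP_eq_neg_iff.1 h))]
  have ant : ∀ o (Φ : P B K), IsAnt B K (antNum K o) (Φ : Fun B K) →
      IsAnt B (K.extend V' E' a) (antNum K o - 1) (inclP B K V' E' a (D Φ) : Fun B _) :=
    fun o Φ h => isAnt_inclF_iff.2 (hD.isAnt_pred (hpos o) h)
  refine ⟨{ even := extendEven D ΔV
            odd := extendOdd D ΔE
            ord := r'
            ant_pos := ?_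
            even_mem := ?_
            odd_mem := ?_
            even_par := ?_
            odd_par := ?_
            even_ant := ?_
            odd_ant := ?_ }, rfl, rfl⟩
  · rintro (_ | _ | i)
    · exact le_rfl
    · exact ha
    · exact hK i
  · rintro (_ | _ | i) v σ
    · exact mem none _ (densEven_mem (K := K) none v σ)
    · exact mem' _ (hV v σ)
    · exact mem (some i) _ (densEven_mem (K := K) (some i) v σ)
  · rintro (_ | _ | i) v σ
    · exact mem none _ (densOdd_mem (K := K) none v σ)
    · exact mem' _ (hE v σ)
    · exact mem (some i) _ (densOdd_mem (K := K) (some i) v σ)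
  · rintro (_ | _ | i) v σ
    · exact par0 _ (Subtype.ext (grF_genEven (K := K) none [] v σ))
    · exact (inclP_grP _).trans ((congrArg _ (grP_eq_neg_iff.2 (pV v σ))).trans (map_neg _ _))
    · exact par0 _ (Subtype.ext (grF_genEven (K := K) (some i) [] v σ))
  · rintro (_ | _ | i) v σ
    · exact par1 _ (Subtype.ext (grF_genOdd (K := K) none [] v σ))
    · exact (inclP_grP _).trans (congrArg _ (grP_eq_self_iff.2 (pE v σ)))
    · exact par1 _ (Subtype.ext (grF_genOdd (K := K) (some i) [] v σ))
  · rintro (_ | _ | i) v σ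
    · exact ant none _ (isAnt_genEven (K := K) none [] v σ)
    · exact isAnt_inclF_iff.2 (aV v σ)
    · exact ant (some i) _ (isAnt_genEven (K := K) (some i) [] v σ)
  · rintro (_ | _ | i) v σ
    · exact ant none _ (isAnt_genOdd (K := K) none [] v σ)
    · exact isAnt_inclF_iff.2 (aE v σ)
    · exact ant (some i) _ (isAnt_genOdd (K := K) (some i) [] v σ)

/-- Compare inside the old ring: include, apply D', set the new antifields to zero, and subtract D.
This defect is derivation-like and vanishes on the antifields, hence is zero. Setting the new
antifields to zero loses nothing, because D' respects the bound a − 1 on the antifield number. -/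
theorem IsContactDer.extend_apply {D' : P B (K.extend V' E' a) →ₗ[Sm n X] P B (K.extend V' E' a)}
    (hD : IsContactDer D) (hD' : IsContactDer D') (hKa : ∀ i, K.ant i < a) (ha : 2 ≤ a)
    (he : ∀ o v σ, D' (inclP B K V' E' a (densEven B K o v σ)) =
      inclP B K V' E' a (D (densEven B K o v σ)))
    (ho : ∀ o v σ, D' (inclP B K V' E' a (densOdd B K o v σ)) =
      inclP B K V' E' a (D (densOdd B K o v σ)))
    (Φ : P B K) : D' (inclP B K V' E' a Φ) = inclP B K V' E' a (D Φ) := by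
  have hT : IsDerLike (resP B K V' E' a ∘ₗ D' ∘ₗ inclP B K V' E' a - D) := by
    refine ⟨?_, ?_, ?_, ?_⟩
    · have h1 : D' (inclP B K V' E' a 1) = 0 := hD'.fields 0 _ (inclF_mem (one_mem _))
      change resP B K V' E' a (D' (inclP B K V' E' a 1)) - D 1 = 0
      rw [h1, map_zero, hD.map_one, sub_zero]
    · intro Φ g r b i hg (h : resP B K V' E' a (D' (inclP B K V' E' a Φ)) - D Φ = 0)
        (h' : resP B K V' E' a (D' (inclP B K V' E' a g)) - D g = 0)
      change resP B K V' E' a (D' (inclP B K V' E' a (Φ * g))) - D (Φ * g) = 0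
      rw [inclP_mul, hD'.map_mul, hD.map_mul, map_add, resP_mul, resP_mul, inclP_grP, resP_inclP,
        resP_inclP, sub_eq_zero.1 h, sub_eq_zero.1 h', sub_self]
    · intro r Φ h
      have h1 : D' (inclP B K V' E' a Φ) = 0 := hD'.fields r _ (inclF_mem h)
      change resP B K V' E' a (D' (inclP B K V' E' a Φ)) - D Φ = 0
      rw [h1, map_zero, hD.fields r Φ h, sub_zero]
    · intro τ Φ
      change resP B K V' E' a (D' (inclP B K V' E' a (tdP τ Φ))) - D (tdP τ Φ) =
        tdP τ (resP B K V' E' a (D' (inclP B K V' E' a Φ)) - D Φ)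
      rw [inclP_tdP, hD'.map_tdP, hD.map_tdP, resP_tdP, tdP_sub]
  obtain ⟨r, l, hr⟩ := Φ.2
  have hr := ordLe_le_of_ant_le (l := a - 1) (fun i => Nat.le_sub_one_of_lt (hKa i)) (by omega) r l hr
  have key : ∀ Φ : P B K, D' (inclP B K V' E' a Φ) = inclP B K V' E' a (D Φ) →
      resP B K V' E' a (D' (inclP B K V' E' a Φ)) - D Φ = 0 := fun Φ h => by
    rw [h, resP_inclP, sub_self]
  have h0 : resP B K V' E' a (D' (inclP B K V' E' a Φ)) - D Φ = 0 := by
    refine hT.eq_zero (l := a - 1) ?_ ?_ ?_ ?_ hr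
    · intro _ v σ Φ e
      obtain rfl : Φ = densEven B K none v σ := Subtype.ext e
      exact key _ (he none v σ)
    · intro _ v σ Φ e
      obtain rfl : Φ = densOdd B K none v σ := Subtype.ext e
      exact key _ (ho none v σ)
    · intro i _ v σ Φ e
      obtain rfl : Φ = densEven B K (some i) v σ := Subtype.ext e
      exact key _ (he (some i) v σ)
    · intro i _ v σ Φ e
      obtain rfl : Φ = densOdd B K (some i) v σ := Subtype.ext e
      exact key _ (ho (some i) v σ)
  obtain ⟨r', hr'⟩ := hD'.order r (a - 1)
  rw [← sub_eq_zero.1 h0, inclP_resP (by omega) (hr' _ (inclF_mem hr))]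

/-- A contact derivation extends to the ring with new antifields, with given values on the new
antifields. -/
theorem IsContactDer.exists_extend [Finite ι] (hD : IsContactDer D) (hK : ∀ i, 1 ≤ K.ant i)
    (hKa : ∀ i, K.ant i < a) (ha : 2 ≤ a)
    (ΔV : Sec V' →ₗ[Sm n X] Dens B K) (ΔE : Sec E' →ₗ[Sm n X] Dens B K) {r : ℕ}
    (hV : ∀ v σ, (ΔV v σ : Fun B K) ∈ ordLe B K r (a - 1))
    (hE : ∀ v σ, (ΔE v σ : Fun B K) ∈ ordLe B K r (a - 1))
    (pV : ∀ v, (ΔV v).IsPar 1) (pE : ∀ v, (ΔE v).IsPar 0)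
    (aV : ∀ v σ, IsAnt B K (a - 1) (ΔV v σ : Fun B K))
    (aE : ∀ v σ, IsAnt B K (a - 1) (ΔE v σ : Fun B K)) :
    ∃ D' : P B (K.extend V' E' a) →ₗ[Sm n X] P B (K.extend V' E' a), IsContactDer D' ∧
      (∀ Φ, D' (inclP B K V' E' a Φ) = inclP B K V' E' a (D Φ)) ∧
      (∀ v σ (Φ' : P B (K.extend V' E' a)),
        (Φ' : Fun B _) = ghostEven B (K.extend V' E' a) none [] v σ →
          D' Φ' = inclP B K V' E' a (ΔV v σ)) ∧
      (∀ v σ (Φ' : P B (K.extend V' E' a)),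
        (Φ' : Fun B _) = ghostOdd B (K.extend V' E' a) none [] v σ →
          D' Φ' = inclP B K V' E' a (ΔE v σ)) := by
  obtain ⟨A, hA0, hA1⟩ := hD.exists_antiValues hK (by omega) ΔV ΔE hV hE pV pE aV aE
  obtain ⟨D', hD', h0, h1⟩ := A.exists_contactDer
  rw [hA0] at h0
  rw [hA1] at h1
  refine ⟨D', hD', hD.extend_apply hD' hKa ha ?_ ?_, fun v σ Φ e => h0 (some none) v σ Φ e,
    fun v σ Φ e => h1 (some none) v σ Φ e⟩
  · rintro (_ | i) v σ
    · exact h0 none v σ _ (inclF_antiEven [] v σ)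
    · exact h0 (some (some i)) v σ _ (inclF_ghostEven i [] v σ)
  · rintro (_ | i) v σ
    · exact h1 none v σ _ (inclF_antiOdd [] v σ)
    · exact h1 (some (some i)) v σ _ (inclF_ghostOdd i [] v σ)

end Extend

end KoszulTate
end

noncomputable section

namespace KoszulTate

variable {n d : ℕ} {X Y : Type}
  [TopologicalSpace X] [ChartedSpace (EuclideanSpace ℝ (Fin n)) X] [IsManifold (𝓡 n) ∞ X]
  [T2Space X] [TopologicalSpace Y] [ChartedSpace (EuclideanSpace ℝ (Fin d)) Y]
  [IsManifold (𝓡 d) ∞ Y] {B : FieldSpace n d X Y} {ι : Type} {K : Antifields n X ι}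

/-! ### Lie derivatives of graded densities -/

theorem VF.lie_add (τ ξ η : VF n X) : ⁅τ, ξ + η⁆ = ⁅τ, ξ⁆ + ⁅τ, η⁆ := by
  refine Derivation.ext fun g => ?_
  rw [Derivation.commutator_apply, Derivation.add_apply, Derivation.add_apply,
    Derivation.add_apply, Derivation.commutator_apply, Derivation.commutator_apply, map_add]
  abel

theorem VF.lie_smul (τ : VF n X) (f : Sm n X) (ξ : VF n X) : ⁅τ, f • ξ⁆ = τ f • ξ + f • ⁅τ, ξ⁆ := by
  refine Derivation.ext fun g => ?_
  rw [Derivation.add_apply, Derivation.smul_apply, Derivation.smul_apply,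
    Derivation.commutator_apply, Derivation.commutator_apply, Derivation.smul_apply,
    Derivation.smul_apply, smul_eq_mul, smul_eq_mul, smul_eq_mul, smul_eq_mul, Derivation.leibniz,
    smul_eq_mul, smul_eq_mul]
  ring

/-- The Lie derivative of a graded density along a total derivative. -/
def lieDens (τ : VF n X) (Φ : Dens B K) : Dens B K where
  toFun σ := tdP τ (Φ σ) - ∑ i, Φ (Function.update σ i ⁅τ, σ i⁆)
  map_update_add' {_} σ i ξ η := by
    have h : ∀ j, Φ (Function.update (Function.update σ i (ξ + η)) j
          ⁅τ, Function.update σ i (ξ + η) j⁆) =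
        Φ (Function.update (Function.update σ i ξ) j ⁅τ, Function.update σ i ξ j⁆) +
        Φ (Function.update (Function.update σ i η) j ⁅τ, Function.update σ i η j⁆) := by
      intro j
      by_cases hj : j = i
      · subst hj
        simp only [Function.update_self, Function.update_idem]
        rw [VF.lie_add]
        convert Φ.map_update_add σ j ⁅τ, ξ⁆ ⁅τ, η⁆
      · simp only [Function.update_of_ne hj]
        rw [Function.update_comm (Ne.symm hj), Function.update_comm (Ne.symm hj),
          Function.update_comm (Ne.symm hj)]
        convert Φ.map_update_add (Function.update σ j ⁅τ, σ j⁆) i ξ η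
    have h2 := congrArg₂ (· - ·) ((congrArg (tdP τ) (Φ.map_update_add σ i ξ η)).trans (tdP_add τ _ _))
      ((Finset.sum_congr (s₁ := Finset.univ) rfl fun j _ => h j).trans Finset.sum_add_distrib)
    refine Eq.trans ?_ (h2.trans ((add_sub_add_comm _ _ _ _).trans ?_)) <;> convert rfl
  -- The operation is tensorial: the term with τ f from the Leibniz rule cancels the one from the
  -- bracket of τ with f ξ in slot i.
  map_update_smul' {_} σ i f ξ := by
    have h : ∀ j, Φ (Function.update (Function.update σ i (f • ξ)) j
          ⁅τ, Function.update σ i (f • ξ) j⁆) =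
        f • Φ (Function.update (Function.update σ i ξ) j ⁅τ, Function.update σ i ξ j⁆) +
        if j = i then τ f • Φ (Function.update σ i ξ) else 0 := by
      intro j
      by_cases hj : j = i
      · subst hj
        simp only [Function.update_self, Function.update_idem, if_true]
        rw [VF.lie_smul, add_comm, ← Φ.map_update_smul, ← Φ.map_update_smul, ← Φ.map_update_add]
      · simp only [Function.update_of_ne hj, if_neg hj, add_zero]
        rw [Function.update_comm (Ne.symm hj), Function.update_comm (Ne.symm hj)]
        convert Φ.map_update_smul (Function.update σ j ⁅τ, σ j⁆) i f ξ
    have h2 : ∑ j, Φ (Function.update (Function.update σ i (f • ξ)) j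
          ⁅τ, Function.update σ i (f • ξ) j⁆) =
        f • ∑ j, Φ (Function.update (Function.update σ i ξ) j ⁅τ, Function.update σ i ξ j⁆) +
          τ f • Φ (Function.update σ i ξ) := by
      rw [Finset.sum_congr rfl fun j _ => h j, Finset.sum_add_distrib, Finset.smul_sum,
        Finset.sum_ite_eq' Finset.univ i, if_pos (Finset.mem_univ _)]
    have h3 : tdP τ (Φ (Function.update σ i (f • ξ))) =
        τ f • Φ (Function.update σ i ξ) + f • tdP τ (Φ (Function.update σ i ξ)) := by
      rw [Φ.map_update_smul, tdP_smul]
    have := congrArg₂ (· - ·) h3 h2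
    rw [smul_sub]
    convert this using 1
    · convert rfl
    · rw [add_comm (f • _) (τ f • _), add_sub_add_left_eq_sub]
      convert rfl
  map_eq_zero_of_eq' σ i j e hij := by
    -- When σ i = σ j, the summands for slots i and j differ by exchanging these two arguments and
    -- cancel; all other summands still have two equal arguments.
    have h1 : Function.update σ j ⁅τ, σ j⁆ = Function.update σ i ⁅τ, σ i⁆ ∘ Equiv.swap i j := by
      funext k
      by_cases hk : k = j
      · subst hk
        rw [Function.comp_apply, Equiv.swap_apply_right, Function.update_self, Function.update_self, e]
      · rw [Function.update_of_ne hk]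
        by_cases hk' : k = i
        · subst hk'
          rw [Function.comp_apply, Equiv.swap_apply_left, Function.update_of_ne hij.symm, e]
        · rw [Function.comp_apply, Equiv.swap_apply_of_ne_of_ne hk' hk, Function.update_of_ne hk']
    rw [Φ.map_eq_zero_of_eq σ e hij, tdP_zero, zero_sub, neg_eq_zero,
      Finset.sum_eq_add (a := i) (b := j) hij, h1, Φ.map_swap _ hij, add_neg_cancel]
    · exact fun k _ hk => Φ.map_eq_zero_of_eq _
        (by rw [Function.update_of_ne hk.1.symm, Function.update_of_ne hk.2.symm, e]) hij
    · exact fun h => absurd (Finset.mem_univ _) h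
    · exact fun h => absurd (Finset.mem_univ _) h

theorem lieDens_apply (τ : VF n X) (Φ : Dens B K) (σ : Fin n → VF n X) :
    lieDens τ Φ σ = tdP τ (Φ σ) - ∑ i, Φ (Function.update σ i ⁅τ, σ i⁆) := rfl

theorem lieDens_chain (τ : VF n X) {l m : ℕ} {Φ : Dens B K} (h : Φ ∈ chains B K l m) :
    lieDens τ Φ ∈ chains B K l m := by
  obtain ⟨⟨r, hr⟩, ha⟩ := h
  refine ⟨⟨r + 1, fun σ => ?_⟩, fun σ => ?_⟩
  · rw [lieDens_apply]
    refine sub_mem ((ordLe_isTD (hr σ)).2 τ) ?_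
    rw [AddSubmonoidClass.coe_finsetSum]
    exact sum_mem fun i _ => ordLe_mono B K (Nat.le_succ r) le_rfl (hr _)
  · rw [lieDens_apply]
    refine IsAnt.sub (isAnt_tdP (ha σ) τ) ?_
    rw [AddSubmonoidClass.coe_finsetSum]
    exact Finset.sum_induction _ (IsAnt B K m) (fun _ _ => IsAnt.add) IsAnt.zero fun i _ => ha _

theorem IsContactDer.act_lieDens {D : P B K →ₗ[Sm n X] P B K} (hD : IsContactDer D) (τ : VF n X)
    (Φ : Dens B K) : act D (lieDens τ Φ) = lieDens τ (act D Φ) := AlternatingMap.ext fun σ => by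
  rw [act_apply, lieDens_apply, lieDens_apply, map_sub, hD.map_tdP, map_sum]
  rfl

theorem Dens.IsLieDeriv.eq_lieDens {τ : VF n X} {Φ Ψ : Dens B K} (h : Dens.IsLieDeriv τ Φ Ψ) :
    Ψ = lieDens τ Φ := AlternatingMap.ext fun σ => Subtype.ext (by
  rw [h σ, lieDens_apply, AddSubgroupClass.coe_sub, AddSubmonoidClass.coe_finsetSum]
  rfl)

/-! ### Multiplication of densities by graded functions of the fields -/

theorem isAnt_zero_of_mem {r : ℕ} {Φ : P B K} (h : (Φ : Fun B K) ∈ ordLe B K r 0) :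
    IsAnt B K 0 (Φ : Fun B K) := by
  refine ordLe_induction (Q := fun Φ => IsAnt B K 0 (Φ : Fun B K)) ?_ ?_ IsAnt.zero
    (fun _ _ => IsAnt.add) (fun a _ h => h.smul a) ?_ h
  · intro t z
    rw [pow_zero, one_smul]
    exact congrFun (map_one (subst B K _)) z
  · intro Φ g a i hΦ ha hg
    obtain rfl : a = 0 := Nat.le_zero.1 ha
    exact hΦ.mul hg.isAnt
  · intro Φ h t z
    obtain ⟨U, hU, Ψ, hΨ, e⟩ := h z.1.x
    have hz := mem_of_mem_nhds hU
    have h1 : subst B K (fun j => t ^ j) Φ z = subst B K (fun j => t ^ j) Ψ z :=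
      congrArg _ (e (z.1, scaleEven B K _ z.2) hz)
    rw [h1, hΨ t z, e z hz]

/-- The product of a graded function and a graded density. -/
def mulDens (f : P B K) (Φ : Dens B K) : Dens B K :=
  (LinearMap.mulLeft (Sm n X) f).compAlternatingMap Φ

theorem mulDens_apply (f : P B K) (Φ : Dens B K) (σ : Fin n → VF n X) :
    mulDens f Φ σ = f * Φ σ := rfl

theorem mulDens_chain {f : P B K} {r l m : ℕ} (hf : (f : Fun B K) ∈ ordLe B K r 0) {Φ : Dens B K}
    (h : Φ ∈ chains B K l m) : mulDens f Φ ∈ chains B K l m := by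
  obtain ⟨⟨r', hr⟩, ha⟩ := h
  refine ⟨⟨max r r', fun σ => mul_mem (ordLe_mono B K (le_max_left _ _) (Nat.zero_le _) hf)
    (ordLe_mono B K (le_max_right _ _) le_rfl (hr σ))⟩, fun σ => ?_⟩
  have := (isAnt_zero_of_mem hf).mul (ha σ)
  rwa [Nat.zero_add] at this

theorem IsContactDer.act_mulDens {D : P B K →ₗ[Sm n X] P B K} (hD : IsContactDer D) {f : P B K}
    {r : ℕ} (hf : (f : Fun B K) ∈ ordLe B K r 0) (Φ : Dens B K) :
    act D (mulDens f Φ) = mulDens f (act D Φ) := AlternatingMap.ext fun σ => by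
  rw [act_apply, mulDens_apply, mulDens_apply, hD.map_mul, hD.fields r f hf, zero_mul, zero_add]
  rfl

/-! ### Nilpotency and the complete Noether identities -/

theorem IsContactDer.map_grP {D : P B K →ₗ[Sm n X] P B K} (hD : IsContactDer D) {i : ZMod 2}
    {Φ : P B K} (h : IsPar B K i (Φ : Fun B K)) : D (grP Φ) = -grP (D Φ) := by
  have h1 := hD.parity i Φ h
  fin_cases i
  · rw [grP_eq_self_iff.2 h, grP_eq_neg_iff.2 h1, neg_neg]
  · rw [grP_eq_neg_iff.2 h, map_neg, grP_eq_self_iff.2 h1]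

/-- Expanding D (D (Φ g)), the two mixed terms are D Φ · D (gr g) and D Φ · gr (D g). They cancel
because an odd derivation anticommutes with the grade involution. -/
theorem IsContactDer.isDerLike_sq {D : P B K →ₗ[Sm n X] P B K} (hD : IsContactDer D) :
    IsDerLike (D ∘ₗ D) where
  one := (congrArg D hD.map_one).trans (map_zero D)
  mul Φ g r a i hg (h : D (D Φ) = 0) (h' : D (D g) = 0) := by
    change D (D (Φ * g)) = 0
    rw [hD.map_mul, map_add, hD.map_mul, hD.map_mul, h, h', hD.map_grP hg.par]
    simp
  fields r Φ h := (congrArg D (hD.fields r Φ h)).trans (map_zero D)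
  contact τ Φ := by
    change D (D (tdP τ Φ)) = tdP τ (D (D Φ))
    rw [hD.map_tdP, hD.map_tdP]

/-- Nilpotency makes the value of D on an antifield a cycle, so each identity is an instance of the
passage from cycles to Noether identities. For k = 0 the value involves only antifields of number
one, where D is δbar. -/
theorem IsPair.completeIdentities {D δbar : P B K →ₗ[Sm n X] P B K} (H : IsPair D δbar)
    (hD2 : ∀ Φ, D (D Φ) = 0) (M : ℕ) : CompleteIdentities δbar D M := by
  intro i k _ _ Δ hΔ hv
  have hcyc : act D Δ = 0 := by
    refine AlternatingMap.ext fun σ => ?_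
    change D (Δ σ) = 0
    rcases hv with ⟨v, hv⟩ | ⟨v, hv⟩
    all_goals
      obtain ⟨Φ, -, e⟩ := hv σ
      rw [← e, hD2]
  refine ⟨fun hk => ?_, fun hk => ?_⟩
  · subst hk
    obtain ⟨⟨r, hr⟩, -⟩ := hΔ
    refine Eq.trans (AlternatingMap.ext fun σ => ?_) hcyc
    exact (H.agree r _ (hr σ)).symm
  · obtain ⟨k, rfl⟩ := Nat.exists_eq_add_of_le' hk
    exact H.noetherIdentity_of_cycle ⟨hΔ, hcyc⟩

end KoszulTate
end

noncomputable section

namespace KoszulTate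

variable {n d : ℕ} {X Y : Type}
  [TopologicalSpace X] [ChartedSpace (EuclideanSpace ℝ (Fin n)) X] [IsManifold (𝓡 n) ∞ X]
  [T2Space X] [TopologicalSpace Y] [ChartedSpace (EuclideanSpace ℝ (Fin d)) Y]
  [IsManifold (𝓡 d) ∞ Y] {B : FieldSpace n d X Y} {ι : Type} {K : Antifields n X ι}

/-! ### Trivial vector bundles -/

/-- The trivial vector bundle of rank `p`. -/
def trivialVB (n : ℕ) (X : Type) [TopologicalSpace X]
    [ChartedSpace (EuclideanSpace ℝ (Fin n)) X] [IsManifold (𝓡 n) ∞ X] (p : ℕ) : VB n X where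
  rank := p
  fiber := Bundle.Trivial X (EuclideanSpace ℝ (Fin p))

/-- The coordinates of the sections of a trivial vector bundle. -/
def trivialVB.coord {p : ℕ} (i : Fin p) : Sec (trivialVB n X p) →ₗ[Sm n X] Sm n X where
  toFun v := ⟨fun x => (show EuclideanSpace ℝ (Fin p) from v x) i, by
    intro x
    have h := (Bundle.contMDiffAt_section x).1 (v.contMDiff x)
    exact ((EuclideanSpace.proj (𝕜 := ℝ) i).contDiff.contMDiff.contMDiffAt).comp x h⟩
  map_add' v w := rfl
  map_smul' f v := rfl

/-- The standard sections of a trivial vector bundle. -/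
def trivialVB.basis {p : ℕ} (i : Fin p) : Sec (trivialVB n X p) :=
  ⟨fun x => (EuclideanSpace.single i 1 : EuclideanSpace ℝ (Fin p)), fun x =>
    (Bundle.contMDiffAt_section (F := EuclideanSpace ℝ (Fin p))
      (E := Bundle.Trivial X (EuclideanSpace ℝ (Fin p))) x).2 contMDiffAt_const⟩

theorem trivialVB.coord_basis {p : ℕ} (i j : Fin p) :
    trivialVB.coord (n := n) (X := X) i (trivialVB.basis j) = if i = j then 1 else 0 := by
  refine ContMDiffMap.ext fun x => ?_
  change (EuclideanSpace.single j (1 : ℝ) : EuclideanSpace ℝ (Fin p)) i = _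
  rw [PiLp.single_apply]
  split_ifs <;> rfl
/-! ### Extension of densities, chains and variational derivatives -/

section Extend

variable {V' E' : VB n X} {a : ℕ}

/-- The inclusion of the graded densities into those of the extended ring. -/
def inclD (B : FieldSpace n d X Y) (K : Antifields n X ι) (V' E' : VB n X) (a : ℕ) :
    Dens B K →ₗ[Sm n X] Dens B (K.extend V' E' a) := actL (inclP B K V' E' a)

theorem inclD_apply (Φ : Dens B K) (σ : Fin n → VF n X) :
    inclD B K V' E' a Φ σ = inclP B K V' E' a (Φ σ) := rfl

theorem inclD_chain {l m : ℕ} {Φ : Dens B K} (h : Φ ∈ chains B K l m) :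
    inclD B K V' E' a Φ ∈ chains B (K.extend V' E' a) l m := by
  obtain ⟨⟨r, hr⟩, ha⟩ := h
  exact ⟨⟨r, fun σ => inclF_mem (hr σ)⟩, fun σ => isAnt_inclF_iff.2 (ha σ)⟩

theorem inclD_lieDens (τ : VF n X) (Φ : Dens B K) :
    inclD B K V' E' a (lieDens τ Φ) = lieDens τ (inclD B K V' E' a Φ) :=
  AlternatingMap.ext fun σ => by
    rw [inclD_apply, lieDens_apply, lieDens_apply, map_sub, inclP_tdP, map_sum]
    rfl

theorem inclD_mulDens (f : P B K) (Φ : Dens B K) :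
    inclD B K V' E' a (mulDens f Φ) = mulDens (inclP B K V' E' a f) (inclD B K V' E' a Φ) :=
  AlternatingMap.ext fun σ => inclP_mul f (Φ σ)

/-- A chain of sufficiently low antifield number of the extended ring is the image of a chain. -/
theorem exists_inclD_eq {l m : ℕ} (hm : m < a) {Φ' : Dens B (K.extend V' E' a)}
    (h : Φ' ∈ chains B (K.extend V' E' a) l m) :
    ∃ Φ ∈ chains B K m m, inclD B K V' E' a Φ = Φ' := by
  obtain ⟨⟨r, hr⟩, ha⟩ := h
  have hr' : ∀ σ, (Φ' σ : Fun B _) ∈ ordLe B (K.extend V' E' a) r m := fun σ =>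
    mem_ordLe_of_isAnt (hr σ) (ha σ)
  have e : ∀ σ, inclP B K V' E' a (resP B K V' E' a (Φ' σ)) = Φ' σ := fun σ =>
    inclP_resP hm (hr' σ)
  refine ⟨(resP B K V' E' a).compAlternatingMap Φ', ⟨⟨r, fun σ => resF_mem (hr' σ)⟩, fun σ => ?_⟩,
    AlternatingMap.ext e⟩
  refine (isAnt_inclF_iff (V' := V') (E' := E') (a := a)).1 ?_
  have := ha σ
  rwa [← e σ] at this

/-- Adding antifields leaves the Lagrangian and the fields unchanged: the local Euler–Lagrange
expressions pull back term by term along the map that forgets the new antifields. -/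
theorem IsELOnAntifields.extend {L : Dens B K} {D : P B K →ₗ[Sm n X] P B K}
    {D' : P B (K.extend V' E' a) →ₗ[Sm n X] P B (K.extend V' E' a)} (h : IsELOnAntifields L D)
    (hD' : ∀ Φ, D' (inclP B K V' E' a Φ) = inclP B K V' E' a (D Φ)) :
    IsELOnAntifields (inclD B K V' E' a L) D' where
  even_fields w := by
    obtain ⟨e, he, h1, h2⟩ := h.even_fields w
    refine ⟨inclD B K V' E' a e, inclD_chain he,
      IsVarDeriv.pull (forgetOdd B K V' E' a) (forgetEven B K V' E' a)
        (fun f Φ z γ h => h.pull _ _) (fun r g hg => Algebra.subset_adjoin (gen_inclF hg))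
        (fun σ => rfl) (fun σ => rfl) h1, fun σ Φ hΦ => ?_⟩
    obtain rfl : Φ = inclP B K V' E' a (densOdd B K none w σ) :=
      Subtype.ext (hΦ.trans (inclF_antiOdd [] w σ).symm)
    rw [hD', h2 σ _ rfl, inclD_apply]
  odd_fields w := by
    obtain ⟨e, he, h1, h2⟩ := h.odd_fields w
    refine ⟨inclD B K V' E' a e, inclD_chain he,
      IsVarDeriv.pull (forgetOdd B K V' E' a) (forgetEven B K V' E' a)
        (fun f Φ z γ h => h.pull _ _ fun _ => rfl)
        (fun r g hg => Algebra.subset_adjoin (gen_inclF hg))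
        (fun σ => rfl) (fun σ => rfl) h1, fun σ Φ hΦ => ?_⟩
    obtain rfl : Φ = inclP B K V' E' a (densEven B K none w σ) :=
      Subtype.ext (hΦ.trans (inclF_antiEven [] w σ).symm)
    rw [hD', h2 σ _ rfl, inclD_apply]

variable {D : P B K →ₗ[Sm n X] P B K}
  {D' : P B (K.extend V' E' a) →ₗ[Sm n X] P B (K.extend V' E' a)}

theorem act_inclD (hD' : ∀ Φ, D' (inclP B K V' E' a Φ) = inclP B K V' E' a (D Φ)) (Φ : Dens B K) :
    act D' (inclD B K V' E' a Φ) = inclD B K V' E' a (act D Φ) :=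
  AlternatingMap.ext fun σ => hD' (Φ σ)

theorem inclD_boundary (hD' : ∀ Φ, D' (inclP B K V' E' a Φ) = inclP B K V' E' a (D Φ)) {l l' m : ℕ}
    (hl : l ≤ l') {Φ : Dens B K} (h : Φ ∈ boundaries D l m) :
    inclD B K V' E' a Φ ∈ boundaries D' l' m := by
  obtain ⟨Ψ, hΨ, rfl⟩ := h
  exact ⟨inclD B K V' E' a Ψ, chains_mono hl (inclD_chain hΨ), act_inclD hD' Ψ⟩

/-- An extension of a nilpotent contact derivation is nilpotent if its values on the new antifields
are cycles. -/
theorem IsContactDer.extend_nilpotent (hc : IsContactDer D') (hD2 : ∀ Φ, D (D Φ) = 0)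
    (hD' : ∀ Φ, D' (inclP B K V' E' a Φ) = inclP B K V' E' a (D Φ))
    (ΔV : Sec V' →ₗ[Sm n X] Dens B K) (ΔE : Sec E' →ₗ[Sm n X] Dens B K)
    (hV : ∀ v σ (Φ' : P B (K.extend V' E' a)),
      (Φ' : Fun B _) = ghostEven B (K.extend V' E' a) none [] v σ →
        D' Φ' = inclP B K V' E' a (ΔV v σ))
    (hE : ∀ v σ (Φ' : P B (K.extend V' E' a)),
      (Φ' : Fun B _) = ghostOdd B (K.extend V' E' a) none [] v σ →
        D' Φ' = inclP B K V' E' a (ΔE v σ))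
    (cV : ∀ v, act D (ΔV v) = 0) (cE : ∀ v, act D (ΔE v) = 0) (Φ : P B (K.extend V' E' a)) :
    D' (D' Φ) = 0 := by
  obtain ⟨r, l, h⟩ := Φ.2
  have hold : ∀ Φ : P B K, D' (D' (inclP B K V' E' a Φ)) = 0 := fun Φ => by
    rw [hD', hD', hD2, map_zero]
  refine hc.isDerLike_sq.eq_zero ?_ ?_ ?_ ?_ h
  · intro _ v σ Φ e
    obtain rfl : Φ = inclP B K V' E' a (densEven B K none v σ) :=
      Subtype.ext (e.trans (inclF_antiEven [] v σ).symm)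
    exact hold _
  · intro _ v σ Φ e
    obtain rfl : Φ = inclP B K V' E' a (densOdd B K none v σ) :=
      Subtype.ext (e.trans (inclF_antiOdd [] v σ).symm)
    exact hold _
  · rintro (_ | i) _ v σ Φ e
    · change D' (D' Φ) = 0
      rw [hV v σ Φ e, hD', show D (ΔV v σ) = 0 from congrArg (fun f : Dens B K => f σ) (cV v),
        map_zero]
    · obtain rfl : Φ = inclP B K V' E' a (densEven B K (some i) v σ) :=
        Subtype.ext (e.trans (inclF_ghostEven i [] v σ).symm)
      exact hold _
  · rintro (_ | i) _ v σ Φ e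
    · change D' (D' Φ) = 0
      rw [hE v σ Φ e, hD', show D (ΔE v σ) = 0 from congrArg (fun f : Dens B K => f σ) (cE v),
        map_zero]
    · obtain rfl : Φ = inclP B K V' E' a (densOdd B K (some i) v σ) :=
        Subtype.ext (e.trans (inclF_ghostOdd i [] v σ).symm)
      exact hold _

/-- The densities generated by boundaries are boundaries. -/
theorem IsContactDer.inclD_generated (hc : IsContactDer D') {l m : ℕ} {S : Set (Dens B K)}
    (hS : ∀ Φ ∈ S, inclD B K V' E' a Φ ∈ boundaries D' l m) {Φ : Dens B K} (h : Generated S Φ) :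
    inclD B K V' E' a Φ ∈ boundaries D' l m := by
  induction h with
  | base Φ h => exact hS Φ h
  | zero =>
    rw [LinearMap.map_zero]
    exact zero_mem _
  | add Φ Ψ h h' ih ih' =>
    rw [map_add]
    exact add_mem ih ih'
  | mul f r hf Φ Ψ h e ih =>
    obtain ⟨Θ, hΘ, eΘ⟩ := ih
    obtain rfl : Ψ = mulDens f Φ := AlternatingMap.ext e
    have hf' : (inclP B K V' E' a f : Fun B _) ∈ ordLe B (K.extend V' E' a) r 0 := inclF_mem hf
    exact ⟨mulDens (inclP B K V' E' a f) Θ, mulDens_chain hf' hΘ, by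
      rw [hc.act_mulDens hf', eΘ, inclD_mulDens]⟩
  | lie τ Φ Ψ h e ih =>
    obtain ⟨Θ, hΘ, eΘ⟩ := ih
    obtain rfl := e.eq_lieDens
    exact ⟨lieDens τ Θ, lieDens_chain τ hΘ, by rw [hc.act_lieDens, eΘ, inclD_lieDens]⟩

end Extend

/-! ### Generators of the homology -/

/-- The graded densities of parity `i`, as a submodule. -/
def parDens (B : FieldSpace n d X Y) (K : Antifields n X ι) (i : ZMod 2) :
    Submodule (Sm n X) (Dens B K) where
  carrier := {Φ | Φ.IsPar i}
  add_mem' h h' := fun σ z => add_mem (h σ z) (h' σ z)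
  zero_mem' := fun σ z => zero_mem _
  smul_mem' f Φ h := fun σ z => by
    have := P.coe_smul_apply f (Φ σ) z
    exact this ▸ Submodule.smul_mem _ _ (h σ z)

/-- The graded densities of bounded order, as a submodule. -/
def ordDens (B : FieldSpace n d X Y) (K : Antifields n X ι) (r l : ℕ) :
    Submodule (Sm n X) (Dens B K) where
  carrier := {Φ | ∀ σ, (Φ σ : Fun B K) ∈ ordLe B K r l}
  add_mem' h h' := fun σ => add_mem (h σ) (h' σ)
  zero_mem' := fun σ => zero_mem _
  smul_mem' f Φ h := fun σ => Subalgebra.smul_mem _ (h σ) f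

section Generators

variable {D : P B K →ₗ[Sm n X] P B K} {l m p : ℕ}

/-- The linear map from the sections of a trivial bundle to cycles with given values on the standard
sections. -/
def genMap (Φ : Fin p → ↥(cycles D l m)) : Sec (trivialVB n X p) →ₗ[Sm n X] ↥(cycles D l m) :=
  ∑ i, (trivialVB.coord i).smulRight (Φ i)

theorem genMap_apply (Φ : Fin p → ↥(cycles D l m)) (v : Sec (trivialVB n X p)) :
    genMap Φ v = ∑ i, trivialVB.coord i v • Φ i := by
  rw [genMap, LinearMap.sum_apply]
  rfl

theorem genMap_basis (Φ : Fin p → ↥(cycles D l m)) (i : Fin p) :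
    genMap Φ (trivialVB.basis i) = Φ i := by
  rw [genMap_apply, Finset.sum_eq_single i]
  · rw [trivialVB.coord_basis, if_pos rfl, one_smul]
  · intro j _ hj
    rw [trivialVB.coord_basis, if_neg hj, zero_smul]
  · exact fun h => absurd (Finset.mem_univ _) h

theorem genMap_mem {S : Submodule (Sm n X) (Dens B K)} {Φ : Fin p → ↥(cycles D l m)}
    (h : ∀ i, (Φ i : Dens B K) ∈ S) (v : Sec (trivialVB n X p)) : (genMap Φ v : Dens B K) ∈ S := by
  rw [genMap_apply, Submodule.coe_sum]
  exact sum_mem fun i _ => S.smul_mem _ (h i)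

theorem exists_ordDens (Φ : Fin p → ↥(cycles D l m)) :
    ∃ r, ∀ i, (Φ i : Dens B K) ∈ ordDens B K r l := by
  choose R hR using fun i => (Φ i).2.1.1
  exact ⟨Finset.univ.sup R, fun i σ =>
    ordLe_mono B K (Finset.le_sup (Finset.mem_univ i)) le_rfl (hR i σ)⟩

theorem range_genMap (Φ : Fin p → ↥(cycles D l m)) :
    LinearMap.range (hclass D l m ∘ₗ genMap Φ) =
      Submodule.span (Sm n X) (Set.range fun i => hclass D l m (Φ i)) := by
  refine le_antisymm ?_ (Submodule.span_le.2 ?_)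
  · rintro _ ⟨v, rfl⟩
    rw [LinearMap.comp_apply, genMap_apply, map_sum]
    refine sum_mem fun i _ => ?_
    rw [map_smul]
    exact Submodule.smul_mem _ _ (Submodule.subset_span ⟨i, rfl⟩)
  · rintro _ ⟨i, rfl⟩
    exact ⟨trivialVB.basis i, congrArg _ (genMap_basis Φ i)⟩

/-- The grading of C splits each of finitely many generators into parity parts within C. The odd
parts are represented by the cycles assigned to new even antifields, the even parts by those
assigned to new odd ones. -/
theorem IsFinitelyGeneratedBy.exists_generators {C : Submodule (Sm n X) (Homology D l m)}
    (h : IsFinitelyGeneratedBy D l m C) :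
    ∃ (p : ℕ) (Φ Ψ : Fin p → ↥(cycles D l m)), (∀ i, (Φ i : Dens B K) ∈ parDens B K 1) ∧
      (∀ i, (Ψ i : Dens B K) ∈ parDens B K 0) ∧
      LinearMap.range (hclass D l m ∘ₗ genMap Φ) ⊔ LinearMap.range (hclass D l m ∘ₗ genMap Ψ) = C := by
  obtain ⟨p, s, hs⟩ := h.finite.exists_fin
  choose c₀ h₀ c₁ h₁ hp₀ hp₁ e using fun i => h.graded (s i) (s i).2
  choose Ψ hΨ eΨ using hp₀
  choose Φ hΦ eΦ using hp₁
  refine ⟨p, Φ, Ψ, hΦ, hΨ, ?_⟩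
  rw [range_genMap, range_genMap]
  refine le_antisymm (sup_le (Submodule.span_le.2 ?_) (Submodule.span_le.2 ?_)) ?_
  · rintro _ ⟨i, rfl⟩
    change hclass D l m (Φ i) ∈ C
    rw [eΦ]
    exact h₁ i
  · rintro _ ⟨i, rfl⟩
    change hclass D l m (Ψ i) ∈ C
    rw [eΨ]
    exact h₀ i
  · have h2 : Submodule.span (Sm n X) (Set.range fun i => (s i : Homology D l m)) = C := by
      have := congrArg (Submodule.map C.subtype) hs
      rw [Submodule.map_span, ← Set.range_comp, Submodule.map_top, Submodule.range_subtype] at this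
      exact this
    rw [← h2]
    refine Submodule.span_le.2 ?_
    rintro _ ⟨i, rfl⟩
    change (s i : Homology D l m) ∈ _
    rw [e i, add_comm, ← eΦ, ← eΨ]
    exact Submodule.add_mem_sup (Submodule.subset_span ⟨i, rfl⟩) (Submodule.subset_span ⟨i, rfl⟩)

end Generators

end KoszulTate
end

noncomputable section

namespace KoszulTate

variable {n d : ℕ} {X Y : Type}
  [TopologicalSpace X] [ChartedSpace (EuclideanSpace ℝ (Fin n)) X] [IsManifold (𝓡 n) ∞ X]
  [T2Space X] [TopologicalSpace Y] [ChartedSpace (EuclideanSpace ℝ (Fin d)) Y]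
  [IsManifold (𝓡 d) ∞ Y] {B : FieldSpace n d X Y} {ι : Type} {K : Antifields n X ι}

/-! ### The next stage of the Koszul–Tate complex -/

/-- The bounding chain is the new antifield itself, paired with v and read as a density. -/
theorem inclD_mem_boundaries_of_even {V' E' : VB n X} {m : ℕ} {Δ : Dens B K} {v : Sec V'}
    {D' : P B (K.extend V' E' (m + 1)) →ₗ[Sm n X] P B (K.extend V' E' (m + 1))}
    (hV : ∀ σ (Φ' : P B (K.extend V' E' (m + 1))),
      (Φ' : Fun B _) = ghostEven B (K.extend V' E' (m + 1)) none [] v σ →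
        D' Φ' = inclP B K V' E' (m + 1) (Δ σ)) :
    inclD B K V' E' (m + 1) Δ ∈ boundaries D' (m + 1) m := by
  refine ⟨densEven B (K.extend V' E' (m + 1)) (some none) v,
    densEven_chain (K := K.extend V' E' (m + 1)) (some none) v, AlternatingMap.ext fun σ => ?_⟩
  exact hV σ (densEven B (K.extend V' E' (m + 1)) (some none) v σ) rfl

theorem inclD_mem_boundaries_of_odd {V' E' : VB n X} {m : ℕ} {Δ : Dens B K} {v : Sec E'}
    {D' : P B (K.extend V' E' (m + 1)) →ₗ[Sm n X] P B (K.extend V' E' (m + 1))}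
    (hE : ∀ σ (Φ' : P B (K.extend V' E' (m + 1))),
      (Φ' : Fun B _) = ghostOdd B (K.extend V' E' (m + 1)) none [] v σ →
        D' Φ' = inclP B K V' E' (m + 1) (Δ σ)) :
    inclD B K V' E' (m + 1) Δ ∈ boundaries D' (m + 1) m := by
  refine ⟨densOdd B (K.extend V' E' (m + 1)) (some none) v,
    densOdd_chain (K := K.extend V' E' (m + 1)) (some none) v, AlternatingMap.ext fun σ => ?_⟩
  exact hE σ (densOdd B (K.extend V' E' (m + 1)) (some none) v σ) rfl

/-- New antifields have number N + 3, so a cycle of degree at most N + 2 is an old cycle. Up to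
degree N + 1 it was already a boundary. In degree N + 2 it is generated by representatives of
classes in C, and generation preserves boundaries of the extended complex. -/
theorem IsReducible.exact_extend {L : Dens B K} {N : ℕ} {δ : P B K →ₗ[Sm n X] P B K}
    (hδ : IsReducible L N δ) {C : Submodule (Sm n X) (Homology δ (N + 2) (N + 2))}
    (hC : IsFinitelyGeneratedBy δ (N + 2) (N + 2) C) {V' E' : VB n X}
    {D' : P B (K.extend V' E' (N + 3)) →ₗ[Sm n X] P B (K.extend V' E' (N + 3))}
    (hc : IsContactDer D')
    (hD' : ∀ Φ, D' (inclP B K V' E' (N + 3) Φ) = inclP B K V' E' (N + 3) (δ Φ))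
    (ΔV : Sec V' →ₗ[Sm n X] ↥(cycles δ (N + 2) (N + 2)))
    (ΔE : Sec E' →ₗ[Sm n X] ↥(cycles δ (N + 2) (N + 2)))
    (hV : ∀ v σ (Φ' : P B (K.extend V' E' (N + 3))),
      (Φ' : Fun B _) = ghostEven B (K.extend V' E' (N + 3)) none [] v σ →
        D' Φ' = inclP B K V' E' (N + 3) ((ΔV v : Dens B K) σ))
    (hE : ∀ v σ (Φ' : P B (K.extend V' E' (N + 3))),
      (Φ' : Fun B _) = ghostOdd B (K.extend V' E' (N + 3)) none [] v σ →
        D' Φ' = inclP B K V' E' (N + 3) ((ΔE v : Dens B K) σ))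
    (hr : C ≤ LinearMap.range (hclass δ (N + 2) (N + 2) ∘ₗ ΔV) ⊔
      LinearMap.range (hclass δ (N + 2) (N + 2) ∘ₗ ΔE)) : IsExactUpTo D' (N + 3) (N + 2) := by
  intro m h1 h2 Φ' hΦ'
  obtain ⟨Φ, hΦ, rfl⟩ := exists_inclD_eq (Nat.lt_succ_of_le h2) hΦ'.1
  have hcyc : Φ ∈ cycles δ (N + 2) m := by
    refine ⟨chains_mono h2 hΦ, AlternatingMap.ext fun σ =>
      inclP_injective (V' := V') (E' := E') (a := N + 3) ?_⟩
    exact (hD' (Φ σ)).symm.trans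
      ((congrArg (fun f : Dens B (K.extend V' E' (N + 3)) => f σ) hΦ'.2).trans (map_zero _).symm)
  rcases Nat.lt_or_ge (N + 1) m with hm | hm
  · obtain rfl : m = N + 2 := le_antisymm h2 hm
    refine hc.inclD_generated ?_ (hC.generates Φ hcyc)
    rintro Δ ⟨hΔ, hcl⟩
    -- A representative of a class in C equals a value on an even new antifield plus a value on an
    -- odd one, up to an old boundary; all three summands are boundaries in the extended complex.
    obtain ⟨_, ⟨v, rfl⟩, _, ⟨w, rfl⟩, e⟩ := Submodule.mem_sup.1 (hr hcl)
    have e' : hclass δ (N + 2) (N + 2) ⟨Δ, hΔ⟩ = hclass δ (N + 2) (N + 2) (ΔV v + ΔE w) :=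
      e.symm.trans (LinearMap.map_add (hclass δ (N + 2) (N + 2)) (ΔV v) (ΔE w)).symm
    have hb := inclD_boundary hD' (Nat.le_succ (N + 2)) ((hclass_eq_iff _ _).1 e')
    have hv : inclD B K V' E' (N + 3) (ΔV v) ∈ boundaries D' (N + 3) (N + 2) :=
      inclD_mem_boundaries_of_even (hV v)
    have hw : inclD B K V' E' (N + 3) (ΔE w) ∈ boundaries D' (N + 3) (N + 2) :=
      inclD_mem_boundaries_of_odd (hE w)
    have hsum := add_mem hb (add_mem hv hw)
    rw [← LinearMap.map_add, ← LinearMap.map_add] at hsum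
    convert hsum using 2
    exact (sub_add_cancel Δ ((ΔV v : Dens B K) + ΔE w)).symm
  · exact inclD_boundary hD' (Nat.le_succ (N + 2)) (hδ.exact_upTo m h1 hm hcyc)

theorem IsReducible.exists_extension [Finite ι] {L : Dens B K} {N : ℕ}
    {δbar δ : P B K →ₗ[Sm n X] P B K} (hbar : IsKoszulTate L δbar) (hδ : IsReducible L N δ)
    (C : Submodule (Sm n X) (Homology δ (N + 2) (N + 2)))
    (hC : IsFinitelyGeneratedBy δ (N + 2) (N + 2) C) :
    ∃ (V' E' : VB n X) (L' : Dens B (K.extend V' E' (N + 3)))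
      (δbar' δ' : P B (K.extend V' E' (N + 3)) →ₗ[Sm n X] P B (K.extend V' E' (N + 3))),
      IsExtension L δbar δ N C V' E' L' δbar' δ' ∧ (∀ Φ, δ' (δ' Φ) = 0) ∧
        IsExactUpTo δ' (N + 3) (N + 2) := by
  obtain ⟨p, Φ, Ψ, hΦ, hΨ, hr⟩ := hC.exists_generators
  obtain ⟨r₁, hr₁⟩ := exists_ordDens Φ
  obtain ⟨r₂, hr₂⟩ := exists_ordDens Ψ
  -- The values on the new antifields need only represent generators of C, so trivial bundles, with
  -- one standard section for each generator, suffice for both parities.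
  let V' := trivialVB n X p
  let ΔV : Sec V' →ₗ[Sm n X] Dens B K := (cycles δ (N + 2) (N + 2)).subtype ∘ₗ genMap Φ
  let ΔE : Sec V' →ₗ[Sm n X] Dens B K := (cycles δ (N + 2) (N + 2)).subtype ∘ₗ genMap Ψ
  have h1 : ∀ i, 1 ≤ K.ant i := fun i => (Nat.le_succ 1).trans (hδ.ant_ge i)
  have h2 : ∀ i, K.ant i < N + 3 := fun i => Nat.lt_succ_of_le (hδ.ant_le i)
  obtain ⟨δ', hc, hD', hV, hE⟩ := hδ.contactDer.exists_extend (V' := V') (E' := V') h1 h2 (by omega)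
    ΔV ΔE (r := max r₁ r₂)
    (fun v σ => ordLe_mono B K (le_max_left _ _) le_rfl (genMap_mem hr₁ v σ))
    (fun v σ => ordLe_mono B K (le_max_right _ _) le_rfl (genMap_mem hr₂ v σ))
    (fun v => genMap_mem hΦ v) (fun v => genMap_mem hΨ v)
    (fun v σ => (genMap Φ v).2.1.2 σ) (fun v σ => (genMap Ψ v).2.1.2 σ)
  -- The Koszul–Tate differential of the extended ring is the extension by zero on the new
  -- antifields.
  obtain ⟨δbar', hcb, hDb, hVb, hEb⟩ := hbar.contactDer.exists_extend (V' := V') (E' := V') h1 h2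
    (by omega) 0 0 (r := 0) (fun v σ => zero_mem _) (fun v σ => zero_mem _)
    (fun v σ z => zero_mem _) (fun v σ z => zero_mem _) (fun v σ => IsAnt.zero)
    (fun v σ => IsAnt.zero)
  have hcoe : ∀ {D : P B K →ₗ[Sm n X] P B K}
      {D' : P B (K.extend V' V' (N + 3)) →ₗ[Sm n X] P B (K.extend V' V' (N + 3))},
      (∀ Φ, D' (inclP B K V' V' (N + 3) Φ) = inclP B K V' V' (N + 3) (D Φ)) →
      ∀ (Φ : P B K) (Φ' : P B (K.extend V' V' (N + 3))),
        (Φ' : Fun B _) = incl B K V' V' (N + 3) Φ →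
          (D' Φ' : Fun B _) = incl B K V' V' (N + 3) (D Φ) := fun h Φ Φ' e => by
    obtain rfl : Φ' = inclP B K V' V' (N + 3) Φ := Subtype.ext e
    rw [h]
    rfl
  refine ⟨V', V', inclD B K V' V' (N + 3) L, δbar', δ', ?_, ?_, ?_⟩
  · refine
      { lagrangian := fun σ => rfl
        koszulTate := ⟨hcb, hbar.antifields.extend hDb, ?_, ?_⟩
        contactDer := hc
        antifields := hδ.antifields.extend hD'
        extends_bar := hcoe hDb
        extends_delta := hcoe hD'
        generators := ⟨genMap Φ, genMap Ψ, genMap_mem hΦ, genMap_mem hΨ,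
          fun v σ Φ' e => congrArg Subtype.val (hV v σ Φ' e),
          fun v σ Φ' e => congrArg Subtype.val (hE v σ Φ' e), hr⟩ }
    · rintro (_ | i) v σ Φ e
      · exact (hVb v σ Φ e).trans (map_zero _)
      · obtain rfl : Φ = inclP B K V' V' (N + 3) (densEven B K (some i) v σ) :=
          Subtype.ext (e.trans (inclF_ghostEven i [] v σ).symm)
        rw [hDb, hbar.ghostEven i v σ _ rfl, map_zero]
    · rintro (_ | i) v σ Φ e
      · exact (hEb v σ Φ e).trans (map_zero _)
      · obtain rfl : Φ = inclP B K V' V' (N + 3) (densOdd B K (some i) v σ) :=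
          Subtype.ext (e.trans (inclF_ghostOdd i [] v σ).symm)
        rw [hDb, hbar.ghostOdd i v σ _ rfl, map_zero]
  · exact hc.extend_nilpotent hδ.nilpotent hD' ΔV ΔE hV hE (fun v => (genMap Φ v).2.2)
      (fun v => (genMap Ψ v).2.2)
  · exact hδ.exact_extend hC hc hD' (genMap Φ) (genMap Ψ) hV hE hr.ge

end KoszulTate
end

/-! ### The theorem. -/

open KoszulTate in
theorem theorem2 {n d : ℕ} {X Y : Type}
    [TopologicalSpace X] [ChartedSpace (EuclideanSpace ℝ (Fin n)) X] [IsManifold (𝓡 n) ∞ X]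
    [T2Space X] [SecondCountableTopology X] [ConnectedSpace X]
    [TopologicalSpace Y] [ChartedSpace (EuclideanSpace ℝ (Fin d)) Y] [IsManifold (𝓡 d) ∞ Y]
    [T2Space Y] [SecondCountableTopology Y] [ConnectedSpace Y]
    (B : FieldSpace n d X Y) {ι : Type} [Finite ι] (K : Antifields n X ι)
    (L : Dens B K) (N : ℕ) (δbar δ : P B K →ₗ[Sm n X] P B K)
    (hbar : IsKoszulTate L δbar) (hδ : IsReducible L N δ)
    (hH : Nontrivial (Homology δ (N + 2) (N + 2))) :
    ((∀ Φ ∈ cycles δ (N + 2) (N + 2),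
        IsNoetherIdentity δbar δ (N + 1) (linPart (N + 2) Φ) (bilinPart (N + 2) Φ)) ∧
      (∀ G H, IsNoetherIdentity δbar δ (N + 1) G H →
        ∃ Φ ∈ cycles δ (N + 2) (N + 2), linPart (N + 2) Φ = G)) ∧
    (((∀ Φ ∈ cycles δ (N + 2) (N + 2),
        IsTrivialNI δbar δ N Φ → Φ ∈ boundaries δ (N + 2) (N + 2)) ↔
          IsHomologyRegular δ (N + 1)) ∧
      (IsHomologyRegular δ (N + 1) →
        (∀ Φ : ↥(cycles δ (N + 2) (N + 2)),
          ¬ IsTrivialNI δbar δ N Φ ↔ hclass δ (N + 2) (N + 2) Φ ≠ 0) ∧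
        (∀ Φ Φ' : ↥(cycles δ (N + 2) (N + 2)),
          IsTrivialNI δbar δ N ((Φ : Dens B K) - Φ') ↔
            hclass δ (N + 2) (N + 2) Φ = hclass δ (N + 2) (N + 2) Φ'))) ∧
    (∀ C : Submodule (Sm n X) (Homology δ (N + 2) (N + 2)),
      IsFinitelyGeneratedBy δ (N + 2) (N + 2) C →
      ∃ (V' E' : VB n X) (L' : Dens B (K.extend V' E' (N + 3)))
        (δbar' δ' : P B (K.extend V' E' (N + 3)) →ₗ[Sm n X] P B (K.extend V' E' (N + 3))),
        IsExtension L δbar δ N C V' E' L' δbar' δ' ∧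
        (∀ Φ, δ' (δ' Φ) = 0) ∧
        IsExactUpTo δ' (N + 3) (N + 2) ∧
        CompleteIdentities δbar' δ' (N + 1) ∧
        (∀ D : P B (K.extend V' E' (N + 3)) →ₗ[Sm n X] P B (K.extend V' E' (N + 3)),
          IsContactDer D → IsELOnAntifields L' D → (∀ Φ, D (D Φ) = 0) →
            CompleteIdentities δbar' D (N + 1))) := by
  have hp : IsPair δ δbar := hbar.isPair hδ.ant_ge hδ.contactDer hδ.antifields
  have hiff := trivial_boundary_iff_regular hp hδ.nilpotent hδ.regular
  refine ⟨⟨fun Φ hΦ => hp.noetherIdentity_of_cycle hΦ, fun G H h => ?_⟩,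
    ⟨hiff, fun hreg => ?_⟩, fun C hC => ?_⟩
  -- The regularity condition is used at its top index l = N, which belongs to its range because N ≥
  -- 1.
  · exact hp.exists_cycle_of_noetherIdentity hδ.nilpotent (hδ.regular N hδ.one_le le_rfl) h
  · have htriv : ∀ Φ ∈ cycles δ (N + 2) (N + 2),
        IsTrivialNI δbar δ N Φ ↔ Φ ∈ boundaries δ (N + 2) (N + 2) := fun Φ hΦ =>
      ⟨hiff.2 hreg Φ hΦ, Or.inl⟩
    exact ⟨fun Φ => not_congr ((htriv Φ Φ.2).trans (hclass_eq_zero_iff Φ).symm),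
      fun Φ Φ' => (htriv _ (sub_mem Φ.2 Φ'.2)).trans (hclass_eq_iff Φ Φ').symm⟩
  · obtain ⟨V', E', L', δbar', δ', hext, hnil, hex⟩ := hδ.exists_extension hbar C hC
    -- With all higher antifields of number at least two, any derivation with the right values on
    -- the antifields of number one forms a pair with the extended δbar, and the identities follow
    -- from its nilpotency alone.
    have hant : ∀ o, 2 ≤ (K.extend V' E' (N + 3)).ant o := by
      rintro (_ | i)
      · exact Nat.le_add_left 2 (N + 1)
      · exact hδ.ant_ge i
    have hcomp : ∀ D : P B (K.extend V' E' (N + 3)) →ₗ[Sm n X] P B (K.extend V' E' (N + 3)),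
        IsContactDer D → IsELOnAntifields L' D → (∀ Φ, D (D Φ) = 0) →
          CompleteIdentities δbar' D (N + 1) := fun D hD hL hD2 =>
      (hext.koszulTate.isPair hant hD hL).completeIdentities hD2 (N + 1)
    exact ⟨V', E', L', δbar', δ', hext, hnil, hex,
      hcomp δ' hext.contactDer hext.antifields hnil, hcomp⟩
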